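/- **Theorem (Cyclic Hochschild–Kostant–Rosenberg theorem).** Let $A=\mathbb C[x_1,\dots,x_d]$ and let $\Omega=c\,dx_1\wedge\dots\wedge dx_d$, $c\in\mathbb C^{*}$, be a volume form (so that contraction with $\Omega$ is an isomorphism from polynomial polyvector fields to polynomial differential forms). *Polyvector fields.* Let $T_{\rm poly}^{\ell-1}=\Lambda^{\ell}_A\,{\rm Der}(A)$ $(\ell\ge 0)$ be the space of $\ell$-vector fields with polynomial coefficients, and let ${\rm div}:T_{\rm poly}^{\ell}\to T_{\rm poly}^{\ell-1}$ be defined by $\iota_{{\rm div}\,\gamma}\Omega=d_{DR}(\iota_\gamma\Omega)$, where $\iota_{\xi_1\wedge\dots\wedge\xi_\ell}=\iota_{\xi_1}\circ\dots\circ\iota_{\xi_\ell}$ (and ${\rm div}=0$ on $T^{-1}_{\rm poly}$). On $T_{\rm poly}^{\bullet}\otimes\mathbb C[u]$, with $\deg u=2$, put $d_{\rm div}(\gamma\otimes u^k)={\rm div}(\gamma)\otimes u^{k+1}$. *Polydifferential operators.* Let ${\cal D}_{\rm poly}^{n-1}$ $(n\ge 0)$ be the space of polydifferential operators $\psi:A^{\otimes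 n}\to A$ with coefficients in $A$ (so ${\cal D}_{\rm poly}^{-1}=A$), with the Hochschild differential $$(d_{\rm Hoch}\psi)(f_1,\dots,f_{n+1})=f_1\psi(f_2,\dots,f_{n+1})+\sum_{i=1}^{n}(-1)^i\psi(f_1,\dots,f_if_{i+1},\dots,f_{n+1})+(-1)^{n+1}\psi(f_1,\dots,f_n)f_{n+1}.$$ Polydifferential operators act also on smooth functions on $\mathbb R^d$, and the cyclic shift $C:{\cal D}_{\rm poly}^{n-1}\to{\cal D}_{\rm poly}^{n-1}$ is determined by $$\int_{\mathbb R^d}\psi(f_1,\dots,f_n)\,f_{n+1}\,\Omega=(-1)^n\int_{\mathbb R^d}C(\psi)(f_2,\dots,f_{n+1})\,f_1\,\Omega$$ for all smooth compactly supported functions $f_1,\dots,f_{n+1}$. Put $[{\cal D}_{\rm poly}^{\bullet}]_{\rm cycl}=\{\psi\mid C(\psi)=\psi\}$; it is a subcomplex of $({\cal D}_{\rm poly}^\bullet,d_{\rm Hoch})$. *The map.* For $\ell,k\ge0$ let $\Gamma(\ell,k)$ be the set of all choices $\Gamma$ of $\ell$ vertices ("endpoints") $i_1<\dots<i_\ell$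 among the $\ell+2k$ vertices $1,2,\dots,\ell+2k$ on a line such that the number of the remaining vertices is even before the first endpoint, between any two consecutive endpoints, and after the last endpoint. For $\Gamma\in\Gamma(\ell,k)$ and vector fields $\xi_1,\dots,\xi_\ell$ put $$\varphi_\Gamma(\xi_1\wedge\dots\wedge\xi_\ell)(f_1,\dots,f_{\ell+2k})=\sum_{\sigma\in S_\ell}{\rm sgn}(\sigma)\prod_{j=1}^{\ell}\xi_{\sigma(j)}(f_{i_j})\cdot\prod_{i\notin\{i_1,\dots,i_\ell\}}f_i,$$ extended $A$-linearly to all $\gamma\in T_{\rm poly}^{\ell-1}$. Define $$\widetilde\varphi(\gamma\otimes u^k)=\frac{k!}{(\ell+2k)!}\sum_{\Gamma\in\Gamma(\ell,k)}\varphi_\Gamma(\gamma),\qquad \varphi^{\rm cycl}_{\rm HKR}(\gamma\otimes u^k)=\frac1{\ell+2k+1}\left(1+C+C^2+\dots+C^{\ell+2k}\right)\widetilde\varphi(\gamma\otimes u^k).$$ Then $\varphi^{\rm cycl}_{\rm HKR}$ takes values in $[{\cal D}_{\rm poly}^{\bullet}]_{\rm cycl}$, and $$\varphi^{\rm cycl}_{\rm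 HKR}:\{T_{\rm poly}^{\bullet}\otimes\mathbb C[u],\,d_{\rm div}\}\to\{[{\cal D}_{\rm poly}^{\bullet}]_{\rm cycl},\,d_{\rm Hoch}\}$$ is a map of complexes and a quasi-isomorphism of complexes. -/

import Mathlib

namespace CyclicHKR

noncomputable section

open scoped TensorProduct ContDiff

/-- The algebra `A = ℂ[x_1, …, x_d]`. -/
abbrev Poly (d : ℕ) : Type := MvPolynomial (Fin d) ℂ

/-- Polynomial `ℓ`-vector fields (the space of degree `ℓ - 1` in `T_poly`): since `Der A` is free on
the `∂/∂x_i`, the `A`-module `Λ^ℓ_A Der A` is `A ⊗_ℂ Λ^ℓ ℂ^d`, where a vector `v ∈ ℂ^d` stands for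
the constant vector field `∑ v_i ∂/∂x_i`. -/
abbrev Polyvector (d ℓ : ℕ) : Type := Poly d ⊗[ℂ] (⋀[ℂ]^ℓ (Fin d → ℂ))

/-- Contraction of constant polyvectors with `dx_i`:
`v_0 ∧ … ∧ v_ℓ ↦ ∑_j (-1)^j dx_i(v_j) v_0 ∧ … v̂_j … ∧ v_ℓ`. -/
def contract {d : ℕ} (i : Fin d) (ℓ : ℕ) :
    ⋀[ℂ]^(ℓ + 1) (Fin d → ℂ) →ₗ[ℂ] ⋀[ℂ]^ℓ (Fin d → ℂ) :=
  exteriorPower.alternatingMapLinearEquiv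
    (AlternatingMap.alternatizeUncurryFin
      ((LinearMap.proj i : (Fin d → ℂ) →ₗ[ℂ] ℂ).smulRight (exteriorPower.ιMulti ℂ ℓ)))

/-- The divergence for `dx_1 ∧ … ∧ dx_d`: `∑_i ∂/∂x_i ⊗ (contraction with dx_i)`. -/
def flatDiv (d ℓ : ℕ) : Polyvector d (ℓ + 1) →ₗ[ℂ] Polyvector d ℓ :=
  ∑ i : Fin d, TensorProduct.map (MvPolynomial.pderiv i).toLinearMap (contract i ℓ)

/-- The divergence operator of the volume form `Ω = vol · dx_1 ∧ … ∧ dx_d`, where `vol` is a unit of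
`A` (this is what makes the contraction with `Ω` an isomorphism from polynomial polyvector fields to
polynomial differential forms). That this operator is the de Rham differential transported by the
contraction with `Ω` is `volContract_divergence` below. -/
def divergence {d : ℕ} (vol : (Poly d)ˣ) (ℓ : ℕ) : Polyvector d (ℓ + 1) →ₗ[ℂ] Polyvector d ℓ :=
  LinearMap.rTensor _ (LinearMap.mulLeft ℂ (vol⁻¹ : (Poly d)ˣ).val) ∘ₗ flatDiv d ℓ ∘ₗ
    LinearMap.rTensor _ (LinearMap.mulLeft ℂ vol.val)

lemma contract_contract {d : ℕ} (i j : Fin d) (ℓ : ℕ) (g : ⋀[ℂ]^(ℓ + 2) (Fin d → ℂ)) :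
    contract i ℓ (contract j (ℓ + 1) g) + contract j ℓ (contract i (ℓ + 1) g) = 0 := by
  let G : Fin d → Fin d → ((Fin d → ℂ) →ₗ[ℂ] (Fin d → ℂ) →ₗ[ℂ]
      (Fin d → ℂ) [⋀^Fin ℓ]→ₗ[ℂ] ⋀[ℂ]^ℓ (Fin d → ℂ)) := fun i j =>
    (LinearMap.proj j : (Fin d → ℂ) →ₗ[ℂ] ℂ).smulRight
      ((LinearMap.proj i : (Fin d → ℂ) →ₗ[ℂ] ℂ).smulRight (exteriorPower.ιMulti ℂ ℓ))
  have key : ∀ i j : Fin d, (contract i ℓ ∘ₗ contract j (ℓ + 1)).compAlternatingMap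
      (exteriorPower.ιMulti ℂ (ℓ + 2)) =
      AlternatingMap.alternatizeUncurryFin (AlternatingMap.alternatizeUncurryFinLM ∘ₗ G i j) := by
    intro i j
    ext w
    simp [contract, AlternatingMap.alternatizeUncurryFin_apply,
      exteriorPower.alternatingMapLinearEquiv_apply_ιMulti, G]
  have h0 : contract i ℓ ∘ₗ contract j (ℓ + 1) + contract j ℓ ∘ₗ contract i (ℓ + 1) = 0 := by
    apply exteriorPower.linearMap_ext
    have h1 := AlternatingMap.alternatizeUncurryFin_alternatizeUncurryFinLM_comp_of_symmetric
      (f := G i j + G j i) (by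
        intro x y
        ext w
        simp [G]
        rw [smul_comm (x j), smul_comm (x i), add_comm])
    rw [LinearMap.comp_add, AlternatingMap.alternatizeUncurryFin_add, ← key, ← key] at h1
    ext w
    simpa using congrArg (fun F => (F w).1) h1
  exact LinearMap.congr_fun h0 g

lemma pderiv_comm {d : ℕ} (i j : Fin d) (a : Poly d) :
    MvPolynomial.pderiv i (MvPolynomial.pderiv j a) =
      MvPolynomial.pderiv j (MvPolynomial.pderiv i a) := by
  have h : ⁅(MvPolynomial.pderiv i : Derivation ℂ (Poly d) (Poly d)),
      (MvPolynomial.pderiv j : Derivation ℂ (Poly d) (Poly d))⁆ = 0 := by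
    apply MvPolynomial.derivation_ext
    intro k
    rw [Derivation.commutator_apply]
    simp only [MvPolynomial.pderiv_X, Pi.single_apply]
    split_ifs <;> simp
  have := congrArg (fun D : Derivation ℂ (Poly d) (Poly d) => D a) h
  rw [Derivation.commutator_apply] at this
  exact sub_eq_zero.mp this

lemma flatDiv_tmul {d : ℕ} (ℓ : ℕ) (a : Poly d) (g : ⋀[ℂ]^(ℓ + 1) (Fin d → ℂ)) :
    flatDiv d ℓ (a ⊗ₜ g) = ∑ i : Fin d, (MvPolynomial.pderiv i a) ⊗ₜ[ℂ] contract i ℓ g := by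
  rw [flatDiv, LinearMap.sum_apply]
  rfl

lemma flatDiv_flatDiv (d ℓ : ℕ) (t : Polyvector d (ℓ + 2)) :
    flatDiv d ℓ (flatDiv d (ℓ + 1) t) = 0 := by
  induction t using TensorProduct.induction_on with
  | zero => rw [map_zero, map_zero]
  | add x y hx hy => rw [map_add, map_add, hx, hy, add_zero]
  | tmul a g =>
    have h : flatDiv d ℓ (flatDiv d (ℓ + 1) (a ⊗ₜ g)) =
        ∑ i : Fin d, ∑ j : Fin d, (MvPolynomial.pderiv j (MvPolynomial.pderiv i a)) ⊗ₜ[ℂ]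
          contract j ℓ (contract i (ℓ + 1) g) := by
      rw [flatDiv_tmul, map_sum]
      exact Finset.sum_congr rfl fun i _ => flatDiv_tmul _ _ _
    have h2 : flatDiv d ℓ (flatDiv d (ℓ + 1) (a ⊗ₜ g)) +
        flatDiv d ℓ (flatDiv d (ℓ + 1) (a ⊗ₜ g)) = 0 := by
      have h' := h
      rw [Finset.sum_comm] at h'
      refine (congrArg₂ (· + ·) h h').trans ?_
      rw [← Finset.sum_add_distrib]
      refine Finset.sum_eq_zero fun i _ => ?_
      rw [← Finset.sum_add_distrib]
      refine Finset.sum_eq_zero fun j _ => ?_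
      rw [pderiv_comm i j, ← TensorProduct.tmul_add, contract_contract, TensorProduct.tmul_zero]
    rw [← two_smul ℂ] at h2
    exact (smul_eq_zero.mp h2).resolve_left two_ne_zero

lemma divergence_divergence {d : ℕ} (vol : (Poly d)ˣ) (ℓ : ℕ) (t : Polyvector d (ℓ + 2)) :
    divergence vol ℓ (divergence vol (ℓ + 1) t) = 0 := by
  have h : ∀ s : Polyvector d (ℓ + 1), LinearMap.rTensor _ (LinearMap.mulLeft ℂ vol.val)
      (LinearMap.rTensor _ (LinearMap.mulLeft ℂ (vol⁻¹ : (Poly d)ˣ).val) s) = s := by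
    intro s
    rw [← LinearMap.comp_apply, ← LinearMap.rTensor_comp, ← LinearMap.mulLeft_mul]
    simp
  simp only [divergence, LinearMap.comp_apply, h, flatDiv_flatDiv, map_zero]

/-- Polynomial differential `m`-forms, as alternating forms in constant vector fields. -/
abbrev Form (d m : ℕ) : Type := (Fin d → ℂ) [⋀^Fin m]→ₗ[ℂ] Poly d

/-- The de Rham differential,
`(dα)(u_0, …, u_m) = ∑_j (-1)^j ∂_{u_j} (α(u_0, …, û_j, …, u_m))`. -/
def deRham {d : ℕ} (m : ℕ) (α : Form d m) : Form d (m + 1) :=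
  AlternatingMap.alternatizeUncurryFin (Fintype.linearCombination ℂ
    fun c : Fin d => (MvPolynomial.pderiv c).toLinearMap.compAlternatingMap α)

/-- The linear form on the exterior algebra of `ℂ^d` given by the determinant in degree `d`, and by
`0` in the other degrees. -/
def detPairing (d : ℕ) : ExteriorAlgebra ℂ (Fin d → ℂ) →ₗ[ℂ] ℂ :=
  ExteriorAlgebra.liftAlternating fun m =>
    if h : d = m then Matrix.detRowAlternating.domDomCongr (finCongr h) else 0

/-- Contraction `γ ↦ ι_γ Ω` of `Ω = vol · dx_1 ∧ … ∧ dx_d` with `ℓ`-vector fields, with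
`ι_{ξ_1 ∧ … ∧ ξ_ℓ} = ι_{ξ_1} ∘ … ∘ ι_{ξ_ℓ}`, i.e.
`(ι_{ξ_1 ∧ … ∧ ξ_ℓ} Ω)(u_1, …, u_m) = Ω(ξ_ℓ, …, ξ_1, u_1, …, u_m)`; it is zero if `ℓ + m ≠ d`. -/
def volContract {d : ℕ} (vol : (Poly d)ˣ) (ℓ m : ℕ) : Polyvector d ℓ →ₗ[ℂ] Form d m :=
  TensorProduct.lift (LinearMap.mk₂ ℂ
    (fun (a : Poly d) (g : ⋀[ℂ]^ℓ (Fin d → ℂ)) =>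
      ((LinearMap.toSpanSingleton ℂ (Poly d) (a * vol.val)) ∘ₗ detPairing d ∘ₗ
        LinearMap.mulLeft ℂ (CliffordAlgebra.reverse g.1)).compAlternatingMap
          (ExteriorAlgebra.ιMulti ℂ m))
    (fun a a' g => by ext; simp [add_mul])
    (fun c a g => by ext; simp [mul_left_comm])
    (fun a g g' => by ext; simp [add_mul])
    (fun c a g => by ext; simp [mul_assoc]))

lemma volContract_tmul {d : ℕ} (vol : (Poly d)ˣ) (ℓ m : ℕ) (a : Poly d)
    (g : ⋀[ℂ]^ℓ (Fin d → ℂ)) (u : Fin m → Fin d → ℂ) :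
    volContract vol ℓ m (a ⊗ₜ g) u =
      detPairing d (CliffordAlgebra.reverse g.1 * ExteriorAlgebra.ιMulti ℂ m u) • (a * vol.val) := by
  rfl

lemma contractLeft_ιMulti {d m : ℕ} (lam : Module.Dual ℂ (Fin d → ℂ)) (u : Fin (m + 1) → Fin d → ℂ) :
    CliffordAlgebra.contractLeft lam (ExteriorAlgebra.ιMulti ℂ (m + 1) u) =
      ∑ j : Fin (m + 1), (-1 : ℂ) ^ (j : ℕ) •
        lam (u j) • ExteriorAlgebra.ιMulti ℂ m (j.removeNth u) := by
  induction m with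
  | zero =>
    rw [ExteriorAlgebra.ιMulti_succ_apply, CliffordAlgebra.contractLeft_ι_mul]
    simp
  | succ m ih =>
    rw [ExteriorAlgebra.ιMulti_succ_apply, CliffordAlgebra.contractLeft_ι_mul,
      Fin.sum_univ_succ]
    change _ - ExteriorAlgebra.ι ℂ (u 0) * CliffordAlgebra.contractLeft lam
      (ExteriorAlgebra.ιMulti ℂ (m + 1) (Fin.tail u)) = _
    rw [ih, Finset.mul_sum, sub_eq_add_neg, ← Finset.sum_neg_distrib]
    congr 1
    · simp [Fin.removeNth_zero]
      rfl
    · refine Finset.sum_congr rfl fun j _ => ?_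
      rw [ExteriorAlgebra.ιMulti_succ_apply]
      have h1 : Matrix.vecTail (j.succ.removeNth u) = j.removeNth (Fin.tail u) := by
        funext k
        simp [Matrix.vecTail, Fin.removeNth, Fin.tail]
      have h2 : (j.succ.removeNth u) 0 = u 0 := by
        simp [Fin.removeNth]
      rw [h1, h2, Fin.val_succ, pow_succ, mul_smul_comm, mul_smul_comm]
      simp [Fin.tail]

lemma contractLeft_reverse_mul {d ℓ : ℕ} (lam : Module.Dual ℂ (Fin d → ℂ))
    (v : Fin ℓ → Fin d → ℂ) (U : ExteriorAlgebra ℂ (Fin d → ℂ)) :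
    CliffordAlgebra.contractLeft lam
      (CliffordAlgebra.reverse (ExteriorAlgebra.ιMulti ℂ ℓ v) * U) =
    (-1 : ℂ) ^ ℓ • (CliffordAlgebra.reverse (ExteriorAlgebra.ιMulti ℂ ℓ v) *
        CliffordAlgebra.contractLeft lam U -
      CliffordAlgebra.reverse (CliffordAlgebra.contractLeft lam (ExteriorAlgebra.ιMulti ℂ ℓ v)) * U) := by
  induction ℓ generalizing U with
  | zero => simp
  | succ ℓ ih =>
    rw [ExteriorAlgebra.ιMulti_succ_apply]
    simp only [Matrix.vecTail, Function.comp_def]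
    set g := ExteriorAlgebra.ιMulti ℂ ℓ (fun i => v i.succ) with hg
    have := ih (fun i => v i.succ) (ExteriorAlgebra.ι ℂ (v 0) * U)
    rw [← hg] at this
    rw [CliffordAlgebra.reverse.map_mul, CliffordAlgebra.reverse_ι, mul_assoc, this,
      CliffordAlgebra.contractLeft_ι_mul, CliffordAlgebra.contractLeft_ι_mul, map_sub, map_smul,
      CliffordAlgebra.reverse.map_mul, CliffordAlgebra.reverse_ι, pow_succ]
    simp only [mul_sub, sub_mul, mul_smul_comm, smul_mul_assoc, mul_assoc, smul_sub]
    module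



lemma detPairing_ιMulti_of_ne {d m : ℕ} (h : d ≠ m) (u : Fin m → Fin d → ℂ) :
    detPairing d (ExteriorAlgebra.ιMulti ℂ m u) = 0 := by
  rw [detPairing, ExteriorAlgebra.liftAlternating_apply_ιMulti, dif_neg h]
  rfl

lemma detPairing_contractLeft {d : ℕ} (lam : Module.Dual ℂ (Fin d → ℂ))
    (x : ExteriorAlgebra ℂ (Fin d → ℂ)) :
    detPairing d (CliffordAlgebra.contractLeft lam x) = 0 := by
  have h : detPairing d ∘ₗ CliffordAlgebra.contractLeft lam = 0 := by
    apply ExteriorAlgebra.lhom_ext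
    intro i
    ext u
    cases i with
    | zero => simp
    | succ m =>
      change detPairing d (CliffordAlgebra.contractLeft lam
        (ExteriorAlgebra.ιMulti ℂ (m + 1) u)) = 0
      rcases eq_or_ne d m with rfl | hdm
      · have hu : ExteriorAlgebra.ιMulti ℂ (d + 1) u = 0 := by
          apply AlternatingMap.map_linearDependent
          intro hli
          have := hli.fintype_card_le_finrank
          simp at this
        rw [hu, map_zero, map_zero]
      · rw [contractLeft_ιMulti, map_sum]
        refine Finset.sum_eq_zero fun j _ => ?_
        rw [map_smul, map_smul, detPairing_ιMulti_of_ne hdm, smul_zero, smul_zero]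
  exact LinearMap.congr_fun h x

lemma neg_one_pow_smul_alg {M : Type} [AddCommGroup M] [Module ℂ M] (j : ℕ) (x : M) :
    (-1 : ℂ) ^ j • x = (-1 : ℤ) ^ j • x := by
  rw [← Int.cast_smul_eq_zsmul ℂ]
  norm_num

lemma form_sum_apply {d m : ℕ} {N : Type} [AddCommMonoid N] [Module ℂ N] {I : Type} (s : Finset I)
    (F : I → (Fin d → ℂ) [⋀^Fin m]→ₗ[ℂ] N) (u : Fin m → Fin d → ℂ) :
    (∑ i ∈ s, F i) u = ∑ i ∈ s, F i u := by
  classical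
  induction s using Finset.induction_on with
  | empty => simp
  | insert a s ha ih => rw [Finset.sum_insert ha, Finset.sum_insert ha, AlternatingMap.add_apply, ih]

lemma coe_contract {d ℓ : ℕ} (i : Fin d) (g : ⋀[ℂ]^(ℓ + 1) (Fin d → ℂ)) :
    (contract i ℓ g).1 = CliffordAlgebra.contractLeft
      (LinearMap.proj i : Module.Dual ℂ (Fin d → ℂ)) g.1 := by
  have h : (⋀[ℂ]^ℓ (Fin d → ℂ)).subtype ∘ₗ contract i ℓ = CliffordAlgebra.contractLeft
      (LinearMap.proj i : Module.Dual ℂ (Fin d → ℂ)) ∘ₗ (⋀[ℂ]^(ℓ + 1) (Fin d → ℂ)).subtype := by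
    apply exteriorPower.linearMap_ext
    ext v
    have h1 := contractLeft_ιMulti (LinearMap.proj i : Module.Dual ℂ (Fin d → ℂ)) v
    simp only [LinearMap.compAlternatingMap_apply, LinearMap.comp_apply, Submodule.subtype_apply,
      exteriorPower.ιMulti_apply_coe, h1, contract,
      exteriorPower.alternatingMapLinearEquiv_apply_ιMulti,
      AlternatingMap.alternatizeUncurryFin_apply]
    rw [Submodule.coe_sum]
    refine Finset.sum_congr rfl fun j _ => ?_
    rw [← neg_one_pow_smul_alg, Submodule.coe_smul]
    rfl
  exact LinearMap.congr_fun h g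

/-- `ι_{div γ} Ω = d_DR (ι_γ Ω)`. -/
theorem volContract_divergence {d : ℕ} (vol : (Poly d)ˣ) (ℓ m : ℕ) (γ : Polyvector d (ℓ + 1)) :
    volContract vol ℓ (m + 1) (divergence vol ℓ γ) = deRham m (volContract vol (ℓ + 1) m γ) := by
  have hadd : ∀ α β : Form d m, deRham m (α + β) = deRham m α + deRham m β := by
    intro α β
    ext u
    simp [deRham, AlternatingMap.alternatizeUncurryFin_apply, Fintype.linearCombination_apply,
      Finset.sum_add_distrib]
  induction γ using TensorProduct.induction_on with
  | zero =>
    rw [map_zero, map_zero, map_zero]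
    have := hadd 0 0
    rw [add_zero] at this
    exact (left_eq_add.mp this).symm
  | add x y hx hy => rw [map_add, map_add, hx, hy, map_add, hadd]
  | tmul a g =>
    ext1 u
    have hdiv : divergence vol ℓ (a ⊗ₜ g) = ∑ i : Fin d,
        ((vol⁻¹ : (Poly d)ˣ).val * MvPolynomial.pderiv i (vol.val * a)) ⊗ₜ[ℂ] contract i ℓ g := by
      rw [divergence, LinearMap.comp_apply, LinearMap.comp_apply, LinearMap.rTensor_tmul,
        LinearMap.mulLeft_apply, flatDiv_tmul, map_sum]
      rfl
    have hl : volContract vol ℓ (m + 1) (divergence vol ℓ (a ⊗ₜ g)) u = ∑ i : Fin d,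
        detPairing d (CliffordAlgebra.reverse (CliffordAlgebra.contractLeft
          (LinearMap.proj i : Module.Dual ℂ (Fin d → ℂ)) g.1) *
            ExteriorAlgebra.ιMulti ℂ (m + 1) u) • MvPolynomial.pderiv i (vol.val * a) := by
      rw [hdiv, map_sum, form_sum_apply]
      refine Finset.sum_congr rfl fun i _ => ?_
      rw [volContract_tmul, coe_contract, mul_comm _ vol.val, Units.mul_inv_cancel_left]
    have hr : deRham m (volContract vol (ℓ + 1) m (a ⊗ₜ g)) u = ∑ i : Fin d,
        detPairing d (CliffordAlgebra.reverse g.1 * CliffordAlgebra.contractLeft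
          (LinearMap.proj i : Module.Dual ℂ (Fin d → ℂ)) (ExteriorAlgebra.ιMulti ℂ (m + 1) u)) •
            MvPolynomial.pderiv i (vol.val * a) := by
      rw [deRham, AlternatingMap.alternatizeUncurryFin_apply]
      simp only [contractLeft_ιMulti, Finset.mul_sum, map_sum, mul_smul_comm, map_smul,
        Finset.sum_smul, Fintype.linearCombination_apply, form_sum_apply,
        Finset.smul_sum]
      rw [Finset.sum_comm]
      refine Finset.sum_congr rfl fun i _ => Finset.sum_congr rfl fun j _ => ?_
      rw [AlternatingMap.smul_apply, LinearMap.compAlternatingMap_apply, volContract_tmul,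
        ← neg_one_pow_smul_alg, mul_comm a]
      have hD : ∀ (c : ℂ) (b : Poly d), (MvPolynomial.pderiv i).toLinearMap (c • b) =
          c • MvPolynomial.pderiv i b := fun c b => map_smul _ c b
      rw [hD, smul_smul, smul_smul]
      simp [mul_assoc]
    rw [hl, hr]
    refine Finset.sum_congr rfl fun i _ => ?_
    congr 1
    have hspan : ∀ g : ⋀[ℂ]^(ℓ + 1) (Fin d → ℂ), 
        detPairing d (CliffordAlgebra.reverse (CliffordAlgebra.contractLeft
          (LinearMap.proj i : Module.Dual ℂ (Fin d → ℂ)) g.1) *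
            ExteriorAlgebra.ιMulti ℂ (m + 1) u) =
        detPairing d (CliffordAlgebra.reverse g.1 * CliffordAlgebra.contractLeft
          (LinearMap.proj i : Module.Dual ℂ (Fin d → ℂ)) (ExteriorAlgebra.ιMulti ℂ (m + 1) u)) := by
      intro g
      have hg : g ∈ Submodule.span ℂ (Set.range (exteriorPower.ιMulti ℂ (ℓ + 1)
          (M := Fin d → ℂ))) := by
        rw [exteriorPower.ιMulti_span]; trivial
      induction hg using Submodule.span_induction with
      | mem x hx =>
        obtain ⟨v, rfl⟩ := hx
        have h1 := contractLeft_reverse_mul (LinearMap.proj i : Module.Dual ℂ (Fin d → ℂ)) v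
          (ExteriorAlgebra.ιMulti ℂ (m + 1) u)
        have h2 := congrArg (detPairing d) h1
        rw [detPairing_contractLeft, map_smul, map_sub, eq_comm, smul_eq_zero] at h2
        exact (sub_eq_zero.mp (h2.resolve_left (pow_ne_zero _ (by norm_num)))).symm
      | zero => simp
      | add x y _ _ hx hy =>
        simp only [Submodule.coe_add, map_add, add_mul, hx, hy]
      | smul c x _ hx =>
        simp only [Submodule.coe_smul, map_smul, smul_mul_assoc, hx]
    exact hspan g

/-- The pairs `(ℓ, k)` for which `ℓ`-vector fields times `u^k` have degree `n`. Throughout, the degree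
`n` (the number of arguments of a cochain) is the degree in the convention of `T_poly` and `D_poly`
plus one. -/
abbrev Bidegree (n : ℕ) : Type := {p : ℕ × ℕ // p.1 + 2 * p.2 = n}

instance (n : ℕ) : Fintype (Bidegree n) :=
  Fintype.subtype ((Finset.range (n + 1) ×ˢ Finset.range (n + 1)).filter
    fun p => p.1 + 2 * p.2 = n) (by
      rintro ⟨a, b⟩
      simp only [Finset.mem_filter, Finset.mem_product, Finset.mem_range]
      omega)

/-- The degree `n` part of `T_poly ⊗ ℂ[u]`: the (finite) direct sum over `ℓ + 2k = n` of the
`ℓ`-vector fields times `u^k`. -/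
abbrev PolyvectorU (d n : ℕ) : Type := (p : Bidegree n) → Polyvector d p.1.1

/-- The differential `d_div (γ ⊗ u^k) = div γ ⊗ u^(k+1)`. -/
def dDiv {d : ℕ} (vol : (Poly d)ˣ) (n : ℕ) : PolyvectorU d n →ₗ[ℂ] PolyvectorU d (n + 1) :=
  LinearMap.pi fun p => match p with
    | ⟨(_, 0), _⟩ => 0
    | ⟨(ℓ, k + 1), h⟩ =>
        divergence vol ℓ ∘ₗ LinearMap.proj (⟨(ℓ + 1, k), by dsimp only at h ⊢; omega⟩ : Bidegree n)

lemma dDiv_dDiv {d : ℕ} (vol : (Poly d)ˣ) (n : ℕ) : dDiv vol (n + 1) ∘ₗ dDiv vol n = 0 := by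
  apply LinearMap.ext
  intro x
  funext p
  obtain ⟨⟨ℓ, k⟩, h⟩ := p
  match k, h with
  | 0, h => rfl
  | 1, h => exact (divergence vol ℓ).map_zero
  | k + 2, h => exact divergence_divergence vol ℓ _

/-- Maps in `n` arguments; the cochains in the theorem are polydifferential, hence multilinear. -/
abbrev Cochain (B : Type) (n : ℕ) : Type := (Fin n → B) → B

/-- The Hochschild differential. -/
def dHoch {B : Type} [CommRing B] [Algebra ℂ B] (n : ℕ) : Cochain B n →ₗ[ℂ] Cochain B (n + 1) where
  toFun ψ f := f 0 * ψ (Fin.tail f)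
    + ∑ j : Fin n, (-1) ^ (j.val + 1) * ψ (Fin.contractNth j.castSucc (· * ·) f)
    + (-1) ^ (n + 1) * (ψ (Fin.init f) * f (Fin.last n))
  map_add' ψ ψ' := by
    funext f
    simp only [Pi.add_apply, mul_add, add_mul, Finset.sum_add_distrib]
    ring
  map_smul' c ψ := by
    funext f
    simp only [Pi.smul_apply, mul_smul_comm, smul_mul_assoc, smul_add, Finset.smul_sum,
      RingHom.id_apply]

/-- The `j`-th way to pass from `n + 1` to `n` arguments by multiplying neighbours (`j = 0` and
`j = n + 1` drop the first and the last argument). -/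
def mergeAt {B : Type} [CommRing B] {n : ℕ} (j : ℕ) (f : Fin (n + 1) → B) (i : Fin n) : B :=
  if i.val + 1 < j then f i.castSucc
  else if i.val + 1 = j then f i.castSucc * f i.succ else f i.succ

/-- The argument dropped by `mergeAt`. -/
def mergeCoeff {B : Type} [CommRing B] {n : ℕ} (j : ℕ) (f : Fin (n + 1) → B) : B :=
  if j = 0 then f 0 else if j = n + 1 then f (Fin.last n) else 1

lemma dHoch_apply {B : Type} [CommRing B] [Algebra ℂ B] {n : ℕ} (ψ : Cochain B n)
    (f : Fin (n + 1) → B) :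
    dHoch n ψ f = ∑ j ∈ Finset.range (n + 2), (-1) ^ j * (mergeCoeff j f * ψ (mergeAt j f)) := by
  rw [Finset.sum_range_succ, Finset.sum_range_succ', Finset.sum_range]
  have h0 : mergeAt 0 f = Fin.tail f := by
    funext i; simp [mergeAt, Fin.tail]
  have h1 : mergeAt (n + 1) f = Fin.init f := by
    funext i; have := i.2; simp [mergeAt, Fin.init]
  have h2 : ∀ j : Fin n, mergeAt (j.val + 1) f = Fin.contractNth j.castSucc (· * ·) f := by
    intro j; funext i; simp [mergeAt, Fin.contractNth]
  simp only [h0, h1, h2, mergeCoeff]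
  change f 0 * ψ (Fin.tail f)
    + ∑ j : Fin n, (-1) ^ (j.val + 1) * ψ (Fin.contractNth j.castSucc (· * ·) f)
    + (-1) ^ (n + 1) * (ψ (Fin.init f) * f (Fin.last n)) = _
  have h3 : ∀ j : Fin n, ¬ (j.val + 1 = n + 1) := fun j => by have := j.2; omega
  simp
  have h4 : ∀ j : Fin n, ¬ (j.val = n) := fun j => by have := j.2; omega
  simp [h4]
  ring

lemma mergeAt_mergeAt {B : Type} [CommRing B] {n : ℕ} (i j : ℕ) (hij : i ≤ j) (hj : j ≤ n + 1)
    (f : Fin (n + 2) → B) :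
    mergeCoeff (j + 1) f * mergeCoeff i (mergeAt (j + 1) f) =
      mergeCoeff i f * mergeCoeff j (mergeAt i f) ∧
    mergeAt i (mergeAt (j + 1) f) = mergeAt j (mergeAt i f) := by
  constructor
  · rcases Nat.eq_zero_or_pos i with rfl | hi
    · rcases Nat.eq_zero_or_pos j with rfl | hj0
      · simp [mergeCoeff, mergeAt]
      · have h1 : ¬ j = 0 := by omega
        rcases eq_or_ne j (n + 1) with rfl | hjn
        · simp [mergeCoeff, mergeAt, mul_comm]
        · simp [mergeCoeff, mergeAt, h1, hj0, hjn]
    · have h1 : ¬ j = 0 := by omega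
      have h2 : ¬ i = 0 := by omega
      have h3 : ¬ i = n + 2 := by omega
      rcases eq_or_ne j (n + 1) with rfl | hjn
      · rcases eq_or_ne i (n + 1) with rfl | hin
        · simp [mergeCoeff, mergeAt, mul_comm]
        · have h4 : ¬ n + 1 < i := by omega
          simp [mergeCoeff, mergeAt, h2, h3, hin, h4, hin.symm]
      · have h4 : ¬ i = n + 1 := by omega
        simp [mergeCoeff, h1, h2, h3, hjn, h4]
  · funext k
    simp only [mergeAt, Fin.val_castSucc, Fin.val_succ, Fin.succ_castSucc]
    split_ifs <;> first | omega | rfl | ring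

lemma dHoch_dHoch {B : Type} [CommRing B] [Algebra ℂ B] {n : ℕ} (ψ : Cochain B n) :
    dHoch (n + 1) (dHoch n ψ) = 0 := by
  funext f
  rw [dHoch_apply]
  simp only [dHoch_apply]
  let S : ℕ → ℕ → B := fun i j =>
    mergeCoeff j f * mergeCoeff i (mergeAt j f) * ψ (mergeAt i (mergeAt j f))
  have hS : ∀ i j, i ≤ j → j ≤ n + 1 → S i (j + 1) = S j i := by
    intro i j hij hj
    obtain ⟨h1, h2⟩ := mergeAt_mergeAt i j hij hj f
    simp only [S, h1, h2]
  have : ∀ N : ℕ, N ≤ n + 2 → ∑ j ∈ Finset.range (N + 1), (∑ i ∈ Finset.range N,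
      (-1 : B) ^ (i + j) * S i j) = 0 := by
    intro N
    induction N with
    | zero => intro _; simp
    | succ N ih =>
      intro hN
      rw [Finset.sum_range_succ, Finset.sum_congr rfl fun j _ =>
        Finset.sum_range_succ (fun i => (-1 : B) ^ (i + j) * S i j) N,
        Finset.sum_add_distrib, ih (by omega), zero_add, ← Finset.sum_add_distrib]
      refine Finset.sum_eq_zero fun i hi => ?_
      rw [Finset.mem_range] at hi
      rw [hS i N (by omega) (by omega)]
      ring
  rw [Pi.zero_apply, ← this (n + 2) le_rfl]
  refine Finset.sum_congr rfl fun j _ => ?_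
  rw [Finset.mul_sum, Finset.mul_sum]
  refine Finset.sum_congr rfl fun i _ => ?_
  simp only [S]
  ring

/-- Smooth complex-valued functions on `ℝ^d`. -/
def smoothSubalgebra (d : ℕ) : Subalgebra ℂ ((Fin d → ℝ) → ℂ) where
  carrier := {f | ContDiff ℝ ∞ f}
  mul_mem' {f g} hf hg := by
    simp only [Set.mem_ofPred_eq] at hf hg ⊢
    exact ContDiff.mul hf hg
  add_mem' {f g} hf hg := by
    simp only [Set.mem_ofPred_eq] at hf hg ⊢
    exact ContDiff.add hf hg
  algebraMap_mem' c := by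
    simp only [Set.mem_ofPred_eq]
    exact contDiff_const (c := c)

/-- The algebra of smooth complex-valued functions on `ℝ^d`. -/
def SmoothFun (d : ℕ) : Type := smoothSubalgebra d

instance (d : ℕ) : CommRing (SmoothFun d) := inferInstanceAs (CommRing (smoothSubalgebra d))

instance (d : ℕ) : Algebra ℂ (SmoothFun d) := inferInstanceAs (Algebra ℂ (smoothSubalgebra d))

/-- The inclusion of smooth functions in all functions. -/
def smoothIncl (d : ℕ) : SmoothFun d →ₐ[ℂ] ((Fin d → ℝ) → ℂ) := (smoothSubalgebra d).val

lemma contDiff_smoothFun {d : ℕ} (f : SmoothFun d) : ContDiff ℝ ∞ f.1 := f.2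

lemma differentiableAt_smoothFun {d : ℕ} (f : SmoothFun d) (x : Fin d → ℝ) :
    DifferentiableAt ℝ f.1 x :=
  ((contDiff_smoothFun f).differentiable (by simp)) x

/-- The partial derivative `∂/∂x_c` on smooth functions. -/
def smoothDeriv {d : ℕ} (c : Fin d) : Module.End ℂ (SmoothFun d) where
  toFun f := ⟨fun x => fderiv ℝ f.1 x (Pi.single c 1), by
    change ContDiff ℝ ∞ _
    exact ((contDiff_smoothFun f).fderiv_right (m := ∞) (by simp)).clm_apply contDiff_const⟩
  map_add' f g := by
    apply Subtype.ext
    funext x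
    have := fderiv_add (differentiableAt_smoothFun f x) (differentiableAt_smoothFun g x)
    change fderiv ℝ (f.1 + g.1) x _ = _
    rw [this]; rfl
  map_smul' a f := by
    apply Subtype.ext
    funext x
    change fderiv ℝ (a • f.1) x _ = _
    rw [fderiv_const_smul (differentiableAt_smoothFun f x)]; rfl

lemma smoothDeriv_mul {d : ℕ} (c : Fin d) (f g : SmoothFun d) :
    smoothDeriv c (f * g) = smoothDeriv c f * g + f * smoothDeriv c g := by
  apply Subtype.ext
  funext x
  change fderiv ℝ (f.1 * g.1) x _ = fderiv ℝ f.1 x _ * g.1 x + f.1 x * fderiv ℝ g.1 x _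
  rw [fderiv_mul (differentiableAt_smoothFun f x) (differentiableAt_smoothFun g x)]
  simp only [add_apply, smul_apply, smul_eq_mul]
  ring

/-- The coordinate function `x_c`. -/
def smoothCoord {d : ℕ} (c : Fin d) : SmoothFun d :=
  ⟨fun x => (x c : ℂ), by
    change ContDiff ℝ ∞ _
    exact Complex.ofRealCLM.contDiff.comp (contDiff_apply ℝ ℝ c)⟩

lemma pderiv_mul_rule {d : ℕ} (c : Fin d) (f g : Poly d) :
    (MvPolynomial.pderiv c).toLinearMap (f * g) =
      (MvPolynomial.pderiv c).toLinearMap f * g + f * (MvPolynomial.pderiv c).toLinearMap g := by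
  have h := (MvPolynomial.pderiv c).leibniz f g
  rw [smul_eq_mul, smul_eq_mul] at h
  refine h.trans ?_
  rw [add_comm, mul_comm g]
  rfl

/-- Polynomials as smooth functions on `ℝ^d`. -/
def polyToSmooth (d : ℕ) : Poly d →ₐ[ℂ] SmoothFun d := MvPolynomial.aeval smoothCoord

/-- The iterated partial derivative given by a word in the indices `1, …, d`. -/
def wordDeriv {d : ℕ} {B : Type} [CommRing B] [Algebra ℂ B]
    (D : Fin d → Module.End ℂ B) (w : List (Fin d)) : Module.End ℂ B :=
  (w.map D).prod

/-- The operator `(f_1, …, f_n) ↦ a · ∂^{w_1} f_1 ⋯ ∂^{w_n} f_n`, where `a` is a polynomial. -/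
def monomialOp {d n : ℕ} {B : Type} [CommRing B] [Algebra ℂ B] (j : Poly d →ₐ[ℂ] B)
    (D : Fin d → Module.End ℂ B) (a : Poly d) (w : Fin n → List (Fin d)) : Cochain B n :=
  fun f => j a * ∏ i : Fin n, wordDeriv D (w i) (f i)

/-- The operator `(f_1, …, f_n) ↦ a · ∂^{w_1} f_1 ⋯ ∂^{w_n} f_n`, on polynomials and on smooth
functions. -/
def monomialPair {d n : ℕ} (a : Poly d) (w : Fin n → List (Fin d)) :
    Cochain (Poly d) n × Cochain (SmoothFun d) n :=
  (monomialOp (AlgHom.id ℂ (Poly d)) (fun c => (MvPolynomial.pderiv c).toLinearMap) a w,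
    monomialOp (polyToSmooth d) smoothDeriv a w)

/-- Polydifferential operators with polynomial coefficients in `n` arguments, as operators on
polynomials (first component) and on smooth functions (second component): `(ψ, Ψ)` is in this space
iff `ψ : A^n → A` is a polydifferential operator and `Ψ` is its extension to smooth functions. -/
def polyDiffPair (d n : ℕ) :
    Submodule ℂ (Cochain (Poly d) n × Cochain (SmoothFun d) n) :=
  Submodule.span ℂ {P | ∃ (a : Poly d) (w : Fin n → List (Fin d)), P = monomialPair a w}

/-- `∫_{ℝ^d} Ψ(f_1, …, f_n) · g · Ω`. -/
def pairing {d n : ℕ} (vol : (Poly d)ˣ) (Ψ : Cochain (SmoothFun d) n)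
    (f : Fin n → SmoothFun d) (g : SmoothFun d) : ℂ :=
  ∫ x : Fin d → ℝ, (Ψ f).1 x * g.1 x * (polyToSmooth d vol.val).1 x

/-- `∫ Ψ(f_1, …, f_n) · f_{n+1} · Ω = (-1)^n ∫ Φ(f_2, …, f_{n+1}) · f_1 · Ω` for all smooth functions
`f_1, …, f_{n+1}` with compact support. -/
def IsSmoothShift {d n : ℕ} (vol : (Poly d)ˣ) (Ψ Φ : Cochain (SmoothFun d) n) : Prop :=
  ∀ f : Fin (n + 1) → SmoothFun d, (∀ i, HasCompactSupport (f i).1) →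
    pairing vol Ψ (Fin.init f) (f (Fin.last n)) = (-1) ^ n * pairing vol Φ (Fin.tail f) (f 0)

/-- `ψ` and `φ` are polydifferential operators in `n` arguments, and `φ = C(ψ)` is the cyclic shift of
`ψ`. -/
def IsCyclicShift {d n : ℕ} (vol : (Poly d)ˣ) (ψ φ : Cochain (Poly d) n) : Prop :=
  ∃ Ψ Φ : Cochain (SmoothFun d) n, (ψ, Ψ) ∈ polyDiffPair d n ∧ (φ, Φ) ∈ polyDiffPair d n ∧
    IsSmoothShift vol Ψ Φ

/-- The cyclic shift operator `C` on polydifferential operators: `C(ψ)` is the (unique)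
polydifferential operator that satisfies the defining relation `IsCyclicShift`. -/
def cyclicShift {d n : ℕ} (vol : (Poly d)ˣ) (ψ : Cochain (Poly d) n) : Cochain (Poly d) n :=
  Classical.epsilon (IsCyclicShift vol ψ)

/-- The ways to distribute the letters of a word over two words (as in the Leibniz rule). -/
def splits {d : ℕ} : List (Fin d) → List (List (Fin d) × List (Fin d))
  | [] => [([], [])]
  | c :: w => (splits w).map (fun p => (c :: p.1, p.2)) ++ (splits w).map (fun p => (p.1, c :: p.2))

lemma wordDeriv_mul {d : ℕ} {B : Type} [CommRing B] [Algebra ℂ B]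
    (D : Fin d → Module.End ℂ B) (hD : ∀ c f g, D c (f * g) = D c f * g + f * D c g)
    (w : List (Fin d)) (f g : B) :
    wordDeriv D w (f * g) =
      ((splits w).map fun p => wordDeriv D p.1 f * wordDeriv D p.2 g).sum := by
  induction w with
  | nil => simp [splits, wordDeriv]
  | cons c w ih =>
    have h : ∀ (w : List (Fin d)) (f : B), wordDeriv D (c :: w) f = D c (wordDeriv D w f) := by
      intro w f
      simp [wordDeriv]
    rw [h, ih, map_list_sum, List.map_map, splits, List.map_append, List.sum_append,
      List.map_map, List.map_map, ← List.sum_map_add]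
    congr 1
    refine List.map_congr_left fun p _ => ?_
    simp [hD, h]

lemma monomialOp_contractNth {d n : ℕ} {B : Type} [CommRing B] [Algebra ℂ B] (j : Poly d →ₐ[ℂ] B)
    (D : Fin d → Module.End ℂ B) (hD : ∀ c f g, D c (f * g) = D c f * g + f * D c g)
    (a : Poly d) (w : Fin n → List (Fin d)) (i : Fin n) (f : Fin (n + 1) → B) :
    monomialOp j D a w (Fin.contractNth i.castSucc (· * ·) f) =
      ((splits (w i)).map fun p =>
        monomialOp j D a (i.succ.insertNth p.2 (Function.update w i p.1)) f).sum := by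
  have h1 : ∀ k : Fin n, k ≠ i →
      Fin.contractNth i.castSucc (· * ·) f k = f (i.succ.succAbove k) := by
    intro k hk
    have hk' : k.val ≠ i.val := fun h => hk (Fin.ext h)
    rw [Fin.contractNth, Fin.succAbove]
    simp only [Fin.val_castSucc, Fin.lt_def, Fin.val_succ]
    split_ifs <;> first | rfl | omega
  have h2 : Fin.contractNth i.castSucc (· * ·) f i = f i.castSucc * f i.succ := by
    rw [Fin.contractNth]; simp
  have h3 : i.succ.succAbove i = i.castSucc := by
    rw [Fin.succAbove_of_castSucc_lt]
    simp [Fin.lt_def]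
  unfold monomialOp
  rw [← Finset.mul_prod_erase Finset.univ _ (Finset.mem_univ i), h2, wordDeriv_mul D hD,
    ← List.sum_map_mul_right, ← List.sum_map_mul_left]
  congr 1
  refine List.map_congr_left fun p _ => ?_
  rw [Fin.prod_univ_succAbove _ i.succ]
  simp only [Fin.insertNth_apply_same, Fin.insertNth_apply_succAbove]
  rw [← Finset.mul_prod_erase Finset.univ
    (fun k => wordDeriv D (Function.update w i p.1 k) (f (i.succ.succAbove k)))
    (Finset.mem_univ i)]
  simp only [Function.update_self, h3]
  rw [Finset.prod_congr rfl fun k hk => by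
    rw [h1 k (Finset.ne_of_mem_erase hk)]]
  have h4 : ∏ k ∈ Finset.univ.erase i,
      wordDeriv D (Function.update w i p.1 k) (f (i.succ.succAbove k)) =
      ∏ k ∈ Finset.univ.erase i, wordDeriv D (w k) (f (i.succ.succAbove k)) :=
    Finset.prod_congr rfl fun k hk => by
      rw [Function.update_of_ne (Finset.ne_of_mem_erase hk)]
  rw [h4]
  ring

lemma dHoch_monomialOp {d n : ℕ} {B : Type} [CommRing B] [Algebra ℂ B] (j : Poly d →ₐ[ℂ] B)
    (D : Fin d → Module.End ℂ B) (hD : ∀ c f g, D c (f * g) = D c f * g + f * D c g)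
    (a : Poly d) (w : Fin n → List (Fin d)) :
    dHoch n (monomialOp j D a w) = monomialOp j D a (Fin.cons [] w : Fin (n + 1) → List (Fin d))
      + ∑ i : Fin n, (-1 : ℂ) ^ (i.val + 1) • ((splits (w i)).map fun p =>
        monomialOp j D a (i.succ.insertNth p.2 (Function.update w i p.1))).sum
      + (-1 : ℂ) ^ (n + 1) • monomialOp j D a (Fin.snoc w [] : Fin (n + 1) → List (Fin d)) := by
  funext f
  have e1 : f 0 * monomialOp j D a w (Fin.tail f) =
      monomialOp j D a (Fin.cons [] w : Fin (n + 1) → List (Fin d)) f := by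
    simp only [monomialOp, Fin.prod_univ_succ, Fin.cons_zero, Fin.cons_succ, Fin.tail]
    simp [wordDeriv]
    ring
  have e2 : monomialOp j D a w (Fin.init f) * f (Fin.last n) =
      monomialOp j D a (Fin.snoc w [] : Fin (n + 1) → List (Fin d)) f := by
    simp only [monomialOp, Fin.prod_univ_castSucc, Fin.snoc_last, Fin.snoc_castSucc, Fin.init]
    simp [wordDeriv]
    ring
  change f 0 * monomialOp j D a w (Fin.tail f)
    + ∑ i : Fin n, (-1) ^ (i.val + 1) *
        monomialOp j D a w (Fin.contractNth i.castSucc (· * ·) f)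
    + (-1) ^ (n + 1) * (monomialOp j D a w (Fin.init f) * f (Fin.last n)) = _
  rw [e1, e2]
  simp only [Pi.add_apply, Finset.sum_apply, Pi.smul_apply]
  have hs : ∀ (m : ℕ) (b : B), (-1 : ℂ) ^ m • b = (-1) ^ m * b := by
    intro m b
    rw [Algebra.smul_def, map_pow, map_neg, map_one]
  simp only [hs, monomialOp_contractNth j D hD]
  congr 2
  refine Finset.sum_congr rfl fun i _ => ?_
  congr 1
  induction splits (w i) with
  | nil => rfl
  | cons p L ih => simp only [List.map_cons, List.sum_cons, ih, Pi.add_apply]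

lemma dHoch_monomialPair {d n : ℕ} (a : Poly d) (w : Fin n → List (Fin d)) :
    (dHoch n (monomialPair a w).1, dHoch n (monomialPair a w).2) =
      monomialPair a (Fin.cons [] w : Fin (n + 1) → List (Fin d))
      + ∑ i : Fin n, (-1 : ℂ) ^ (i.val + 1) • ((splits (w i)).map fun p =>
        monomialPair a (i.succ.insertNth p.2 (Function.update w i p.1))).sum
      + (-1 : ℂ) ^ (n + 1) • monomialPair a (Fin.snoc w [] : Fin (n + 1) → List (Fin d)) := by
  have hl : ∀ {X : Type} (L : List X) (F : X → Cochain (Poly d) (n + 1) ×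
      Cochain (SmoothFun d) (n + 1)),
      (L.map F).sum = ((L.map fun p => (F p).1).sum, (L.map fun p => (F p).2).sum) := by
    intro X L F
    induction L with
    | nil => rfl
    | cons p L ih => rw [List.map_cons, List.sum_cons, ih]; rfl
  simp only [hl]
  apply Prod.ext
  · simp only [Prod.fst_add, Prod.fst_sum, Prod.smul_fst]
    exact dHoch_monomialOp (AlgHom.id ℂ (Poly d))
      (fun c => (MvPolynomial.pderiv c).toLinearMap) pderiv_mul_rule a w
  · simp only [Prod.snd_add, Prod.snd_sum, Prod.smul_snd]
    exact dHoch_monomialOp (polyToSmooth d) smoothDeriv smoothDeriv_mul a w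

lemma dHoch_monomialPair_mem {d n : ℕ} (a : Poly d) (w : Fin n → List (Fin d)) :
    (dHoch n (monomialPair a w).1, dHoch n (monomialPair a w).2) ∈ polyDiffPair d (n + 1) := by
  have hm : ∀ w' : Fin (n + 1) → List (Fin d), monomialPair a w' ∈ polyDiffPair d (n + 1) :=
    fun w' => Submodule.subset_span ⟨a, w', rfl⟩
  have h1 : ∀ i : Fin n, ((splits (w i)).map fun p =>
        monomialPair a (i.succ.insertNth p.2 (Function.update w i p.1))).sum ∈
        polyDiffPair d (n + 1) := by
    intro i
    refine list_sum_mem fun x hx => ?_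
    obtain ⟨p, _, hp⟩ := List.mem_map.mp hx
    rw [← hp]
    exact hm _
  rw [dHoch_monomialPair]
  exact (polyDiffPair d (n + 1)).add_mem ((polyDiffPair d (n + 1)).add_mem (hm _)
    ((polyDiffPair d (n + 1)).sum_mem fun i _ => (polyDiffPair d (n + 1)).smul_mem _ (h1 i)))
    ((polyDiffPair d (n + 1)).smul_mem _ (hm _))

lemma dHoch_mem_polyDiffPair {d n : ℕ} {ψ : Cochain (Poly d) n} {Ψ : Cochain (SmoothFun d) n}
    (hP : (ψ, Ψ) ∈ polyDiffPair d n) : (dHoch n ψ, dHoch n Ψ) ∈ polyDiffPair d (n + 1) := by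
  obtain ⟨T, hT⟩ : ∃ T : Cochain (Poly d) n × Cochain (SmoothFun d) n →ₗ[ℂ]
      Cochain (Poly d) (n + 1) × Cochain (SmoothFun d) (n + 1),
      ∀ P, T P = (dHoch n P.1, dHoch n P.2) := ⟨(dHoch n).prodMap (dHoch n), fun _ => rfl⟩
  have h : ∀ P ∈ polyDiffPair d n, T P ∈ polyDiffPair d (n + 1) := by
    intro P hP
    induction hP using Submodule.span_induction with
    | mem P hP =>
      obtain ⟨a, w, rfl⟩ := hP
      rw [hT]
      exact dHoch_monomialPair_mem a w
    | zero => rw [map_zero]; exact zero_mem _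
    | add P Q _ _ hP hQ => rw [map_add]; exact add_mem hP hQ
    | smul c P _ hP => rw [map_smul]; exact Submodule.smul_mem _ c hP
  have h' := h _ hP
  rw [hT] at h'
  exact h'

lemma integrable_mul {d : ℕ} (f g h : SmoothFun d) (hg : HasCompactSupport g.1) :
    MeasureTheory.Integrable (fun x : Fin d → ℝ => f.1 x * g.1 x * h.1 x) := by
  refine Continuous.integrable_of_hasCompactSupport ?_ ?_
  · exact ((contDiff_smoothFun f).continuous.mul (contDiff_smoothFun g).continuous).mul
      (contDiff_smoothFun h).continuous
  · exact (HasCompactSupport.mul_left (f := f.1) hg).mul_right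

lemma pairing_dHoch {d n : ℕ} (vol : (Poly d)ˣ) (Ψ : Cochain (SmoothFun d) n)
    (f : Fin (n + 1) → SmoothFun d) (g : SmoothFun d) (hg : HasCompactSupport g.1) :
    pairing vol (dHoch n Ψ) f g = ∑ j ∈ Finset.range (n + 2),
      (-1) ^ j * pairing vol Ψ (mergeAt j f) (mergeCoeff j f * g) := by
  have hg' : ∀ j, HasCompactSupport (mergeCoeff j f * g).1 := fun j =>
    HasCompactSupport.mul_left (f := (mergeCoeff j f).1) hg
  simp only [pairing, ← MeasureTheory.integral_const_mul]
  rw [← MeasureTheory.integral_finsetSum _ fun j _ =>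
    (integrable_mul (Ψ (mergeAt j f)) _ (polyToSmooth d vol.val) (hg' j)).const_mul _]
  congr 1
  funext x
  have h : dHoch n Ψ f * g * polyToSmooth d vol.val = ∑ j ∈ Finset.range (n + 2),
      (-1) ^ j * (Ψ (mergeAt j f) * (mergeCoeff j f * g) * polyToSmooth d vol.val) := by
    rw [dHoch_apply, Finset.sum_mul, Finset.sum_mul]
    exact Finset.sum_congr rfl fun j _ => by ring
  have h2 := congrFun (congrArg (smoothIncl d) h) x
  rw [map_sum, Finset.sum_apply] at h2
  simp only [map_mul, map_pow, map_neg, map_one, Pi.mul_apply, Pi.pow_apply, Pi.neg_apply,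
    Pi.one_apply] at h2
  exact h2

lemma isSmoothShift_dHoch {d n : ℕ} (vol : (Poly d)ˣ) (Ψ : Cochain (SmoothFun d) n)
    (h : IsSmoothShift vol Ψ Ψ) : IsSmoothShift vol (dHoch n Ψ) (dHoch n Ψ) := by
  intro F hF
  rw [pairing_dHoch vol Ψ _ _ (hF _), pairing_dHoch vol Ψ _ _ (hF _), Finset.sum_range_succ',
    Finset.sum_range_succ _ (n + 1)]
  have h0 : pairing vol Ψ (mergeAt 0 (Fin.init F)) (mergeCoeff 0 (Fin.init F) * F (Fin.last (n + 1)))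
      = pairing vol Ψ (mergeAt (n + 1) (Fin.tail F)) (mergeCoeff (n + 1) (Fin.tail F) * F 0) := by
    congr 1
    · funext i
      simp [mergeAt, Fin.init, Fin.tail]
    · simp [mergeCoeff, Fin.init, Fin.tail, mul_comm]
  have h1 : ∀ j ∈ Finset.range (n + 1),
      (-1 : ℂ) ^ (j + 1) * pairing vol Ψ (mergeAt (j + 1) (Fin.init F))
        (mergeCoeff (j + 1) (Fin.init F) * F (Fin.last (n + 1))) =
      (-1) ^ (n + 1) * ((-1) ^ j *
        pairing vol Ψ (mergeAt j (Fin.tail F)) (mergeCoeff j (Fin.tail F) * F 0)) := by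
    intro j hj
    rw [Finset.mem_range] at hj
    have hc : ∀ i, HasCompactSupport (mergeAt (j + 1) F i).1 := by
      intro i
      unfold mergeAt
      split_ifs
      · exact hF _
      · exact HasCompactSupport.mul_left (f := (F i.castSucc).1) (hF _)
      · exact hF _
    have hs := h (mergeAt (j + 1) F) hc
    have a1 : Fin.init (mergeAt (j + 1) F) = mergeAt (j + 1) (Fin.init F) := by
      funext i
      simp [mergeAt, Fin.init]
    have a2 : Fin.tail (mergeAt (j + 1) F) = mergeAt j (Fin.tail F) := by
      funext i
      simp [mergeAt, Fin.tail]
    have a3 : mergeAt (j + 1) F (Fin.last n) =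
        mergeCoeff (j + 1) (Fin.init F) * F (Fin.last (n + 1)) := by
      rcases eq_or_ne j n with rfl | hjn
      · simp [mergeAt, mergeCoeff, Fin.init]
      · have : ¬ n < j := by omega
        simp [mergeAt, mergeCoeff, this, hjn, hjn.symm]
    have a4 : mergeAt (j + 1) F 0 = mergeCoeff j (Fin.tail F) * F 0 := by
      rcases Nat.eq_zero_or_pos j with rfl | hj0
      · simp [mergeAt, mergeCoeff, Fin.tail, mul_comm]
      · have h5 : ¬ j = 0 := by omega
        have h6 : ¬ j = n + 1 := by omega
        simp [mergeAt, mergeCoeff, h5, h6, hj0]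
    rw [a1, a2, a3, a4] at hs
    rw [hs]
    ring
  rw [Finset.sum_congr rfl h1, h0, mul_add, Finset.mul_sum]
  congr 1
  rw [← mul_assoc, ← mul_pow]
  simp

/-- The space `[D_poly]_cycl` in degree `n`: the polydifferential operators `ψ` in `n` arguments with
`C(ψ) = ψ`. -/
def cyclicCochains {d : ℕ} (vol : (Poly d)ˣ) (n : ℕ) : Submodule ℂ (Cochain (Poly d) n) where
  carrier := {ψ | ∃ Ψ, (ψ, Ψ) ∈ polyDiffPair d n ∧ IsSmoothShift vol Ψ Ψ}
  zero_mem' := ⟨0, zero_mem _, fun f _ => by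
    have h0 : ∀ (g : Fin n → SmoothFun d) (k : SmoothFun d), pairing vol 0 g k = 0 := by
      intro g k
      rw [pairing]
      refine (congrArg (MeasureTheory.integral _) (funext fun x => ?_)).trans
        (MeasureTheory.integral_zero _ _)
      change (0 : ℂ) * _ * _ = 0
      ring
    rw [h0, h0, mul_zero]⟩
  add_mem' := by
    rintro ψ φ ⟨Ψ, hΨ, h⟩ ⟨Φ, hΦ, h'⟩
    refine ⟨Ψ + Φ, add_mem hΨ hΦ, fun f hf => ?_⟩
    have hadd : ∀ (g : Fin n → SmoothFun d) (k : SmoothFun d), HasCompactSupport k.1 →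
        pairing vol (Ψ + Φ) g k = pairing vol Ψ g k + pairing vol Φ g k := by
      intro g k hk
      rw [pairing, pairing, pairing, ← MeasureTheory.integral_add (integrable_mul _ _ _ hk)
        (integrable_mul _ _ _ hk)]
      congr 1
      funext x
      change ((Ψ g).1 x + (Φ g).1 x) * _ * _ = _
      ring
    rw [hadd _ _ (hf _), hadd _ _ (hf _), h f hf, h' f hf, mul_add]
  smul_mem' := by
    rintro c ψ ⟨Ψ, hΨ, h⟩
    refine ⟨c • Ψ, Submodule.smul_mem _ c hΨ, fun f hf => ?_⟩
    have hsmul : ∀ (g : Fin n → SmoothFun d) (k : SmoothFun d),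
        pairing vol (c • Ψ) g k = c * pairing vol Ψ g k := by
      intro g k
      rw [pairing, pairing, ← MeasureTheory.integral_const_mul]
      congr 1
      funext x
      change (c * (Ψ g).1 x) * _ * _ = _
      ring
    rw [hsmul, hsmul, h f hf]
    ring

lemma mem_cyclicCochains {d n : ℕ} {vol : (Poly d)ˣ} {ψ : Cochain (Poly d) n} :
    ψ ∈ cyclicCochains vol n ↔ ∃ Ψ, (ψ, Ψ) ∈ polyDiffPair d n ∧ IsSmoothShift vol Ψ Ψ :=
  Iff.rfl

lemma dHoch_mem_cyclicCochains {d n : ℕ} (vol : (Poly d)ˣ) {ψ : Cochain (Poly d) n}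
    (h : ψ ∈ cyclicCochains vol n) : dHoch n ψ ∈ cyclicCochains vol (n + 1) := by
  rw [mem_cyclicCochains] at h ⊢
  exact h.elim fun Ψ hΨ =>
    ⟨dHoch n Ψ, dHoch_mem_polyDiffPair hΨ.1, isSmoothShift_dHoch vol Ψ hΨ.2⟩

/-- The Hochschild differential on `[D_poly]_cycl`. -/
def cyclicDiff {d : ℕ} (vol : (Poly d)ˣ) (n : ℕ) :
    cyclicCochains vol n →ₗ[ℂ] cyclicCochains vol (n + 1) :=
  (dHoch n).restrict fun _ hψ => dHoch_mem_cyclicCochains vol hψ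

lemma cyclicDiff_cyclicDiff {d : ℕ} (vol : (Poly d)ˣ) (n : ℕ) :
    cyclicDiff vol (n + 1) ∘ₗ cyclicDiff vol n = 0 := by
  apply LinearMap.ext
  intro ψ
  apply Subtype.ext
  exact dHoch_dHoch ψ.1

/-- The complex `([D_poly]_cycl, d_Hoch)`. -/
def cyclicComplex {d : ℕ} (vol : (Poly d)ˣ) : CochainComplex (ModuleCat.{0} ℂ) ℕ :=
  CochainComplex.of (fun n => ModuleCat.of ℂ (cyclicCochains vol n))
    (fun n => ModuleCat.ofHom (cyclicDiff vol n))
    (fun n => by rw [← ModuleCat.ofHom_comp, cyclicDiff_cyclicDiff]; rfl)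

/-- The complex `(T_poly ⊗ ℂ[u], d_div)`. -/
def polyvectorComplex {d : ℕ} (vol : (Poly d)ˣ) : CochainComplex (ModuleCat.{0} ℂ) ℕ :=
  CochainComplex.of (fun n => ModuleCat.of ℂ (PolyvectorU d n))
    (fun n => ModuleCat.ofHom (dDiv vol n))
    (fun n => by rw [← ModuleCat.ofHom_comp, dDiv_dDiv]; rfl)

/-- `v ↦ ∂_v f = ∑_c v_c ∂f/∂x_c`. -/
def dirDeriv {d : ℕ} (f : Poly d) : (Fin d → ℂ) →ₗ[ℂ] Poly d :=
  Fintype.linearCombination ℂ (fun c => MvPolynomial.pderiv c f)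

open Classical in
/-- The graphs in `Γ(ℓ, k)`, `n = ℓ + 2k`: `n` vertices on a line, `ℓ` of which are endpoints of edges;
`e j` is the position of the `j`-th endpoint from the left. The number of free vertices before the
first endpoint, between consecutive endpoints, and after the last endpoint has to be even. As there
are `e j - j` free vertices to the left of `e j` and `2k` in total, this says that all `e j - j` are
even. -/
def graphs (ℓ n : ℕ) : Finset (Fin ℓ → Fin n) :=
  Finset.univ.filter fun e => StrictMono e ∧ ∀ j, (e j : ℕ) ≡ (j : ℕ) [MOD 2]

open Classical in
/-- `φ_Γ` for constant vector fields:
`Alt_{v_1, …, v_ℓ} ∏_j (∂_{v_j} f_{e j}) · ∏_{i free} f_i`,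
where `Alt` is the signed sum over all permutations. -/
def graphAlt {d ℓ n : ℕ} (e : Fin ℓ → Fin n) :
    (Fin d → ℂ) [⋀^Fin ℓ]→ₗ[ℂ] Cochain (Poly d) n :=
  MultilinearMap.alternatization (MultilinearMap.pi fun f : Fin n → Poly d =>
    (∏ i ∈ Finset.univ.filter (fun i => ∀ j, e j ≠ i), f i) •
      (MultilinearMap.mkPiAlgebra ℂ (Fin ℓ) (Poly d)).compLinearMap fun j => dirDeriv (f (e j)))

/-- `φ_Γ(γ)` for a polynomial `ℓ`-vector field `γ`. -/
def graphCochain {d ℓ n : ℕ} (e : Fin ℓ → Fin n) : Polyvector d ℓ →ₗ[ℂ] Cochain (Poly d) n :=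
  TensorProduct.lift ((Algebra.lsmul ℂ ℂ (Cochain (Poly d) n)).toLinearMap.compl₂
    (exteriorPower.alternatingMapLinearEquiv (graphAlt e)))

/-- `φ̃(γ ⊗ u^k) = k! / (ℓ + 2k)! · ∑_{Γ ∈ Γ(ℓ, k)} φ_Γ(γ)`. -/
def phiTilde {d : ℕ} (n : ℕ) (x : PolyvectorU d n) : Cochain (Poly d) n :=
  ∑ p : Bidegree n, ((p.1.2.factorial : ℂ) / (n.factorial : ℂ)) •
    ∑ e ∈ graphs p.1.1 n, graphCochain e (x p)

/-- `φ_HKR^cycl = 1 / (n + 1) · (1 + C + … + C^n) φ̃` in degree `n = ℓ + 2k`. -/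
def phiCycl {d : ℕ} (vol : (Poly d)ˣ) (n : ℕ) (x : PolyvectorU d n) : Cochain (Poly d) n :=
  (1 / ((n : ℂ) + 1)) • ∑ j ∈ Finset.range (n + 1), (cyclicShift vol)^[j] (phiTilde n x)

end
end CyclicHKR

/-! A polydifferential operator Ψ in n arguments is determined by the functional (f_0,…,f_n) ↦ ∫ f_0
Ψ(f_1,…,f_n) on test functions, and every functional ∫ a ∂^{w_0}f_0 ⋯ ∂^{w_n}f_n arises in this way
by integration by parts (`functionals_eq_map`, `Represents.unique_operator`). A unit of ℂ[x_1,…,x_d]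
is a constant, so Ω is a constant multiple of Lebesgue measure and the shift C becomes the signed
rotation `cyc` of the n+1 arguments. The theorem then concerns the classical operators of cyclic
theory: b = `hochDiff`, b' = `barDiff` and N = `cycNorm`, with bN = Nb' (`hochDiff_cycNorm`).

Map of complexes. A graph in Γ(ℓ,k) is a word of L = ℓ + k symbols, each of them either one argument
to be differentiated or a product of two neighbouring arguments; the sum over all graphs is `words`
(`sum_graphCochain`). These sums are Hochschild cocycles, so b' of such a sum reduces to minus its
last face (`barDiff_wordsF`). Under N a word may be rotated so that a chosen pair stands first, and
a word has as many choices as it has pairs (`cycNorm_intF_words`). Together with an integration by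
parts that expresses the divergence (`wordsF_divg`), this shows that bN(words γ) is a rational
multiple of N(words (div γ)), and the factors k!/(ℓ+2k)! absorb the multiple (`hochDiff_cyclicMap`).

Quasi-isomorphism. For every finite set s of variables the mapping cone of the cyclic map is shown
to be acyclic (`coneCocycles_le_coneCoboundaries`), by induction on s. Fix c in s. The Euler field E
= x_c ∂_c acts on the cone, and every element is a finite sum of eigenvectors. The square E² maps
cocycles to coboundaries (`coneE_coneE_mem`): on polyvectors E is given by a Cartan formula for the
divergence (`eulerPV_eq`); after subtracting this homotopy, a cyclic functional F with bF = 0 is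
left. By the ordinary HKR theorem F is an alternating operator plus a coboundary, and E F is the
norm of an operation on the first argument, which can be evaluated on both summands
(`cycNorm_plug_wordsF_self`, `cycNorm_plug_hochDiff`). Hence only cocycles z of weight 0 matter.
Write z = ∂_c z' with z' of weight −1. The cone differential of z' is killed by ∂_c and has weight
−1, which forces it to involve neither x_c nor ∂_c; by induction z' can be corrected to a cocycle w
with ∂_c w = z and Ew = −w. Now w = E²w is a coboundary, and so is z. When no variable is left, both
complexes are ℂ in even degrees with zero differential. The cone does not see injectivity in degree
zero; this is checked directly (`eq_zero_of_cyclicMap_zero`).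

The HKR theorem (`exists_eq_words_add_dHoch`) also rests on an Euler operator, which multiplies an
operator by its order modulo lower order. By an explicit homotopy (`dHoch_homot`) it agrees with Σ_c
∂_c ∪ δ_c, where δ_c is the alternating sum over the slots of commutators with x_c, evaluated at 1.
As δ_c removes an argument, a double induction on the number of arguments and on the order shows
that a cocycle whose antisymmetrized symbol vanishes is a coboundary
(`eq_dHoch_of_symbolClass_eq_zero`). -/

namespace CyclicHKR
noncomputable section
open scoped TensorProduct ContDiff

/-! ### Rings with commuting partial derivatives -/

/-- A commutative algebra over `ℂ[x_1, …, x_d]` with commuting derivations that extend the partial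
derivatives. -/
structure IsDiffRing {d : ℕ} {B : Type} [CommRing B] [Algebra ℂ B] (j : Poly d →ₐ[ℂ] B)
    (D : Fin d → Module.End ℂ B) : Prop where
  leibniz : ∀ c f g, D c (f * g) = D c f * g + f * D c g
  comm : ∀ c c' f, D c (D c' f) = D c' (D c f)
  coord : ∀ c p, D c (j p) = j (MvPolynomial.pderiv c p)

lemma isDiffRing_poly (d : ℕ) : IsDiffRing (AlgHom.id ℂ (Poly d))
    (fun c => (MvPolynomial.pderiv c).toLinearMap) where
  leibniz := pderiv_mul_rule
  comm c c' f := pderiv_comm c c' f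
  coord _ _ := rfl

lemma smoothDeriv_one {d : ℕ} (c : Fin d) : smoothDeriv c (1 : SmoothFun d) = 0 := by
  have h := smoothDeriv_mul c (1 : SmoothFun d) 1
  rw [one_mul, mul_one, one_mul] at h
  exact left_eq_add.mp h

lemma smoothDeriv_coord {d : ℕ} (c i : Fin d) :
    smoothDeriv c (smoothCoord i) = if i = c then 1 else 0 := by
  apply Subtype.ext
  funext x
  have h : HasFDerivAt (fun x : Fin d → ℝ => ((x i : ℝ) : ℂ))
      (Complex.ofRealCLM.comp (ContinuousLinearMap.proj i)) x :=
    Complex.ofRealCLM.hasFDerivAt.comp x (hasFDerivAt_apply i x)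
  change fderiv ℝ (fun x : Fin d → ℝ => ((x i : ℝ) : ℂ)) x (Pi.single c 1) = _
  rw [h.fderiv]
  have e1 : ((1 : SmoothFun d)).1 x = 1 := rfl
  have e0 : ((0 : SmoothFun d)).1 x = 0 := rfl
  split_ifs with hic
  · subst hic
    rw [e1]; simp
  · rw [e0]; simp [hic]

lemma smoothDeriv_comm {d : ℕ} (c c' : Fin d) (f : SmoothFun d) :
    smoothDeriv c (smoothDeriv c' f) = smoothDeriv c' (smoothDeriv c f) := by
  apply Subtype.ext
  funext x
  have hf := contDiff_smoothFun f
  have hd : ContDiff ℝ ∞ (fderiv ℝ f.1) := hf.fderiv_right (m := ∞) (by simp)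
  have key : ∀ a b : Fin d, fderiv ℝ (fun y => fderiv ℝ f.1 y (Pi.single b 1)) x (Pi.single a 1) =
      fderiv ℝ (fderiv ℝ f.1) x (Pi.single a 1) (Pi.single b 1) := by
    intro a b
    have h1 : DifferentiableAt ℝ (fderiv ℝ f.1) x := (hd.differentiable (by simp)) x
    rw [fderiv_clm_apply h1 (differentiableAt_const _)]
    simp
  change fderiv ℝ (fun y => fderiv ℝ f.1 y (Pi.single c' 1)) x (Pi.single c 1) =
    fderiv ℝ (fun y => fderiv ℝ f.1 y (Pi.single c 1)) x (Pi.single c' 1)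
  rw [key, key]
  have hs : IsSymmSndFDerivAt ℝ f.1 x :=
    (hf.contDiffAt).isSymmSndFDerivAt (by simp; exact WithTop.coe_le_coe.2 (le_top : (2 : ℕ∞) ≤ ⊤))
  exact hs _ _

lemma isDiffRing_smooth (d : ℕ) : IsDiffRing (polyToSmooth d) smoothDeriv where
  leibniz := smoothDeriv_mul
  comm := smoothDeriv_comm
  coord c p := by
    induction p using MvPolynomial.induction_on with
    | C a =>
      rw [MvPolynomial.pderiv_C, map_zero]
      have : polyToSmooth d (MvPolynomial.C a) = a • (1 : SmoothFun d) := by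
        rw [MvPolynomial.C_eq_smul_one, map_smul, map_one]
      rw [this, map_smul, smoothDeriv_one, smul_zero]
    | add p q hp hq => simp only [map_add, hp, hq]
    | mul_X p i hp =>
      rw [map_mul, smoothDeriv_mul, hp, Derivation.leibniz, smul_eq_mul, smul_eq_mul, map_add,
        map_mul, map_mul]
      have : polyToSmooth d (MvPolynomial.X i) = smoothCoord i := by simp [polyToSmooth]
      rw [this, smoothDeriv_coord, MvPolynomial.pderiv_X, Pi.single_apply]
      split_ifs
      · rw [map_one]; ring
      · rw [map_zero]; ring

section Words

variable {d : ℕ} {B : Type} [CommRing B] [Algebra ℂ B] {j : Poly d →ₐ[ℂ] B}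
  {D : Fin d → Module.End ℂ B}

@[simp] lemma wordDeriv_nil (f : B) : wordDeriv D [] f = f := by
  simp [wordDeriv]

lemma wordDeriv_cons (c : Fin d) (w : List (Fin d)) (f : B) :
    wordDeriv D (c :: w) f = D c (wordDeriv D w f) := by
  simp [wordDeriv]

lemma wordDeriv_append (w w' : List (Fin d)) (f : B) :
    wordDeriv D (w ++ w') f = wordDeriv D w (wordDeriv D w' f) := by
  simp [wordDeriv]

lemma IsDiffRing.wordDeriv_comm (h : IsDiffRing j D) (c : Fin d) (w : List (Fin d)) (f : B) :
    wordDeriv D w (D c f) = D c (wordDeriv D w f) := by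
  induction w with
  | nil => simp
  | cons a w ih => rw [wordDeriv_cons, wordDeriv_cons, ih, h.comm]

lemma IsDiffRing.D_one (h : IsDiffRing j D) (c : Fin d) : D c 1 = 0 := by
  have := h.coord c 1
  simpa using this

lemma IsDiffRing.wordDeriv_erase (h : IsDiffRing j D) {c : Fin d} {w : List (Fin d)} (hc : c ∈ w)
    (f : B) : D c (wordDeriv D (w.erase c) f) = wordDeriv D w f := by
  induction w with
  | nil => simp at hc
  | cons a w ih =>
    by_cases hac : a = c
    · subst hac; rw [List.erase_cons_head, wordDeriv_cons]
    · have hcw : c ∈ w := by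
        rcases List.mem_cons.mp hc with h1 | h1
        · exact absurd h1.symm hac
        · exact h1
      rw [List.erase_cons_tail (by simpa using hac), wordDeriv_cons, wordDeriv_cons, h.comm, ih hcw]

/-- The commutator of ∂^w with x_c deletes one letter c, in as many ways as c occurs. Since the
derivatives commute, it does not matter which occurrence `erase` removes. -/
lemma IsDiffRing.wordDeriv_X_mul (h : IsDiffRing j D) (c : Fin d) (w : List (Fin d)) (f : B) :
    wordDeriv D w (j (MvPolynomial.X c) * f) = j (MvPolynomial.X c) * wordDeriv D w f +
      (w.count c : ℂ) • wordDeriv D (w.erase c) f := by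
  induction w with
  | nil => simp
  | cons a w ih =>
    rw [wordDeriv_cons, ih, map_add, h.leibniz, h.coord, map_smul, wordDeriv_cons,
      MvPolynomial.pderiv_X]
    by_cases hac : a = c
    · subst hac
      rw [List.erase_cons_head, List.count_cons_self, Pi.single_eq_same, map_one, one_mul]
      by_cases haw : a ∈ w
      · rw [h.wordDeriv_erase haw]
        push_cast
        rw [add_smul, one_smul]; ring
      · rw [List.count_eq_zero_of_not_mem haw]
        simp; ring
    · rw [List.erase_cons_tail (by simpa using hac), List.count_cons_of_ne hac, wordDeriv_cons,
        Pi.single_eq_of_ne (Ne.symm hac), map_zero, zero_mul, zero_add]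

/-- Euler's identity for a single derivative word. -/
lemma IsDiffRing.wordDeriv_X_mul_D (h : IsDiffRing j D) (c : Fin d) (w : List (Fin d)) (f : B) :
    wordDeriv D w (j (MvPolynomial.X c) * D c f) =
      j (MvPolynomial.X c) * D c (wordDeriv D w f) + (w.count c : ℂ) • wordDeriv D w f := by
  rw [h.wordDeriv_X_mul, h.wordDeriv_comm]
  by_cases hc : c ∈ w
  · rw [h.wordDeriv_comm, h.wordDeriv_erase hc]
  · rw [List.count_eq_zero_of_not_mem hc]; simp

end Words

/-! ### Test functions and integration -/

/-- Smooth functions with compact support. -/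
def testAlg (d : ℕ) : NonUnitalSubalgebra ℂ (SmoothFun d) where
  carrier := {f | HasCompactSupport f.1}
  add_mem' {f g} hf hg := HasCompactSupport.add (f := f.1) (f' := g.1) hf hg
  zero_mem' := HasCompactSupport.zero
  mul_mem' {f g} hf _ := HasCompactSupport.mul_right (f := f.1) (f' := g.1) hf
  smul_mem' c f hf := HasCompactSupport.smul_left (f := fun _ => c) (f' := f.1) hf

/-- The algebra of smooth functions with compact support. -/
abbrev Test (d : ℕ) : Type := testAlg d

lemma mem_testAlg {d : ℕ} {f : SmoothFun d} : f ∈ testAlg d ↔ HasCompactSupport f.1 := Iff.rfl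

lemma mul_mem_testAlg {d : ℕ} (f : SmoothFun d) {g : SmoothFun d} (hg : g ∈ testAlg d) :
    f * g ∈ testAlg d :=
  HasCompactSupport.mul_left (f := f.1) (f' := g.1) hg

lemma smoothDeriv_mem_testAlg {d : ℕ} (c : Fin d) {g : SmoothFun d} (hg : g ∈ testAlg d) :
    smoothDeriv c g ∈ testAlg d :=
  HasCompactSupport.fderiv_apply (𝕜 := ℝ) (f := g.1) hg _

lemma wordDeriv_mem_testAlg {d : ℕ} (w : List (Fin d)) {g : SmoothFun d} (hg : g ∈ testAlg d) :
    wordDeriv smoothDeriv w g ∈ testAlg d := by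
  induction w with
  | nil => simpa using hg
  | cons c w ih => rw [wordDeriv_cons]; exact smoothDeriv_mem_testAlg c ih

/-- The partial derivative of a test function. -/
def Test.D {d : ℕ} (c : Fin d) (f : Test d) : Test d :=
  ⟨smoothDeriv c f.1, smoothDeriv_mem_testAlg c f.2⟩

/-- The product of a test function with a coordinate. -/
def Test.X {d : ℕ} (c : Fin d) (f : Test d) : Test d :=
  ⟨polyToSmooth d (MvPolynomial.X c) * f.1, mul_mem_testAlg _ f.2⟩

lemma integrable_test {d : ℕ} (f : Test d) : MeasureTheory.Integrable f.1.1 :=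
  Continuous.integrable_of_hasCompactSupport (contDiff_smoothFun f.1).continuous f.2

/-- The integral is additive only on integrable functions. A linear extension from test functions to
all smooth functions makes linearity available without side conditions; only its values on test
functions have a meaning. -/
lemma exists_integral_extension (d : ℕ) : ∃ I : SmoothFun d →ₗ[ℂ] ℂ,
    ∀ f ∈ testAlg d, I f = ∫ x, f.1 x := by
  let I₀ : (testAlg d).toSubmodule →ₗ[ℂ] ℂ :=
    { toFun := fun f => ∫ x, f.1.1 x
      map_add' := fun f g => MeasureTheory.integral_add (integrable_test ⟨f.1, f.2⟩)
        (integrable_test ⟨g.1, g.2⟩)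
      map_smul' := fun c f => MeasureTheory.integral_smul c f.1.1 }
  obtain ⟨I, hI⟩ := LinearMap.exists_extend I₀
  exact ⟨I, fun f hf => LinearMap.congr_fun hI ⟨f, hf⟩⟩

/-- A linear functional on smooth functions that is the Lebesgue integral on test functions. -/
def integral (d : ℕ) : SmoothFun d →ₗ[ℂ] ℂ := Classical.choose (exists_integral_extension d)

lemma integral_eq {d : ℕ} {f : SmoothFun d} (hf : f ∈ testAlg d) : integral d f = ∫ x, f.1 x :=
  Classical.choose_spec (exists_integral_extension d) f hf

lemma integral_smoothDeriv {d : ℕ} (c : Fin d) {f : SmoothFun d} (hf : f ∈ testAlg d) :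
    integral d (smoothDeriv c f) = 0 := by
  rw [integral_eq (smoothDeriv_mem_testAlg c hf)]
  have h1 := integrable_test ⟨_, smoothDeriv_mem_testAlg c hf⟩
  have h2 := integrable_test ⟨f, hf⟩
  -- Integration by parts against the constant function 1.
  have h := integral_mul_fderiv_eq_neg_fderiv_mul_of_integrable (μ := MeasureTheory.volume)
    (f := fun _ : Fin d → ℝ => (1 : ℂ)) (g := f.1) (v := Pi.single c 1) (by simp)
    (by simp only [one_mul]; exact h1) (by simpa using h2) (fun _ _ => differentiableAt_const _)
    (fun x _ => differentiableAt_smoothFun f x)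
  simp only [one_mul, fderiv_fun_const, Pi.zero_apply, zero_apply, zero_mul,
    MeasureTheory.integral_zero, neg_zero] at h
  exact h

/-- The fundamental lemma of the calculus of variations; real-valued test functions already suffice.
-/
lemma eq_zero_of_integral {d : ℕ} (h : SmoothFun d)
    (H : ∀ g ∈ testAlg d, integral d (h * g) = 0) : h = 0 := by
  have hc := (contDiff_smoothFun h).continuous
  have h0 := ae_eq_zero_of_integral_contDiff_smul_eq_zero (μ := MeasureTheory.volume) (f := h.1)
    hc.locallyIntegrable (by
      intro g hg hgc
      let G : SmoothFun d := ⟨fun x => (g x : ℂ), by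
        change ContDiff ℝ ∞ _
        exact Complex.ofRealCLM.contDiff.comp hg⟩
      have hG : G ∈ testAlg d := by
        rw [mem_testAlg]
        exact hgc.comp_left (g := fun r : ℝ => (r : ℂ)) Complex.ofReal_zero
      rw [← H G hG, integral_eq (mul_mem_testAlg _ hG)]
      congr 1
      funext x
      change g x • h.1 x = h.1 x * (g x : ℂ)
      rw [Complex.real_smul, mul_comm])
  apply Subtype.ext
  exact (Continuous.ae_eq_iff_eq MeasureTheory.volume hc continuous_const).mp h0

/-- Near every point, a polynomial coincides with a test function. -/
lemma exists_test_eventuallyEq {d : ℕ} (f : SmoothFun d) (x : Fin d → ℝ) :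
    ∃ g : Test d, ∀ᶠ y in nhds x, g.1.1 y = f.1 y := by
  let b : ContDiffBump x := ⟨1, 2, one_pos, one_lt_two⟩
  let G : SmoothFun d := ⟨fun y => (b y : ℂ), by
    change ContDiff ℝ ∞ _
    exact Complex.ofRealCLM.contDiff.comp b.contDiff⟩
  have hG : G ∈ testAlg d := by
    rw [mem_testAlg]
    exact b.hasCompactSupport.comp_left (g := fun r : ℝ => (r : ℂ)) Complex.ofReal_zero
  refine ⟨⟨f * G, mul_mem_testAlg f hG⟩, ?_⟩
  filter_upwards [b.eventuallyEq_one] with y hy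
  change f.1 y * (b y : ℂ) = f.1 y
  rw [hy]
  simp

lemma wordDeriv_eventuallyEq {d : ℕ} (w : List (Fin d)) {f g : SmoothFun d} {x : Fin d → ℝ}
    (h : ∀ᶠ y in nhds x, f.1 y = g.1 y) :
    ∀ᶠ y in nhds x, (wordDeriv smoothDeriv w f).1 y = (wordDeriv smoothDeriv w g).1 y := by
  induction w with
  | nil => simpa using h
  | cons c w ih =>
    rw [wordDeriv_cons, wordDeriv_cons]
    have := Filter.EventuallyEq.fderiv (𝕜 := ℝ) ih
    filter_upwards [this] with y hy
    change fderiv ℝ _ y _ = fderiv ℝ _ y _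
    rw [hy]

lemma polyToSmooth_apply {d : ℕ} (p : Poly d) (x : Fin d → ℝ) :
    (polyToSmooth d p).1 x = MvPolynomial.eval (fun i => (x i : ℂ)) p := by
  have h : ((Pi.evalAlgHom ℂ (fun _ : Fin d → ℝ => ℂ) x).comp
      ((smoothIncl d).comp (polyToSmooth d))) = MvPolynomial.aeval (fun i => (x i : ℂ)) := by
    apply MvPolynomial.algHom_ext
    intro i
    simp [polyToSmooth]
    rfl
  have := DFunLike.congr_fun h p
  rw [MvPolynomial.aeval_eq_eval] at this
  exact this

/-- The real numbers are an infinite subset of ℂ, so a complex polynomial that vanishes on all real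
points is zero. -/
lemma eq_zero_of_polyToSmooth {d : ℕ} {p : Poly d} (h : ∀ x, (polyToSmooth d p).1 x = 0) :
    p = 0 := by
  refine MvPolynomial.funext_set (fun _ => Set.range ((↑) : ℝ → ℂ))
    (fun _ => Set.infinite_range_of_injective Complex.ofReal_injective) fun x hx => ?_
  choose y hy using fun i => hx i (Set.mem_univ i)
  have := h y
  rw [polyToSmooth_apply] at this
  simp only [hy] at this
  simpa using this

end
end CyclicHKR

/-! ### Order filtration, and the passage between polydifferential operators and functionals. -/

namespace CyclicHKR
noncomputable section
open scoped TensorProduct ContDiff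

/-! ### The order filtration on polydifferential operators -/

/-- The total number of derivatives in a family of words. -/
def wordSize {d m : ℕ} (w : Fin m → List (Fin d)) : ℕ := ∑ i, (w i).length

/-- The monomial `x^α ∏ ∂^{w i}` involves only variables in `s` and has order at most `M`. -/
structure Admissible {d m : ℕ} (s : Finset (Fin d)) (M : ℕ∞) (α : Fin d →₀ ℕ)
    (w : Fin m → List (Fin d)) : Prop where
  support : α.support ⊆ s
  letters : ∀ i, ∀ c ∈ w i, c ∈ s
  size : (wordSize w : ℕ∞) ≤ M

/-- Polydifferential operators of order at most `M` in the variables in `s`, acting on polynomials and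
on smooth functions. -/
def pairs {d : ℕ} (s : Finset (Fin d)) (M : ℕ∞) (n : ℕ) :
    Submodule ℂ (Cochain (Poly d) n × Cochain (SmoothFun d) n) :=
  Submodule.span ℂ {P | ∃ α w, Admissible s M α w ∧ P = monomialPair (MvPolynomial.monomial α 1) w}

lemma monomialPair_mem_pairs {d n : ℕ} {s : Finset (Fin d)} {M : ℕ∞} {α : Fin d →₀ ℕ}
    {w : Fin n → List (Fin d)} (h : Admissible s M α w) :
    monomialPair (MvPolynomial.monomial α 1) w ∈ pairs s M n :=
  Submodule.subset_span ⟨α, w, h, rfl⟩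

lemma pairs_mapsTo {d n : ℕ} {s : Finset (Fin d)} {M : ℕ∞} {X : Type*} [AddCommGroup X] [Module ℂ X]
    (T : Cochain (Poly d) n × Cochain (SmoothFun d) n →ₗ[ℂ] X) (N : Submodule ℂ X)
    (h : ∀ α w, Admissible s M α w → T (monomialPair (MvPolynomial.monomial α 1) w) ∈ N)
    {P : Cochain (Poly d) n × Cochain (SmoothFun d) n} (hP : P ∈ pairs s M n) : T P ∈ N := by
  have : pairs s M n ≤ N.comap T := by
    rw [pairs, Submodule.span_le]
    rintro _ ⟨α, w, hw, rfl⟩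
    exact h α w hw
  exact this hP

lemma pairs_mono {d n : ℕ} {s t : Finset (Fin d)} {M N : ℕ∞} (hs : s ⊆ t) (hM : M ≤ N) :
    pairs s M n ≤ pairs t N n := fun _ hP =>
  pairs_mapsTo LinearMap.id _ (fun _ _ h => monomialPair_mem_pairs
    ⟨h.support.trans hs, fun i c hc => hs (h.letters i c hc), h.size.trans hM⟩) hP

lemma exists_mem_pairs {d n : ℕ} {s : Finset (Fin d)}
    {P : Cochain (Poly d) n × Cochain (SmoothFun d) n} (hP : P ∈ pairs s ⊤ n) :
    ∃ M : ℕ, P ∈ pairs s M n := by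
  induction hP using Submodule.span_induction with
  | mem P hP =>
    obtain ⟨α, w, h, rfl⟩ := hP
    exact ⟨wordSize w, monomialPair_mem_pairs ⟨h.support, h.letters, le_rfl⟩⟩
  | zero => exact ⟨0, zero_mem _⟩
  | add P Q _ _ hP hQ =>
    obtain ⟨M, hP⟩ := hP
    obtain ⟨N, hQ⟩ := hQ
    exact ⟨max M N, add_mem (pairs_mono subset_rfl (by exact_mod_cast le_max_left M N) hP)
      (pairs_mono subset_rfl (by exact_mod_cast le_max_right M N) hQ)⟩
  | smul c P _ hP =>
    obtain ⟨M, hP⟩ := hP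
    exact ⟨M, Submodule.smul_mem _ c hP⟩

lemma monomialOp_add {d n : ℕ} {B : Type} [CommRing B] [Algebra ℂ B] (j : Poly d →ₐ[ℂ] B)
    (D : Fin d → Module.End ℂ B) (a b : Poly d) (w : Fin n → List (Fin d)) :
    monomialOp j D (a + b) w = monomialOp j D a w + monomialOp j D b w := by
  funext f; simp [monomialOp, add_mul]

lemma monomialOp_smul {d n : ℕ} {B : Type} [CommRing B] [Algebra ℂ B] (j : Poly d →ₐ[ℂ] B)
    (D : Fin d → Module.End ℂ B) (c : ℂ) (a : Poly d) (w : Fin n → List (Fin d)) :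
    monomialOp j D (c • a) w = c • monomialOp j D a w := by
  funext f; simp [monomialOp]

/-- `monomialPair` as a linear map in the coefficient. -/
def monomialPairLin {d n : ℕ} (w : Fin n → List (Fin d)) :
    Poly d →ₗ[ℂ] Cochain (Poly d) n × Cochain (SmoothFun d) n where
  toFun a := monomialPair a w
  map_add' a b := Prod.ext (monomialOp_add _ _ a b w) (monomialOp_add _ _ a b w)
  map_smul' c a := Prod.ext (monomialOp_smul _ _ c a w) (monomialOp_smul _ _ c a w)

lemma polyDiffPair_eq (d n : ℕ) : polyDiffPair d n = pairs Finset.univ ⊤ n := by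
  apply le_antisymm
  · rw [polyDiffPair, Submodule.span_le]
    rintro _ ⟨a, w, rfl⟩
    change monomialPairLin w a ∈ _
    induction a using MvPolynomial.induction_on' with
    | monomial α c =>
      have : MvPolynomial.monomial α c = c • (MvPolynomial.monomial α 1 : Poly d) := by
        rw [MvPolynomial.smul_monomial, smul_eq_mul, mul_one]
      rw [this, map_smul]
      exact Submodule.smul_mem _ _ (monomialPair_mem_pairs
        ⟨Finset.subset_univ _, fun _ c _ => Finset.mem_univ c, le_top⟩)
    | add p q hp hq => rw [map_add]; exact add_mem hp hq
  · rw [pairs, Submodule.span_le]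
    rintro _ ⟨α, w, _, rfl⟩
    exact Submodule.subset_span ⟨_, w, rfl⟩

lemma pairs_le_polyDiffPair {d n : ℕ} (s : Finset (Fin d)) (M : ℕ∞) :
    pairs s M n ≤ polyDiffPair d n := by
  rw [polyDiffPair_eq]; exact pairs_mono (Finset.subset_univ _) le_top

section Euler

variable {d n : ℕ} {B : Type} [CommRing B] [Algebra ℂ B]

/-- The commutator of an operator with the multiplication of the `i`-th argument by `x_c`. -/
def adOp (j : Poly d →ₐ[ℂ] B) (i : Fin n) (c : Fin d) : Cochain B n →ₗ[ℂ] Cochain B n where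
  toFun ψ f := ψ (Function.update f i (j (MvPolynomial.X c) * f i)) - j (MvPolynomial.X c) * ψ f
  map_add' ψ φ := by funext f; simp only [Pi.add_apply]; ring
  map_smul' a ψ := by
    funext f; simp only [Pi.smul_apply, RingHom.id_apply, smul_sub, mul_smul_comm]

/-- The Euler operator, that multiplies operators in the variables in `s` by their order. -/
def eulerOp (j : Poly d →ₐ[ℂ] B) (D : Fin d → Module.End ℂ B) (s : Finset (Fin d)) :
    Cochain B n →ₗ[ℂ] Cochain B n where
  toFun ψ f := ∑ i : Fin n, ∑ c ∈ s, adOp j i c ψ (Function.update f i (D c (f i)))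
  map_add' ψ φ := by funext f; simp [Finset.sum_add_distrib]
  map_smul' a ψ := by funext f; simp [Finset.smul_sum]

lemma prod_update_word (D : Fin d → Module.End ℂ B) (w : Fin n → List (Fin d)) (f : Fin n → B)
    (i : Fin n) (g : B) :
    ∏ k, wordDeriv D (w k) (Function.update f i g k) =
      wordDeriv D (w i) g * ∏ k ∈ Finset.univ.erase i, wordDeriv D (w k) (f k) := by
  rw [← Finset.mul_prod_erase Finset.univ _ (Finset.mem_univ i), Function.update_self]
  congr 1
  exact Finset.prod_congr rfl fun k hk => by rw [Function.update_of_ne (Finset.ne_of_mem_erase hk)]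

lemma prod_update_word' (D : Fin d → Module.End ℂ B) (w : Fin n → List (Fin d)) (f : Fin n → B)
    (i : Fin n) (v : List (Fin d)) :
    ∏ k, wordDeriv D (Function.update w i v k) (f k) =
      wordDeriv D v (f i) * ∏ k ∈ Finset.univ.erase i, wordDeriv D (w k) (f k) := by
  rw [← Finset.mul_prod_erase Finset.univ _ (Finset.mem_univ i), Function.update_self]
  congr 1
  exact Finset.prod_congr rfl fun k hk => by rw [Function.update_of_ne (Finset.ne_of_mem_erase hk)]

variable {j : Poly d →ₐ[ℂ] B} {D : Fin d → Module.End ℂ B}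

lemma adOp_monomialOp (h : IsDiffRing j D) (i : Fin n) (c : Fin d) (a : Poly d)
    (w : Fin n → List (Fin d)) :
    adOp j i c (monomialOp j D a w) =
      ((w i).count c : ℂ) • monomialOp j D a (Function.update w i ((w i).erase c)) := by
  funext f
  change monomialOp j D a w _ - j (MvPolynomial.X c) * monomialOp j D a w f = _
  simp only [monomialOp, Pi.smul_apply]
  rw [prod_update_word, prod_update_word', h.wordDeriv_X_mul,
    ← Finset.mul_prod_erase Finset.univ _ (Finset.mem_univ i)]
  simp only [Algebra.smul_def]
  ring

/-- In each slot, the commutator with x_c applied to ∂_c f counts the letters c of the word; the sum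
over slots and over s counts all letters, provided that every letter is in s. -/
lemma eulerOp_monomialOp (h : IsDiffRing j D) (s : Finset (Fin d)) (a : Poly d)
    (w : Fin n → List (Fin d)) (hw : ∀ i, ∀ c ∈ w i, c ∈ s) :
    eulerOp j D s (monomialOp j D a w) = (wordSize w : ℂ) • monomialOp j D a w := by
  funext f
  have h1 : ∀ i c, adOp j i c (monomialOp j D a w) (Function.update f i (D c (f i))) =
      ((w i).count c : ℂ) • monomialOp j D a w f := by
    intro i c
    change monomialOp j D a w _ - j (MvPolynomial.X c) * monomialOp j D a w _ = _
    simp only [monomialOp, Function.update_self, Function.update_idem]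
    rw [prod_update_word, prod_update_word, h.wordDeriv_X_mul_D, h.wordDeriv_comm,
      ← Finset.mul_prod_erase Finset.univ _ (Finset.mem_univ i)]
    simp only [Algebra.smul_def]
    ring
  change ∑ i : Fin n, ∑ c ∈ s, _ = _
  simp only [h1, ← Finset.sum_smul, Pi.smul_apply]
  congr 1
  rw [wordSize]
  push_cast
  refine Finset.sum_congr rfl fun i _ => ?_
  have := Multiset.sum_count_eq_card (s := s) (m := (w i : Multiset (Fin d)))
    (fun c hc => hw i c (by simpa using hc))
  rw [Multiset.coe_card] at this
  rw [← this]
  push_cast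
  simp

end Euler

lemma wordSize_update {d n : ℕ} (w : Fin n → List (Fin d)) (i : Fin n) (v : List (Fin d)) :
    wordSize (Function.update w i v) + (w i).length = wordSize w + v.length := by
  rw [wordSize, wordSize, ← Finset.add_sum_erase _ _ (Finset.mem_univ i),
    ← Finset.add_sum_erase Finset.univ (fun k => (w k).length) (Finset.mem_univ i),
    Function.update_self]
  have : ∑ k ∈ Finset.univ.erase i, (Function.update w i v k).length =
      ∑ k ∈ Finset.univ.erase i, (w k).length :=
    Finset.sum_congr rfl fun k hk => by rw [Function.update_of_ne (Finset.ne_of_mem_erase hk)]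
  rw [this]; ring

/-- `adOp` on polynomials and on smooth functions. -/
def adPair {d n : ℕ} (i : Fin n) (c : Fin d) :
    Cochain (Poly d) n × Cochain (SmoothFun d) n →ₗ[ℂ]
      Cochain (Poly d) n × Cochain (SmoothFun d) n :=
  (adOp (AlgHom.id ℂ (Poly d)) i c).prodMap (adOp (polyToSmooth d) i c)

/-- `eulerOp` on polynomials and on smooth functions. -/
def eulerPair {d n : ℕ} (s : Finset (Fin d)) :
    Cochain (Poly d) n × Cochain (SmoothFun d) n →ₗ[ℂ]
      Cochain (Poly d) n × Cochain (SmoothFun d) n :=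
  (eulerOp (AlgHom.id ℂ (Poly d)) (fun c => (MvPolynomial.pderiv c).toLinearMap) s).prodMap
    (eulerOp (polyToSmooth d) smoothDeriv s)

lemma adPair_monomialPair {d n : ℕ} (i : Fin n) (c : Fin d) (a : Poly d)
    (w : Fin n → List (Fin d)) : adPair i c (monomialPair a w) =
      ((w i).count c : ℂ) • monomialPair a (Function.update w i ((w i).erase c)) :=
  Prod.ext (adOp_monomialOp (isDiffRing_poly d) i c a w)
    (adOp_monomialOp (isDiffRing_smooth d) i c a w)

lemma eulerPair_monomialPair {d n : ℕ} (s : Finset (Fin d)) (a : Poly d)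
    (w : Fin n → List (Fin d)) (hw : ∀ i, ∀ c ∈ w i, c ∈ s) :
    eulerPair s (monomialPair a w) = (wordSize w : ℂ) • monomialPair a w :=
  Prod.ext (eulerOp_monomialOp (isDiffRing_poly d) s a w hw)
    (eulerOp_monomialOp (isDiffRing_smooth d) s a w hw)

lemma adPair_mem {d n : ℕ} {s : Finset (Fin d)} {M : ℕ} (i : Fin n) (c : Fin d)
    {P : Cochain (Poly d) n × Cochain (SmoothFun d) n} (hP : P ∈ pairs s (M + 1 : ℕ) n) :
    adPair i c P ∈ pairs s M n := by
  refine pairs_mapsTo _ _ (fun α w hw => ?_) hP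
  rw [adPair_monomialPair]
  by_cases hc : c ∈ w i
  · refine Submodule.smul_mem _ _ (monomialPair_mem_pairs ⟨hw.support, fun k b hb => ?_, ?_⟩)
    · rcases eq_or_ne k i with rfl | hk
      · rw [Function.update_self] at hb
        exact hw.letters k b (List.mem_of_mem_erase hb)
      · rw [Function.update_of_ne hk] at hb
        exact hw.letters k b hb
    · have h1 := wordSize_update w i ((w i).erase c)
      have h2 := List.length_erase_of_mem hc
      have h3 := List.length_pos_of_mem hc
      have h4 := hw.size
      norm_cast at h4 ⊢
      omega
  · rw [List.count_eq_zero_of_not_mem hc]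
    simp

/-- The Euler operator acts by M + 1 on monomials of order exactly M + 1, and it preserves the lower
ones. This permits division by the order, modulo lower order. -/
lemma eulerPair_sub_mem {d n : ℕ} {s : Finset (Fin d)} {M : ℕ}
    {P : Cochain (Poly d) n × Cochain (SmoothFun d) n} (hP : P ∈ pairs s (M + 1 : ℕ) n) :
    eulerPair s P - ((M + 1 : ℕ) : ℂ) • P ∈ pairs s M n := by
  refine pairs_mapsTo (eulerPair s - ((M + 1 : ℕ) : ℂ) • LinearMap.id) _ (fun α w hw => ?_) hP
  rw [LinearMap.sub_apply, LinearMap.smul_apply, LinearMap.id_apply,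
    eulerPair_monomialPair _ _ _ hw.letters]
  have h4 := hw.size
  norm_cast at h4
  rcases Nat.lt_or_ge M (wordSize w) with h | h
  · rw [show wordSize w = M + 1 by omega, sub_self]
    exact zero_mem _
  · rw [← sub_smul]
    exact Submodule.smul_mem _ _ (monomialPair_mem_pairs
      ⟨hw.support, hw.letters, by exact_mod_cast h⟩)

/-- An operator of order zero is a polynomial times the product of all arguments. The same
coefficient is also shown to be admissible with one argument fewer, because that product is the
primitive needed in `eq_dHoch_of_order_zero`. -/
lemma exists_of_mem_pairs_zero {d n : ℕ} {s : Finset (Fin d)}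
    {P : Cochain (Poly d) n × Cochain (SmoothFun d) n} (hP : P ∈ pairs s 0 n) :
    ∃ a, (∀ M, monomialPair a (fun _ : Fin (n - 1) => []) ∈ pairs s M (n - 1)) ∧
      P = monomialPair a fun _ => [] := by
  induction hP using Submodule.span_induction with
  | mem P hP =>
    obtain ⟨α, w, h, rfl⟩ := hP
    refine ⟨_, fun M => monomialPair_mem_pairs ⟨h.support, by simp, by simp [wordSize]⟩, ?_⟩
    have h0 := h.size
    rw [nonpos_iff_eq_zero] at h0
    norm_cast at h0
    rw [wordSize, Finset.sum_eq_zero_iff] at h0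
    congr 1
    funext i
    exact List.eq_nil_of_length_eq_zero (h0 i (Finset.mem_univ i))
  | zero =>
    have h := fun m => (monomialPairLin (d := d) (fun _ : Fin m => [])).map_zero
    refine ⟨0, fun M => ?_, (h n).symm⟩
    have := h (n - 1)
    change monomialPair 0 _ = 0 at this
    rw [this]; exact zero_mem _
  | add P Q _ _ hP hQ =>
    obtain ⟨a, ha, rfl⟩ := hP
    obtain ⟨b, hb, rfl⟩ := hQ
    have h := fun m => (monomialPairLin (d := d) (fun _ : Fin m => [])).map_add a b
    refine ⟨a + b, fun M => ?_, (h n).symm⟩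
    have := h (n - 1)
    change monomialPair (a + b) _ = monomialPair a _ + monomialPair b _ at this
    rw [this]; exact add_mem (ha M) (hb M)
  | smul c P _ hP =>
    obtain ⟨a, ha, rfl⟩ := hP
    have h := fun m => (monomialPairLin (d := d) (fun _ : Fin m => [])).map_smul c a
    refine ⟨c • a, fun M => ?_, (h n).symm⟩
    have := h (n - 1)
    change monomialPair (c • a) _ = c • monomialPair a _ at this
    rw [this]; exact Submodule.smul_mem _ c (ha M)

/-- The extension of a polydifferential operator to smooth functions is unique. -/
lemma snd_eq_zero_of_mem_pairs {d n M : ℕ} {Ψ : Cochain (SmoothFun d) n}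
    (h : ((0 : Cochain (Poly d) n), Ψ) ∈ pairs Finset.univ M n) : Ψ = 0 := by
  induction M generalizing Ψ with
  | zero =>
    obtain ⟨a, -, ha⟩ := exists_of_mem_pairs_zero (by simpa using h)
    have h1 := congrFun (congrArg Prod.fst ha) (fun _ => 1)
    have h2 := congrArg Prod.snd ha
    have ha0 : a = 0 := by
      simpa [monomialPair, monomialOp] using h1.symm
    subst ha0
    have := congrArg Prod.snd ((monomialPairLin (d := d) (fun _ : Fin n => [])).map_zero)
    exact h2.trans this
  | succ M ih =>
    -- Commutators with coordinates lower the order, so they vanish by induction. Hence the Euler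
    -- operator kills Ψ; but it equals (M + 1)Ψ modulo lower order, so (M + 1)Ψ itself has lower
    -- order and the induction applies again.
    have h1 : ∀ i c, adOp (polyToSmooth d) i c Ψ = 0 := by
      intro i c
      apply ih
      have := adPair_mem i c h
      have h0 : adPair i c ((0 : Cochain (Poly d) n), Ψ) = (0, adOp (polyToSmooth d) i c Ψ) :=
        Prod.ext (LinearMap.map_zero (adOp (AlgHom.id ℂ (Poly d)) i c)) rfl
      rwa [h0] at this
    have h2 : eulerOp (polyToSmooth d) smoothDeriv Finset.univ Ψ = 0 := by
      funext f
      change ∑ i : Fin n, ∑ c ∈ Finset.univ,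
        adOp (polyToSmooth d) i c Ψ (Function.update f i (smoothDeriv c (f i))) = 0
      simp [h1]
    have h3 := eulerPair_sub_mem h
    have h4 : eulerPair Finset.univ ((0 : Cochain (Poly d) n), Ψ) -
        ((M + 1 : ℕ) : ℂ) • ((0 : Cochain (Poly d) n), Ψ) = (0, -(((M + 1 : ℕ) : ℂ) • Ψ)) := by
      refine Prod.ext ?_ ?_
      · simp [eulerPair]
      · simp only [eulerPair, Prod.snd_sub, LinearMap.prodMap_apply, Prod.smul_snd, h2, zero_sub]
    rw [h4] at h3
    have h5 := ih h3
    rw [neg_eq_zero, smul_eq_zero] at h5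
    exact h5.resolve_left (by exact_mod_cast Nat.succ_ne_zero M)

lemma snd_unique {d n : ℕ} {ψ : Cochain (Poly d) n} {Ψ Ψ' : Cochain (SmoothFun d) n}
    (h : (ψ, Ψ) ∈ polyDiffPair d n) (h' : (ψ, Ψ') ∈ polyDiffPair d n) : Ψ = Ψ' := by
  rw [polyDiffPair_eq] at h h'
  have h0 := sub_mem h h'
  rw [Prod.mk_sub_mk, sub_self] at h0
  obtain ⟨M, hM⟩ := exists_mem_pairs h0
  exact sub_eq_zero.mp (snd_eq_zero_of_mem_pairs hM)

/-! ### Polydifferential operators as functionals -/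

/-- Functionals in `n + 1` test functions. -/
abbrev Functional (d n : ℕ) : Type := (Fin (n + 1) → Test d) → ℂ

/-- The functional `(f_0, …, f_n) ↦ ∫ f_0 Ψ(f_1, …, f_n)`. -/
def toFunctional {d n : ℕ} : Cochain (SmoothFun d) n →ₗ[ℂ] Functional d n where
  toFun Ψ f := integral d ((f 0).1 * Ψ fun i => (f i.succ).1)
  map_add' Ψ Φ := by funext f; simp [mul_add]
  map_smul' c Ψ := by funext f; simp

/-- The functional `(f_0, …, f_n) ↦ ∫ a ∏ ∂^{w i} f_i`. -/
def wordFunctional {d n : ℕ} (a : Poly d) (w : Fin (n + 1) → List (Fin d)) : Functional d n :=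
  fun f => integral d (polyToSmooth d a * ∏ i, wordDeriv smoothDeriv (w i) (f i).1)

lemma toFunctional_monomialOp {d n : ℕ} (a : Poly d) (w : Fin n → List (Fin d)) :
    toFunctional (monomialOp (polyToSmooth d) smoothDeriv a w) =
      wordFunctional a (Fin.cons [] w : Fin (n + 1) → List (Fin d)) := by
  funext f
  change integral d _ = integral d _
  congr 1
  rw [Fin.prod_univ_succ]
  simp only [Fin.cons_zero, Fin.cons_succ, wordDeriv_nil, monomialOp]
  ring

/-- `wordFunctional` as a linear map in the coefficient. -/
def wordFunctionalLin {d n : ℕ} (w : Fin (n + 1) → List (Fin d)) : Poly d →ₗ[ℂ] Functional d n where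
  toFun a := wordFunctional a w
  map_add' a b := by funext f; simp [wordFunctional, add_mul]
  map_smul' c a := by funext f; simp [wordFunctional]

/-- Functionals of order at most `M` in the variables in `s`. -/
def functionals {d : ℕ} (s : Finset (Fin d)) (M : ℕ∞) (n : ℕ) : Submodule ℂ (Functional d n) :=
  Submodule.span ℂ {F | ∃ α w, Admissible s M α w ∧ F = wordFunctional (MvPolynomial.monomial α 1) w}

lemma wordFunctional_mem {d n : ℕ} {s : Finset (Fin d)} {M : ℕ∞} {α : Fin d →₀ ℕ}
    {w : Fin (n + 1) → List (Fin d)} (h : Admissible s M α w) :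
    wordFunctional (MvPolynomial.monomial α 1) w ∈ functionals s M n :=
  Submodule.subset_span ⟨α, w, h, rfl⟩

lemma functionals_mapsTo {d n : ℕ} {s : Finset (Fin d)} {M : ℕ∞} {X : Type*} [AddCommGroup X]
    [Module ℂ X] (T : Functional d n →ₗ[ℂ] X) (N : Submodule ℂ X)
    (h : ∀ α w, Admissible s M α w → T (wordFunctional (MvPolynomial.monomial α 1) w) ∈ N)
    {F : Functional d n} (hF : F ∈ functionals s M n) : T F ∈ N := by
  have : functionals s M n ≤ N.comap T := by
    rw [functionals, Submodule.span_le]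
    rintro _ ⟨α, w, hw, rfl⟩
    exact h α w hw
  exact this hF

lemma functionals_mono {d n : ℕ} {s t : Finset (Fin d)} {M N : ℕ∞} (hs : s ⊆ t) (hM : M ≤ N) :
    functionals s M n ≤ functionals t N n := fun _ hP =>
  functionals_mapsTo LinearMap.id _ (fun _ _ h => wordFunctional_mem
    ⟨h.support.trans hs, fun i c hc => hs (h.letters i c hc), h.size.trans hM⟩) hP

lemma IsDiffRing.D_prod {d n : ℕ} {B : Type} [CommRing B] [Algebra ℂ B] {j : Poly d →ₐ[ℂ] B}
    {D : Fin d → Module.End ℂ B} (h : IsDiffRing j D) (c : Fin d) (F : Fin n → B) :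
    D c (∏ i, F i) = ∑ i, D c (F i) * ∏ k ∈ Finset.univ.erase i, F k := by
  have key : ∀ t : Finset (Fin n), D c (∏ i ∈ t, F i) = ∑ i ∈ t, D c (F i) * ∏ k ∈ t.erase i, F k := by
    intro t
    induction t using Finset.induction_on with
    | empty => simp [h.D_one]
    | insert a t ha ih =>
      rw [Finset.prod_insert ha, h.leibniz, ih, Finset.sum_insert ha, Finset.erase_insert ha,
        Finset.mul_sum]
      congr 1
      refine Finset.sum_congr rfl fun i hi => ?_
      have hai : a ≠ i := fun h => ha (h ▸ hi)
      rw [Finset.erase_insert_of_ne hai, Finset.prod_insert (by simp [ha])]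
      ring
  exact key Finset.univ

lemma prod_wordDeriv_mem_testAlg {d n : ℕ} (w : Fin (n + 1) → List (Fin d)) (f : Fin (n + 1) → Test d) :
    ∏ i, wordDeriv smoothDeriv (w i) (f i).1 ∈ testAlg d := by
  rw [Fin.prod_univ_succ, mul_comm]
  exact mul_mem_testAlg _ (wordDeriv_mem_testAlg _ (f 0).2)

/-- Integration by parts. -/
lemma sum_wordFunctional_cons {d n : ℕ} (a : Poly d) (w : Fin (n + 1) → List (Fin d)) (c : Fin d) :
    ∑ i, wordFunctional a (Function.update w i (c :: w i)) =
      -wordFunctional (MvPolynomial.pderiv c a) w := by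
  funext f
  have h := integral_smoothDeriv c (mul_mem_testAlg (polyToSmooth d a)
    (prod_wordDeriv_mem_testAlg w f))
  rw [(isDiffRing_smooth d).leibniz, (isDiffRing_smooth d).coord, (isDiffRing_smooth d).D_prod,
    map_add, Finset.mul_sum, map_sum] at h
  rw [Finset.sum_apply, Pi.neg_apply, eq_neg_iff_add_eq_zero, add_comm]
  rw [← h]
  congr 1
  refine Finset.sum_congr rfl fun i _ => ?_
  simp only [wordFunctional]
  rw [prod_update_word' smoothDeriv w (fun k => (f k).1), wordDeriv_cons]

lemma pderiv_monomial_one {d : ℕ} (c : Fin d) (α : Fin d →₀ ℕ) :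
    MvPolynomial.pderiv c (MvPolynomial.monomial α (1 : ℂ)) =
      (α c : ℂ) • MvPolynomial.monomial (α - Finsupp.single c 1) (1 : ℂ) := by
  rw [MvPolynomial.pderiv_monomial, MvPolynomial.smul_monomial]
  simp

lemma support_sub_single {d : ℕ} (c : Fin d) {α : Fin d →₀ ℕ} {s : Finset (Fin d)}
    (h : α.support ⊆ s) : (α - Finsupp.single c 1).support ⊆ s := by
  refine subset_trans (fun i hi => ?_) h
  rw [Finsupp.mem_support_iff] at hi ⊢
  intro h0
  rw [Finsupp.tsub_apply, h0] at hi
  simp at hi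

lemma Admissible.update_cons {d m : ℕ} {s : Finset (Fin d)} {M : ℕ∞} {α : Fin d →₀ ℕ}
    {w : Fin m → List (Fin d)} {c : Fin d} {i k : Fin m} {v : List (Fin d)}
    (h : Admissible s M α w) (hi : w i = c :: v) (hk : k ≠ i) :
    Admissible s M α (Function.update (Function.update w i v) k (c :: w k)) := by
  refine ⟨h.support, fun l b hb => ?_, ?_⟩
  · have hc : c ∈ s := h.letters i c (by simp [hi])
    rcases eq_or_ne l k with rfl | hl
    · rw [Function.update_self] at hb
      rcases List.mem_cons.mp hb with rfl | hb
      · exact hc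
      · exact h.letters l b hb
    · rw [Function.update_of_ne hl] at hb
      rcases eq_or_ne l i with rfl | hl'
      · rw [Function.update_self] at hb
        exact h.letters l b (by simp [hi, hb])
      · rw [Function.update_of_ne hl'] at hb
        exact h.letters l b hb
  · have h1 := wordSize_update w i v
    have h2 := wordSize_update (Function.update w i v) k (c :: w k)
    rw [Function.update_of_ne hk] at h2
    have h4 : (w i).length = v.length + 1 := by rw [hi]; rfl
    have h5 : (c :: w k).length = (w k).length + 1 := rfl
    refine le_trans ?_ h.size
    norm_cast
    omega

lemma Admissible.update_tail {d m : ℕ} {s : Finset (Fin d)} {M : ℕ∞} {α : Fin d →₀ ℕ}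
    {w : Fin m → List (Fin d)} {c : Fin d} {i : Fin m} {v : List (Fin d)}
    (h : Admissible s M α w) (hi : w i = c :: v) :
    Admissible s M (α - Finsupp.single c 1) (Function.update w i v) := by
  refine ⟨support_sub_single c h.support, fun l b hb => ?_, ?_⟩
  · rcases eq_or_ne l i with rfl | hl'
    · rw [Function.update_self] at hb
      exact h.letters l b (by simp [hi, hb])
    · rw [Function.update_of_ne hl'] at hb
      exact h.letters l b hb
  · have h1 := wordSize_update w i v
    have h4 : (w i).length = v.length + 1 := by rw [hi]; rfl
    refine le_trans ?_ h.size
    norm_cast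
    omega

/-- Functionals in normal form: no derivatives on the first argument. -/
lemma functionals_eq_map {d n : ℕ} (s : Finset (Fin d)) (M : ℕ∞) :
    functionals s M n = (pairs s M n).map (toFunctional ∘ₗ LinearMap.snd ℂ _ _) := by
  apply le_antisymm
  · rw [functionals, Submodule.span_le]
    rintro _ ⟨α, w, hw, rfl⟩
    change _ ∈ (pairs s M n).map (toFunctional ∘ₗ LinearMap.snd ℂ _ _)
    obtain ⟨L, hL⟩ : ∃ L, (w 0).length = L := ⟨_, rfl⟩
    induction L generalizing α w with
    | zero =>
      have hw0 : w = Fin.cons [] (Fin.tail w) := by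
        rw [← List.eq_nil_of_length_eq_zero hL, Fin.cons_self_tail]
      refine ⟨monomialPair (MvPolynomial.monomial α 1) (Fin.tail w), monomialPair_mem_pairs
        ⟨hw.support, fun i => hw.letters i.succ, le_trans ?_ hw.size⟩, ?_⟩
      · norm_cast
        rw [wordSize, wordSize, Fin.sum_univ_succ]
        exact Nat.le_add_left _ _
      · conv_rhs => rw [hw0]
        exact toFunctional_monomialOp _ _
    | succ L ih =>
      obtain ⟨c, v, hcv⟩ := List.exists_cons_of_length_eq_add_one hL
      have hv : v.length = L := by rw [hcv] at hL; simpa using hL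
      -- Integration by parts removes the leading letter c from the first argument; it moves to one
      -- of the other arguments or to the coefficient.
      have h := sum_wordFunctional_cons (MvPolynomial.monomial α 1) (Function.update w 0 v) c
      rw [Fin.sum_univ_succ, Function.update_idem, Function.update_self, ← hcv,
        Function.update_eq_self, ← eq_sub_iff_add_eq, pderiv_monomial_one] at h
      rw [h]
      have h2 : wordFunctional ((α c : ℂ) • MvPolynomial.monomial (α - Finsupp.single c 1) (1 : ℂ))
          (Function.update w 0 v) = (α c : ℂ) • wordFunctional
            (MvPolynomial.monomial (α - Finsupp.single c 1) (1 : ℂ)) (Function.update w 0 v) :=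
        (wordFunctionalLin (n := n) _).map_smul _ _
      rw [h2]
      refine sub_mem (neg_mem (Submodule.smul_mem _ _ (ih _ _ (hw.update_tail hcv) (by simpa))))
        (sum_mem fun k _ => ?_)
      rw [Function.update_of_ne (Fin.succ_ne_zero k)]
      refine ih _ _ (hw.update_cons hcv (Fin.succ_ne_zero k)) ?_
      rw [Function.update_of_ne (Fin.succ_ne_zero k).symm, Function.update_self, hv]
  · rintro _ ⟨P, hP, rfl⟩
    refine pairs_mapsTo _ _ (fun α w hw => ?_) hP
    rw [LinearMap.comp_apply]
    change toFunctional (monomialOp _ _ _ _) ∈ _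
    rw [toFunctional_monomialOp]
    refine wordFunctional_mem ⟨hw.support, fun i => ?_, ?_⟩
    · refine Fin.cases (by simp) (fun k => ?_) i
      exact hw.letters k
    · refine le_trans (le_of_eq ?_) hw.size
      simp [wordSize, Fin.sum_univ_succ]

/-- The functional `F` represents the polydifferential operator `ψ`. -/
def Represents {d n : ℕ} (ψ : Cochain (Poly d) n) (F : Functional d n) : Prop :=
  ∃ Ψ, (ψ, Ψ) ∈ polyDiffPair d n ∧ toFunctional Ψ = F

/-- Polydifferential operators of order at most `M` in the variables in `s`. -/
def operators {d : ℕ} (s : Finset (Fin d)) (M : ℕ∞) (n : ℕ) : Submodule ℂ (Cochain (Poly d) n) :=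
  (pairs s M n).map (LinearMap.fst ℂ _ _)

lemma mem_operators {d n : ℕ} {s : Finset (Fin d)} {M : ℕ∞} {ψ : Cochain (Poly d) n} :
    ψ ∈ operators s M n ↔ ∃ Ψ, (ψ, Ψ) ∈ pairs s M n := by
  constructor
  · rintro ⟨P, hP, rfl⟩; exact ⟨P.2, hP⟩
  · rintro ⟨Ψ, h⟩; exact ⟨_, h, rfl⟩

lemma exists_represents_of_mem_operators {d n : ℕ} {s : Finset (Fin d)} {M : ℕ∞}
    {ψ : Cochain (Poly d) n} (h : ψ ∈ operators s M n) :
    ∃ F ∈ functionals s M n, Represents ψ F := by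
  obtain ⟨Ψ, hΨ⟩ := mem_operators.mp h
  refine ⟨toFunctional Ψ, ?_, Ψ, pairs_le_polyDiffPair s M hΨ, rfl⟩
  rw [functionals_eq_map]
  exact ⟨_, hΨ, rfl⟩

lemma exists_represents_of_mem_functionals {d n : ℕ} {s : Finset (Fin d)} {M : ℕ∞}
    {F : Functional d n} (h : F ∈ functionals s M n) :
    ∃ ψ ∈ operators s M n, Represents ψ F := by
  rw [functionals_eq_map] at h
  obtain ⟨P, hP, rfl⟩ := h
  exact ⟨P.1, mem_operators.mpr ⟨P.2, hP⟩, P.2, pairs_le_polyDiffPair s M hP, rfl⟩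

lemma Represents.unique_functional {d n : ℕ} {ψ : Cochain (Poly d) n} {F G : Functional d n}
    (hF : Represents ψ F) (hG : Represents ψ G) : F = G := by
  obtain ⟨Ψ, h, rfl⟩ := hF
  obtain ⟨Φ, h', rfl⟩ := hG
  rw [snd_unique h h']

lemma Represents.add {d n : ℕ} {ψ φ : Cochain (Poly d) n} {F G : Functional d n}
    (hF : Represents ψ F) (hG : Represents φ G) : Represents (ψ + φ) (F + G) := by
  obtain ⟨Ψ, h, rfl⟩ := hF
  obtain ⟨Φ, h', rfl⟩ := hG
  exact ⟨Ψ + Φ, add_mem h h', map_add _ _ _⟩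

lemma Represents.smul {d n : ℕ} {ψ : Cochain (Poly d) n} {F : Functional d n} (c : ℂ)
    (hF : Represents ψ F) : Represents (c • ψ) (c • F) := by
  obtain ⟨Ψ, h, rfl⟩ := hF
  exact ⟨c • Ψ, Submodule.smul_mem _ c h, map_smul _ _ _⟩

lemma Represents.zero {d n : ℕ} : Represents (0 : Cochain (Poly d) n) 0 :=
  ⟨0, zero_mem _, map_zero _⟩

lemma Represents.neg {d n : ℕ} {ψ : Cochain (Poly d) n} {F : Functional d n}
    (hF : Represents ψ F) : Represents (-ψ) (-F) := by
  simpa using hF.smul (-1)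

lemma Represents.sub {d n : ℕ} {ψ φ : Cochain (Poly d) n} {F G : Functional d n}
    (hF : Represents ψ F) (hG : Represents φ G) : Represents (ψ - φ) (F - G) := by
  rw [sub_eq_add_neg, sub_eq_add_neg]
  exact hF.add hG.neg

lemma Represents.sum {d n : ℕ} {ι : Type*} (t : Finset ι) {ψ : ι → Cochain (Poly d) n}
    {F : ι → Functional d n} (h : ∀ i ∈ t, Represents (ψ i) (F i)) :
    Represents (∑ i ∈ t, ψ i) (∑ i ∈ t, F i) := by
  classical
  induction t using Finset.induction_on with
  | empty => simpa using Represents.zero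
  | insert a t ha ih =>
    rw [Finset.sum_insert ha, Finset.sum_insert ha]
    exact (h a (by simp)).add (ih fun i hi => h i (by simp [hi]))

lemma snd_polyToSmooth {d n : ℕ} {P : Cochain (Poly d) n × Cochain (SmoothFun d) n}
    (hP : P ∈ polyDiffPair d n) (f : Fin n → Poly d) :
    P.2 (fun i => polyToSmooth d (f i)) = polyToSmooth d (P.1 f) := by
  induction hP using Submodule.span_induction with
  | mem P hP =>
    obtain ⟨a, w, rfl⟩ := hP
    have h : ∀ (v : List (Fin d)) (p : Poly d), wordDeriv smoothDeriv v (polyToSmooth d p) =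
        polyToSmooth d (wordDeriv (fun c => (MvPolynomial.pderiv c).toLinearMap) v p) := by
      intro v p
      induction v with
      | nil => simp
      | cons c v ih => rw [wordDeriv_cons, wordDeriv_cons, ih, (isDiffRing_smooth d).coord]; rfl
    simp [monomialPair, monomialOp, h]
  | zero => simp
  | add P Q _ _ hP hQ => simp [hP, hQ]
  | smul c P _ hP => simp [hP]

/-- Polydifferential operators are local: the value at x depends only on the germs of the arguments
at x. -/
lemma snd_eq_of_eventuallyEq {d n : ℕ} {P : Cochain (Poly d) n × Cochain (SmoothFun d) n}
    (hP : P ∈ polyDiffPair d n) {f g : Fin n → SmoothFun d} {x : Fin d → ℝ}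
    (h : ∀ i, ∀ᶠ y in nhds x, (f i).1 y = (g i).1 y) : (P.2 f).1 x = (P.2 g).1 x := by
  induction hP using Submodule.span_induction with
  | mem P hP =>
    obtain ⟨a, w, rfl⟩ := hP
    have e : ∀ f : Fin n → SmoothFun d, ((monomialPair a w).2 f).1 x =
        (polyToSmooth d a).1 x * ∏ i, (wordDeriv smoothDeriv (w i) (f i)).1 x := by
      intro f
      change (smoothIncl d (polyToSmooth d a * ∏ i, wordDeriv smoothDeriv (w i) (f i))) x = _
      rw [map_mul, map_prod, Pi.mul_apply, Finset.prod_apply]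
      rfl
    rw [e, e]
    congr 1
    exact Finset.prod_congr rfl fun i _ => (wordDeriv_eventuallyEq (w i) (h i)).self_of_nhds
  | zero => rfl
  | add P Q _ _ hP hQ => exact congrArg₂ (· + ·) hP hQ
  | smul c P _ hP => exact congrArg (c * ·) hP

/-- The functional determines the smooth operator on test functions by the fundamental lemma.
Polynomials are not test functions, but near any point they agree with one, and locality then
determines the value at that point. -/
lemma Represents.unique_operator {d n : ℕ} {ψ φ : Cochain (Poly d) n} {F : Functional d n}
    (hψ : Represents ψ F) (hφ : Represents φ F) : ψ = φ := by
  have h0 := hψ.sub hφ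
  rw [sub_self] at h0
  rw [← sub_eq_zero]
  obtain ⟨Ψ, h, hΨ⟩ := h0
  set χ := ψ - φ
  funext f
  apply eq_zero_of_polyToSmooth
  intro x
  choose g hg using fun i => exists_test_eventuallyEq (polyToSmooth d (f i)) x
  have h1 : Ψ (fun i => (g i).1) = 0 := by
    apply eq_zero_of_integral
    intro k hk
    have := congrFun hΨ (Fin.cons ⟨k, hk⟩ g)
    rw [mul_comm]
    exact this
  have h2 := snd_eq_of_eventuallyEq h hg
  rw [← snd_polyToSmooth h f]
  rw [← h2]
  exact congrFun (congrArg Subtype.val h1) x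

end
end CyclicHKR

/-! ### Rotation, faces and the identities of cyclic theory. -/

namespace CyclicHKR
noncomputable section
open scoped TensorProduct ContDiff

/-! ### Cyclic operators on functionals -/

section Rotation

variable {X : Type*} {n : ℕ}

/-- The cyclic rotation `(f_0, …, f_n) ↦ (f_n, f_0, …, f_{n-1})`. -/
def rotate (f : Fin (n + 1) → X) : Fin (n + 1) → X := Fin.cons (f (Fin.last n)) (Fin.init f)

lemma rotate_apply (f : Fin (n + 1) → X) (i : Fin (n + 1)) : rotate f i = f (i - 1) := by
  refine Fin.cases ?_ (fun k => ?_) i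
  · rw [rotate, Fin.cons_zero]
    congr 1
    rw [eq_sub_iff_add_eq, Fin.last_add_one]
  · rw [rotate, Fin.cons_succ, Fin.init]
    congr 1
    rw [eq_sub_iff_add_eq, Fin.coeSucc_eq_succ]

lemma rotate_iterate (f : Fin (n + 1) → X) (j : ℕ) (i : Fin (n + 1)) :
    rotate^[j] f i = f (i - j • (1 : Fin (n + 1))) := by
  induction j generalizing f with
  | zero => simp
  | succ j ih =>
    rw [Function.iterate_succ_apply, ih, rotate_apply, succ_nsmul, sub_sub]

lemma rotate_iterate_card (f : Fin (n + 1) → X) : rotate^[n + 1] f = f := by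
  funext i
  have h : (n + 1) • (1 : Fin (n + 1)) = 0 := by
    have := card_nsmul_eq_zero' (G := Fin (n + 1)) (x := 1)
    simpa using this
  rw [rotate_iterate, h, sub_zero]

end Rotation

variable {d n : ℕ}

/-- The cyclic operator. -/
def cyc : Module.End ℂ (Functional d n) where
  toFun F f := (-1) ^ n * F (rotate f)
  map_add' F G := by funext f; simp [mul_add]
  map_smul' c F := by funext f; simp [mul_left_comm]

lemma cyc_apply (F : Functional d n) (f : Fin (n + 1) → Test d) :
    cyc F f = (-1) ^ n * F (rotate f) := rfl

lemma cyc_pow_apply (j : ℕ) (F : Functional d n) (f : Fin (n + 1) → Test d) :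
    (cyc ^ j) F f = (-1) ^ (n * j) * F (rotate^[j] f) := by
  induction j generalizing F f with
  | zero => simp
  | succ j ih =>
    rw [pow_succ', Module.End.mul_apply, cyc_apply, ih, Function.iterate_succ_apply, ← mul_assoc,
      ← pow_add]
    congr 2
    ring

/-- The total sign (−1)^{n(n+1)} is trivial. -/
lemma cyc_pow_card : (cyc : Module.End ℂ (Functional d n)) ^ (n + 1) = 1 := by
  ext F f
  rw [cyc_pow_apply, rotate_iterate_card, (Nat.even_mul_succ_self n).neg_one_pow, one_mul]
  rfl

/-- The norm operator `1 + C + … + C^n`. -/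
def cycNorm : Module.End ℂ (Functional d n) := ∑ j ∈ Finset.range (n + 1), cyc ^ j

lemma cycNorm_apply (F : Functional d n) :
    cycNorm F = ∑ j ∈ Finset.range (n + 1), (cyc ^ j) F := by
  rw [cycNorm, LinearMap.sum_apply]

lemma cyc_mul_cycNorm : (cyc : Module.End ℂ (Functional d n)) * cycNorm = cycNorm := by
  rw [cycNorm, Finset.mul_sum]
  simp_rw [← pow_succ']
  have h1 := Finset.sum_range_succ' (fun j => (cyc : Module.End ℂ (Functional d n)) ^ j) (n + 1)
  rw [Finset.sum_range_succ, cyc_pow_card, pow_zero] at h1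
  exact (add_right_cancel h1).symm

lemma cycNorm_mul_cyc : cycNorm * (cyc : Module.End ℂ (Functional d n)) = cycNorm := by
  have h : Commute cycNorm (cyc : Module.End ℂ (Functional d n)) :=
    Commute.sum_left _ _ _ fun j _ => (Commute.refl cyc).pow_left j
  rw [h.eq, cyc_mul_cycNorm]

lemma cyc_cycNorm (F : Functional d n) : cyc (cycNorm F) = cycNorm F :=
  LinearMap.congr_fun cyc_mul_cycNorm F

lemma cycNorm_cyc (F : Functional d n) : cycNorm (cyc F) = cycNorm F :=
  LinearMap.congr_fun cycNorm_mul_cyc F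

lemma cycNorm_cyc_pow (j : ℕ) (F : Functional d n) : cycNorm ((cyc ^ j) F) = cycNorm F := by
  induction j with
  | zero => rfl
  | succ j ih => rw [pow_succ', Module.End.mul_apply, cycNorm_cyc, ih]

lemma cyc_pow_of_cyclic {F : Functional d n} (h : cyc F = F) (j : ℕ) : (cyc ^ j) F = F := by
  induction j with
  | zero => rfl
  | succ j ih => rw [pow_succ', Module.End.mul_apply, ih, h]

lemma cycNorm_of_cyclic {F : Functional d n} (h : cyc F = F) : cycNorm F = ((n : ℂ) + 1) • F := by
  rw [cycNorm_apply, Finset.sum_congr rfl fun j _ => cyc_pow_of_cyclic h j, Finset.sum_const,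
    Finset.card_range, ← Nat.cast_smul_eq_nsmul ℂ]
  push_cast
  rfl

/-- Multiplication of the neighbours `f_j` and `f_{j+1}`. -/
def mergeTest (j : ℕ) (f : Fin (n + 2) → Test d) (i : Fin (n + 1)) : Test d :=
  if i.val < j then f i.castSucc else if i.val = j then f i.castSucc * f i.succ else f i.succ

/-- Multiplication of the last function and the first one. -/
def mergeLast (f : Fin (n + 2) → Test d) : Fin (n + 1) → Test d :=
  Fin.cons (f (Fin.last (n + 1)) * f 0) fun i => f i.succ.castSucc

/-- The signed face operators. -/
def face (j : ℕ) : Functional d n →ₗ[ℂ] Functional d (n + 1) where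
  toFun F f := (-1) ^ j * F (mergeTest j f)
  map_add' F G := by funext f; simp [mul_add]
  map_smul' c F := by funext f; simp [mul_left_comm]

/-- The last signed face operator. -/
def lastFace : Functional d n →ₗ[ℂ] Functional d (n + 1) where
  toFun F f := (-1) ^ (n + 1) * F (mergeLast f)
  map_add' F G := by funext f; simp [mul_add]
  map_smul' c F := by funext f; simp [mul_left_comm]

lemma face_apply (j : ℕ) (F : Functional d n) (f : Fin (n + 2) → Test d) :
    face j F f = (-1) ^ j * F (mergeTest j f) := rfl

lemma lastFace_apply (F : Functional d n) (f : Fin (n + 2) → Test d) :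
    lastFace F f = (-1) ^ (n + 1) * F (mergeLast f) := rfl

/-- The bar differential. -/
def barDiff : Functional d n →ₗ[ℂ] Functional d (n + 1) := ∑ j ∈ Finset.range (n + 1), face j

/-- The Hochschild differential. -/
def hochDiff : Functional d n →ₗ[ℂ] Functional d (n + 1) := barDiff + lastFace

lemma barDiff_apply (F : Functional d n) :
    barDiff F = ∑ j ∈ Finset.range (n + 1), face j F := by
  rw [barDiff, LinearMap.sum_apply]

lemma hochDiff_apply (F : Functional d n) : hochDiff F = barDiff F + lastFace F := rfl

/-- The signs built into `face` and `cyc` are such that this cyclic relation carries none: (−1)^j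
(−1)^n = (−1)^{n+1} (−1)^{j+1}. -/
lemma face_cyc {j : ℕ} (hj : j < n) (F : Functional d n) : face j (cyc F) = cyc (face (j + 1) F) := by
  funext f
  rw [face_apply, cyc_apply, cyc_apply, face_apply]
  have : rotate (mergeTest j f) = mergeTest (j + 1) (rotate f) := by
    funext i
    refine Fin.cases ?_ (fun k => ?_) i
    · simp only [rotate, Fin.cons_zero, mergeTest, Fin.val_last]
      rw [if_neg (by omega), if_neg (by omega), if_pos (by simp)]
      rfl
    · have h1 : k.succ.castSucc = k.castSucc.succ := rfl
      simp only [rotate, Fin.cons_succ, Fin.init, mergeTest, Fin.val_succ, Fin.val_castSucc, h1,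
        add_lt_add_iff_right, add_left_inj]
  rw [this]
  ring

lemma lastFace_eq (F : Functional d n) : lastFace F = cyc (face 0 F) := by
  funext f
  rw [cyc_apply, face_apply, lastFace_apply]
  have : mergeLast f = mergeTest 0 (rotate f) := by
    funext i
    refine Fin.cases ?_ (fun k => ?_) i
    · simp [rotate, mergeTest, mergeLast, Fin.init]
    · simp [rotate, mergeTest, mergeLast, Fin.init]
  rw [this, pow_zero, one_mul]

lemma face_zero_cyc_pow {j : ℕ} (hj : j ≤ n) (F : Functional d n) :
    face 0 ((cyc ^ j) F) = (cyc ^ j) (face j F) := by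
  induction j generalizing F with
  | zero => rfl
  | succ j ih =>
    rw [pow_succ, Module.End.mul_apply, ih (by omega), face_cyc (by omega), pow_succ,
      Module.End.mul_apply]

lemma cyc_pow_card_apply (F : Functional d n) : (cyc ^ (n + 1)) F = F := by
  rw [cyc_pow_card]; rfl

/-- All faces are conjugate to `face 0` by powers of `cyc`. Together with `lastFace_eq`, this
reduces statements about all faces to statements about `face 0`. -/
lemma face_eq {j : ℕ} (hj : j ≤ n) (F : Functional d n) :
    face j F = (cyc ^ (n + 2 - j)) (face 0 ((cyc ^ j) F)) := by
  rw [face_zero_cyc_pow hj, ← Module.End.mul_apply, ← pow_add,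
    show n + 2 - j + j = n + 1 + 1 by omega, cyc_pow_card_apply]

/-- By `face_zero_cyc_pow`, the j-th face is `face 0` of the j-th rotate up to powers of `cyc`, and
N absorbs these powers. -/
lemma cycNorm_barDiff (F : Functional d n) : cycNorm (barDiff F) = cycNorm (face 0 (cycNorm F)) := by
  rw [barDiff_apply, cycNorm_apply F, map_sum, map_sum, map_sum]
  refine Finset.sum_congr rfl fun j hj => ?_
  rw [face_zero_cyc_pow (by simpa [Nat.lt_succ_iff] using hj), cycNorm_cyc_pow]

/-- On a cyclic functional the n + 2 faces, the last one included, are exactly the n + 2 rotates of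
`face 0`, in reversed order. -/
lemma hochDiff_of_cyclic {F : Functional d n} (h : cyc F = F) :
    hochDiff F = cycNorm (face 0 F) := by
  rw [hochDiff_apply, barDiff_apply, lastFace_eq, cycNorm_apply, Finset.sum_range_succ' _ (n + 1),
    ← Finset.sum_range_reflect, Finset.sum_range_succ' (fun j => (cyc ^ (j + 1)) (face 0 F)) n]
  rw [Finset.sum_range_succ _ n, add_assoc, add_assoc (Finset.sum _ _)]
  congr 1
  · refine Finset.sum_congr rfl fun j hj => ?_
    rw [Finset.mem_range] at hj
    rw [face_eq (by omega), cyc_pow_of_cyclic h]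
    congr 2
    omega
  · rw [add_comm ((cyc ^ (0 + 1)) _)]
    simp

/-- The identity bN = Nb': both sides are the norm of `face 0` of N F. -/
lemma hochDiff_cycNorm (F : Functional d n) : hochDiff (cycNorm F) = cycNorm (barDiff F) := by
  rw [hochDiff_of_cyclic (cyc_cycNorm F), cycNorm_barDiff]

lemma cyc_hochDiff {F : Functional d n} (h : cyc F = F) : cyc (hochDiff F) = hochDiff F := by
  rw [hochDiff_of_cyclic h, cyc_cycNorm]

/-- Precomposition of the `i`-th argument with `T`. -/
def plug (T : Test d → Test d) (i : Fin (n + 1)) : Module.End ℂ (Functional d n) where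
  toFun F f := F (Function.update f i (T (f i)))
  map_add' _ _ := rfl
  map_smul' _ _ := rfl

lemma plug_apply (T : Test d → Test d) (i : Fin (n + 1)) (F : Functional d n)
    (f : Fin (n + 1) → Test d) : plug T i F f = F (Function.update f i (T (f i))) := rfl

/-- The action of `T` on functionals by the Leibniz rule. -/
def totalAction (T : Test d → Test d) : Module.End ℂ (Functional d n) := ∑ i, plug T i

lemma totalAction_apply (T : Test d → Test d) (F : Functional d n) (f : Fin (n + 1) → Test d) :
    totalAction T F f = ∑ i, F (Function.update f i (T (f i))) := by
  rw [totalAction, LinearMap.sum_apply, Finset.sum_apply]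
  rfl

lemma rotate_iterate_update (f : Fin (n + 1) → Test d) (i : Fin (n + 1)) (g : Test d) (j : ℕ) :
    rotate^[j] (Function.update f i g) = Function.update (rotate^[j] f) (i + j • 1) g := by
  funext k
  rw [rotate_iterate]
  rcases eq_or_ne k (i + j • 1) with rfl | hk
  · simp
  · rw [Function.update_of_ne hk, Function.update_of_ne (by
      intro h; apply hk; rw [← h, sub_add_cancel]), rotate_iterate]

lemma rotate_update (f : Fin (n + 1) → Test d) (i : Fin (n + 1)) (g : Test d) :
    rotate (Function.update f i g) = Function.update (rotate f) (i + 1) g := by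
  simpa using rotate_iterate_update f i g 1

lemma totalAction_cyc (T : Test d → Test d) (F : Functional d n) :
    totalAction T (cyc F) = cyc (totalAction T F) := by
  funext f
  simp only [totalAction_apply, cyc_apply, rotate_update, Finset.mul_sum]
  refine Fintype.sum_equiv (Equiv.addRight 1) _ _ fun i => ?_
  simp [rotate_apply]

lemma totalAction_cyc_pow (T : Test d → Test d) (j : ℕ) (F : Functional d n) :
    totalAction T ((cyc ^ j) F) = (cyc ^ j) (totalAction T F) := by
  induction j with
  | zero => rfl
  | succ j ih => rw [pow_succ', Module.End.mul_apply, totalAction_cyc, ih]; rfl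

lemma totalAction_cycNorm (T : Test d → Test d) (F : Functional d n) :
    totalAction T (cycNorm F) = cycNorm (totalAction T F) := by
  rw [cycNorm_apply, cycNorm_apply, map_sum]
  exact Finset.sum_congr rfl fun j _ => totalAction_cyc_pow T j F

/-- On cyclic functionals, the Leibniz action is the cyclic norm of the action on the first argument. -/
lemma cycNorm_plug_of_cyclic (T : Test d → Test d) {F : Functional d n} (h : cyc F = F) :
    cycNorm (plug T 0 F) = totalAction T F := by
  funext f
  rw [cycNorm_apply, Finset.sum_apply, totalAction_apply,
    ← Equiv.sum_comp (Equiv.neg (Fin (n + 1)))]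
  have h1 : ∀ j : ℕ, (cyc ^ j) (plug T 0 F) f =
      F (Function.update f (-(j • 1)) (T (f (-(j • 1))))) := by
    intro j
    conv_rhs => rw [← cyc_pow_of_cyclic h j]
    rw [cyc_pow_apply, cyc_pow_apply, plug_apply, rotate_iterate_update, neg_add_cancel,
      rotate_iterate, zero_sub]
  simp only [h1]
  rw [Finset.sum_range]
  refine Finset.sum_congr rfl fun i _ => ?_
  have : (i : ℕ) • (1 : Fin (n + 1)) = i := by
    refine Fin.induction (by simp) (fun k hk => ?_) i
    rw [Fin.val_succ, succ_nsmul, ← Fin.val_castSucc, hk, Fin.coeSucc_eq_succ]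
  rw [this]
  rfl

end
end CyclicHKR

/-! ### Stability of polydifferential functionals, and the action of the vector fields ∂_c and x_c
∂_c. -/

namespace CyclicHKR
noncomputable section
open scoped TensorProduct ContDiff

variable {d n : ℕ}

/-! ### Cyclic operators preserve polydifferential functionals -/

lemma cyc_wordFunctional (a : Poly d) (w : Fin (n + 1) → List (Fin d)) :
    cyc (wordFunctional a w) = (-1 : ℂ) ^ n • wordFunctional a (Fin.snoc (Fin.tail w) (w 0)) := by
  funext f
  rw [cyc_apply, Pi.smul_apply, smul_eq_mul]
  congr 1
  unfold wordFunctional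
  congr 2
  rw [Fin.prod_univ_succ, Fin.prod_univ_castSucc, mul_comm]
  simp [rotate, Fin.init, Fin.tail]

lemma Admissible.snoc_tail {s : Finset (Fin d)} {M : ℕ∞} {α : Fin d →₀ ℕ}
    {w : Fin (n + 1) → List (Fin d)} (h : Admissible s M α w) :
    Admissible s M α (Fin.snoc (Fin.tail w) (w 0) : Fin (n + 1) → List (Fin d)) := by
  refine ⟨h.support, fun i => ?_, le_trans (le_of_eq ?_) h.size⟩
  · refine Fin.lastCases ?_ (fun k => ?_) i
    · simpa using h.letters 0
    · simpa [Fin.tail] using h.letters k.succ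
  · norm_cast
    rw [wordSize, wordSize, Fin.sum_univ_castSucc, Fin.sum_univ_succ, add_comm]
    simp [Fin.tail]

lemma cyc_mem {s : Finset (Fin d)} {M : ℕ∞} {F : Functional d n} (h : F ∈ functionals s M n) :
    cyc F ∈ functionals s M n := by
  refine functionals_mapsTo _ _ (fun α w hw => ?_) h
  rw [cyc_wordFunctional]
  exact Submodule.smul_mem _ _ (wordFunctional_mem hw.snoc_tail)

lemma cyc_pow_mem {s : Finset (Fin d)} {M : ℕ∞} {F : Functional d n} (h : F ∈ functionals s M n)
    (j : ℕ) : (cyc ^ j) F ∈ functionals s M n := by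
  induction j with
  | zero => exact h
  | succ j ih => rw [pow_succ', Module.End.mul_apply]; exact cyc_mem ih

lemma cycNorm_mem {s : Finset (Fin d)} {M : ℕ∞} {F : Functional d n} (h : F ∈ functionals s M n) :
    cycNorm F ∈ functionals s M n := by
  rw [cycNorm_apply]
  exact sum_mem fun j _ => cyc_pow_mem h j

lemma mem_splits {w : List (Fin d)} {p : List (Fin d) × List (Fin d)} (h : p ∈ splits w) :
    (∀ c ∈ p.1, c ∈ w) ∧ (∀ c ∈ p.2, c ∈ w) := by
  induction w generalizing p with
  | nil => simp [splits] at h; subst h; simp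
  | cons c w ih =>
    simp only [splits, List.mem_append, List.mem_map] at h
    rcases h with ⟨q, hq, rfl⟩ | ⟨q, hq, rfl⟩ <;>
    · obtain ⟨h1, h2⟩ := ih hq
      constructor <;> intro b hb <;> simp only [List.mem_cons] at hb ⊢ <;> grind

lemma face_zero_wordFunctional (a : Poly d) (w : Fin (n + 1) → List (Fin d)) :
    face 0 (wordFunctional a w) = ((splits (w 0)).map fun p =>
      wordFunctional a (Fin.cons p.1 (Fin.cons p.2 (Fin.tail w) : Fin (n + 1) → List (Fin d)))).sum := by
  funext f
  rw [face_apply, pow_zero, one_mul]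
  have h1 : ∏ i, wordDeriv smoothDeriv (w i) (mergeTest 0 f i).1 =
      ((splits (w 0)).map fun p => ∏ i, wordDeriv smoothDeriv
        ((Fin.cons p.1 (Fin.cons p.2 (Fin.tail w) : Fin (n + 1) → List (Fin d)) :
          Fin (n + 2) → List (Fin d)) i) (f i).1).sum := by
    rw [Fin.prod_univ_succ]
    have : (mergeTest 0 f 0).1 = (f 0).1 * (f 1).1 := by simp [mergeTest]
    rw [this, wordDeriv_mul _ smoothDeriv_mul, ← List.sum_map_mul_right]
    congr 1
    refine List.map_congr_left fun p _ => ?_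
    rw [Fin.prod_univ_succ, Fin.prod_univ_succ]
    simp [mergeTest, Fin.tail, mul_assoc]
  unfold wordFunctional
  rw [h1, ← List.sum_map_mul_left]
  induction splits (w 0) with
  | nil => simp
  | cons p L ih => simp only [List.map_cons, List.sum_cons, map_add, Pi.add_apply, ih]

lemma face_zero_mem {s : Finset (Fin d)} {F : Functional d n} (h : F ∈ functionals s ⊤ n) :
    face 0 F ∈ functionals s ⊤ (n + 1) := by
  refine functionals_mapsTo _ _ (fun α w hw => ?_) h
  rw [face_zero_wordFunctional]
  refine list_sum_mem fun x hx => ?_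
  obtain ⟨p, hp, rfl⟩ := List.mem_map.mp hx
  obtain ⟨h1, h2⟩ := mem_splits hp
  refine wordFunctional_mem ⟨hw.support, fun i => ?_, le_top⟩
  refine Fin.cases ?_ (fun k => Fin.cases ?_ (fun l => ?_) k) i
  · exact fun c hc => hw.letters 0 c (h1 c hc)
  · exact fun c hc => hw.letters 0 c (h2 c hc)
  · exact hw.letters l.succ

lemma face_mem {s : Finset (Fin d)} {F : Functional d n} (h : F ∈ functionals s ⊤ n) {j : ℕ}
    (hj : j ≤ n) : face j F ∈ functionals s ⊤ (n + 1) := by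
  rw [face_eq hj]
  exact cyc_pow_mem (face_zero_mem (cyc_pow_mem h _)) _

lemma barDiff_mem {s : Finset (Fin d)} {F : Functional d n} (h : F ∈ functionals s ⊤ n) :
    barDiff F ∈ functionals s ⊤ (n + 1) := by
  rw [barDiff_apply]
  exact sum_mem fun j hj => face_mem h (by simpa [Nat.lt_succ_iff] using hj)

lemma hochDiff_mem {s : Finset (Fin d)} {F : Functional d n} (h : F ∈ functionals s ⊤ n) :
    hochDiff F ∈ functionals s ⊤ (n + 1) := by
  rw [hochDiff_apply, lastFace_eq]
  exact add_mem (barDiff_mem h) (cyc_mem (face_zero_mem h))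

lemma plug_D_wordFunctional (c : Fin d) (i : Fin (n + 1)) (a : Poly d)
    (w : Fin (n + 1) → List (Fin d)) :
    plug (Test.D c) i (wordFunctional a w) = wordFunctional a (Function.update w i (c :: w i)) := by
  funext f
  rw [plug_apply]
  unfold wordFunctional
  have h : ∀ k, (Function.update f i (Test.D c (f i)) k).1 =
      Function.update (fun k => (f k).1) i (smoothDeriv c (f i).1) k := by
    intro k
    rcases eq_or_ne k i with rfl | hk
    · simp [Test.D]
    · simp [hk]
  simp only [h]
  rw [prod_update_word, prod_update_word' smoothDeriv w (fun k => (f k).1), wordDeriv_cons,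
    (isDiffRing_smooth d).wordDeriv_comm]

lemma plug_XD_wordFunctional (c : Fin d) (i : Fin (n + 1)) (a : Poly d)
    (w : Fin (n + 1) → List (Fin d)) :
    plug (fun g => Test.X c (Test.D c g)) i (wordFunctional a w) =
      wordFunctional (MvPolynomial.X c * a) (Function.update w i (c :: w i)) +
        ((w i).count c : ℂ) • wordFunctional a w := by
  funext f
  rw [plug_apply, Pi.add_apply, Pi.smul_apply]
  unfold wordFunctional
  have h : ∀ k, (Function.update f i (Test.X c (Test.D c (f i))) k).1 =
      Function.update (fun k => (f k).1) i
        (polyToSmooth d (MvPolynomial.X c) * smoothDeriv c (f i).1) k := by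
    intro k
    rcases eq_or_ne k i with rfl | hk
    · simp [Test.D, Test.X]
    · simp [hk]
  simp only [h]
  rw [prod_update_word, prod_update_word' smoothDeriv w (fun k => (f k).1), wordDeriv_cons,
    (isDiffRing_smooth d).wordDeriv_X_mul_D, ← map_smul (integral d), ← map_add,
    ← Finset.mul_prod_erase Finset.univ _ (Finset.mem_univ i), map_mul (polyToSmooth d)]
  congr 1
  simp only [Algebra.smul_def]
  ring

lemma plug_X_wordFunctional (c : Fin d) (i : Fin (n + 1)) (a : Poly d)
    (w : Fin (n + 1) → List (Fin d)) :
    plug (Test.X c) i (wordFunctional a w) = wordFunctional (MvPolynomial.X c * a) w +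
      ((w i).count c : ℂ) • wordFunctional a (Function.update w i ((w i).erase c)) := by
  funext f
  rw [plug_apply, Pi.add_apply, Pi.smul_apply]
  unfold wordFunctional
  have h : ∀ k, (Function.update f i (Test.X c (f i)) k).1 =
      Function.update (fun k => (f k).1) i (polyToSmooth d (MvPolynomial.X c) * (f i).1) k := by
    intro k
    rcases eq_or_ne k i with rfl | hk
    · simp [Test.X]
    · simp [hk]
  simp only [h]
  rw [prod_update_word, prod_update_word' smoothDeriv w (fun k => (f k).1),
    (isDiffRing_smooth d).wordDeriv_X_mul, ← map_smul (integral d), ← map_add,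
    ← Finset.mul_prod_erase Finset.univ _ (Finset.mem_univ i), map_mul (polyToSmooth d)]
  congr 1
  simp only [Algebra.smul_def]
  ring

lemma X_mul_monomial (c : Fin d) (α : Fin d →₀ ℕ) :
    MvPolynomial.X c * MvPolynomial.monomial α (1 : ℂ) =
      MvPolynomial.monomial (α + Finsupp.single c 1) 1 := by
  rw [mul_comm, MvPolynomial.X, MvPolynomial.monomial_mul, one_mul]

lemma Admissible.update {s : Finset (Fin d)} {m : ℕ} {α : Fin d →₀ ℕ}
    {w : Fin m → List (Fin d)} (h : Admissible s ⊤ α w) (i : Fin m) {v : List (Fin d)}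
    (hv : ∀ c ∈ v, c ∈ s) : Admissible s ⊤ α (Function.update w i v) := by
  refine ⟨h.support, fun k => ?_, le_top⟩
  rcases eq_or_ne k i with rfl | hk
  · rwa [Function.update_self]
  · rw [Function.update_of_ne hk]; exact h.letters k

lemma Admissible.add_single {s : Finset (Fin d)} {m : ℕ} {M : ℕ∞} {α : Fin d →₀ ℕ}
    {w : Fin m → List (Fin d)} (h : Admissible s M α w) {c : Fin d} (hc : c ∈ s) :
    Admissible s M (α + Finsupp.single c 1) w := by
  classical
  refine ⟨subset_trans Finsupp.support_add (Finset.union_subset h.support ?_), h.letters, h.size⟩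
  exact subset_trans Finsupp.support_single_subset (by simpa using hc)

lemma Admissible.cons_letter {s : Finset (Fin d)} {m : ℕ} {α : Fin d →₀ ℕ}
    {w : Fin m → List (Fin d)} (h : Admissible s ⊤ α w) {c : Fin d} (hc : c ∈ s) (i : Fin m) :
    Admissible s ⊤ α (Function.update w i (c :: w i)) :=
  h.update i fun b hb => by
    rcases List.mem_cons.mp hb with rfl | hb
    · exact hc
    · exact h.letters i b hb

lemma plug_D_mem {s : Finset (Fin d)} {c : Fin d} (hc : c ∈ s) (i : Fin (n + 1))
    {F : Functional d n} (h : F ∈ functionals s ⊤ n) : plug (Test.D c) i F ∈ functionals s ⊤ n := by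
  refine functionals_mapsTo _ _ (fun α w hw => ?_) h
  rw [plug_D_wordFunctional]
  exact wordFunctional_mem (hw.cons_letter hc i)

lemma plug_XD_mem {s : Finset (Fin d)} {c : Fin d} (hc : c ∈ s) (i : Fin (n + 1))
    {F : Functional d n} (h : F ∈ functionals s ⊤ n) :
    plug (fun g => Test.X c (Test.D c g)) i F ∈ functionals s ⊤ n := by
  refine functionals_mapsTo _ _ (fun α w hw => ?_) h
  rw [plug_XD_wordFunctional, X_mul_monomial]
  exact add_mem (wordFunctional_mem ((hw.cons_letter hc i).add_single hc))
    (Submodule.smul_mem _ _ (wordFunctional_mem hw))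

lemma plug_X_mem {s : Finset (Fin d)} {c : Fin d} (hc : c ∈ s) (i : Fin (n + 1))
    {F : Functional d n} (h : F ∈ functionals s ⊤ n) : plug (Test.X c) i F ∈ functionals s ⊤ n := by
  refine functionals_mapsTo _ _ (fun α w hw => ?_) h
  rw [plug_X_wordFunctional, X_mul_monomial]
  exact add_mem (wordFunctional_mem (hw.add_single hc)) (Submodule.smul_mem _ _ (wordFunctional_mem
    (hw.update i fun b hb => hw.letters i b (List.mem_of_mem_erase hb))))

/-- The action of the vector field `∂_c` on functionals. -/
abbrev lieD (c : Fin d) : Module.End ℂ (Functional d n) := totalAction (Test.D c)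

/-- The action of the Euler vector field `x_c ∂_c` on functionals. -/
abbrev lieE (c : Fin d) : Module.End ℂ (Functional d n) :=
  totalAction fun g => Test.X c (Test.D c g)

lemma totalAction_eq_sum (T : Test d → Test d) (F : Functional d n) :
    totalAction T F = ∑ i, plug T i F := by
  rw [totalAction, LinearMap.sum_apply]

lemma lieD_mem {s : Finset (Fin d)} {c : Fin d} (hc : c ∈ s)
    {F : Functional d n} (h : F ∈ functionals s ⊤ n) : lieD c F ∈ functionals s ⊤ n := by
  rw [lieD, totalAction_eq_sum]
  exact sum_mem fun i _ => plug_D_mem hc i h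

lemma lieE_mem {s : Finset (Fin d)} {c : Fin d} (hc : c ∈ s)
    {F : Functional d n} (h : F ∈ functionals s ⊤ n) : lieE c F ∈ functionals s ⊤ n := by
  rw [lieE, totalAction_eq_sum]
  exact sum_mem fun i _ => plug_XD_mem hc i h

lemma lieD_wordFunctional (c : Fin d) (a : Poly d) (w : Fin (n + 1) → List (Fin d)) :
    lieD c (wordFunctional a w) = -wordFunctional (MvPolynomial.pderiv c a) w := by
  rw [lieD, totalAction_eq_sum, ← sum_wordFunctional_cons]
  exact Finset.sum_congr rfl fun i _ => plug_D_wordFunctional c i a w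

lemma lieD_wordFunctional_monomial (c : Fin d) (α : Fin d →₀ ℕ) (w : Fin (n + 1) → List (Fin d)) :
    lieD c (wordFunctional (MvPolynomial.monomial α 1) w) =
      -(α c : ℂ) • wordFunctional (MvPolynomial.monomial (α - Finsupp.single c 1) 1) w := by
  rw [lieD_wordFunctional, pderiv_monomial_one, neg_smul]
  congr 1
  exact (wordFunctionalLin w).map_smul _ _

/-- The number of occurrences of a letter in a family of words. -/
def letterCount {m : ℕ} (c : Fin d) (w : Fin m → List (Fin d)) : ℕ := ∑ i, (w i).count c

/-- Commuting x_c past the words contributes one for each letter c. What is left is x_c times a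
total derivative ∂_c, and integration by parts against x_c · x^α gives −(α_c + 1). -/
lemma lieE_wordFunctional_monomial (c : Fin d) (α : Fin d →₀ ℕ) (w : Fin (n + 1) → List (Fin d)) :
    lieE c (wordFunctional (MvPolynomial.monomial α 1) w) =
      ((letterCount c w : ℂ) - α c - 1) • wordFunctional (MvPolynomial.monomial α 1) w := by
  rw [lieE, totalAction_eq_sum, Finset.sum_congr rfl fun i _ => plug_XD_wordFunctional c i _ w,
    Finset.sum_add_distrib, sum_wordFunctional_cons, ← Finset.sum_smul, X_mul_monomial,
    pderiv_monomial_one, add_tsub_cancel_right]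
  have : wordFunctional ((((α + Finsupp.single c 1 : Fin d →₀ ℕ) c : ℕ) : ℂ) • MvPolynomial.monomial α (1 : ℂ)) w =
    (((α + Finsupp.single c 1 : Fin d →₀ ℕ) c : ℕ) : ℂ) • wordFunctional (MvPolynomial.monomial α (1 : ℂ)) w :=
    (wordFunctionalLin w).map_smul _ _
  rw [this, letterCount]
  simp only [Finsupp.add_apply, Finsupp.single_eq_same]
  push_cast
  module

/-! ### Derivations and the Hochschild differential -/

lemma Test.D_mul (c : Fin d) (f g : Test d) :
    Test.D c (f * g) = Test.D c f * g + f * Test.D c g :=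
  Subtype.ext (smoothDeriv_mul c f.1 g.1)

lemma Test.XD_mul (c : Fin d) (f g : Test d) :
    Test.X c (Test.D c (f * g)) = Test.X c (Test.D c f) * g + f * Test.X c (Test.D c g) := by
  apply Subtype.ext
  change _ * smoothDeriv c (f.1 * g.1) =
    polyToSmooth d (MvPolynomial.X c) * smoothDeriv c f.1 * g.1 +
      f.1 * (polyToSmooth d (MvPolynomial.X c) * smoothDeriv c g.1)
  rw [smoothDeriv_mul]
  ring

/-- Functionals that are additive in the first argument. -/
def firstAdditive (d n : ℕ) : Submodule ℂ (Functional d n) where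
  carrier := {F | ∀ f g h, F (Function.update f 0 (g + h)) =
    F (Function.update f 0 g) + F (Function.update f 0 h)}
  zero_mem' := by simp
  add_mem' {F G} hF hG f g h := by
    simp only [Set.mem_ofPred_eq] at hF hG
    simp only [Pi.add_apply, hF, hG]; ring
  smul_mem' c F hF f g h := by
    simp only [Set.mem_ofPred_eq] at hF
    simp only [Pi.smul_apply, hF, smul_add]

lemma functionals_le_firstAdditive (s : Finset (Fin d)) (M : ℕ∞) :
    functionals s M n ≤ firstAdditive d n := by
  rw [functionals, Submodule.span_le]
  rintro _ ⟨α, w, -, rfl⟩ f g h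
  have e : ∀ g : Test d, ∀ k, (Function.update f 0 g k).1 =
      Function.update (fun k => (f k).1) 0 g.1 k := by
    intro g k
    rcases eq_or_ne k 0 with rfl | hk
    · simp
    · simp [hk]
  simp only [wordFunctional, e, prod_update_word]
  rw [← map_add]
  congr 1
  change _ * (wordDeriv smoothDeriv (w 0) (g.1 + h.1) * _) = _
  rw [map_add]
  ring

lemma totalAction_face_zero {T : Test d → Test d} (hT : ∀ f g, T (f * g) = T f * g + f * T g)
    {F : Functional d n} (hF : F ∈ firstAdditive d n) :
    totalAction T (face 0 F) = face 0 (totalAction T F) := by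
  funext f
  simp only [totalAction_apply, face_apply, pow_zero, one_mul]
  rw [Fin.sum_univ_succ, Fin.sum_univ_succ, Fin.sum_univ_succ, ← add_assoc]
  congr 1
  · have h0 : mergeTest 0 f 0 = f 0 * f 1 := by simp [mergeTest]
    rw [h0, hT, hF]
    congr 2 <;>
    · funext i
      refine Fin.cases ?_ (fun k => ?_) i
      · simp [mergeTest]
      · have : k.succ.succ ≠ 1 := by simp [Fin.ext_iff]
        simp [mergeTest, this]
  · refine Finset.sum_congr rfl fun k _ => ?_
    congr 1
    funext i
    refine Fin.cases ?_ (fun l => ?_) i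
    · have h1 : k.succ.succ ≠ 1 := by simp [Fin.ext_iff]
      simp [mergeTest, h1.symm, (Fin.succ_ne_zero _).symm]
    · rcases eq_or_ne l k with rfl | hl
      · simp [mergeTest]
      · have : l.succ.succ ≠ k.succ.succ := by simpa [Fin.ext_iff] using hl
        simp [mergeTest, hl]

/-- A derivation of the product is compatible with `face 0` by the Leibniz rule and additivity in
the first slot. It commutes with rotations, hence with all other faces. -/
lemma totalAction_hochDiff {T : Test d → Test d} (hT : ∀ f g, T (f * g) = T f * g + f * T g)
    {s : Finset (Fin d)} {F : Functional d n} (hF : F ∈ functionals s ⊤ n) :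
    totalAction T (hochDiff F) = hochDiff (totalAction T F) := by
  have h0 : ∀ j ≤ n, totalAction T (face j F) = face j (totalAction T F) := by
    intro j hj
    rw [face_eq hj, totalAction_cyc_pow,
      totalAction_face_zero hT (functionals_le_firstAdditive _ _ (cyc_pow_mem hF j)),
      totalAction_cyc_pow, ← face_eq hj]
  rw [hochDiff_apply, hochDiff_apply, lastFace_eq, lastFace_eq, map_add, totalAction_cyc,
    h0 0 (Nat.zero_le n), barDiff_apply, barDiff_apply, map_sum]
  congr 1
  exact Finset.sum_congr rfl fun j hj => h0 j (by simpa [Nat.lt_succ_iff] using hj)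

/-- A derivation acting on the first argument alone fails to commute with b in two faces. In `face
0` the Leibniz rule produces an extra term X, with T on the second argument; the last face
contributes `cyc X` on the other side. Under N the two defects cancel. -/
lemma cycNorm_plug_hochDiff {T : Test d → Test d} (hT : ∀ f g, T (f * g) = T f * g + f * T g)
    {F : Functional d n} (hF : F ∈ firstAdditive d n) :
    cycNorm (plug T 0 (hochDiff F)) = hochDiff (cycNorm (plug T 0 F)) := by
  let X : Functional d (n + 1) := fun f => F (Function.update (mergeTest 0 f) 0 (f 0 * T (f 1)))
  have h0 : face 0 (plug T 0 F) = plug T 0 (face 0 F) + X := by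
    funext f
    rw [Pi.add_apply, face_apply, plug_apply, plug_apply, face_apply, pow_zero, one_mul, one_mul]
    have h0 : mergeTest 0 f 0 = f 0 * f 1 := by simp [mergeTest]
    rw [h0, hT, hF]
    congr 2
    funext i
    refine Fin.cases ?_ (fun k => ?_) i
    · simp [mergeTest]
    · simp [mergeTest]
  have h1 : ∀ j, face (j + 1) (plug T 0 F) = plug T 0 (face (j + 1) F) := by
    intro j
    funext f
    rw [face_apply, plug_apply, plug_apply, face_apply]
    congr 2
    funext i
    refine Fin.cases ?_ (fun k => ?_) i
    · simp [mergeTest]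
    · simp [mergeTest]
  have h2 : plug T 0 (lastFace F) = cyc X := by
    funext f
    rw [plug_apply, lastFace_apply, cyc_apply]
    congr 2
    funext i
    refine Fin.cases ?_ (fun k => ?_) i
    · simp [mergeLast, rotate, Fin.init]
    · simp [mergeLast, mergeTest, rotate, Fin.init]
  rw [hochDiff_cycNorm, hochDiff_apply, map_add, h2, map_add, cycNorm_cyc, ← map_add]
  congr 1
  rw [barDiff_apply, barDiff_apply, Finset.sum_range_succ', Finset.sum_range_succ', map_add,
    map_sum, h0, add_assoc]
  congr 1
  exact (Finset.sum_congr rfl fun j _ => h1 j).symm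

/-! ### Functionals and the Hochschild differential of operators -/

lemma toFunctional_dHoch (Ψ : Cochain (SmoothFun d) n) :
    toFunctional (dHoch n Ψ) = hochDiff (toFunctional Ψ) := by
  funext f
  change integral d ((f 0).1 * dHoch n Ψ fun i => (f i.succ).1) = _
  rw [dHoch_apply, Finset.mul_sum, map_sum, Finset.sum_range_succ, hochDiff_apply, barDiff_apply,
    Pi.add_apply, Finset.sum_apply]
  have hs : ∀ (j : ℕ) (x : SmoothFun d), integral d ((-1) ^ j * x) = (-1) ^ j * integral d x := by
    intro j x
    have : (-1) ^ j * x = ((-1 : ℂ) ^ j) • x := by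
      rw [Algebra.smul_def, map_pow, map_neg, map_one]
    rw [this, map_smul, smul_eq_mul]
  congr 1
  · refine Finset.sum_congr rfl fun j hj => ?_
    rw [Finset.mem_range] at hj
    rw [face_apply]
    change _ = (-1) ^ j * integral d ((mergeTest j f 0).1 * Ψ fun i => (mergeTest j f i.succ).1)
    rw [← hs]
    congr 1
    have e : (fun i => (mergeTest j f i.succ).1) = mergeAt j fun i => (f i.succ).1 := by
      funext i
      simp only [mergeTest, mergeAt, Fin.val_succ, Fin.succ_castSucc]
      rcases lt_trichotomy (i.val + 1) j with h | h | h
      · simp [h]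
      · simp [h]
      · simp [show ¬ i.val + 1 < j by omega, show ¬ i.val + 1 = j by omega]
    rw [e]
    rcases Nat.eq_zero_or_pos j with rfl | hj0
    · simp [mergeTest, mergeCoeff]
      ring
    · have h1 : ¬ j = 0 := by omega
      have h2 : ¬ j = n + 1 := by omega
      simp [mergeTest, mergeCoeff, h1, h2, hj0]
      ring
  · rw [lastFace_apply]
    change _ = (-1) ^ (n + 1) * integral d ((mergeLast f 0).1 * Ψ fun i => (mergeLast f i.succ).1)
    rw [← hs]
    congr 1
    have e : (fun i => (mergeLast f i.succ).1) = mergeAt (n + 1) fun i => (f i.succ).1 := by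
      funext i
      simp [mergeLast, mergeAt]
    rw [e]
    simp [mergeLast, mergeCoeff]
    ring

lemma Represents.dHoch {ψ : Cochain (Poly d) n} {F : Functional d n} (h : Represents ψ F) :
    Represents (dHoch n ψ) (hochDiff F) := by
  obtain ⟨Ψ, h, rfl⟩ := h
  exact ⟨_, dHoch_mem_polyDiffPair h, toFunctional_dHoch Ψ⟩

lemma toFunctional_X_mul (c : Fin d) (Ψ : Cochain (SmoothFun d) n) :
    toFunctional (fun f => polyToSmooth d (MvPolynomial.X c) * Ψ f) =
      plug (Test.X c) 0 (toFunctional Ψ) := by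
  funext f
  change integral d ((f 0).1 * (_ * Ψ _)) = integral d ((Function.update f 0 (Test.X c (f 0)) 0).1 *
    Ψ fun i => (Function.update f 0 (Test.X c (f 0)) i.succ).1)
  simp only [Function.update_self, Function.update_of_ne (Fin.succ_ne_zero _), Test.X]
  congr 1
  ring

/-- Multiplying the first argument by x_c multiplies the values of the operator by x_c, and the
Hochschild differential is linear over the coefficient algebra. -/
lemma plug_X_hochDiff (c : Fin d) {F : Functional d n} (hF : F ∈ functionals Finset.univ ⊤ n) :
    plug (Test.X c) 0 (hochDiff F) = hochDiff (plug (Test.X c) 0 F) := by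
  obtain ⟨ψ, -, Ψ, -, rfl⟩ := exists_represents_of_mem_functionals hF
  rw [← toFunctional_X_mul, ← toFunctional_dHoch, ← toFunctional_dHoch, ← toFunctional_X_mul]
  congr 1
  funext f
  rw [dHoch_apply, dHoch_apply, Finset.mul_sum]
  exact Finset.sum_congr rfl fun j _ => by ring

end
end CyclicHKR

/-! ### Polyvectors in the exterior algebra, and sums over words built from either end. -/

namespace CyclicHKR
noncomputable section
open scoped TensorProduct ContDiff

/-! ### Polyvectors with coefficients in a differential ring -/

/-- The exterior algebra of `ℂ^d`. -/
abbrev Ext (d : ℕ) : Type := ExteriorAlgebra ℂ (Fin d → ℂ)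

/-- Polyvectors of mixed degree with coefficients in `B`. -/
abbrev PV (B : Type) [CommRing B] [Algebra ℂ B] (d : ℕ) : Type := B ⊗[ℂ] Ext d

section PV

variable {d : ℕ} {B : Type} [CommRing B] [Algebra ℂ B]

/-- Contraction with `dx_c`. -/
def contr (c : Fin d) : Module.End ℂ (PV B d) :=
  LinearMap.lTensor B (CliffordAlgebra.contractLeft (LinearMap.proj c : Module.Dual ℂ (Fin d → ℂ)))

/-- Exterior multiplication with `∂/∂x_c`. -/
def wedge (c : Fin d) : Module.End ℂ (PV B d) :=
  LinearMap.lTensor B (LinearMap.mulLeft ℂ (ExteriorAlgebra.ι ℂ (Pi.single c 1 : Fin d → ℂ)))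

/-- An operator acting on coefficients. -/
abbrev onCoeff {B' : Type} [CommRing B'] [Algebra ℂ B'] (T : B →ₗ[ℂ] B') : PV B d →ₗ[ℂ] PV B' d :=
  LinearMap.rTensor (Ext d) T

/-- The component of exterior degree zero. -/
def augment : PV B d →ₗ[ℂ] B :=
  (TensorProduct.rid ℂ B).toLinearMap ∘ₗ
    LinearMap.lTensor B (ExteriorAlgebra.algebraMapInv (R := ℂ) (M := Fin d → ℂ)).toLinearMap

lemma contr_tmul (c : Fin d) (a : B) (g : Ext d) : contr c (a ⊗ₜ[ℂ] g) =
    a ⊗ₜ CliffordAlgebra.contractLeft (LinearMap.proj c : Module.Dual ℂ (Fin d → ℂ)) g := rfl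

lemma wedge_tmul (c : Fin d) (a : B) (g : Ext d) : wedge c (a ⊗ₜ[ℂ] g) =
    a ⊗ₜ (ExteriorAlgebra.ι ℂ (Pi.single c 1 : Fin d → ℂ) * g) := rfl

lemma augment_tmul (a : B) (g : Ext d) :
    augment (a ⊗ₜ[ℂ] g) = ExteriorAlgebra.algebraMapInv g • a := by
  simp [augment]

lemma contr_contr (b c : Fin d) (γ : PV B d) : contr b (contr c γ) = -contr c (contr b γ) := by
  induction γ using TensorProduct.induction_on with
  | zero => simp
  | add x y hx hy => simp only [map_add, hx, hy]; abel
  | tmul a g =>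
    rw [contr_tmul, contr_tmul, contr_tmul, contr_tmul, CliffordAlgebra.contractLeft_comm,
      TensorProduct.tmul_neg]

lemma contr_wedge (b c : Fin d) (γ : PV B d) :
    contr b (wedge c γ) = (if b = c then γ else 0) - wedge c (contr b γ) := by
  induction γ using TensorProduct.induction_on with
  | zero => simp
  | add x y hx hy => simp only [map_add, hx, hy]; split_ifs <;> abel
  | tmul a g =>
    rw [wedge_tmul, contr_tmul, contr_tmul, wedge_tmul]
    have := CliffordAlgebra.contractLeft_ι_mul (Q := (0 : QuadraticForm ℂ (Fin d → ℂ)))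
      (d := LinearMap.proj b) (Pi.single c 1 : Fin d → ℂ) g
    erw [this]
    rw [TensorProduct.tmul_sub]
    congr 1
    rw [LinearMap.proj_apply, Pi.single_apply]
    split_ifs <;> simp

lemma onCoeff_contr {B' : Type} [CommRing B'] [Algebra ℂ B'] (T : B →ₗ[ℂ] B') (c : Fin d)
    (γ : PV B d) : onCoeff T (contr c γ) = contr c (onCoeff T γ) := by
  induction γ using TensorProduct.induction_on with
  | zero => simp
  | add x y hx hy => simp only [map_add, hx, hy]
  | tmul a g => rfl

lemma onCoeff_wedge {B' : Type} [CommRing B'] [Algebra ℂ B'] (T : B →ₗ[ℂ] B') (c : Fin d)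
    (γ : PV B d) : onCoeff T (wedge c γ) = wedge c (onCoeff T γ) := by
  induction γ using TensorProduct.induction_on with
  | zero => simp
  | add x y hx hy => simp only [map_add, hx, hy]
  | tmul a g => rfl

lemma augment_onCoeff {B' : Type} [CommRing B'] [Algebra ℂ B'] (T : B →ₗ[ℂ] B') (γ : PV B d) :
    augment (onCoeff T γ) = T (augment γ) := by
  induction γ using TensorProduct.induction_on with
  | zero => simp
  | add x y hx hy => simp only [map_add, hx, hy]
  | tmul a g => rw [LinearMap.rTensor_tmul, augment_tmul, augment_tmul, map_smul]

lemma augment_wedge (c : Fin d) (γ : PV B d) : augment (wedge c γ) = 0 := by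
  induction γ using TensorProduct.induction_on with
  | zero => simp
  | add x y hx hy => rw [map_add, map_add, hx, hy, add_zero]
  | tmul a g =>
    rw [wedge_tmul, augment_tmul, map_mul]
    have : ExteriorAlgebra.algebraMapInv
        (ExteriorAlgebra.ι ℂ (Pi.single c 1 : Fin d → ℂ)) = (0 : ℂ) := by
      simp [ExteriorAlgebra.algebraMapInv]
    rw [this, zero_mul, zero_smul]

/-- The divergence. -/
def divg (D : Fin d → Module.End ℂ B) : Module.End ℂ (PV B d) := ∑ c, onCoeff (D c) ∘ₗ contr c

lemma divg_apply (D : Fin d → Module.End ℂ B) (γ : PV B d) :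
    divg D γ = ∑ c, onCoeff (D c) (contr c γ) := by
  rw [divg, LinearMap.sum_apply]
  rfl

lemma divg_contr (D : Fin d → Module.End ℂ B) (c : Fin d) (γ : PV B d) :
    divg D (contr c γ) = -contr c (divg D γ) := by
  rw [divg_apply, divg_apply, map_sum, ← Finset.sum_neg_distrib]
  refine Finset.sum_congr rfl fun b _ => ?_
  rw [contr_contr, map_neg, onCoeff_contr]

lemma divg_divg {j : Poly d →ₐ[ℂ] B} {D : Fin d → Module.End ℂ B} (h : IsDiffRing j D)
    (γ : PV B d) : divg D (divg D γ) = 0 := by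
  have hc : ∀ b c (γ : PV B d), onCoeff (D b) (onCoeff (D c) γ) = onCoeff (D c) (onCoeff (D b) γ) := by
    intro b c γ
    rw [← LinearMap.comp_apply, ← LinearMap.comp_apply, ← LinearMap.rTensor_comp,
      ← LinearMap.rTensor_comp]
    congr 2
    ext f
    exact h.comm b c f
  have ht : ∀ b c, onCoeff (D b) (contr b (onCoeff (D c) (contr c γ))) =
      -onCoeff (D c) (contr c (onCoeff (D b) (contr b γ))) := by
    intro b c
    rw [← onCoeff_contr, ← onCoeff_contr, hc, contr_contr, map_neg, map_neg]
  -- Exchanging the summation indices changes the sign, since the derivatives commute while the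
  -- contractions anticommute; so the sum is its own negative.
  have e : divg D (divg D γ) = -divg D (divg D γ) := by
    have h1 : divg D (divg D γ) =
        ∑ b, ∑ c, onCoeff (D b) (contr b (onCoeff (D c) (contr c γ))) := by
      simp only [divg_apply, map_sum]
      rw [Finset.sum_comm]
    conv_lhs => rw [h1, Finset.sum_comm]
    rw [h1, ← Finset.sum_neg_distrib]
    refine Finset.sum_congr rfl fun b _ => ?_
    rw [← Finset.sum_neg_distrib]
    exact Finset.sum_congr rfl fun c _ => ht c b
  rw [eq_neg_iff_add_eq_zero, ← two_smul ℂ] at e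
  exact (smul_eq_zero.mp e).resolve_left two_ne_zero

end PV

/-! ### Families of cochains depending on a polyvector -/

/-- Families of cochains that depend on a polyvector. -/
abbrev Fam (B : Type) [CommRing B] [Algebra ℂ B] (d : ℕ) : Type :=
  (n : ℕ) → PV B d →ₗ[ℂ] Cochain B n

section Fam

variable {d : ℕ} {B : Type} [CommRing B] [Algebra ℂ B] (D : Fin d → Module.End ℂ B)

/-- The cup product with a linear operator from the left. -/
def cup {n : ℕ} (T : Module.End ℂ B) : Cochain B n →ₗ[ℂ] Cochain B (n + 1) where
  toFun ψ f := T (f 0) * ψ (Fin.tail f)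
  map_add' ψ φ := by funext f; simp [mul_add]
  map_smul' c ψ := by funext f; simp

/-- The cup product with a linear operator from the right. -/
def cupRight {n : ℕ} (T : Module.End ℂ B) : Cochain B n →ₗ[ℂ] Cochain B (n + 1) where
  toFun ψ f := ψ (Fin.init f) * T (f (Fin.last n))
  map_add' ψ φ := by funext f; simp [add_mul]
  map_smul' c ψ := by funext f; simp

lemma cup_apply {n : ℕ} (T : Module.End ℂ B) (ψ : Cochain B n) (f : Fin (n + 1) → B) :
    cup T ψ f = T (f 0) * ψ (Fin.tail f) := rfl

lemma cupRight_apply {n : ℕ} (T : Module.End ℂ B) (ψ : Cochain B n) (f : Fin (n + 1) → B) :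
    cupRight T ψ f = ψ (Fin.init f) * T (f (Fin.last n)) := rfl

lemma cup_cupRight {n : ℕ} (S T : Module.End ℂ B) (ψ : Cochain B n) :
    cup S (cupRight T ψ) = cupRight T (cup S ψ) := by
  funext f
  rw [cup_apply, cupRight_apply, cupRight_apply, cup_apply, Fin.tail_init_eq_init_tail, mul_assoc]
  rfl

/-- Multiplication by the first argument. -/
def preI (X : Fam B d) : Fam B d
  | 0 => 0
  | n + 1 => cup 1 ∘ₗ X n

/-- Multiplication by the last argument. -/
def postI (X : Fam B d) : Fam B d
  | 0 => 0
  | n + 1 => cupRight 1 ∘ₗ X n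

/-- Contraction with the de Rham differential of the first argument. -/
def preT (X : Fam B d) : Fam B d
  | 0 => 0
  | n + 1 => ∑ c, cup (D c) ∘ₗ X n ∘ₗ contr c

/-- Contraction with the de Rham differential of the last argument. -/
def postT (X : Fam B d) : Fam B d
  | 0 => 0
  | n + 1 => (-1 : ℂ) ^ n • ∑ c, cupRight (D c) ∘ₗ X n ∘ₗ contr c

variable {D}

lemma preI_succ (X : Fam B d) (n : ℕ) (γ : PV B d) : preI X (n + 1) γ = cup 1 (X n γ) := rfl

lemma postI_succ (X : Fam B d) (n : ℕ) (γ : PV B d) : postI X (n + 1) γ = cupRight 1 (X n γ) := rfl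

lemma preT_succ (X : Fam B d) (n : ℕ) (γ : PV B d) :
    preT D X (n + 1) γ = ∑ c, cup (D c) (X n (contr c γ)) := by
  rw [preT, LinearMap.sum_apply]; rfl

lemma postT_succ (X : Fam B d) (n : ℕ) (γ : PV B d) :
    postT D X (n + 1) γ = (-1 : ℂ) ^ n • ∑ c, cupRight (D c) (X n (contr c γ)) := by
  rw [postT, LinearMap.smul_apply, LinearMap.sum_apply]; rfl

lemma preI_add (X Y : Fam B d) : preI (X + Y) = preI X + preI Y := by
  funext n; cases n with
  | zero => simp [preI]
  | succ n => ext γ; simp [preI]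

lemma preT_add (X Y : Fam B d) : preT D (X + Y) = preT D X + preT D Y := by
  funext n
  refine LinearMap.ext fun γ => ?_
  cases n with
  | zero => simp [preT]
  | succ n =>
    change _ = preT D X (n + 1) γ + preT D Y (n + 1) γ
    rw [preT_succ, preT_succ, preT_succ, ← Finset.sum_add_distrib]
    simp only [Pi.add_apply, LinearMap.add_apply, map_add]

lemma preI_postI (X : Fam B d) : preI (postI X) = postI (preI X) := by
  funext n
  refine LinearMap.ext fun γ => ?_
  match n with
  | 0 => rfl
  | 1 => rw [preI_succ, postI_succ]; simp [preI, postI]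
  | n + 2 => rw [preI_succ, postI_succ, postI_succ, preI_succ, cup_cupRight]

lemma preT_postI (X : Fam B d) : preT D (postI X) = postI (preT D X) := by
  funext n
  refine LinearMap.ext fun γ => ?_
  match n with
  | 0 => rfl
  | 1 => rw [preT_succ, postI_succ]; simp [preT, postI]
  | n + 2 => rw [preT_succ, postI_succ, preT_succ, map_sum]; simp [postI_succ, cup_cupRight]

lemma preI_postT (X : Fam B d) : preI (postT D X) = -postT D (preI X) := by
  funext n
  refine LinearMap.ext fun γ => ?_
  match n with
  | 0 => simp [preI, postT]
  | 1 => rw [preI_succ, Pi.neg_apply, LinearMap.neg_apply, postT_succ]; simp [preI, postT]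
  | n + 2 =>
    rw [preI_succ, Pi.neg_apply, LinearMap.neg_apply, postT_succ, postT_succ, map_smul, map_sum,
      pow_succ]
    simp only [preI_succ, cup_cupRight]
    module

/-- The sign (−1)^n in `postT` changes when an argument is prepended; this compensates the
anticommutation of the two contractions. -/
lemma preT_postT (X : Fam B d) : preT D (postT D X) = postT D (preT D X) := by
  funext n
  refine LinearMap.ext fun γ => ?_
  match n with
  | 0 => rfl
  | 1 => rw [preT_succ, postT_succ]; simp [preT, postT]
  | n + 2 =>
    rw [preT_succ, postT_succ]
    simp only [postT_succ, preT_succ, map_smul, map_sum, ← cup_cupRight]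
    rw [Finset.sum_comm, ← Finset.smul_sum, Finset.sum_comm, pow_succ, mul_neg_one, neg_smul,
      ← smul_neg, ← Finset.sum_neg_distrib]
    congr 1
    rw [Finset.sum_comm]
    refine Finset.sum_congr rfl fun b _ => ?_
    rw [← Finset.sum_neg_distrib]
    refine Finset.sum_congr rfl fun c _ => ?_
    rw [contr_contr]
    simp only [map_neg]

variable (D) in
/-- Sum over the two ways to prepend a symbol: one argument that is contracted, or a product of two
arguments. -/
def pre (X : Fam B d) : Fam B d := preT D X + preI (preI X)

variable (D) in
/-- Sum over the two ways to append a symbol. -/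
def post (X : Fam B d) : Fam B d := postT D X + postI (postI X)

lemma postI_add (X Y : Fam B d) : postI (X + Y) = postI X + postI Y := by
  funext n; cases n with
  | zero => simp [postI]
  | succ n => ext γ; simp [postI]

lemma postT_add (X Y : Fam B d) : postT D (X + Y) = postT D X + postT D Y := by
  funext n
  refine LinearMap.ext fun γ => ?_
  cases n with
  | zero => simp [postT]
  | succ n =>
    change _ = postT D X (n + 1) γ + postT D Y (n + 1) γ
    rw [postT_succ, postT_succ, postT_succ, ← smul_add, ← Finset.sum_add_distrib]
    simp only [Pi.add_apply, LinearMap.add_apply, map_add]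

lemma preI_neg (X : Fam B d) : preI (-X) = -preI X := by
  funext n; cases n with
  | zero => simp [preI]
  | succ n => ext γ; simp [preI]

lemma preI_preI_post (X : Fam B d) : preI (preI (post D X)) = post D (preI (preI X)) := by
  rw [post, post, preI_add, preI_add, preI_postT, preI_neg, preI_postT, neg_neg, preI_postI,
    preI_postI, preI_postI, preI_postI]

/-- Prepending and appending a symbol act on different arguments and commute without sign: a pair
passes two sign changes, and a contracted argument passes another one by `preT_postT`. -/
lemma pre_post (X : Fam B d) : pre D (post D X) = post D (pre D X) := by
  rw [pre, preI_preI_post, pre, post, post, post, preT_add, postT_add, postI_add, postI_add,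
    preT_postT, preT_postI, preT_postI]
  abel

/-- The family that is the augmentation in degree zero. -/
def unitFam (B : Type) [CommRing B] [Algebra ℂ B] (d : ℕ) : Fam B d
  | 0 => LinearMap.pi fun _ => augment
  | _ + 1 => 0

lemma unitFam_zero (γ : PV B d) (f : Fin 0 → B) : unitFam B d 0 γ f = augment γ := rfl

lemma unitFam_succ (n : ℕ) (γ : PV B d) : unitFam B d (n + 1) γ = 0 := rfl

lemma preI_unitFam : preI (unitFam B d) = postI (unitFam B d) := by
  funext n
  refine LinearMap.ext fun γ => ?_
  match n with
  | 0 => rfl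
  | 1 =>
    funext f
    rw [preI_succ, postI_succ, cup_apply, cupRight_apply, unitFam_zero, unitFam_zero, mul_comm]
    rfl
  | n + 2 => rw [preI_succ, postI_succ, unitFam_succ, map_zero, map_zero]

lemma preT_unitFam : preT D (unitFam B d) = postT D (unitFam B d) := by
  funext n
  refine LinearMap.ext fun γ => ?_
  match n with
  | 0 => rfl
  | 1 =>
    funext f
    rw [preT_succ, postT_succ, pow_zero, one_smul, Finset.sum_apply, Finset.sum_apply]
    refine Finset.sum_congr rfl fun c _ => ?_
    rw [cup_apply, cupRight_apply, unitFam_zero, unitFam_zero, mul_comm]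
    rfl
  | n + 2 => rw [preT_succ, postT_succ]; simp [unitFam_succ]

lemma pre_unitFam : pre D (unitFam B d) = post D (unitFam B d) := by
  rw [pre, post, preT_unitFam, preI_unitFam, preI_postI, preI_unitFam]

variable (D) in
/-- Sum over all words of `L` symbols. -/
def words (L : ℕ) : Fam B d := (pre D)^[L] (unitFam B d)

lemma words_zero : words D 0 = unitFam B d := rfl

lemma words_succ (L : ℕ) : words D (L + 1) = pre D (words D L) :=
  Function.iterate_succ_apply' _ _ _

/-- For the empty word the two ways to add a symbol agree because the ring is commutative; by
`pre_post` they agree for all words. This makes it possible to move symbols around the circle later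
on. -/
lemma words_succ_eq_post (L : ℕ) : words D (L + 1) = post D (words D L) := by
  induction L with
  | zero => exact pre_unitFam
  | succ L ih =>
    rw [words_succ]
    conv_lhs => rw [ih]
    rw [pre_post, ← words_succ]

/-- Every symbol uses at least one argument. -/
lemma words_eq_zero {L n : ℕ} (h : n < L) : words D L n = 0 := by
  induction L generalizing n with
  | zero => omega
  | succ L ih =>
    rw [words_succ]
    refine LinearMap.ext fun γ => ?_
    rw [pre, Pi.add_apply, LinearMap.add_apply]
    match n with
    | 0 => simp [preT, preI]
    | 1 =>
      rw [preT_succ, preI_succ, ih (by omega)]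
      simp [preI]
    | n + 2 =>
      rw [preT_succ, preI_succ, preI_succ, ih (by omega), ih (by omega)]
      simp

lemma words_self_succ (n : ℕ) : words D (n + 1) (n + 1) = preT D (words D n) (n + 1) := by
  rw [words_succ, pre, Pi.add_apply]
  refine add_eq_left.mpr (LinearMap.ext fun γ => ?_)
  cases n with
  | zero => rw [preI_succ]; simp [preI]
  | succ n => rw [preI_succ, preI_succ, words_eq_zero (by omega)]; simp

variable (D) in
/-- Sum over all words with a product of two arguments in a marked place, with `i` symbols before it and
`j` symbols after it. -/
def markedWords (i j : ℕ) : Fam B d := (pre D)^[i] (preI (preI (words D j)))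

lemma markedWords_succ_left (i j : ℕ) : markedWords D (i + 1) j = pre D (markedWords D i j) :=
  Function.iterate_succ_apply' _ _ _

lemma markedWords_succ_right (i j : ℕ) : markedWords D i (j + 1) = post D (markedWords D i j) := by
  induction i with
  | zero =>
    change preI (preI (words D (j + 1))) = post D (preI (preI (words D j)))
    rw [words_succ_eq_post, preI_preI_post]
  | succ i ih => rw [markedWords_succ_left, ih, pre_post, ← markedWords_succ_left]

/-- A word of L + 1 symbols in n arguments contains n − (L + 1) pairs, and it is counted once for
each pair that can be marked. -/
lemma sum_markedWords (L n : ℕ) :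
    ∑ i ∈ Finset.range (L + 1), markedWords D i (L - i) n =
      ((n : ℂ) - (L + 1)) • words D (L + 1) n := by
  -- Additivity of `pre`, in a form in which the sum is taken in each degree separately.
  have pre_sum : ∀ (t : Finset ℕ) (X : ℕ → Fam B d) (m : ℕ),
      ∑ i ∈ t, pre D (X i) m = pre D (fun m => ∑ i ∈ t, X i m) m := by
    intro t X m
    induction t using Finset.induction_on with
    | empty =>
      refine LinearMap.ext fun γ => ?_
      match m with
      | 0 => simp [pre, preT, preI]
      | 1 => simp [pre, preT_succ, preI]
      | m + 2 => simp [pre, preT_succ, preI]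
    | insert a t ha ih =>
      have : (fun m => ∑ i ∈ insert a t, X i m) = X a + fun m => ∑ i ∈ t, X i m := by
        funext m; rw [Finset.sum_insert ha]; rfl
      rw [Finset.sum_insert ha, ih, this, pre, pre, pre, preT_add, preI_add, preI_add]
      simp only [Pi.add_apply]
      abel
  induction L generalizing n with
  | zero =>
    rw [Finset.sum_range_one, words_succ, words_zero]
    change preI (preI (unitFam B d)) n = _
    refine LinearMap.ext fun γ => ?_
    match n with
    | 0 => simp [pre, preT, preI]
    | 1 => simp [preI]
    | 2 =>
      rw [pre, LinearMap.smul_apply, Pi.add_apply, LinearMap.add_apply, preT_succ, unitFam]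
      norm_num
    | n + 3 => simp [pre, preT_succ, preI, unitFam]
  | succ L ih =>
    rw [Finset.sum_range_succ']
    have h1 : ∀ i ∈ Finset.range (L + 1), markedWords D (i + 1) (L + 1 - (i + 1)) n =
        pre D (markedWords D i (L - i)) n := by
      intro i _
      rw [markedWords_succ_left, Nat.add_sub_add_right]
    rw [Finset.sum_congr rfl h1, pre_sum, words_succ]
    simp only [ih]
    change _ + preI (preI (words D (L + 1))) n = _
    refine LinearMap.ext fun γ => ?_
    match n with
    | 0 => simp [pre, preT, preI]
    | 1 =>
      simp only [pre, Pi.add_apply, LinearMap.add_apply, LinearMap.smul_apply, preT_succ, preI,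
        words_eq_zero (show 0 < L + 1 by omega)]
      simp
    | n + 2 =>
      simp only [pre, Pi.add_apply, LinearMap.add_apply, LinearMap.smul_apply, preT_succ, preI_succ,
        map_smul, ← Finset.smul_sum]
      push_cast
      module

end Fam

end
end CyclicHKR

/-! ### Divergence and cocycle properties of words, and integration under the cyclic norm. -/

namespace CyclicHKR
noncomputable section
open scoped TensorProduct ContDiff

section Fam

variable {d : ℕ} {B : Type} [CommRing B] [Algebra ℂ B] {j : Poly d →ₐ[ℂ] B}
  {D : Fin d → Module.End ℂ B}

/-! ### The divergence of families -/

variable (D) in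
/-- The divergence of the values of a family. -/
def nabla (X : Fam B d) : Fam B d := fun n => ∑ b, (D b).compLeft (Fin n → B) ∘ₗ X n ∘ₗ contr b

lemma nabla_apply (X : Fam B d) (n : ℕ) (γ : PV B d) (f : Fin n → B) :
    nabla D X n γ f = ∑ b, D b (X n (contr b γ) f) := by
  rw [nabla, LinearMap.sum_apply, Finset.sum_apply]
  rfl

variable (D) in
/-- Precomposition with the divergence of polyvectors. -/
def compDivg (X : Fam B d) : Fam B d := fun n => X n ∘ₗ divg D

/-- Change of the signs of a family in odd degrees. -/
def altSign (X : Fam B d) : Fam B d := fun n => (-1 : ℂ) ^ n • X n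

lemma compDivg_apply (X : Fam B d) (n : ℕ) (γ : PV B d) : compDivg D X n γ = X n (divg D γ) := rfl

lemma altSign_apply (X : Fam B d) (n : ℕ) (γ : PV B d) : altSign X n γ = (-1 : ℂ) ^ n • X n γ := rfl

lemma compDivg_add (X Y : Fam B d) : compDivg D (X + Y) = compDivg D X + compDivg D Y := rfl

lemma altSign_add (X Y : Fam B d) : altSign (X + Y) = altSign X + altSign Y := by
  funext n; exact smul_add _ _ _

lemma nabla_add (X Y : Fam B d) : nabla D (X + Y) = nabla D X + nabla D Y := by
  funext n
  refine LinearMap.ext fun γ => funext fun f => ?_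
  change _ = nabla D X n γ f + nabla D Y n γ f
  rw [nabla_apply, nabla_apply, nabla_apply, ← Finset.sum_add_distrib]
  exact Finset.sum_congr rfl fun b _ => map_add _ _ _

lemma preI_compDivg (X : Fam B d) : preI (compDivg D X) = compDivg D (preI X) := by
  funext n; cases n <;> rfl

lemma preT_compDivg (X : Fam B d) : preT D (compDivg D X) = -compDivg D (preT D X) := by
  funext n
  refine LinearMap.ext fun γ => ?_
  cases n with
  | zero => simp [preT, compDivg]
  | succ n =>
    change _ = -preT D X (n + 1) (divg D γ)
    rw [preT_succ, preT_succ, ← Finset.sum_neg_distrib]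
    refine Finset.sum_congr rfl fun c _ => ?_
    rw [compDivg_apply, divg_contr, map_neg, map_neg]

lemma preI_altSign (X : Fam B d) : preI (altSign X) = -altSign (preI X) := by
  funext n
  refine LinearMap.ext fun γ => ?_
  cases n with
  | zero => simp [preI, altSign]
  | succ n =>
    change _ = -((-1 : ℂ) ^ (n + 1) • preI X (n + 1) γ)
    rw [preI_succ, preI_succ, altSign_apply, map_smul]
    module

lemma preT_altSign (X : Fam B d) : preT D (altSign X) = -altSign (preT D X) := by
  funext n
  refine LinearMap.ext fun γ => ?_
  cases n with
  | zero => simp [preT, altSign]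
  | succ n =>
    change _ = -((-1 : ℂ) ^ (n + 1) • preT D X (n + 1) γ)
    rw [preT_succ, preT_succ]
    simp only [altSign_apply, map_smul, ← Finset.smul_sum]
    module

lemma nabla_preI (h : IsDiffRing j D) (X : Fam B d) :
    nabla D (preI X) = preT D X + preI (nabla D X) := by
  funext n
  refine LinearMap.ext fun γ => funext fun f => ?_
  change _ = preT D X n γ f + preI (nabla D X) n γ f
  cases n with
  | zero => simp [nabla_apply, preI, preT]
  | succ n =>
    rw [nabla_apply, preT_succ, preI_succ, Finset.sum_apply, cup_apply, nabla_apply]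
    simp only [preI_succ, cup_apply, Module.End.one_apply, h.leibniz, Finset.sum_add_distrib,
      Finset.mul_sum]

/-- The second derivatives of the first argument are symmetric and meet an antisymmetric double
contraction, so they drop out; anticommuting the contractions in the remaining terms gives the sign.
-/
lemma nabla_preT (h : IsDiffRing j D) (X : Fam B d) :
    nabla D (preT D X) = -preT D (nabla D X) := by
  funext n
  refine LinearMap.ext fun γ => funext fun f => ?_
  change _ = -(preT D (nabla D X) n γ f)
  cases n with
  | zero => simp [nabla_apply, preT]
  | succ n =>
    rw [nabla_apply, preT_succ, Finset.sum_apply]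
    simp only [preT_succ, Finset.sum_apply, cup_apply, map_sum, nabla_apply, h.leibniz,
      Finset.sum_add_distrib, Finset.mul_sum]
    have h0 : ∑ b, ∑ c, D b (D c (f 0)) * X n (contr c (contr b γ)) (Fin.tail f) = 0 := by
      have e : ∑ b, ∑ c, D b (D c (f 0)) * X n (contr c (contr b γ)) (Fin.tail f) =
          -∑ b, ∑ c, D b (D c (f 0)) * X n (contr c (contr b γ)) (Fin.tail f) := by
        conv_lhs => rw [Finset.sum_comm]
        rw [← Finset.sum_neg_distrib]
        refine Finset.sum_congr rfl fun b _ => ?_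
        rw [← Finset.sum_neg_distrib]
        refine Finset.sum_congr rfl fun c _ => ?_
        rw [h.comm, contr_contr, map_neg, Pi.neg_apply, mul_neg]
      rw [eq_neg_iff_add_eq_zero, ← two_smul ℂ] at e
      exact (smul_eq_zero.mp e).resolve_left two_ne_zero
    rw [h0, zero_add, Finset.sum_comm, ← Finset.sum_neg_distrib]
    refine Finset.sum_congr rfl fun b _ => ?_
    rw [← Finset.sum_neg_distrib]
    refine Finset.sum_congr rfl fun c _ => ?_
    rw [contr_contr, map_neg, Pi.neg_apply, map_neg, mul_neg]

/-- Only degree zero contributes, through the divergence. The last two summands live in degree one,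
where they cancel; they are present because this is the start of the induction in `nabla_words`. -/
lemma nabla_unitFam : nabla D (unitFam B d) =
    compDivg D (unitFam B d) + altSign (postI (unitFam B d)) + preI (unitFam B d) := by
  funext n
  refine LinearMap.ext fun γ => funext fun f => ?_
  rw [← preI_unitFam]
  change _ = unitFam B d n (divg D γ) f + ((-1 : ℂ) ^ n • preI (unitFam B d) n γ) f +
    preI (unitFam B d) n γ f
  match n with
  | 0 =>
    simp only [nabla_apply, unitFam_zero, preI, divg_apply, map_sum, augment_onCoeff]
    simp
  | 1 => simp [nabla_apply, unitFam_succ, preI]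
  | n + 2 => simp [nabla_apply, unitFam_succ, preI]

/-- The divergence of the values of `words D L`. -/
lemma nabla_words (h : IsDiffRing j D) (L : ℕ) : nabla D (words D L) =
    compDivg D (words D L) + altSign (postI (words D L)) + preI (words D L) := by
  induction L with
  | zero => exact nabla_unitFam
  | succ L ih =>
    rw [words_succ]
    -- The Leibniz rule for the first argument of a pair yields `preT (preI W)`, which cancels the
    -- same term from the induction hypothesis. The rest reassembles, as `postI` commutes with
    -- prepending.
    simp only [pre, nabla_add, nabla_preT h, nabla_preI h, ih, preT_add, preI_add, preT_compDivg,
      preI_compDivg, preT_altSign, preI_altSign, preT_postI, preI_postI, preI_neg, postI_add,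
      altSign_add, compDivg_add]
    abel

/-! ### Families of Hochschild cocycles -/

lemma dHoch_cup {n : ℕ} (T : Module.End ℂ B) (ψ : Cochain B n) (f : Fin (n + 2) → B) :
    dHoch (n + 1) (cup T ψ) f =
      (f 0 * T (f 1) - T (f 0 * f 1) + T (f 0) * f 1) * ψ (Fin.tail (Fin.tail f)) -
        T (f 0) * dHoch n ψ (Fin.tail f) := by
  rw [dHoch_apply, dHoch_apply, Finset.sum_range_succ', Finset.sum_range_succ', Finset.mul_sum,
    Finset.sum_range_succ' _ (n + 1)]
  have h : ∀ j ∈ Finset.range (n + 1), (-1 : B) ^ (j + 1 + 1) *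
      (mergeCoeff (j + 1 + 1) f * cup T ψ (mergeAt (j + 1 + 1) f)) =
      -(T (f 0) * ((-1) ^ (j + 1) *
        (mergeCoeff (j + 1) (Fin.tail f) * ψ (mergeAt (j + 1) (Fin.tail f))))) := by
    intro j _
    have h1 : mergeCoeff (j + 1 + 1) f = mergeCoeff (j + 1) (Fin.tail f) := by
      simp [mergeCoeff, Fin.tail]
    have h2 : mergeAt (j + 1 + 1) f 0 = f 0 := by simp [mergeAt]
    have h3 : Fin.tail (mergeAt (j + 1 + 1) f) = mergeAt (j + 1) (Fin.tail f) := by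
      funext i; simp [mergeAt, Fin.tail]
    rw [cup_apply, h1, h2, h3]
    ring
  rw [Finset.sum_congr rfl h, Finset.sum_neg_distrib]
  have e1 : mergeCoeff 1 f = 1 := by simp [mergeCoeff]
  have e2 : mergeCoeff 0 f = f 0 := by simp [mergeCoeff]
  have e3 : mergeCoeff 0 (Fin.tail f) = f 1 := by simp [mergeCoeff, Fin.tail]
  have e4 : mergeAt 1 f 0 = f 0 * f 1 := by simp [mergeAt]
  have e5 : Fin.tail (mergeAt 1 f) = Fin.tail (Fin.tail f) := by
    funext i; simp [mergeAt, Fin.tail]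
  have e6 : mergeAt 0 f 0 = f 1 := by simp [mergeAt]
  have e7 : Fin.tail (mergeAt 0 f) = Fin.tail (Fin.tail f) := by
    funext i; simp [mergeAt, Fin.tail]
  have e8 : mergeAt 0 (Fin.tail f) = Fin.tail (Fin.tail f) := by
    funext i; simp [mergeAt, Fin.tail]
  rw [cup_apply, cup_apply, zero_add, e1, e2, e3, e4, e5, e6, e7, e8]
  ring

lemma dHoch_cup_one {n : ℕ} (ψ : Cochain B n) :
    dHoch (n + 1) (cup 1 ψ) = cup 1 (cup 1 ψ) - cup 1 (dHoch n ψ) := by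
  funext f
  rw [dHoch_cup]
  change _ = f 0 * (f 1 * ψ (Fin.tail (Fin.tail f))) - f 0 * dHoch n ψ (Fin.tail f)
  simp only [Module.End.one_apply]
  ring

lemma dHoch_cup_derivation {n : ℕ} {T : Module.End ℂ B} (hT : ∀ f g, T (f * g) = T f * g + f * T g)
    (ψ : Cochain B n) : dHoch (n + 1) (cup T ψ) = -cup T (dHoch n ψ) := by
  funext f
  rw [dHoch_cup, hT]
  change _ = -(T (f 0) * dHoch n ψ (Fin.tail f))
  ring

/-- A derivation in the first slot anticommutes with the differential. For a pair, the two terms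
with three leading arguments cancel, so prepending a pair commutes with it. -/
lemma dHoch_words (h : IsDiffRing j D) (L n : ℕ) (γ : PV B d) : dHoch n (words D L n γ) = 0 := by
  induction L generalizing n γ with
  | zero =>
    match n with
    | 0 =>
      funext f
      rw [dHoch_apply]
      simp [words_zero, Finset.sum_range_succ, mergeCoeff, unitFam_zero]
    | n + 1 => rw [words_zero, unitFam_succ, map_zero]
  | succ L ih =>
    rw [words_succ, pre]
    change dHoch n (preT D _ n γ + preI (preI _) n γ) = 0
    have h1 : dHoch n (preT D (words D L) n γ) = 0 := by
      cases n with
      | zero => simp [preT]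
      | succ n =>
        rw [preT_succ, map_sum]
        refine Finset.sum_eq_zero fun c _ => ?_
        rw [dHoch_cup_derivation (h.leibniz c), ih, map_zero, neg_zero]
    rw [map_add, h1, zero_add]
    match n with
    | 0 => simp [preI]
    | 1 => simp [preI]
    | n + 2 =>
      rw [preI_succ, preI_succ, dHoch_cup_one, dHoch_cup_one, ih, map_zero, sub_zero, sub_self]

/-! ### Lie derivatives -/

/-- The Lie derivative of the values of `X` along `T` agrees with the action on arguments and on
polyvectors. -/
def IsInvariant (T : Module.End ℂ B) (S : Module.End ℂ (PV B d)) (X : Fam B d) : Prop :=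
  ∀ n γ f, ∑ i, X n γ (Function.update f i (T (f i))) = T (X n γ f) - X n (S γ) f

section

variable {T : Module.End ℂ B} {S : Module.End ℂ (PV B d)} {X : Fam B d}

lemma sum_cup_update {n : ℕ} (U : Module.End ℂ B) (ψ : Cochain B n) (f : Fin (n + 1) → B) :
    ∑ i, cup U ψ (Function.update f i (T (f i))) = U (T (f 0)) * ψ (Fin.tail f) +
      U (f 0) * ∑ i, ψ (Function.update (Fin.tail f) i (T (Fin.tail f i))) := by
  rw [Fin.sum_univ_succ, Finset.mul_sum]
  simp only [cup_apply, Function.update_self, Fin.tail_update_zero, Fin.tail_update_succ,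
    Function.update_of_ne (Fin.succ_ne_zero _).symm]
  rfl

lemma IsInvariant.preI (hT : ∀ f g, T (f * g) = T f * g + f * T g) (hX : IsInvariant T S X) :
    IsInvariant T S (preI X) := by
  intro n γ f
  cases n with
  | zero => simp [CyclicHKR.preI]
  | succ n =>
    rw [preI_succ, sum_cup_update, hX, preI_succ, cup_apply, cup_apply]
    simp only [Module.End.one_apply, hT]
    ring

lemma IsInvariant.preT {τ : Fin d → ℂ} (hT : ∀ f g, T (f * g) = T f * g + f * T g)
    (hD : ∀ b f, D b (T f) = T (D b f) + τ b • D b f)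
    (hS : ∀ b γ, S (contr b γ) = contr b (S γ) + τ b • contr b γ) (hX : IsInvariant T S X) :
    IsInvariant T S (preT D X) := by
  intro n γ f
  cases n with
  | zero => simp [CyclicHKR.preT]
  | succ n =>
    simp only [preT_succ, Finset.sum_apply]
    rw [Finset.sum_comm, map_sum, ← Finset.sum_sub_distrib]
    refine Finset.sum_congr rfl fun b _ => ?_
    rw [sum_cup_update, hX, hD, hS, map_add, map_smul, cup_apply, cup_apply, hT, Pi.add_apply,
      Pi.smul_apply]
    simp only [Algebra.smul_def]
    ring

/-- The numbers τ_b record [∂_b, T] = τ_b ∂_b: they vanish for T = ∂_c, and are δ_{bc} for T = x_c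
∂_c. The operator S is the corresponding Lie derivative of polyvectors, and its commutators with
contractions compensate τ. -/
lemma isInvariant_words {τ : Fin d → ℂ} (hT : ∀ f g, T (f * g) = T f * g + f * T g)
    (hD : ∀ b f, D b (T f) = T (D b f) + τ b • D b f)
    (hS : ∀ b γ, S (contr b γ) = contr b (S γ) + τ b • contr b γ)
    (hε : ∀ γ, augment (S γ) = T (augment γ)) (L : ℕ) : IsInvariant T S (words D L) := by
  induction L with
  | zero =>
    intro n γ f
    cases n with
    | zero => simp [words_zero, unitFam_zero, hε]
    | succ n => simp [words_zero, unitFam_succ]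
  | succ L ih =>
    intro n γ f
    have h1 := IsInvariant.preT hT hD hS ih n γ f
    have h2 := IsInvariant.preI hT (IsInvariant.preI hT ih) n γ f
    simp only [words_succ, pre, Pi.add_apply, LinearMap.add_apply, Finset.sum_add_distrib, h1, h2,
      map_add]
    abel

end

/-! ### Contraction with a fixed derivation in the first argument -/

variable (D) in
/-- The derivative `D c` of the first argument. -/
def preD (c : Fin d) (X : Fam B d) : Fam B d
  | 0 => 0
  | n + 1 => cup (D c) ∘ₗ X n

/-- Precomposition with exterior multiplication. -/
def compWedge (c : Fin d) (X : Fam B d) : Fam B d := fun n => X n ∘ₗ wedge c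

lemma preD_succ (c : Fin d) (X : Fam B d) (n : ℕ) (γ : PV B d) :
    preD D c X (n + 1) γ = cup (D c) (X n γ) := rfl

lemma postT_preD (c : Fin d) (X : Fam B d) : postT D (preD D c X) = -preD D c (postT D X) := by
  funext n
  refine LinearMap.ext fun γ => ?_
  match n with
  | 0 => simp [preD, postT]
  | 1 => rw [Pi.neg_apply, LinearMap.neg_apply, postT_succ, preD_succ]; simp [preD, postT]
  | n + 2 =>
    rw [Pi.neg_apply, LinearMap.neg_apply, preD_succ, postT_succ, postT_succ, map_smul, map_sum,
      pow_succ]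
    simp only [preD_succ, cup_cupRight]
    module

/-- Contraction with dx_b anticommutes with exterior multiplication by ∂_c up to δ_{bc}, and that
exceptional term differentiates the first argument along c. -/
lemma compWedge_preT (c : Fin d) (X : Fam B d) :
    compWedge c (preT D X) = preD D c X - preT D (compWedge c X) := by
  funext n
  refine LinearMap.ext fun γ => ?_
  cases n with
  | zero => simp [compWedge, preT, preD]
  | succ n =>
    change preT D X (n + 1) (wedge c γ) = preD D c X (n + 1) γ - preT D (compWedge c X) (n + 1) γ
    rw [preT_succ, preT_succ, preD_succ, eq_sub_iff_add_eq, ← Finset.sum_add_distrib]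
    rw [Finset.sum_eq_single c]
    · rw [contr_wedge, if_pos rfl, ← map_add, compWedge, LinearMap.comp_apply, ← map_add,
        sub_add_cancel]
    · intro b _ hb
      rw [contr_wedge, if_neg hb, ← map_add, compWedge, LinearMap.comp_apply, ← map_add]
      simp
    · simp

lemma postT_neg (X : Fam B d) : postT D (-X) = -postT D X := by
  funext n
  refine LinearMap.ext fun γ => ?_
  cases n with
  | zero => simp [postT]
  | succ n =>
    change _ = -postT D X (n + 1) γ
    rw [postT_succ, postT_succ, ← smul_neg, ← Finset.sum_neg_distrib]
    simp only [Pi.neg_apply, LinearMap.neg_apply, map_neg]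

lemma postT_sub (X Y : Fam B d) : postT D (X - Y) = postT D X - postT D Y := by
  rw [sub_eq_add_neg, postT_add, postT_neg, ← sub_eq_add_neg]

variable (D) in
/-- The family of alternating words. -/
def altWords (n : ℕ) : Fam B d := (preT D)^[n] (unitFam B d)

lemma altWords_succ (n : ℕ) : altWords D (n + 1) = preT D (altWords D n) :=
  Function.iterate_succ_apply' _ _ _

lemma altWords_succ_eq_postT (n : ℕ) : altWords D (n + 1) = postT D (altWords D n) := by
  induction n with
  | zero => exact preT_unitFam
  | succ n ih =>
    rw [altWords_succ]
    conv_lhs => rw [ih]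
    rw [preT_postT, ← altWords_succ]

/-- With as many symbols as arguments there is no room for a pair. -/
lemma words_self (n : ℕ) : words D n n = altWords D n n := by
  induction n with
  | zero => rfl
  | succ n ih =>
    rw [words_self_succ, altWords_succ]
    refine LinearMap.ext fun γ => ?_
    rw [preT_succ, preT_succ, ih]

lemma compWedge_altWords_zero (c : Fin d) : compWedge c (altWords D 0) = 0 := by
  funext n
  refine LinearMap.ext fun γ => ?_
  cases n with
  | zero =>
    funext f
    exact augment_wedge c γ
  | succ n => rfl

lemma postT_iterate_preT (i : ℕ) (X : Fam B d) :
    (postT D)^[i] (preT D X) = preT D ((postT D)^[i] X) := by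
  induction i with
  | zero => rfl
  | succ i ih => rw [Function.iterate_succ_apply', ih, ← preT_postT, Function.iterate_succ_apply']

lemma postT_iterate_preD (c : Fin d) (i n : ℕ) :
    (postT D)^[i] (preD D c (altWords D n)) = (-1 : ℤ) ^ i • preD D c (altWords D (n + i)) := by
  induction i with
  | zero => simp
  | succ i ih =>
    have hz : ∀ Y : Fam B d, postT D ((-1 : ℤ) ^ i • Y) = (-1 : ℤ) ^ i • postT D Y := by
      intro Y
      rcases neg_one_pow_eq_or ℤ i with h | h <;> rw [h]
      · simp
      · rw [neg_one_smul, neg_one_smul, postT_neg]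
    rw [Function.iterate_succ_apply', ih, hz, postT_preD, ← altWords_succ_eq_postT, pow_succ,
      mul_neg_one, neg_smul, smul_neg]
    rfl

lemma postT_iterate_sub (i : ℕ) (X Y : Fam B d) :
    (postT D)^[i] (X - Y) = (postT D)^[i] X - (postT D)^[i] Y := by
  induction i generalizing X Y with
  | zero => rfl
  | succ i ih => rw [Function.iterate_succ_apply, postT_sub, ih]; rfl

end Fam

/-! ### Functionals from families -/

variable {d : ℕ}

/-- The functional given by the integral of a cochain. -/
def intF {n : ℕ} : Cochain (SmoothFun d) (n + 1) →ₗ[ℂ] Functional d n where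
  toFun Ψ f := integral d (Ψ fun i => (f i).1)
  map_add' Ψ Φ := by funext f; simp
  map_smul' c Ψ := by funext f; simp

lemma intF_apply {n : ℕ} (Ψ : Cochain (SmoothFun d) (n + 1)) (f : Fin (n + 1) → Test d) :
    intF Ψ f = integral d (Ψ fun i => (f i).1) := rfl

lemma cyc_intF_cup {n : ℕ} (T : Module.End ℂ (SmoothFun d)) (Ψ : Cochain (SmoothFun d) n) :
    cyc (intF (cup T Ψ)) = (-1 : ℂ) ^ n • intF (cupRight T Ψ) := by
  funext f
  rw [cyc_apply, Pi.smul_apply, smul_eq_mul, intF_apply, intF_apply, cup_apply, cupRight_apply,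
    mul_comm (T _)]
  rfl

lemma cyc_intF_preI (X : Fam (SmoothFun d) d) (n : ℕ) (γ : PV (SmoothFun d) d) :
    cyc (intF (preI X (n + 1) γ)) = (-1 : ℂ) ^ n • intF (postI X (n + 1) γ) :=
  cyc_intF_cup _ _

lemma cyc_intF_preT (X : Fam (SmoothFun d) d) (n : ℕ) (γ : PV (SmoothFun d) d) :
    cyc (intF (preT smoothDeriv X (n + 1) γ)) = intF (postT smoothDeriv X (n + 1) γ) := by
  rw [preT_succ, postT_succ, map_sum, map_sum, map_smul, map_sum, Finset.smul_sum]
  exact Finset.sum_congr rfl fun c _ => cyc_intF_cup _ _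

lemma cyc_cyc_intF_preI_preI (X : Fam (SmoothFun d) d) (n : ℕ) (γ : PV (SmoothFun d) d) :
    cyc (cyc (intF (preI (preI X) (n + 1) γ))) = intF (postI (postI X) (n + 1) γ) := by
  cases n with
  | zero => rw [preI_succ, postI_succ]; simp [preI, postI]
  | succ n =>
    rw [cyc_intF_preI, ← preI_postI, map_smul, cyc_intF_preI, smul_smul, ← mul_pow]
    simp

/-- Under the integral, one rotation carries a differentiated first argument to the end, and two
rotations carry a leading pair there; N does not see rotations. -/
lemma cycNorm_intF_pre (X : Fam (SmoothFun d) d) (n : ℕ) (γ : PV (SmoothFun d) d) :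
    cycNorm (intF (pre smoothDeriv X (n + 1) γ)) =
      cycNorm (intF (post smoothDeriv X (n + 1) γ)) := by
  change cycNorm (intF (preT smoothDeriv X (n + 1) γ + preI (preI X) (n + 1) γ)) =
    cycNorm (intF (postT smoothDeriv X (n + 1) γ + postI (postI X) (n + 1) γ))
  rw [← cycNorm_cyc, ← cycNorm_cyc, map_add, map_add, map_add, map_add, cyc_cyc_intF_preI_preI,
    map_add, ← cyc_intF_preT, map_add]
  congr 1
  simp only [cycNorm_cyc]

/-- Symbols before the marked pair are moved to the end one at a time, until the pair stands first.
-/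
lemma cycNorm_intF_markedWords (i j n : ℕ) (γ : PV (SmoothFun d) d) :
    cycNorm (intF (markedWords smoothDeriv i j (n + 1) γ)) =
      cycNorm (intF (preI (preI (words smoothDeriv (i + j))) (n + 1) γ)) := by
  induction i generalizing j with
  | zero => rw [zero_add]; rfl
  | succ i ih =>
    rw [markedWords_succ_left, cycNorm_intF_pre, ← markedWords_succ_right, ih,
      show i + 1 + j = i + (j + 1) by ring]

/-- The count of `sum_markedWords` in n + 1 arguments: all L + 1 positions of the mark give the same
norm, and each word is counted n − L times. -/
lemma cycNorm_intF_words (L n : ℕ) (γ : PV (SmoothFun d) d) :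
    ((n : ℂ) - L) • cycNorm (intF (words smoothDeriv (L + 1) (n + 1) γ)) =
      ((L : ℂ) + 1) • cycNorm (intF (preI (preI (words smoothDeriv L)) (n + 1) γ)) := by
  have h := LinearMap.congr_fun (sum_markedWords (D := smoothDeriv (d := d)) L (n + 1)) γ
  rw [LinearMap.sum_apply, LinearMap.smul_apply] at h
  have h2 := congrArg (fun Ψ => cycNorm (intF Ψ)) h
  simp only [map_sum, map_smul] at h2
  have h3 : ∀ i ∈ Finset.range (L + 1),
      cycNorm (intF (markedWords smoothDeriv i (L - i) (n + 1) γ)) =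
        cycNorm (intF (preI (preI (words smoothDeriv L)) (n + 1) γ)) := by
    intro i hi
    rw [Finset.mem_range] at hi
    rw [cycNorm_intF_markedWords, Nat.add_sub_of_le (by omega)]
  rw [Finset.sum_congr rfl h3, Finset.sum_const, Finset.card_range, ← Nat.cast_smul_eq_nsmul ℂ] at h2
  push_cast at h2
  rw [h2]
  congr 1
  ring

/-- The functional of `words`. -/
def wordsF (L n : ℕ) : PV (SmoothFun d) d →ₗ[ℂ] Functional d n :=
  toFunctional ∘ₗ words smoothDeriv L n

lemma wordsF_eq (L n : ℕ) (γ : PV (SmoothFun d) d) :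
    wordsF L n γ = intF (preI (words smoothDeriv L) (n + 1) γ) := rfl

lemma words_mem_testAlg (L n : ℕ) (γ : PV (SmoothFun d) d) (f : Fin (n + 1) → Test d) :
    words smoothDeriv L (n + 1) γ (fun i => (f i).1) ∈ testAlg d := by
  cases L with
  | zero => exact zero_mem _
  | succ L =>
    rw [words_succ]
    change preT _ _ (n + 1) γ _ + preI (preI _) (n + 1) γ _ ∈ testAlg d
    refine add_mem ?_ ?_
    · rw [preT_succ, Finset.sum_apply]
      refine sum_mem fun c _ => ?_
      rw [cup_apply, mul_comm]
      exact mul_mem_testAlg _ (smoothDeriv_mem_testAlg c (f 0).2)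
    · rw [preI_succ, cup_apply, mul_comm]
      exact mul_mem_testAlg _ (f 0).2

lemma preI_mem_testAlg (X : Fam (SmoothFun d) d) (n : ℕ) (γ : PV (SmoothFun d) d)
    (f : Fin (n + 1) → Test d) : preI X (n + 1) γ (fun i => (f i).1) ∈ testAlg d := by
  rw [preI_succ, cup_apply, mul_comm]
  exact mul_mem_testAlg _ (f 0).2

lemma intF_nabla_eq_zero {X : Fam (SmoothFun d) d} {n : ℕ}
    (hX : ∀ γ (f : Fin (n + 1) → Test d), X (n + 1) γ (fun i => (f i).1) ∈ testAlg d)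
    (γ : PV (SmoothFun d) d) : intF (nabla smoothDeriv X (n + 1) γ) = 0 := by
  funext f
  rw [intF_apply, nabla_apply, map_sum]
  exact Finset.sum_eq_zero fun b _ => integral_smoothDeriv b (hX _ f)

/-- The functional of the divergence of a polyvector. -/
lemma wordsF_divg (L n : ℕ) (γ : PV (SmoothFun d) d) :
    wordsF L n (divg smoothDeriv γ) = -intF (words smoothDeriv (L + 1) (n + 1) γ) -
      cyc (intF (preI (preI (words smoothDeriv L)) (n + 1) γ)) := by
  -- The integral of a divergence vanishes; expanding it for the integrand f_0 · words(f_1, …) gives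
  -- the formula.
  have h := intF_nabla_eq_zero (preI_mem_testAlg (words smoothDeriv L) n) γ
  rw [nabla_preI (isDiffRing_smooth d), nabla_words (isDiffRing_smooth d), preI_add, preI_add,
    preI_compDivg, preI_altSign, preI_postI] at h
  change intF (preT smoothDeriv _ (n + 1) γ + (preI _ (n + 1) (divg smoothDeriv γ) +
    -((-1 : ℂ) ^ (n + 1) • postI (preI _) (n + 1) γ) + preI (preI _) (n + 1) γ)) = 0 at h
  rw [words_succ, cyc_intF_preI, wordsF_eq]
  change _ = -intF (preT smoothDeriv _ (n + 1) γ + preI (preI _) (n + 1) γ) - _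
  simp only [map_add, map_neg, map_smul] at h ⊢
  rw [← sub_eq_zero, ← h]
  module

lemma hochDiff_wordsF (L n : ℕ) (γ : PV (SmoothFun d) d) : hochDiff (wordsF L n γ) = 0 := by
  rw [wordsF, LinearMap.comp_apply, ← toFunctional_dHoch, dHoch_words (isDiffRing_smooth d), map_zero]

/-- Since b kills the functional, b' is minus the last face, which is the rotation of `face 0`; and
`face 0` replaces f_0 by f_0 f_1, that is, it puts a pair in front. -/
lemma barDiff_wordsF (L n : ℕ) (γ : PV (SmoothFun d) d) :
    barDiff (wordsF L n γ) = -cyc (intF (preI (preI (words smoothDeriv L)) (n + 2) γ)) := by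
  have h := hochDiff_wordsF L n γ
  rw [hochDiff_apply, lastFace_eq, ← eq_neg_iff_add_eq_zero] at h
  rw [h]
  congr 2
  funext f
  rw [face_apply, pow_zero, one_mul]
  change integral d ((mergeTest 0 f 0).1 * _) = integral d ((f 0).1 * ((f 1).1 * _))
  have : (mergeTest 0 f 0).1 = (f 0).1 * (f 1).1 := by simp [mergeTest]
  rw [this, mul_assoc]
  congr 3

/-- The normalized cyclic words give a map of complexes. -/
lemma hochDiff_cycNorm_wordsF (L n : ℕ) (γ : PV (SmoothFun d) d) :
    ((n : ℂ) + 2) • hochDiff (cycNorm (wordsF L n γ)) =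
      ((n : ℂ) + 1 - L) • cycNorm (wordsF L (n + 1) (divg smoothDeriv γ)) := by
  -- Let A be the norm of the words with L + 1 symbols and P that of a pair followed by L symbols.
  -- The left norm equals −P and the right one −A − P, while (n + 1 − L) A = (L + 1) P; the factors
  -- n + 2 and n + 1 − L follow.
  have h := cycNorm_intF_words L (n + 1) γ
  rw [hochDiff_cycNorm, barDiff_wordsF, wordsF_divg, map_sub, map_neg, map_neg, cycNorm_cyc, smul_sub,
    smul_neg, smul_neg]
  push_cast at h
  rw [h]
  module

/-- `wordsF n n` is cyclic up to lower order. -/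
lemma cyc_wordsF_self (n : ℕ) (γ : PV (SmoothFun d) d) : cyc (wordsF n n γ) =
    wordsF n n γ + intF (words smoothDeriv n (n + 1) (divg smoothDeriv γ)) := by
  have h := intF_nabla_eq_zero (words_mem_testAlg n n) γ
  rw [nabla_words (isDiffRing_smooth d)] at h
  change intF (words _ n (n + 1) (divg smoothDeriv γ) + ((-1 : ℂ) ^ (n + 1) • postI _ (n + 1) γ) +
    preI _ (n + 1) γ) = 0 at h
  rw [wordsF_eq, cyc_intF_preI]
  simp only [map_add, map_smul] at h
  rw [← sub_eq_zero, ← neg_eq_zero, ← h]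
  module

/-- The field ∂_c is inserted into an alternating word symbol by symbol. Each step splits off the
term where the first argument is differentiated along c, and rotates the remaining symbol to the
end; by antisymmetry the n + 1 terms agree. -/
lemma cycNorm_intF_postT_iterate (c : Fin d) (m n i : ℕ) (γ : PV (SmoothFun d) d) :
    cycNorm (intF ((postT smoothDeriv)^[i] (compWedge c (altWords smoothDeriv (n + 1))) (m + 1) γ)) =
      ((-1 : ℤ) ^ i * (n + 1)) •
        cycNorm (intF (preD smoothDeriv c (altWords smoothDeriv (n + i)) (m + 1) γ)) := by
  have step : ∀ n i, cycNorm (intF ((postT smoothDeriv)^[i]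
      (compWedge c (altWords smoothDeriv (n + 1))) (m + 1) γ)) =
      (-1 : ℤ) ^ i • cycNorm (intF (preD smoothDeriv c (altWords smoothDeriv (n + i)) (m + 1) γ)) -
      cycNorm (intF ((postT smoothDeriv)^[i + 1]
        (compWedge c (altWords smoothDeriv n)) (m + 1) γ)) := by
    intro n i
    rw [altWords_succ, compWedge_preT, postT_iterate_sub, postT_iterate_preT, postT_iterate_preD]
    change cycNorm (intF (((-1 : ℤ) ^ i • preD smoothDeriv c (altWords smoothDeriv (n + i)) (m + 1)) γ
      - preT smoothDeriv _ (m + 1) γ)) = _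
    rw [map_sub, map_sub, Function.iterate_succ_apply', ← cyc_intF_preT, cycNorm_cyc,
      LinearMap.smul_apply, map_zsmul, map_zsmul]
  induction n generalizing i with
  -- Exterior multiplication leaves nothing of degree zero, so the insertion into the empty word
  -- vanishes and stays zero after appending symbols.
  | zero =>
    rw [step, compWedge_altWords_zero]
    have : ∀ i : ℕ, (postT (smoothDeriv (d := d)))^[i] 0 = 0 := by
      intro i
      induction i with
      | zero => rfl
      | succ i ih =>
        rw [Function.iterate_succ_apply', ih]
        have := postT_sub (D := smoothDeriv (d := d)) 0 0
        rwa [sub_self, sub_self] at this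
    rw [this]
    simp
  | succ n ih =>
    rw [step, ih, show n + (i + 1) = n + 1 + i by ring, ← sub_smul]
    congr 1
    push_cast
    ring

lemma cyc_intF_altWords (n m : ℕ) (γ : PV (SmoothFun d) d) :
    cyc (intF (altWords smoothDeriv (n + 1) (m + 1) γ)) =
      intF (altWords smoothDeriv (n + 1) (m + 1) γ) := by
  conv_lhs => rw [altWords_succ, cyc_intF_preT, ← altWords_succ_eq_postT]

/-- Differentiating f_0 along c and taking the norm produces the full alternating word of ∂_c ∧ γ in
n + 1 arguments. By `wordsF_divg`, which has no pair term here, its integral is minus the functional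
of the divergence. -/
lemma cycNorm_plug_wordsF_self (c : Fin d) (n : ℕ) (γ : PV (SmoothFun d) d) :
    cycNorm (plug (Test.D c) 0 (wordsF n n γ)) = -wordsF n n (divg smoothDeriv (wedge c γ)) := by
  have h1 : plug (Test.D c) 0 (wordsF n n γ) =
      intF (preD smoothDeriv c (altWords smoothDeriv n) (n + 1) γ) := by
    rw [preD_succ, ← words_self]
    rfl
  have h2 := cycNorm_intF_postT_iterate c n n 0 γ
  have h3 : cycNorm (intF (compWedge c (altWords smoothDeriv (n + 1)) (n + 1) γ)) =
      ((n : ℂ) + 1) • intF (words smoothDeriv (n + 1) (n + 1) (wedge c γ)) := by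
    rw [words_self]
    exact cycNorm_of_cyclic (cyc_intF_altWords n n (wedge c γ))
  have h4 : preI (preI (words (smoothDeriv (d := d)) n)) (n + 1) = 0 := by
    cases n with
    | zero => refine LinearMap.ext fun γ => ?_; rw [preI_succ]; simp [preI]
    | succ n =>
      refine LinearMap.ext fun γ => ?_
      rw [preI_succ, preI_succ, words_eq_zero (by omega)]
      simp
  rw [h1, wordsF_divg, h4]
  simp only [Function.iterate_zero, id_eq, add_zero] at h2
  rw [h3, pow_zero, one_mul, ← Int.cast_smul_eq_zsmul ℂ] at h2
  push_cast at h2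
  have hn : ((n : ℂ) + 1) ≠ 0 := by exact_mod_cast Nat.succ_ne_zero n
  rw [smul_right_inj hn] at h2
  rw [← h2]
  simp

end
end CyclicHKR

/-! ### Lie derivatives of word functionals, and polynomial polyvectors. -/

namespace CyclicHKR
noncomputable section
open scoped TensorProduct ContDiff

variable {d : ℕ}

/-- Invariance of words under ∂_c; the derivative of the total integrand integrates to zero, so only
the action on the coefficients remains, with a minus sign. -/
lemma lieD_wordsF (c : Fin d) (L n : ℕ) (γ : PV (SmoothFun d) d) :
    lieD c (wordsF L n γ) = -wordsF L n (onCoeff (smoothDeriv c) γ) := by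
  have h := IsInvariant.preI (smoothDeriv_mul c) (isInvariant_words (D := smoothDeriv (d := d))
    (T := smoothDeriv c) (S := onCoeff (smoothDeriv c)) (τ := 0) (smoothDeriv_mul c)
    (fun b f => by simp [smoothDeriv_comm b c]) (fun b γ => by simp [onCoeff_contr])
    (fun γ => augment_onCoeff _ _) L)
  funext f
  have e : ∀ i, (fun k => (Function.update f i (Test.D c (f i)) k).1) =
      Function.update (fun k => (f k).1) i (smoothDeriv c (f i).1) := by
    intro i
    funext k
    rcases eq_or_ne k i with rfl | hk
    · simp [Test.D]
    · simp [hk]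
  simp only [totalAction_apply, wordsF_eq, intF_apply, e]
  rw [← map_sum, h (n + 1) γ fun k => (f k).1, map_sub,
    integral_smoothDeriv c (preI_mem_testAlg _ n γ f), zero_sub]
  rfl

/-- Invariance under the Euler field, which acts on polyvectors by x_c ∂_c on coefficients minus the
number of factors ∂_c. The summand −γ appears because the integral of x_c ∂_c g is minus the
integral of g. -/
lemma lieE_wordsF (c : Fin d) (L n : ℕ) (γ : PV (SmoothFun d) d) :
    lieE c (wordsF L n γ) = wordsF L n (wedge c (contr c γ) - γ - onCoeff
      (LinearMap.mulLeft ℂ (polyToSmooth d (MvPolynomial.X c)) ∘ₗ smoothDeriv c) γ) := by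
  set T : Module.End ℂ (SmoothFun d) :=
    LinearMap.mulLeft ℂ (polyToSmooth d (MvPolynomial.X c)) ∘ₗ smoothDeriv c with hTdef
  have hTapp : ∀ f, T f = polyToSmooth d (MvPolynomial.X c) * smoothDeriv c f := fun _ => rfl
  have hT : ∀ f g, T (f * g) = T f * g + f * T g := by
    intro f g
    simp only [hTapp, smoothDeriv_mul]
    ring
  have hD : ∀ b f, smoothDeriv b (T f) = T (smoothDeriv b f) +
      (if b = c then (1 : ℂ) else 0) • smoothDeriv b f := by
    intro b f
    rw [hTapp, hTapp, smoothDeriv_mul, (isDiffRing_smooth d).coord, smoothDeriv_comm b c,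
      MvPolynomial.pderiv_X]
    split_ifs with hb
    · subst hb; simp; ring
    · simp [Pi.single_eq_of_ne (Ne.symm hb)]
  have h := IsInvariant.preI hT (isInvariant_words (D := smoothDeriv (d := d))
    (T := T) (S := onCoeff T - wedge c ∘ₗ contr c) (τ := fun b => if b = c then 1 else 0) hT hD
    (fun b γ => by
      rw [LinearMap.sub_apply, LinearMap.sub_apply, LinearMap.comp_apply, LinearMap.comp_apply,
        map_sub, onCoeff_contr, contr_wedge, contr_contr c b, map_neg]
      split_ifs with hb
      · subst hb; simp; abel
      · simp)
    (fun γ => by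
      rw [LinearMap.sub_apply, LinearMap.comp_apply, map_sub, augment_wedge, augment_onCoeff,
        sub_zero]) L)
  funext f
  have e : ∀ i, (fun k => (Function.update f i (Test.X c (Test.D c (f i))) k).1) =
      Function.update (fun k => (f k).1) i (T (f i).1) := by
    intro i
    funext k
    rcases eq_or_ne k i with rfl | hk
    · simp [Test.D, Test.X, hTapp]
    · simp [hk]
  have hint : ∀ g ∈ testAlg d, integral d (T g) = -integral d g := by
    intro g hg
    have := integral_smoothDeriv c (mul_mem_testAlg (polyToSmooth d (MvPolynomial.X c)) hg)
    rw [smoothDeriv_mul, (isDiffRing_smooth d).coord, MvPolynomial.pderiv_X_self, map_one, one_mul,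
      map_add, add_comm] at this
    exact eq_neg_of_add_eq_zero_left this
  simp only [totalAction_apply, wordsF_eq, intF_apply, e]
  rw [← map_sum, h (n + 1) γ fun k => (f k).1, map_sub, hint _ (preI_mem_testAlg _ n γ f)]
  rw [LinearMap.sub_apply, LinearMap.comp_apply, map_sub, map_sub, map_sub]
  change -integral d (preI _ _ _ _) - integral d (preI _ _ _ _ - preI _ _ _ _) =
    integral d (preI _ _ _ _ - preI _ _ _ _ - preI _ _ _ _)
  rw [map_sub, map_sub, map_sub]
  ring

lemma words_onCoeff_mul {B : Type} [CommRing B] [Algebra ℂ B] (D : Fin d → Module.End ℂ B) (a : B)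
    (L n : ℕ) (γ : PV B d) (f : Fin n → B) :
    words D L n (onCoeff (LinearMap.mulLeft ℂ a) γ) f = a * words D L n γ f := by
  induction L generalizing n γ with
  | zero =>
    cases n with
    | zero => rw [words_zero, unitFam_zero, unitFam_zero, augment_onCoeff]; rfl
    | succ n => rw [words_zero, unitFam_succ, unitFam_succ]; simp
  | succ L ih =>
    rw [words_succ]
    change preT D _ n _ f + preI (preI _) n _ f = a * (preT D _ n _ f + preI (preI _) n _ f)
    rw [mul_add]
    congr 1
    · cases n with
      | zero => simp [preT]
      | succ n =>
        rw [preT_succ, preT_succ, Finset.sum_apply, Finset.sum_apply, Finset.mul_sum]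
        refine Finset.sum_congr rfl fun c _ => ?_
        rw [cup_apply, cup_apply, ← onCoeff_contr, ih]
        ring
    · match n with
      | 0 => simp [preI]
      | 1 => rw [preI_succ]; simp [preI]
      | n + 2 =>
        simp only [preI_succ, cup_apply, ih]
        ring

/-! ### Polynomial polyvectors -/

/-- The partial derivatives of polynomials. -/
abbrev pd (c : Fin d) : Module.End ℂ (Poly d) := (MvPolynomial.pderiv c).toLinearMap

/-- Multiplication of polynomials by a coordinate. -/
abbrev mulX (c : Fin d) : Module.End ℂ (Poly d) := LinearMap.mulLeft ℂ (MvPolynomial.X c)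

/-- The functional of `words` for a polynomial polyvector. -/
def polyF (L n : ℕ) : PV (Poly d) d →ₗ[ℂ] Functional d n :=
  wordsF L n ∘ₗ onCoeff (polyToSmooth d).toLinearMap

lemma polyF_apply (L n : ℕ) (γ : PV (Poly d) d) :
    polyF L n γ = wordsF L n (onCoeff (polyToSmooth d).toLinearMap γ) := rfl

lemma onCoeff_onCoeff {B₁ B₂ B₃ : Type} [CommRing B₁] [Algebra ℂ B₁] [CommRing B₂] [Algebra ℂ B₂]
    [CommRing B₃] [Algebra ℂ B₃] (S : B₂ →ₗ[ℂ] B₃) (T : B₁ →ₗ[ℂ] B₂) (γ : PV B₁ d) :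
    onCoeff S (onCoeff T γ) = onCoeff (S ∘ₗ T) γ := by
  rw [onCoeff, onCoeff, onCoeff, LinearMap.rTensor_comp]; rfl

lemma smoothDeriv_comp_polyToSmooth (c : Fin d) :
    smoothDeriv c ∘ₗ (polyToSmooth d).toLinearMap = (polyToSmooth d).toLinearMap ∘ₗ pd c :=
  LinearMap.ext fun p => (isDiffRing_smooth d).coord c p

lemma onCoeff_divg (γ : PV (Poly d) d) : onCoeff (polyToSmooth d).toLinearMap (divg pd γ) =
    divg smoothDeriv (onCoeff (polyToSmooth d).toLinearMap γ) := by
  rw [divg_apply, divg_apply, map_sum]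
  refine Finset.sum_congr rfl fun c _ => ?_
  rw [onCoeff_onCoeff, ← onCoeff_contr, onCoeff_onCoeff, smoothDeriv_comp_polyToSmooth]

lemma hochDiff_cycNorm_polyF (L n : ℕ) (γ : PV (Poly d) d) :
    ((n : ℂ) + 2) • hochDiff (cycNorm (polyF L n γ)) =
      ((n : ℂ) + 1 - L) • cycNorm (polyF L (n + 1) (divg pd γ)) := by
  rw [polyF_apply, polyF_apply, onCoeff_divg, hochDiff_cycNorm_wordsF]

lemma cycNorm_plug_polyF_self (c : Fin d) (n : ℕ) (γ : PV (Poly d) d) :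
    cycNorm (plug (Test.D c) 0 (polyF n n γ)) = -polyF n n (divg pd (wedge c γ)) := by
  rw [polyF_apply, polyF_apply, onCoeff_divg, onCoeff_wedge, cycNorm_plug_wordsF_self]

lemma lieD_polyF (c : Fin d) (L n : ℕ) (γ : PV (Poly d) d) :
    lieD c (polyF L n γ) = -polyF L n (onCoeff (pd c) γ) := by
  rw [polyF_apply, polyF_apply, lieD_wordsF, onCoeff_onCoeff, onCoeff_onCoeff,
    smoothDeriv_comp_polyToSmooth]

/-- The operator on polyvectors that corresponds to `lieE`. -/
def eulerPV (c : Fin d) : Module.End ℂ (PV (Poly d) d) :=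
  wedge c ∘ₗ contr c - 1 - onCoeff (mulX c ∘ₗ pd c)

lemma eulerPV_apply (c : Fin d) (γ : PV (Poly d) d) :
    eulerPV c γ = wedge c (contr c γ) - γ - onCoeff (mulX c ∘ₗ pd c) γ := rfl

lemma lieE_polyF (c : Fin d) (L n : ℕ) (γ : PV (Poly d) d) :
    lieE c (polyF L n γ) = polyF L n (eulerPV c γ) := by
  rw [polyF_apply, polyF_apply, lieE_wordsF]
  congr 1
  rw [eulerPV_apply, map_sub, map_sub, onCoeff_wedge, onCoeff_contr, onCoeff_onCoeff,
    onCoeff_onCoeff]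
  congr 3
  refine LinearMap.ext fun p => ?_
  change _ * smoothDeriv c (polyToSmooth d p) = polyToSmooth d (_ * MvPolynomial.pderiv c p)
  rw [(isDiffRing_smooth d).coord, map_mul]

lemma plug_X_polyF (c : Fin d) (L n : ℕ) (γ : PV (Poly d) d) :
    plug (Test.X c) 0 (polyF L n γ) = polyF L n (onCoeff (mulX c) γ) := by
  rw [polyF_apply, polyF_apply, wordsF, LinearMap.comp_apply, LinearMap.comp_apply,
    ← toFunctional_X_mul, onCoeff_onCoeff]
  have : (polyToSmooth d).toLinearMap ∘ₗ mulX c =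
      LinearMap.mulLeft ℂ (polyToSmooth d (MvPolynomial.X c)) ∘ₗ (polyToSmooth d).toLinearMap := by
    refine LinearMap.ext fun p => ?_
    exact map_mul (polyToSmooth d) _ _
  rw [this, ← onCoeff_onCoeff]
  congr 1
  funext f
  rw [words_onCoeff_mul]

/-- `x^α ∂_{w_1} ∧ … ∧ ∂_{w_ℓ}`. -/
def polyvec (α : Fin d →₀ ℕ) (w : List (Fin d)) : PV (Poly d) d :=
  w.foldr (fun c γ => wedge c γ) (MvPolynomial.monomial α 1 ⊗ₜ 1)

lemma polyvec_nil (α : Fin d →₀ ℕ) : polyvec α [] = MvPolynomial.monomial α 1 ⊗ₜ 1 := rfl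

lemma polyvec_cons (α : Fin d →₀ ℕ) (c : Fin d) (w : List (Fin d)) :
    polyvec α (c :: w) = wedge c (polyvec α w) := rfl

/-- Polyvectors of degree `ℓ` in the variables in `s`. -/
def polyvecs (s : Finset (Fin d)) (ℓ : ℕ) : Submodule ℂ (PV (Poly d) d) :=
  Submodule.span ℂ {γ | ∃ α w, α.support ⊆ s ∧ (∀ c ∈ w, c ∈ s) ∧ w.length = ℓ ∧ γ = polyvec α w}

lemma polyvec_mem {s : Finset (Fin d)} {α : Fin d →₀ ℕ} {w : List (Fin d)} (hα : α.support ⊆ s)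
    (hw : ∀ c ∈ w, c ∈ s) : polyvec α w ∈ polyvecs s w.length :=
  Submodule.subset_span ⟨α, w, hα, hw, rfl, rfl⟩

lemma polyvecs_mapsTo {s : Finset (Fin d)} {ℓ : ℕ} {X : Type*} [AddCommGroup X] [Module ℂ X]
    (T : PV (Poly d) d →ₗ[ℂ] X) (N : Submodule ℂ X)
    (h : ∀ α w, α.support ⊆ s → (∀ c ∈ w, c ∈ s) → w.length = ℓ → T (polyvec α w) ∈ N)
    {γ : PV (Poly d) d} (hγ : γ ∈ polyvecs s ℓ) : T γ ∈ N := by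
  have : polyvecs s ℓ ≤ N.comap T := by
    rw [polyvecs, Submodule.span_le]
    rintro _ ⟨α, w, hα, hw, hℓ, rfl⟩
    exact h α w hα hw hℓ
  exact this hγ

lemma polyvecs_mono {s t : Finset (Fin d)} (h : s ⊆ t) (ℓ : ℕ) : polyvecs s ℓ ≤ polyvecs t ℓ := by
  intro γ hγ
  refine polyvecs_mapsTo LinearMap.id _ (fun α w hα hw hℓ => ?_) hγ
  rw [← hℓ]
  exact polyvec_mem (hα.trans h) fun c hc => h (hw c hc)

lemma wedge_mem {s : Finset (Fin d)} {ℓ : ℕ} {c : Fin d} (hc : c ∈ s) {γ : PV (Poly d) d}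
    (hγ : γ ∈ polyvecs s ℓ) : wedge c γ ∈ polyvecs s (ℓ + 1) := by
  refine polyvecs_mapsTo _ _ (fun α w hα hw hℓ => ?_) hγ
  have h := polyvec_mem (w := c :: w) hα (List.forall_mem_cons.mpr ⟨hc, hw⟩)
  rw [List.length_cons, hℓ] at h
  exact h

lemma contr_polyvec_nil (c : Fin d) (α : Fin d →₀ ℕ) : contr c (polyvec α []) = 0 := by
  rw [polyvec_nil, contr_tmul]
  simp

lemma contr_polyvec_of_notMem {c : Fin d} {w : List (Fin d)} (h : c ∉ w) (α : Fin d →₀ ℕ) :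
    contr c (polyvec α w) = 0 := by
  induction w with
  | nil => exact contr_polyvec_nil c α
  | cons b w ih =>
    rw [List.mem_cons, not_or] at h
    rw [polyvec_cons, contr_wedge, if_neg h.1, ih h.2, map_zero, sub_zero]

lemma contr_eq_zero {s : Finset (Fin d)} {ℓ : ℕ} {c : Fin d} (hc : c ∉ s) {γ : PV (Poly d) d}
    (hγ : γ ∈ polyvecs s ℓ) : contr c γ = 0 := by
  rw [← Submodule.mem_bot ℂ]
  refine polyvecs_mapsTo _ _ (fun α w hα hw hℓ => ?_) hγ
  rw [contr_polyvec_of_notMem fun h => hc (hw c h)]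
  exact zero_mem _

lemma contr_eq_zero_of_degree_zero {s : Finset (Fin d)} (c : Fin d) {γ : PV (Poly d) d}
    (hγ : γ ∈ polyvecs s 0) : contr c γ = 0 := by
  rw [← Submodule.mem_bot ℂ]
  refine polyvecs_mapsTo _ _ (fun α w hα hw hℓ => ?_) hγ
  rw [List.eq_nil_of_length_eq_zero hℓ, contr_polyvec_nil]
  exact zero_mem _

lemma contr_mem {s : Finset (Fin d)} {ℓ : ℕ} (c : Fin d) {γ : PV (Poly d) d}
    (hγ : γ ∈ polyvecs s ℓ) : contr c γ ∈ polyvecs s (ℓ - 1) := by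
  refine polyvecs_mapsTo _ _ (fun α w hα hw hℓ => ?_) hγ
  subst hℓ
  clear hγ
  induction w with
  | nil => rw [contr_polyvec_nil]; exact zero_mem _
  | cons b w ih =>
    rw [List.forall_mem_cons] at hw
    rw [polyvec_cons, contr_wedge]
    have h1 : polyvec α w ∈ polyvecs s ((b :: w).length - 1) := polyvec_mem hα hw.2
    refine sub_mem ?_ ?_
    · split_ifs
      · exact h1
      · exact zero_mem _
    · cases w with
      | nil => rw [contr_polyvec_nil, map_zero]; exact zero_mem _
      | cons b' w => exact wedge_mem hw.1 (ih hw.2)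

lemma onCoeff_polyvec (T : Module.End ℂ (Poly d)) (α : Fin d →₀ ℕ) (w : List (Fin d)) :
    onCoeff T (polyvec α w) =
      w.foldr (fun c γ => wedge c γ) (T (MvPolynomial.monomial α 1) ⊗ₜ 1) := by
  induction w with
  | nil => rfl
  | cons b w ih => rw [polyvec_cons, onCoeff_wedge, ih]; rfl

lemma foldr_wedge_smul (a : ℂ) (γ : PV (Poly d) d) (w : List (Fin d)) :
    w.foldr (fun c γ => wedge c γ) (a • γ) = a • w.foldr (fun c γ => wedge c γ) γ := by
  induction w with
  | nil => rfl
  | cons b w ih => rw [List.foldr_cons, List.foldr_cons, ih, map_smul]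

lemma onCoeff_pd_polyvec (c : Fin d) (α : Fin d →₀ ℕ) (w : List (Fin d)) :
    onCoeff (pd c) (polyvec α w) = (α c : ℂ) • polyvec (α - Finsupp.single c 1) w := by
  rw [onCoeff_polyvec]
  change w.foldr _ ((MvPolynomial.pderiv c (MvPolynomial.monomial α (1 : ℂ))) ⊗ₜ 1) = _
  rw [pderiv_monomial_one, ← TensorProduct.smul_tmul', foldr_wedge_smul]
  rfl

lemma onCoeff_mulX_polyvec (c : Fin d) (α : Fin d →₀ ℕ) (w : List (Fin d)) :
    onCoeff (mulX c) (polyvec α w) = polyvec (α + Finsupp.single c 1) w := by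
  rw [onCoeff_polyvec, LinearMap.mulLeft_apply, X_mul_monomial]
  rfl

lemma support_add_single {c : Fin d} {α : Fin d →₀ ℕ} {s : Finset (Fin d)} (hc : c ∈ s)
    (h : α.support ⊆ s) : (α + Finsupp.single c 1).support ⊆ s := by
  classical
  exact subset_trans Finsupp.support_add (Finset.union_subset h
    (subset_trans Finsupp.support_single_subset (by simpa using hc)))

lemma onCoeff_pd_mem {s : Finset (Fin d)} {ℓ : ℕ} (c : Fin d) {γ : PV (Poly d) d}
    (hγ : γ ∈ polyvecs s ℓ) : onCoeff (pd c) γ ∈ polyvecs s ℓ := by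
  refine polyvecs_mapsTo _ _ (fun α w hα hw hℓ => ?_) hγ
  rw [onCoeff_pd_polyvec, ← hℓ]
  exact Submodule.smul_mem _ _ (polyvec_mem (support_sub_single c hα) hw)

lemma onCoeff_mulX_mem {s : Finset (Fin d)} {ℓ : ℕ} {c : Fin d} (hc : c ∈ s) {γ : PV (Poly d) d}
    (hγ : γ ∈ polyvecs s ℓ) : onCoeff (mulX c) γ ∈ polyvecs s ℓ := by
  refine polyvecs_mapsTo _ _ (fun α w hα hw hℓ => ?_) hγ
  rw [onCoeff_mulX_polyvec, ← hℓ]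
  exact polyvec_mem (support_add_single hc hα) hw

lemma divg_mem {s : Finset (Fin d)} {ℓ : ℕ} {γ : PV (Poly d) d}
    (hγ : γ ∈ polyvecs s ℓ) : divg pd γ ∈ polyvecs s (ℓ - 1) := by
  rw [divg_apply]
  exact sum_mem fun c _ => onCoeff_pd_mem c (contr_mem c hγ)

lemma divg_eq_zero_of_degree_zero {s : Finset (Fin d)} {γ : PV (Poly d) d}
    (hγ : γ ∈ polyvecs s 0) : divg pd γ = 0 := by
  rw [divg_apply]
  exact Finset.sum_eq_zero fun c _ => by rw [contr_eq_zero_of_degree_zero c hγ, map_zero]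

lemma wedge_wedge (b c : Fin d) (γ : PV (Poly d) d) :
    wedge b (wedge c γ) = -wedge c (wedge b γ) := by
  induction γ using TensorProduct.induction_on with
  | zero => simp
  | add x y hx hy => simp only [map_add, hx, hy]; abel
  | tmul a g =>
    simp only [wedge_tmul]
    rw [← TensorProduct.tmul_neg, ← mul_assoc, ← mul_assoc, ← neg_mul]
    congr 2
    rw [eq_neg_iff_add_eq_zero]
    exact ExteriorAlgebra.ι_add_mul_swap _ _

/-- The number operator of the letter c. A word that repeats c gives the polyvector 0, so the
statement is harmless there and no distinctness is assumed. -/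
lemma wedge_contr_polyvec (c : Fin d) (α : Fin d →₀ ℕ) (w : List (Fin d)) :
    wedge c (contr c (polyvec α w)) = (w.count c : ℂ) • polyvec α w := by
  induction w with
  | nil => rw [contr_polyvec_nil]; simp
  | cons b w ih =>
    rw [polyvec_cons, contr_wedge, map_sub, wedge_wedge c b, ih, map_smul, sub_neg_eq_add,
      List.count_cons]
    split_ifs with h1 h2 h2
    · subst h1; push_cast; module
    · exact absurd (by simpa using h1.symm) h2
    · exact absurd (beq_iff_eq.mp h2).symm h1
    · simp

lemma sum_wedge_contr {s : Finset (Fin d)} {ℓ : ℕ} {γ : PV (Poly d) d}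
    (hγ : γ ∈ polyvecs s ℓ) : ∑ c, wedge c (contr c γ) = (ℓ : ℂ) • γ := by
  have h : (∑ c, wedge c ∘ₗ contr c - (ℓ : ℂ) • LinearMap.id : Module.End ℂ (PV (Poly d) d)) γ ∈
      (⊥ : Submodule ℂ (PV (Poly d) d)) := by
    refine polyvecs_mapsTo _ _ (fun α w hα hw hℓ => ?_) hγ
    rw [Submodule.mem_bot, LinearMap.sub_apply, LinearMap.sum_apply, sub_eq_zero]
    simp only [LinearMap.comp_apply, wedge_contr_polyvec, ← Finset.sum_smul]
    have := Multiset.sum_count_eq_card (s := Finset.univ) (m := (w : Multiset (Fin d)))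
      (fun c _ => Finset.mem_univ c)
    rw [Multiset.coe_card, hℓ] at this
    rw [← this]
    push_cast
    simp
  rw [Submodule.mem_bot, LinearMap.sub_apply, sub_eq_zero, LinearMap.sum_apply] at h
  exact h

/-- The weight has the same shape as that of a word functional: occurrences of ∂_c minus the
exponent of x_c minus one. -/
lemma eulerPV_polyvec (c : Fin d) (α : Fin d →₀ ℕ) (w : List (Fin d)) :
    eulerPV c (polyvec α w) = ((w.count c : ℂ) - α c - 1) • polyvec α w := by
  rw [eulerPV_apply, wedge_contr_polyvec, ← onCoeff_onCoeff, onCoeff_pd_polyvec, map_smul,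
    onCoeff_mulX_polyvec]
  rcases Nat.eq_zero_or_pos (α c) with h | h
  · rw [h]; push_cast; module
  · rw [tsub_add_cancel_of_le (Finsupp.single_le_iff.mpr h)]
    module

/-- A Cartan formula: up to sign, the Euler operator is the anticommutator of the divergence with γ
↦ ∂_c ∧ x_c γ, by [∂_b, x_c] = δ_{bc} and the Clifford relation. Hence the Euler operator is
null-homotopic for the divergence. -/
lemma eulerPV_eq (c : Fin d) (γ : PV (Poly d) d) :
    eulerPV c γ = -(divg pd (wedge c (onCoeff (mulX c) γ)) +
      wedge c (onCoeff (mulX c) (divg pd γ))) := by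
  have h1 : ∀ b, onCoeff (pd b) (contr b (wedge c (onCoeff (mulX c) γ))) =
      (if b = c then onCoeff (pd c) (onCoeff (mulX c) γ) else 0) -
        wedge c (contr b (onCoeff (pd b) (onCoeff (mulX c) γ))) := by
    intro b
    rw [contr_wedge, map_sub, onCoeff_wedge, onCoeff_contr]
    split_ifs with h
    · rw [h]
    · rw [map_zero]
  have h2 : ∀ b, onCoeff (pd b) (onCoeff (mulX c) γ) =
      (if b = c then γ else 0) + onCoeff (mulX c) (onCoeff (pd b) γ) := by
    intro b
    rw [onCoeff_onCoeff, onCoeff_onCoeff]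
    have e : ∀ p : Poly d, pd b (mulX c p) = pd b (MvPolynomial.X c) * p + mulX c (pd b p) :=
      fun p => pderiv_mul_rule b (MvPolynomial.X c) p
    rcases eq_or_ne b c with rfl | h
    · have : pd b ∘ₗ mulX b = LinearMap.id + mulX b ∘ₗ pd b := by
        refine LinearMap.ext fun p => ?_
        rw [LinearMap.comp_apply, e, Derivation.coeFn_coe, MvPolynomial.pderiv_X_self, one_mul]
        rfl
      rw [this, if_pos rfl, onCoeff, LinearMap.rTensor_add, LinearMap.rTensor_id]
      rfl
    · have : pd b ∘ₗ mulX c = mulX c ∘ₗ pd b := by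
        refine LinearMap.ext fun p => ?_
        rw [LinearMap.comp_apply, e, Derivation.coeFn_coe, MvPolynomial.pderiv_X_of_ne h.symm,
          zero_mul, zero_add]
        rfl
      rw [this, if_neg h, zero_add]
  have h3 : ∀ b, wedge c (contr b (onCoeff (pd b) (onCoeff (mulX c) γ))) =
      (if b = c then wedge c (contr c γ) else 0) +
        wedge c (onCoeff (mulX c) (onCoeff (pd b) (contr b γ))) := by
    intro b
    rw [h2, map_add, map_add, ← onCoeff_contr, ← onCoeff_contr]
    split_ifs with h
    · rw [h]
    · rw [map_zero, map_zero]
  rw [divg_apply, Finset.sum_congr rfl fun b _ => h1 b, Finset.sum_sub_distrib,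
    Finset.sum_congr rfl fun b _ => h3 b, Finset.sum_add_distrib, divg_apply, map_sum, map_sum,
    Finset.sum_ite_eq' Finset.univ c, Finset.sum_ite_eq' Finset.univ c, h2, eulerPV_apply,
    ← onCoeff_onCoeff]
  simp only [Finset.mem_univ, if_true]
  abel

end
end CyclicHKR

/-! ### Words as polydifferential operators, and the sum over graphs as a sum over words. -/

namespace CyclicHKR
noncomputable section
open scoped TensorProduct ContDiff

variable {d : ℕ}

/-! ### Words are polydifferential operators -/

lemma cup_monomialOp {B : Type} [CommRing B] [Algebra ℂ B] (j : Poly d →ₐ[ℂ] B)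
    (D : Fin d → Module.End ℂ B) (v : List (Fin d)) (a : Poly d) {n : ℕ} (w : Fin n → List (Fin d)) :
    cup (wordDeriv D v) (monomialOp j D a w) =
      monomialOp j D a (Fin.cons v w : Fin (n + 1) → List (Fin d)) := by
  funext f
  rw [cup_apply]
  simp only [monomialOp, Fin.prod_univ_succ, Fin.cons_zero, Fin.cons_succ, Fin.tail]
  ring

/-- The cup product with an iterated derivative, for polynomials and for smooth functions. -/
def cupPair {n : ℕ} (v : List (Fin d)) : Cochain (Poly d) n × Cochain (SmoothFun d) n →ₗ[ℂ]
    Cochain (Poly d) (n + 1) × Cochain (SmoothFun d) (n + 1) :=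
  (cup (wordDeriv pd v)).prodMap (cup (wordDeriv smoothDeriv v))

lemma cupPair_mem {n : ℕ} {s : Finset (Fin d)} {M N : ℕ∞} {v : List (Fin d)} (hv : ∀ c ∈ v, c ∈ s)
    (hN : M + v.length ≤ N) {P : Cochain (Poly d) n × Cochain (SmoothFun d) n}
    (hP : P ∈ pairs s M n) : cupPair v P ∈ pairs s N (n + 1) := by
  refine pairs_mapsTo _ _ (fun α w hw => ?_) hP
  have : cupPair v (monomialPair (MvPolynomial.monomial α 1) w) = monomialPair
      (MvPolynomial.monomial α 1) (Fin.cons v w : Fin (n + 1) → List (Fin d)) :=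
    Prod.ext (cup_monomialOp _ _ _ _ _) (cup_monomialOp _ _ _ _ _)
  rw [this]
  refine monomialPair_mem_pairs ⟨hw.support, fun i => ?_, le_trans ?_ hN⟩
  · refine Fin.cases ?_ (fun k => ?_) i
    · simpa using hv
    · simpa using hw.letters k
  · rw [wordSize, Fin.sum_univ_succ]
    simp only [Fin.cons_zero, Fin.cons_succ]
    rw [add_comm]
    push_cast
    gcongr
    have := hw.size
    rw [wordSize] at this
    exact_mod_cast this

/-- Every symbol uses at most two arguments. -/
lemma words_eq_zero_of_lt {B : Type} [CommRing B] [Algebra ℂ B] {D : Fin d → Module.End ℂ B}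
    {L n : ℕ} (h : 2 * L < n) : words D L n = 0 := by
  induction L generalizing n with
  | zero =>
    obtain ⟨m, rfl⟩ : ∃ m, n = m + 1 := ⟨n - 1, by omega⟩
    rfl
  | succ L ih =>
    obtain ⟨m, rfl⟩ : ∃ m, n = m + 2 := ⟨n - 2, by omega⟩
    rw [words_succ]
    refine LinearMap.ext fun γ => ?_
    rw [pre, Pi.add_apply, LinearMap.add_apply, preT_succ, preI_succ, preI_succ, ih (by omega),
      ih (by omega)]
    simp

/-- With p differentiated arguments and q pairs one has L = p + q and n = p + 2q, so the order p
equals 2L − n. -/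
lemma words_pair_mem {s : Finset (Fin d)} (L n M ℓ : ℕ) (h : 2 * L ≤ n + M) {γ : PV (Poly d) d}
    (hγ : γ ∈ polyvecs s ℓ) : (words pd L n γ,
      words smoothDeriv L n (onCoeff (polyToSmooth d).toLinearMap γ)) ∈ pairs s M n := by
  induction L generalizing n M ℓ γ with
  | zero =>
    cases n with
    | zero =>
      let T : PV (Poly d) d →ₗ[ℂ] Cochain (Poly d) 0 × Cochain (SmoothFun d) 0 :=
        (words pd 0 0).prod (words smoothDeriv 0 0 ∘ₗ onCoeff (polyToSmooth d).toLinearMap)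
      change T γ ∈ _
      refine polyvecs_mapsTo T _ (fun α w hα hw hℓ => ?_) hγ
      cases w with
      | nil =>
        have : T (polyvec α []) = monomialPair (MvPolynomial.monomial α 1) ![] := by
          refine Prod.ext (funext fun f => ?_) (funext fun f => ?_)
          · change augment (polyvec α []) = _
            rw [polyvec_nil, augment_tmul]
            simp [monomialPair, monomialOp]
          · change augment (onCoeff _ (polyvec α [])) = _
            rw [augment_onCoeff, polyvec_nil, augment_tmul]
            simp [monomialPair, monomialOp]
        rw [this]
        exact monomialPair_mem_pairs ⟨hα, fun i => i.elim0, by simp [wordSize]⟩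
      | cons b w =>
        have : T (polyvec α (b :: w)) = 0 := by
          refine Prod.ext (funext fun f => ?_) (funext fun f => ?_)
          · exact augment_wedge b _
          · change augment (onCoeff _ (polyvec α (b :: w))) = _
            rw [augment_onCoeff, polyvec_cons, augment_wedge, map_zero]
            rfl
        rw [this]
        exact zero_mem _
    | succ n => exact zero_mem _
  | succ L ih =>
    rw [words_succ, words_succ]
    have key : ∀ X Y : Cochain (Poly d) n × Cochain (SmoothFun d) n, X ∈ pairs s M n →
        Y ∈ pairs s M n → (X.1 + Y.1, X.2 + Y.2) ∈ pairs s M n := fun X Y hX hY => add_mem hX hY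
    refine key (preT pd _ n γ, preT smoothDeriv _ n _) (preI (preI _) n γ, preI (preI _) n _) ?_ ?_
    · cases n with
      | zero => exact zero_mem _
      | succ n =>
        rw [preT_succ, preT_succ]
        have e : (∑ c, cup (pd c) (words pd L n (contr c γ)), ∑ c, cup (smoothDeriv c)
            (words smoothDeriv L n (contr c (onCoeff (polyToSmooth d).toLinearMap γ)))) =
            ∑ c, cupPair [c] (words pd L n (contr c γ), words smoothDeriv L n
              (onCoeff (polyToSmooth d).toLinearMap (contr c γ))) := by
          refine Prod.ext ?_ ?_
          · refine Eq.trans ?_ (Prod.fst_sum ..).symm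
            simp [cupPair, wordDeriv]
          · refine Eq.trans ?_ (Prod.snd_sum ..).symm
            simp [cupPair, wordDeriv, onCoeff_contr]
        rw [e]
        refine sum_mem fun c _ => ?_
        by_cases hc : c ∈ s
        · rcases Nat.eq_zero_or_pos M with rfl | hM
          -- With order bound zero there are too many arguments for the remaining L symbols.
          · rw [words_eq_zero_of_lt, words_eq_zero_of_lt]
            · exact (map_zero (cupPair (n := n) [c])).symm ▸ zero_mem _
            · omega
            · omega
          · refine cupPair_mem (M := (M - 1 : ℕ)) (by simpa using hc) ?_
              (ih n (M - 1) _ (by omega) (contr_mem c hγ))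
            norm_cast
            simp only [List.length_singleton]
            omega
        · rw [contr_eq_zero hc hγ]
          simp only [map_zero]
          exact (map_zero (cupPair (n := n) [c])).symm ▸ zero_mem _
    · match n with
      | 0 => exact zero_mem _
      | 1 =>
        have e : ∀ (B : Type) [CommRing B] [Algebra ℂ B] (X : Fam B d) (γ : PV B d),
          preI (preI X) 1 γ = 0 := by
          intro B _ _ X γ
          rw [preI_succ]; simp [preI]
        rw [e, e]
        exact zero_mem _
      | n + 2 =>
        have h1 := ih n M ℓ (by omega) hγ
        have h2 := cupPair_mem (v := []) (N := M) (by simp) (by simp)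
          (cupPair_mem (v := []) (N := M) (by simp) (by simp) h1)
        rw [preI_succ, preI_succ, preI_succ, preI_succ]
        simpa [cupPair, wordDeriv] using h2

lemma polyF_mem {s : Finset (Fin d)} {L n M ℓ : ℕ} (h : 2 * L ≤ n + M) {γ : PV (Poly d) d}
    (hγ : γ ∈ polyvecs s ℓ) : polyF L n γ ∈ functionals s M n := by
  rw [functionals_eq_map]
  exact ⟨_, words_pair_mem L n M ℓ h hγ, rfl⟩

lemma represents_polyF {s : Finset (Fin d)} {L n ℓ : ℕ} {γ : PV (Poly d) d}
    (hγ : γ ∈ polyvecs s ℓ) : Represents (words pd L n γ) (polyF L n γ) :=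
  ⟨_, pairs_le_polyDiffPair _ _ (words_pair_mem L n (2 * L) ℓ (by omega) hγ), rfl⟩

lemma intF_words_mem {s : Finset (Fin d)} {L n M ℓ : ℕ} (h : 2 * L ≤ n + 1 + M) {γ : PV (Poly d) d}
    (hγ : γ ∈ polyvecs s ℓ) : intF (words smoothDeriv L (n + 1)
      (onCoeff (polyToSmooth d).toLinearMap γ)) ∈ functionals s M n := by
  have h1 := words_pair_mem L (n + 1) M ℓ h hγ
  refine pairs_mapsTo (intF ∘ₗ LinearMap.snd ℂ _ _) (functionals s M n) (fun α w hw => ?_) h1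
  exact wordFunctional_mem hw

/-! ### Graphs -/

/-- The embedding of homogeneous polyvectors in polyvectors of mixed degree. -/
def toPV (ℓ : ℕ) : Polyvector d ℓ →ₗ[ℂ] PV (Poly d) d :=
  LinearMap.lTensor (Poly d) (⋀[ℂ]^ℓ (Fin d → ℂ)).subtype

/-- The contribution of a graph, as a determinant. -/
def graphTerm {ℓ n : ℕ} (e : Fin ℓ → Fin n) (v : Fin ℓ → Fin d → ℂ) (f : Fin n → Poly d) : Poly d :=
  (∏ i, open Classical in if ∀ j, e j ≠ i then f i else 1) *
    (Matrix.of fun i j => dirDeriv (f (e j)) (v i)).det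

lemma graphCochain_tmul_ιMulti {ℓ n : ℕ} (e : Fin ℓ → Fin n) (a : Poly d) (v : Fin ℓ → Fin d → ℂ)
    (f : Fin n → Poly d) :
    graphCochain e (a ⊗ₜ exteriorPower.ιMulti ℂ ℓ v) f = a * graphTerm e v f := by
  have h : graphCochain e (a ⊗ₜ exteriorPower.ιMulti ℂ ℓ v) = a • graphAlt e v := by
    simp [graphCochain, exteriorPower.alternatingMapLinearEquiv_apply_ιMulti]
  rw [h, Pi.smul_apply, smul_eq_mul]
  congr 1
  rw [graphAlt, MultilinearMap.alternatization_apply, Finset.sum_apply, graphTerm, Matrix.det_apply,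
    Finset.mul_sum, ← Finset.prod_filter]
  refine Finset.sum_congr rfl fun σ _ => ?_
  simp only [Pi.smul_apply, MultilinearMap.domDomCongr_apply, MultilinearMap.pi_apply,
    smul_apply, MultilinearMap.compLinearMap_apply, MultilinearMap.mkPiAlgebra_apply,
    Matrix.of_apply, smul_eq_mul, mul_smul_comm]

lemma mem_graphs {ℓ n : ℕ} {e : Fin ℓ → Fin n} :
    e ∈ graphs ℓ n ↔ StrictMono e ∧ ∀ j, (e j : ℕ) ≡ (j : ℕ) [MOD 2] := by
  simp [graphs]

/-- Laplace expansion along the first column, which belongs to the argument f 0. -/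
lemma graphTerm_cons {ℓ n : ℕ} (e : Fin ℓ → Fin n) (v : Fin (ℓ + 1) → Fin d → ℂ)
    (f : Fin (n + 1) → Poly d) :
    graphTerm (Fin.cons 0 fun j => (e j).succ) v f =
      ∑ j : Fin (ℓ + 1), (-1) ^ (j : ℕ) * dirDeriv (f 0) (v j) *
        graphTerm e (j.removeNth v) (Fin.tail f) := by
  rw [graphTerm, Fin.prod_univ_succ, Matrix.det_succ_column_zero, Finset.mul_sum, if_neg (by
    intro h; exact h 0 rfl), one_mul]
  refine Finset.sum_congr rfl fun j _ => ?_
  rw [graphTerm]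
  have h1 : ∀ i : Fin n, (∀ k : Fin (ℓ + 1),
      (Fin.cons 0 (fun j => (e j).succ) : Fin (ℓ + 1) → Fin (n + 1)) k ≠ i.succ) ↔
      ∀ k, e k ≠ i := by
    intro i
    rw [Fin.forall_fin_succ]
    simp [(Fin.succ_ne_zero i).symm]
  simp only [h1, Matrix.of_apply, Fin.cons_zero]
  have h2 : (Matrix.of fun i j => dirDeriv (f ((Fin.cons 0 (fun j => (e j).succ) :
      Fin (ℓ + 1) → Fin (n + 1)) j)) (v i)).submatrix j.succAbove Fin.succ =
      Matrix.of fun i k => dirDeriv (Fin.tail f (e k)) (j.removeNth v i) := by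
    ext i k
    simp [Fin.tail, Fin.removeNth]
  rw [h2]
  simp only [Fin.tail]
  ring

lemma graphTerm_succ_succ {ℓ n : ℕ} (e : Fin ℓ → Fin n) (v : Fin ℓ → Fin d → ℂ)
    (f : Fin (n + 2) → Poly d) :
    graphTerm (fun j => (e j).succ.succ) v f =
      f 0 * f 1 * graphTerm e v (Fin.tail (Fin.tail f)) := by
  rw [graphTerm, Fin.prod_univ_succ, Fin.prod_univ_succ, if_pos fun j => Fin.succ_ne_zero _, if_pos
    fun j h => Fin.succ_ne_zero _ (Fin.succ_injective _ h), graphTerm]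
  simp only [ne_eq, Fin.succ_inj, Fin.tail, mul_assoc]
  rfl

lemma cons_mem_graphs {ℓ n : ℕ} {e : Fin ℓ → Fin n} (he : e ∈ graphs ℓ n) :
    (Fin.cons 0 fun j => (e j).succ : Fin (ℓ + 1) → Fin (n + 1)) ∈ graphs (ℓ + 1) (n + 1) := by
  rw [mem_graphs] at he ⊢
  refine ⟨?_, fun j => ?_⟩
  · intro i j hij
    refine Fin.cases (fun hij => ?_) (fun i hij => ?_) i hij
    · obtain ⟨j, rfl⟩ := Fin.exists_succ_eq.mpr (ne_of_gt hij)
      simp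
    · obtain ⟨j, rfl⟩ := Fin.exists_succ_eq.mpr (ne_of_gt (lt_of_le_of_lt (Fin.zero_le _) hij))
      simpa using he.1 (Fin.succ_lt_succ_iff.mp hij)
  · refine Fin.cases ?_ (fun j => ?_) j
    · rfl
    · simpa using (he.2 j).add_right 1

lemma succ_succ_mem_graphs {ℓ n : ℕ} {e : Fin ℓ → Fin n} (he : e ∈ graphs ℓ n) :
    (fun j => (e j).succ.succ : Fin ℓ → Fin (n + 2)) ∈ graphs ℓ (n + 2) := by
  rw [mem_graphs] at he ⊢
  refine ⟨fun i j hij => by simpa using he.1 hij, fun j => ?_⟩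
  have := he.2 j
  simp only [Fin.val_succ]
  rw [add_assoc]
  exact (Nat.add_modEq_right).trans this

/-- Either the first vertex is an endpoint, or by parity the first two vertices are both free. This
matches the two ways to prepend a symbol to a word. -/
lemma graphs_cases {ℓ n : ℕ} {e : Fin ℓ → Fin (n + 2)} (he : e ∈ graphs ℓ (n + 2)) :
    (∃ e' ∈ graphs ℓ n, (fun j => (e' j).succ.succ) = e) ∨
      ∃ h : 0 < ℓ, e ⟨0, h⟩ = 0 := by
  rw [mem_graphs] at he
  obtain ⟨h1, h2⟩ := he
  by_cases h0 : ∃ h : 0 < ℓ, e ⟨0, h⟩ = 0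
  · exact Or.inr h0
  · left
    have h3 : ∀ j, 2 ≤ (e j : ℕ) := by
      intro j
      have hpos : 0 < ℓ := lt_of_le_of_lt (Nat.zero_le _) j.2
      have h4 : (e ⟨0, hpos⟩ : ℕ) ≠ 0 := fun h => h0 ⟨hpos, Fin.ext h⟩
      have h5 := h2 ⟨0, hpos⟩
      have h6 : e ⟨0, hpos⟩ ≤ e j := h1.monotone (Fin.mk_le_of_le_val (Nat.zero_le _))
      rw [Fin.le_def] at h6
      rw [Nat.ModEq] at h5
      simp only at h5
      omega
    refine ⟨fun j => ⟨(e j : ℕ) - 2, by have := (e j).2; have := h3 j; omega⟩, ?_, ?_⟩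
    · rw [mem_graphs]
      refine ⟨fun i j hij => ?_, fun j => ?_⟩
      · have := h1 hij
        rw [Fin.lt_def] at this ⊢
        have := h3 i
        simp only
        omega
      · have h4 := h2 j
        have := h3 j
        rw [Nat.ModEq] at h4 ⊢
        simp only
        omega
    · funext j
      apply Fin.ext
      have := h3 j
      simp only [Fin.val_succ]
      omega

lemma exists_of_graph_zero {ℓ n : ℕ} {e : Fin (ℓ + 1) → Fin (n + 1)} (he : e ∈ graphs (ℓ + 1) (n + 1))
    (h0 : e 0 = 0) : ∃ e' ∈ graphs ℓ n, (Fin.cons 0 fun j => (e' j).succ) = e := by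
  rw [mem_graphs] at he
  obtain ⟨h1, h2⟩ := he
  have h3 : ∀ j : Fin ℓ, e j.succ ≠ 0 := by
    intro j h
    have := h1 (Fin.succ_pos j)
    rw [h0, h] at this
    exact lt_irrefl _ this
  refine ⟨fun j => (e j.succ).pred (h3 j), ?_, ?_⟩
  · rw [mem_graphs]
    refine ⟨fun i j hij => ?_, fun j => ?_⟩
    · rw [Fin.pred_lt_pred_iff]
      exact h1 (Fin.succ_lt_succ_iff.mpr hij)
    · have h4 := h2 j.succ
      have h5 : (e j.succ : ℕ) ≠ 0 := fun h => h3 j (Fin.ext h)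
      rw [Nat.ModEq] at h4 ⊢
      simp only [Fin.val_succ, Fin.val_pred] at h4 ⊢
      omega
  · funext j
    refine Fin.cases ?_ (fun j => ?_) j
    · rw [Fin.cons_zero, h0]
    · rw [Fin.cons_succ, Fin.succ_pred]

/-- The sum over all graphs. -/
def graphSum (ℓ n : ℕ) (v : Fin ℓ → Fin d → ℂ) (f : Fin n → Poly d) : Poly d :=
  ∑ e ∈ graphs ℓ n, graphTerm e v f

lemma sum_graphs_zero {ℓ n : ℕ} (v : Fin (ℓ + 1) → Fin d → ℂ) (f : Fin (n + 1) → Poly d) :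
    ∑ e ∈ (graphs (ℓ + 1) (n + 1)).filter (fun e => e 0 = 0), graphTerm e v f =
      ∑ j : Fin (ℓ + 1), (-1) ^ (j : ℕ) * dirDeriv (f 0) (v j) *
        graphSum ℓ n (j.removeNth v) (Fin.tail f) := by
  simp only [graphSum, Finset.mul_sum]
  rw [Finset.sum_comm]
  symm
  refine Finset.sum_bij (fun e _ => Fin.cons 0 fun j => (e j).succ) ?_ ?_ ?_ ?_
  · intro e he
    rw [Finset.mem_filter]
    exact ⟨cons_mem_graphs he, rfl⟩
  · intro e _ e' _ h
    funext j
    have := congrFun h j.succ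
    simpa using this
  · intro e he
    rw [Finset.mem_filter] at he
    obtain ⟨e', he', h⟩ := exists_of_graph_zero he.1 he.2
    exact ⟨e', he', h⟩
  · intro e _
    exact (graphTerm_cons e v f).symm

lemma sum_graphs_succ_succ {ℓ n : ℕ} (v : Fin ℓ → Fin d → ℂ) (f : Fin (n + 2) → Poly d)
    (p : (Fin ℓ → Fin (n + 2)) → Prop) [DecidablePred p]
    (hp : ∀ e, p e ↔ ¬ ∃ h : 0 < ℓ, e ⟨0, h⟩ = 0) :
    ∑ e ∈ (graphs ℓ (n + 2)).filter p, graphTerm e v f =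
      f 0 * f 1 * graphSum ℓ n v (Fin.tail (Fin.tail f)) := by
  rw [graphSum, Finset.mul_sum]
  symm
  refine Finset.sum_bij (fun e _ j => (e j).succ.succ) ?_ ?_ ?_ ?_
  · intro e he
    rw [Finset.mem_filter, hp]
    refine ⟨succ_succ_mem_graphs he, ?_⟩
    rintro ⟨h, h0⟩
    exact Fin.succ_ne_zero _ h0
  · intro e _ e' _ h
    funext j
    have := congrFun h j
    simpa using this
  · intro e he
    rw [Finset.mem_filter, hp] at he
    obtain ⟨e', he', h⟩ := (graphs_cases he.1).resolve_right he.2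
    exact ⟨e', he', h⟩
  · intro e _
    exact (graphTerm_succ_succ e v f).symm

lemma preT_tmul_ιMulti (X : Fam (Poly d) d) {ℓ n : ℕ} (a : Poly d) (v : Fin (ℓ + 1) → Fin d → ℂ)
    (f : Fin (n + 1) → Poly d) :
    preT pd X (n + 1) (a ⊗ₜ ExteriorAlgebra.ιMulti ℂ (ℓ + 1) v) f =
      ∑ j : Fin (ℓ + 1), (-1) ^ (j : ℕ) * dirDeriv (f 0) (v j) *
        X n (a ⊗ₜ ExteriorAlgebra.ιMulti ℂ ℓ (j.removeNth v)) (Fin.tail f) := by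
  rw [preT_succ, Finset.sum_apply]
  simp only [cup_apply, contr_tmul, contractLeft_ιMulti, TensorProduct.tmul_sum,
    TensorProduct.tmul_smul, map_sum, map_smul, Finset.sum_apply, Pi.smul_apply, Finset.mul_sum]
  rw [Finset.sum_comm]
  refine Finset.sum_congr rfl fun j _ => ?_
  rw [dirDeriv, Fintype.linearCombination_apply, Finset.mul_sum, Finset.sum_mul]
  refine Finset.sum_congr rfl fun c _ => ?_
  simp only [Algebra.smul_def, map_pow, map_neg, map_one, LinearMap.proj_apply,
    Derivation.coeFn_coe]
  ring

/-- The sums over graphs and over words obey the same recursion in the first symbol. The relation 2L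
= n + ℓ says that exactly ℓ of the L symbols are endpoints, all others being pairs. -/
lemma words_tmul_ιMulti (L ℓ n : ℕ) (h : 2 * L = n + ℓ) (a : Poly d) (v : Fin ℓ → Fin d → ℂ)
    (f : Fin n → Poly d) :
    words pd L n (a ⊗ₜ ExteriorAlgebra.ιMulti ℂ ℓ v) f = a * graphSum ℓ n v f := by
  induction L generalizing ℓ n with
  | zero =>
    obtain rfl : n = 0 := by omega
    obtain rfl : ℓ = 0 := by omega
    have hg : graphs 0 0 = {Fin.elim0} := by
      ext e
      rw [mem_graphs, Finset.mem_singleton]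
      exact ⟨fun _ => Subsingleton.elim _ _, fun _ => ⟨fun i => i.elim0, fun i => i.elim0⟩⟩
    rw [words_zero, unitFam_zero, augment_tmul, graphSum, hg, Finset.sum_singleton, graphTerm]
    simp
  | succ L ih =>
    rw [words_succ]
    change preT pd _ n _ f + preI (preI _) n _ f = _
    match n with
    | 0 =>
      obtain ⟨m, rfl⟩ : ∃ m, ℓ = m + 1 := ⟨ℓ - 1, by omega⟩
      have : graphs (m + 1) 0 = ∅ := Finset.eq_empty_of_forall_notMem fun e => (e 0).elim0
      rw [graphSum, this]
      simp [preT, preI]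
    | 1 =>
      obtain ⟨m, rfl⟩ : ∃ m, ℓ = m + 1 := ⟨ℓ - 1, by omega⟩
      rw [preT_tmul_ιMulti, preI_succ]
      have h1 : (graphs (m + 1) 1) = (graphs (m + 1) 1).filter fun e => e 0 = 0 := by
        rw [Finset.filter_true_of_mem]
        intro e _
        exact Subsingleton.elim _ _
      rw [graphSum, h1, sum_graphs_zero, Finset.mul_sum]
      simp only [preI, LinearMap.zero_apply, map_zero, Pi.zero_apply, add_zero]
      refine Finset.sum_congr rfl fun j _ => ?_
      rw [ih m 0 (by omega)]
      ring
    | n + 2 =>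
      have hI : preI (preI (words pd L)) (n + 2) (a ⊗ₜ ExteriorAlgebra.ιMulti ℂ ℓ v) f =
          a * (f 0 * f 1 * graphSum ℓ n v (Fin.tail (Fin.tail f))) := by
        rw [preI_succ, preI_succ, cup_apply, cup_apply, ih ℓ n (by omega)]
        change f 0 * (f 1 * _) = _
        ring
      rw [hI]
      conv_rhs => rw [graphSum]
      cases ℓ with
      | zero =>
        have h1 : preT pd (words pd L) (n + 2) (a ⊗ₜ ExteriorAlgebra.ιMulti ℂ 0 v) f = 0 := by
          rw [preT_succ, Finset.sum_apply]
          refine Finset.sum_eq_zero fun c _ => ?_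
          rw [contr_tmul, ExteriorAlgebra.ιMulti_zero_apply]
          simp
        rw [h1, zero_add, ← sum_graphs_succ_succ v f (fun _ => True) (by simp)]
        simp
      | succ ℓ =>
        rw [preT_tmul_ιMulti, ← Finset.sum_filter_add_sum_filter_not (graphs (ℓ + 1) (n + 2))
          (fun e => e 0 = 0), sum_graphs_zero,
          sum_graphs_succ_succ v f (fun e => ¬ e 0 = 0) (by simp), mul_add, Finset.mul_sum]
        congr 1
        refine Finset.sum_congr rfl fun j _ => ?_
        rw [ih ℓ (n + 1) (by omega)]
        ring

/-- The sum over all graphs is given by words. -/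
lemma sum_graphCochain {ℓ k : ℕ} (γ : Polyvector d ℓ) :
    ∑ e ∈ graphs ℓ (ℓ + 2 * k), graphCochain e γ =
      words pd (ℓ + k) (ℓ + 2 * k) (toPV ℓ γ) := by
  have h : (∑ e ∈ graphs ℓ (ℓ + 2 * k), graphCochain (d := d) e) =
      words pd (ℓ + k) (ℓ + 2 * k) ∘ₗ toPV ℓ := by
    refine TensorProduct.ext ?_
    refine LinearMap.ext fun a => ?_
    apply exteriorPower.linearMap_ext
    refine AlternatingMap.ext fun v => funext fun f => ?_
    change (∑ e ∈ graphs ℓ (ℓ + 2 * k), graphCochain e) (a ⊗ₜ exteriorPower.ιMulti ℂ ℓ v) f =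
      words pd (ℓ + k) (ℓ + 2 * k) (toPV ℓ (a ⊗ₜ exteriorPower.ιMulti ℂ ℓ v)) f
    rw [LinearMap.sum_apply, Finset.sum_apply]
    simp only [graphCochain_tmul_ιMulti]
    rw [toPV, LinearMap.lTensor_tmul, Submodule.subtype_apply, exteriorPower.ιMulti_apply_coe,
      words_tmul_ιMulti _ ℓ _ (by omega), graphSum, Finset.mul_sum]
  have h2 := LinearMap.congr_fun h γ
  rw [LinearMap.sum_apply] at h2
  exact h2

end
end CyclicHKR

/-! ### Cochains by slices, and the homotopy for the Hochschild differential. -/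

namespace CyclicHKR
noncomputable section
open scoped TensorProduct ContDiff

variable {d : ℕ}

section Slices

variable {B : Type} [CommRing B] [Algebra ℂ B] {n m : ℕ}

/-! ### The homotopy for the Hochschild differential -/

/-- A cochain with fixed first argument. -/
def slice (g : B) : Cochain B (n + 1) →ₗ[ℂ] Cochain B n where
  toFun χ f := χ (Fin.cons g f : Fin (n + 1) → B)
  map_add' _ _ := rfl
  map_smul' _ _ := rfl

lemma slice_apply (g : B) (χ : Cochain B (n + 1)) (f : Fin n → B) :
    slice g χ f = χ (Fin.cons g f : Fin (n + 1) → B) := rfl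

lemma cochain_ext {χ φ : Cochain B (n + 1)} (h : ∀ g, slice g χ = slice g φ) : χ = φ := by
  funext f
  rw [← Fin.cons_self_tail f]
  exact congrFun (h (f 0)) (Fin.tail f)

lemma slice_smul (a g : B) (χ : Cochain B (n + 1)) : slice g (a • χ) = a • slice g χ := rfl

lemma slice_cup (T : Module.End ℂ B) (g : B) (χ : Cochain B n) : slice g (cup T χ) = T g • χ := rfl

/-- Apply an operator to all slices. -/
def spread (T : Cochain B n →ₗ[ℂ] Cochain B m) : Cochain B (n + 1) →ₗ[ℂ] Cochain B (m + 1) where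
  toFun χ f := T (slice (f 0) χ) (Fin.tail f)
  map_add' χ φ := by funext f; simp
  map_smul' a χ := by funext f; simp

lemma slice_spread (T : Cochain B n →ₗ[ℂ] Cochain B m) (g : B) (χ : Cochain B (n + 1)) :
    slice g (spread T χ) = T (slice g χ) := rfl

/-- Precomposition with `T` in the first argument. -/
def precomp (T : Module.End ℂ B) : Cochain B (n + 1) →ₗ[ℂ] Cochain B (n + 1) where
  toFun χ f := slice (T (f 0)) χ (Fin.tail f)
  map_add' χ φ := by funext f; simp
  map_smul' a χ := by funext f; simp

lemma slice_precomp (T : Module.End ℂ B) (g : B) (χ : Cochain B (n + 1)) :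
    slice g (precomp T χ) = slice (T g) χ := rfl

/-- The part of `slice g (dHoch χ)` that is not `-dHoch (slice g χ)`. -/
def bump (g : B) (χ : Cochain B (n + 1)) : Cochain B (n + 1) := fun f =>
  g * χ f - slice (g * f 0) χ (Fin.tail f) + f 0 * slice g χ (Fin.tail f)

lemma slice_bump (g h : B) (χ : Cochain B (n + 1)) :
    slice h (bump g χ) = g • slice h χ - slice (g * h) χ + h • slice g χ := rfl

lemma slice_dHoch (g : B) (χ : Cochain B (n + 1)) :
    slice g (dHoch (n + 1) χ) = bump g χ - dHoch n (slice g χ) := by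
  funext f
  rw [slice_apply, Pi.sub_apply, dHoch_apply, dHoch_apply, Finset.sum_range_succ',
    Finset.sum_range_succ', Finset.sum_range_succ' _ (n + 1)]
  have h : ∀ j ∈ Finset.range (n + 1), (-1 : B) ^ (j + 1 + 1) *
      (mergeCoeff (j + 1 + 1) (Fin.cons g f : Fin (n + 2) → B) *
        χ (mergeAt (j + 1 + 1) (Fin.cons g f : Fin (n + 2) → B))) =
      -((-1) ^ (j + 1) * (mergeCoeff (j + 1) f * slice g χ (mergeAt (j + 1) f))) := by
    intro j _
    have h1 : mergeCoeff (j + 1 + 1) (Fin.cons g f : Fin (n + 2) → B) = mergeCoeff (j + 1) f := by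
      simp only [mergeCoeff, Nat.add_eq_zero_iff, one_ne_zero, and_false, if_false,
        Nat.add_right_cancel_iff]
      rfl
    have h2 : mergeAt (j + 1 + 1) (Fin.cons g f : Fin (n + 2) → B) =
        (Fin.cons g (mergeAt (j + 1) f) : Fin (n + 1) → B) := by
      funext i
      refine Fin.cases ?_ (fun i => ?_) i
      · simp [mergeAt]
      · simp [mergeAt]
    rw [h1, h2, slice_apply]
    ring
  rw [Finset.sum_congr rfl h, Finset.sum_neg_distrib]
  have e1 : mergeCoeff 1 (Fin.cons g f : Fin (n + 2) → B) = 1 := by simp [mergeCoeff]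
  have e2 : mergeCoeff 0 (Fin.cons g f : Fin (n + 2) → B) = g := by simp [mergeCoeff]
  have e3 : mergeCoeff 0 f = f 0 := by simp [mergeCoeff]
  have e4 : mergeAt 1 (Fin.cons g f : Fin (n + 2) → B) =
      (Fin.cons (g * f 0) (Fin.tail f) : Fin (n + 1) → B) := by
    funext i
    refine Fin.cases ?_ (fun i => ?_) i
    · simp [mergeAt]
    · simp [mergeAt, Fin.tail]
  have e5 : mergeAt 0 (Fin.cons g f : Fin (n + 2) → B) = f := by
    funext i; simp [mergeAt]
  have e6 : mergeAt 0 f = Fin.tail f := by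
    funext i; simp [mergeAt, Fin.tail]
  rw [zero_add, e1, e2, e3, e4, e5, e6, bump, slice_apply, slice_apply]
  ring

lemma dHoch_zero (χ : Cochain B 0) : dHoch 0 χ = 0 := by
  funext f
  rw [dHoch_apply]
  simp only [Finset.sum_range_succ, Finset.sum_range_zero, mergeCoeff]
  rw [Subsingleton.elim (mergeAt 1 f) (mergeAt 0 f)]
  simp

lemma dHoch_smul (a : B) (χ : Cochain B n) : dHoch n (a • χ) = a • dHoch n χ := by
  funext f
  simp only [dHoch_apply, Pi.smul_apply, smul_eq_mul, Finset.mul_sum]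
  exact Finset.sum_congr rfl fun j _ => by ring

/-- The commutator of the first slot with `x`, applied to `1`. -/
def lead (x : B) : Cochain B (n + 1) →ₗ[ℂ] Cochain B n where
  toFun χ := slice x χ - x • slice 1 χ
  map_add' χ φ := by rw [map_add, map_add, smul_add]; abel
  map_smul' a χ := by rw [map_smul, map_smul, smul_comm, RingHom.id_apply, smul_sub]

lemma lead_apply (x : B) (χ : Cochain B (n + 1)) : lead x χ = slice x χ - x • slice 1 χ := rfl

/-- The alternating sum of the insertions of `x`. -/
def delta (x : B) : (n : ℕ) → Cochain B (n + 1) →ₗ[ℂ] Cochain B n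
  | 0 => lead x
  | n + 1 => lead x - spread (delta x n)

lemma delta_zero (x : B) (χ : Cochain B 1) : delta x 0 χ = lead x χ := rfl

lemma delta_succ (x : B) (χ : Cochain B (n + 2)) :
    delta x (n + 1) χ = lead x χ - spread (delta x n) χ := rfl

lemma lead_smul (x a : B) (χ : Cochain B (n + 1)) : lead x (a • χ) = a • lead x χ := by
  rw [lead_apply, lead_apply, slice_smul, slice_smul, smul_sub, smul_comm]

lemma spread_smul {T : Cochain B n →ₗ[ℂ] Cochain B m} (hT : ∀ (a : B) χ, T (a • χ) = a • T χ) (a : B)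
    (χ : Cochain B (n + 1)) : spread T (a • χ) = a • spread T χ :=
  cochain_ext fun g => by rw [slice_spread, slice_smul, hT, slice_smul, slice_spread]

lemma delta_smul (x a : B) (χ : Cochain B (n + 1)) : delta x n (a • χ) = a • delta x n χ := by
  induction n generalizing a with
  | zero => exact lead_smul x a χ
  | succ n ih => rw [delta_succ, delta_succ, lead_smul, spread_smul fun a χ => ih a χ, smul_sub]

lemma lead_dHoch (x : B) (χ : Cochain B (n + 1)) :
    lead x (dHoch (n + 1) χ) = (bump x χ - x • bump 1 χ) - dHoch n (lead x χ) := by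
  rw [lead_apply, lead_apply, slice_dHoch, slice_dHoch, map_sub, dHoch_smul]
  module

lemma slice_bump_sub (x h : B) (χ : Cochain B (n + 1)) :
    slice h (bump x χ - x • bump 1 χ) = lead x (bump h χ) := by
  rw [lead_apply, map_sub, slice_smul, slice_bump, slice_bump, slice_bump, slice_bump, one_mul,
    mul_one, mul_comm h x]
  module

lemma lead_bump (x h : B) (χ : Cochain B (n + 1)) :
    lead x (bump h χ) = h • lead x χ - (slice (x * h) χ - x • slice h χ) := by
  rw [lead_apply, lead_apply, slice_bump, slice_bump, mul_one, mul_comm h x]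
  module

lemma spread_bump {T : Cochain B n →ₗ[ℂ] Cochain B m} (hT : ∀ (a : B) χ, T (a • χ) = a • T χ) (h : B)
    (χ : Cochain B (n + 1)) : spread T (bump h χ) = bump h (spread T χ) :=
  cochain_ext fun g => by
    rw [slice_spread, slice_bump, slice_bump, map_add, map_sub, hT, hT, slice_spread, slice_spread,
      slice_spread]

/-- Induction over slices: in both slots next to a product, the commutator with x sees the same
defect `bump`, and these contributions cancel between the leading term and the spread one. -/
lemma delta_dHoch (x : B) (χ : Cochain B (n + 1)) :
    delta x (n + 1) (dHoch (n + 1) χ) = -dHoch n (delta x n χ) := by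
  induction n with
  | zero =>
    refine cochain_ext fun h => ?_
    rw [delta_succ, lead_dHoch, map_sub, map_sub, slice_bump_sub, slice_spread, slice_dHoch,
      delta_zero, dHoch_zero, dHoch_zero, sub_zero, dHoch_zero]
    simp
  | succ n ih =>
    refine cochain_ext fun h => ?_
    rw [delta_succ, lead_dHoch, map_sub, map_sub, slice_bump_sub, slice_spread, slice_dHoch h χ,
      map_sub, ih, delta_succ, spread_bump (delta_smul x), delta_succ, map_sub, map_neg, map_sub,
      slice_dHoch _ (spread (delta x n) χ), slice_spread]
    abel

lemma lead_spread (x : B) (T : Cochain B n →ₗ[ℂ] Cochain B m) (hT : ∀ (a : B) χ, T (a • χ) = a • T χ)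
    (χ : Cochain B (n + 1)) : lead x (spread T χ) = T (lead x χ) := by
  rw [lead_apply, lead_apply, slice_spread, slice_spread, map_sub, hT]

/-- Insertions in two different slots carry opposite signs according to which is made first, as the
second one is counted in one slot fewer. -/
lemma delta_delta (x y : B) (χ : Cochain B (n + 2)) :
    delta x n (delta y (n + 1) χ) = -delta y n (delta x (n + 1) χ) := by
  induction n with
  | zero =>
    simp only [delta_succ, delta_zero, map_sub]
    rw [lead_spread x _ (delta_smul y), lead_spread y _ (delta_smul x), delta_zero, delta_zero]
    abel
  | succ n ih =>
    have hs : spread (delta x n) (spread (delta y (n + 1)) χ) =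
        -spread (delta y n) (spread (delta x (n + 1)) χ) := cochain_ext fun g => by
      rw [slice_spread, slice_spread, map_neg, slice_spread, slice_spread, ih]
    rw [delta_succ y, delta_succ x, delta_succ x, delta_succ y, map_sub, map_sub, map_sub, map_sub,
      lead_spread x _ (delta_smul y), lead_spread y _ (delta_smul x), hs, delta_succ, delta_succ]
    abel

lemma delta_cup_zero (x : B) (T : Module.End ℂ B) (χ : Cochain B 0) :
    delta x 0 (cup T χ) = (T x - x * T 1) • χ := by
  rw [delta_zero, lead_apply, slice_cup, slice_cup]
  module

lemma delta_cup (x : B) (T : Module.End ℂ B) (χ : Cochain B (n + 1)) :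
    delta x (n + 1) (cup T χ) = (T x - x * T 1) • χ - cup T (delta x n χ) := by
  have hs : spread (delta x n) (cup T χ) = cup T (delta x n χ) := cochain_ext fun g => by
    rw [slice_spread, slice_cup, slice_cup, delta_smul]
  rw [delta_succ, lead_apply, slice_cup, slice_cup, hs]
  module

variable (j : Poly d →ₐ[ℂ] B) (D : Fin d → Module.End ℂ B) (s : Finset (Fin d))

/-- The homotopy between the Euler operator and its part that comes from polyvectors. -/
def homot : (n : ℕ) → Cochain B (n + 1) →ₗ[ℂ] Cochain B n
  | 0 => 0
  | n + 1 => -spread (homot n) -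
      ∑ c ∈ s, spread (delta (j (MvPolynomial.X c)) n) ∘ₗ precomp (D c)

lemma homot_succ (χ : Cochain B (n + 2)) : homot j D s (n + 1) χ = -spread (homot j D s n) χ -
    ∑ c ∈ s, spread (delta (j (MvPolynomial.X c)) n) (precomp (D c) χ) := by
  rw [homot, LinearMap.sub_apply, LinearMap.sum_apply]
  rfl

lemma homot_smul (a : B) (χ : Cochain B (n + 1)) : homot j D s n (a • χ) = a • homot j D s n χ := by
  induction n generalizing a with
  | zero => exact (smul_zero a).symm
  | succ n ih =>
    rw [homot_succ, homot_succ, spread_smul fun a χ => ih a χ, smul_sub, smul_neg, Finset.smul_sum]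
    congr 1
    exact Finset.sum_congr rfl fun c _ => spread_smul (delta_smul _) a _

lemma slice_homot_succ (h : B) (χ : Cochain B (n + 2)) :
    slice h (homot j D s (n + 1) χ) = -homot j D s n (slice h χ) -
      ∑ c ∈ s, delta (j (MvPolynomial.X c)) n (slice (D c h) χ) := by
  rw [homot_succ, map_sub, map_neg, slice_spread, map_sum]
  rfl

lemma slice_eulerOp (h : B) (χ : Cochain B (n + 1)) : slice h (eulerOp j D s χ) =
    ∑ c ∈ s, (slice (j (MvPolynomial.X c) * D c h) χ - j (MvPolynomial.X c) • slice (D c h) χ) +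
      eulerOp j D s (slice h χ) := by
  funext f
  rw [Pi.add_apply, Finset.sum_apply]
  change ∑ i : Fin (n + 1), ∑ c ∈ s, adOp j i c χ _ = _ + ∑ i : Fin n, ∑ c ∈ s, adOp j i c _ _
  rw [Fin.sum_univ_succ]
  simp only [adOp, LinearMap.coe_mk, AddHom.coe_mk, slice_apply, Fin.cons_update, Fin.cons_zero,
    Fin.cons_succ, Fin.update_cons_zero, Pi.sub_apply, Pi.smul_apply, smul_eq_mul,
    Function.update_self, Function.update_idem]

lemma eulerOp_zero (χ : Cochain B 0) : eulerOp j D s χ = 0 := rfl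

variable (B n) in
/-- Cochains that are additive in each argument. -/
def additiveCochains : Submodule ℂ (Cochain B n) where
  carrier := {χ | ∀ i f a b, χ (Function.update f i (a + b)) =
    χ (Function.update f i a) + χ (Function.update f i b)}
  zero_mem' i f a b := by simp
  add_mem' hχ hφ i f a b := by simp only [Pi.add_apply, hχ i f a b, hφ i f a b]; abel
  smul_mem' c χ hχ i f a b := by simp only [Pi.smul_apply, hχ i f a b, smul_add]

variable {j D s}

lemma slice_mem_additiveCochains {χ : Cochain B (n + 1)} (hχ : χ ∈ additiveCochains B (n + 1))
    (g : B) : slice g χ ∈ additiveCochains B n := by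
  intro i f a b
  simp only [slice_apply, Fin.cons_update]
  exact hχ i.succ _ a b

lemma slice_add_of_mem {χ : Cochain B (n + 1)} (hχ : χ ∈ additiveCochains B (n + 1)) (g h : B) :
    slice (g + h) χ = slice g χ + slice h χ := by
  funext f
  have := hχ 0 (Fin.cons 0 f) g h
  simp only [Fin.update_cons_zero] at this
  exact this

/-- A derivation in the first slot commutes with `bump h` except for the Leibniz terms of D(hg).
Additivity of χ is needed to split a slice taken at a sum. -/
lemma spread_precomp_bump {T : Cochain B n →ₗ[ℂ] Cochain B m} (hT : ∀ (a : B) χ, T (a • χ) = a • T χ)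
    {D : Module.End ℂ B} (hD : ∀ f g, D (f * g) = D f * g + f * D g) {χ : Cochain B (n + 1)}
    (hχ : χ ∈ additiveCochains B (n + 1)) (h : B) :
    spread T (precomp D (bump h χ)) - bump h (spread T (precomp D χ)) + bump (D h) (spread T χ) =
      D h • spread T χ + cup D (T (slice h χ)) := by
  refine cochain_ext fun g => ?_
  simp only [map_sub, map_add, slice_spread, slice_precomp, slice_bump, slice_smul, slice_cup, hT, hD,
    slice_add_of_mem hχ]
  abel

/-- The homotopy formula. -/
lemma dHoch_homot (h : IsDiffRing j D) {χ : Cochain B (n + 1)} (hχ : χ ∈ additiveCochains B (n + 1)) :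
    dHoch n (homot j D s n χ) + homot j D s (n + 1) (dHoch (n + 1) χ) =
      eulerOp j D s χ - ∑ c ∈ s, cup (D c) (delta (j (MvPolynomial.X c)) n χ) := by
  induction n with
  | zero =>
    refine cochain_ext fun g => ?_
    have h0 : ∀ φ : Cochain B 1, 0 + φ = φ := zero_add
    rw [dHoch_zero, h0, slice_homot_succ, map_sub, slice_eulerOp, eulerOp_zero, add_zero, homot,
      LinearMap.zero_apply, neg_zero, zero_sub, map_sum, ← Finset.sum_sub_distrib,
      ← Finset.sum_neg_distrib]
    refine Finset.sum_congr rfl fun c _ => ?_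
    rw [slice_dHoch, dHoch_zero, sub_zero, delta_zero, delta_zero, lead_bump, slice_cup]
    abel
  | succ n ih =>
    -- All operators in the formula are given recursively by slices, so the slices at `g` are
    -- compared. The induction hypothesis for `slice g χ` accounts for the terms not differentiated
    -- along the first argument; the exchange rules `e1`, `e3` and `e5` take care of the rest.
    refine cochain_ext fun g => ?_
    have e1 : ∀ c, delta (j (MvPolynomial.X c)) (n + 1) (slice (D c g) (dHoch (n + 2) χ)) =
        D c g • delta (j (MvPolynomial.X c)) (n + 1) χ + D c g • spread (delta (j (MvPolynomial.X c)) n) χ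
        - (slice (j (MvPolynomial.X c) * D c g) χ - j (MvPolynomial.X c) • slice (D c g) χ)
        - bump (D c g) (spread (delta (j (MvPolynomial.X c)) n) χ)
        + dHoch n (delta (j (MvPolynomial.X c)) n (slice (D c g) χ)) := by
      intro c
      rw [slice_dHoch, map_sub, delta_dHoch, delta_succ, lead_bump, spread_bump (delta_smul _),
        delta_succ]
      module
    have e2 : homot j D s (n + 1) (slice g (dHoch (n + 2) χ)) =
        -bump g (spread (homot j D s n) χ) -
        ∑ c ∈ s, spread (delta (j (MvPolynomial.X c)) n) (precomp (D c) (bump g χ)) -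
        homot j D s (n + 1) (dHoch (n + 1) (slice g χ)) := by
      rw [slice_dHoch, map_sub, homot_succ _ _ _ (bump g χ), spread_bump (homot_smul j D s)]
    have e3 : bump g (homot j D s (n + 1) χ) = -bump g (spread (homot j D s n) χ) -
        ∑ c ∈ s, bump g (spread (delta (j (MvPolynomial.X c)) n) (precomp (D c) χ)) := by
      refine cochain_ext fun h => ?_
      simp only [slice_bump, map_sub, map_neg, map_sum, homot_succ, smul_sub, smul_neg,
        Finset.smul_sum, Finset.sum_add_distrib, Finset.sum_sub_distrib]
      abel
    have e4 := ih (slice_mem_additiveCochains hχ g)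
    have e5 : ∀ c, spread (delta (j (MvPolynomial.X c)) n) (precomp (D c) (bump g χ)) =
        bump g (spread (delta (j (MvPolynomial.X c)) n) (precomp (D c) χ)) -
        bump (D c g) (spread (delta (j (MvPolynomial.X c)) n) χ) +
        (D c g • spread (delta (j (MvPolynomial.X c)) n) χ +
          cup (D c) (delta (j (MvPolynomial.X c)) n (slice g χ))) := by
      intro c
      rw [← spread_precomp_bump (delta_smul _) (h.leibniz c) hχ g]
      abel
    rw [map_add, slice_dHoch, e3, slice_homot_succ, slice_homot_succ, e2, map_sub (slice g),
      slice_eulerOp, map_sum]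
    simp only [e1, e5, slice_cup, map_sub, map_neg, map_sum, Finset.sum_add_distrib,
      Finset.sum_sub_distrib] at e4 ⊢
    linear_combination (exp := 1) e4

end Slices

end
end CyclicHKR

/-! ### The antisymmetrized symbol and the ordinary HKR theorem. -/

namespace CyclicHKR
noncomputable section
open scoped TensorProduct ContDiff

variable {d : ℕ}

/-! ### Polydifferential operators on polynomials -/

/-- The monomial operators on polynomials. -/
abbrev polyOp {n : ℕ} (α : Fin d →₀ ℕ) (w : Fin n → List (Fin d)) : Cochain (Poly d) n :=
  monomialOp (AlgHom.id ℂ (Poly d)) pd (MvPolynomial.monomial α 1) w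

lemma operators_mapsTo {n : ℕ} {s : Finset (Fin d)} {M : ℕ∞} {X : Type*} [AddCommGroup X] [Module ℂ X]
    (T : Cochain (Poly d) n →ₗ[ℂ] X) (N : Submodule ℂ X)
    (h : ∀ α w, Admissible s M α w → T (polyOp α w) ∈ N)
    {ψ : Cochain (Poly d) n} (hψ : ψ ∈ operators s M n) : T ψ ∈ N := by
  obtain ⟨Ψ, hΨ⟩ := mem_operators.mp hψ
  exact pairs_mapsTo (T ∘ₗ LinearMap.fst ℂ _ _) N h hΨ

lemma polyOp_mem {n : ℕ} {s : Finset (Fin d)} {M : ℕ∞} {α : Fin d →₀ ℕ} {w : Fin n → List (Fin d)}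
    (h : Admissible s M α w) : polyOp α w ∈ operators s M n :=
  mem_operators.mpr ⟨_, monomialPair_mem_pairs h⟩

lemma operators_mono {n : ℕ} {s t : Finset (Fin d)} {M N : ℕ∞} (hs : s ⊆ t) (hM : M ≤ N) :
    operators s M n ≤ operators t N n :=
  Submodule.map_mono (pairs_mono hs hM)

lemma exists_mem_operators {n : ℕ} {s : Finset (Fin d)} {ψ : Cochain (Poly d) n}
    (h : ψ ∈ operators s ⊤ n) : ∃ M : ℕ, ψ ∈ operators s M n := by
  obtain ⟨Ψ, hΨ⟩ := mem_operators.mp h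
  obtain ⟨M, hM⟩ := exists_mem_pairs hΨ
  exact ⟨M, mem_operators.mpr ⟨Ψ, hM⟩⟩

lemma cup_mem_operators {n : ℕ} {s : Finset (Fin d)} {M N : ℕ∞} {v : List (Fin d)}
    (hv : ∀ c ∈ v, c ∈ s) (hN : M + v.length ≤ N) {ψ : Cochain (Poly d) n} (h : ψ ∈ operators s M n) :
    cup (wordDeriv pd v) ψ ∈ operators s N (n + 1) := by
  obtain ⟨Ψ, hΨ⟩ := mem_operators.mp h
  have hP : cupPair v (ψ, Ψ) ∈ pairs s N (n + 1) := cupPair_mem hv hN hΨ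
  exact mem_operators.mpr ⟨cup (wordDeriv smoothDeriv v) Ψ, hP⟩

lemma polyOp_cons {n : ℕ} (α : Fin d →₀ ℕ) (w : Fin (n + 1) → List (Fin d)) :
    polyOp α w = cup (wordDeriv pd (w 0)) (polyOp α (Fin.tail w)) := by
  rw [polyOp, polyOp, cup_monomialOp, Fin.cons_self_tail]

lemma wordSize_succ {n : ℕ} (w : Fin (n + 1) → List (Fin d)) :
    wordSize w = (w 0).length + wordSize (Fin.tail w) := by
  rw [wordSize, Fin.sum_univ_succ]; rfl

lemma wordDeriv_pd_one {v : List (Fin d)} (h : v ≠ []) : wordDeriv pd v (1 : Poly d) = 0 := by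
  obtain ⟨c, w, rfl⟩ := List.exists_cons_of_ne_nil h
  rw [wordDeriv_cons, ← (isDiffRing_poly d).wordDeriv_comm, (isDiffRing_poly d).D_one, map_zero]

/-- The commutator of ∂^w with x_c, applied to 1, is a derivative of 1 unless the word is the single
letter c. -/
lemma wordDeriv_pd_X (c : Fin d) (v : List (Fin d)) :
    wordDeriv pd v (MvPolynomial.X c) - MvPolynomial.X c * wordDeriv pd v 1 =
      if v = [c] then 1 else 0 := by
  have h := (isDiffRing_poly d).wordDeriv_X_mul c v 1
  rw [mul_one] at h
  change wordDeriv pd v (MvPolynomial.X c) = MvPolynomial.X c * wordDeriv pd v 1 + _ at h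
  rw [h, add_sub_cancel_left]
  split_ifs with hv
  · subst hv; simp
  · by_cases hc : c ∈ v
    · have : v.erase c ≠ [] := by
        intro h0
        have h1 := List.perm_cons_erase hc
        rw [h0] at h1
        exact hv (List.perm_singleton.mp h1)
      change _ • wordDeriv pd _ _ = 0
      rw [wordDeriv_pd_one this, smul_zero]
    · rw [List.count_eq_zero_of_not_mem hc]; simp

/-- `delta` for a coordinate. -/
abbrev deltaX (c : Fin d) (n : ℕ) : Cochain (Poly d) (n + 1) →ₗ[ℂ] Cochain (Poly d) n :=
  delta (MvPolynomial.X c) n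

/-- Only a slot whose word is exactly [c] contributes, and it loses that letter. Vanishing for order
zero is proved alongside, since the bound `wordSize w - 1` is truncated and would not suffice for
the induction. -/
lemma deltaX_polyOp (c : Fin d) {n : ℕ} (s : Finset (Fin d)) (α : Fin d →₀ ℕ)
    (w : Fin (n + 1) → List (Fin d)) (h : Admissible s ⊤ α w) :
    deltaX c n (polyOp α w) ∈ operators s (wordSize w - 1 : ℕ) n ∧
      (wordSize w = 0 ∨ c ∉ s → deltaX c n (polyOp α w) = 0) := by
  have hlead : ∀ {m : ℕ} (u : Fin m → List (Fin d)) (v : List (Fin d)), Admissible s ⊤ α u →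
      (∀ b ∈ v, b ∈ s) →
      (if v = [c] then 1 else 0 : Poly d) • polyOp α u ∈
        operators s (v.length + wordSize u - 1 : ℕ) m ∧
      (v.length + wordSize u = 0 ∨ c ∉ s → (if v = [c] then 1 else 0 : Poly d) • polyOp α u = 0) := by
    intro m u v hu hv
    split_ifs with hvc
    · subst hvc
      rw [one_smul]
      refine ⟨polyOp_mem ⟨hu.support, hu.letters, ?_⟩, ?_⟩
      · rw [List.length_singleton, Nat.add_sub_cancel_left]
      · rintro (h0 | h0)
        · simp at h0
        · exact absurd (hv c (by simp)) h0
    · rw [zero_smul]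
      exact ⟨zero_mem _, fun _ => rfl⟩
  induction n with
  | zero =>
    rw [polyOp_cons, deltaX, delta_cup_zero, wordDeriv_pd_X, wordSize_succ]
    exact hlead _ _ ⟨h.support, fun i => i.elim0, le_top⟩ (h.letters 0)
  | succ n ih =>
    have ht : Admissible s ⊤ α (Fin.tail w) := ⟨h.support, fun i => h.letters i.succ, le_top⟩
    obtain ⟨h1, h2⟩ := hlead (Fin.tail w) (w 0) ht (h.letters 0)
    obtain ⟨h3, h4⟩ := ih (Fin.tail w) ht
    rw [polyOp_cons, deltaX, delta_cup, wordDeriv_pd_X, wordSize_succ]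
    refine ⟨sub_mem h1 ?_, fun h0 => ?_⟩
    · rcases Nat.eq_zero_or_pos (wordSize (Fin.tail w)) with h5 | h5
      · rw [h4 (Or.inl h5), map_zero]
        exact zero_mem _
      · refine cup_mem_operators (h.letters 0) ?_ h3
        norm_cast
        omega
    · rw [h2 h0, h4 (h0.imp_left (by omega)), map_zero, sub_zero]

lemma deltaX_mem (c : Fin d) {n : ℕ} {s : Finset (Fin d)} {M : ℕ} {ψ : Cochain (Poly d) (n + 1)}
    (h : ψ ∈ operators s (M + 1 : ℕ) (n + 1)) : deltaX c n ψ ∈ operators s M n := by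
  refine operators_mapsTo _ _ (fun α w hw => ?_) h
  refine operators_mono subset_rfl ?_ (deltaX_polyOp c s α w ⟨hw.support, hw.letters, le_top⟩).1
  have := hw.size
  norm_cast at this ⊢
  omega

lemma deltaX_mem_top (c : Fin d) {n : ℕ} {s : Finset (Fin d)} {ψ : Cochain (Poly d) (n + 1)}
    (h : ψ ∈ operators s ⊤ (n + 1)) : deltaX c n ψ ∈ operators s ⊤ n :=
  operators_mapsTo _ _ (fun α w hw => operators_mono subset_rfl le_top
    (deltaX_polyOp c s α w ⟨hw.support, hw.letters, le_top⟩).1) h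

lemma deltaX_eq_zero_of_order_zero (c : Fin d) {n : ℕ} {s : Finset (Fin d)}
    {ψ : Cochain (Poly d) (n + 1)} (h : ψ ∈ operators s 0 (n + 1)) : deltaX c n ψ = 0 := by
  rw [← Submodule.mem_bot ℂ]
  refine operators_mapsTo _ _ (fun α w hw => ?_) h
  rw [Submodule.mem_bot]
  refine (deltaX_polyOp c s α w ⟨hw.support, hw.letters, le_top⟩).2 (Or.inl ?_)
  have := hw.size
  rw [nonpos_iff_eq_zero] at this
  exact_mod_cast this

lemma deltaX_eq_zero_of_notMem {c : Fin d} {n : ℕ} {s : Finset (Fin d)} (hc : c ∉ s)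
    {ψ : Cochain (Poly d) (n + 1)} (h : ψ ∈ operators s ⊤ (n + 1)) : deltaX c n ψ = 0 := by
  rw [← Submodule.mem_bot ℂ]
  refine operators_mapsTo _ _ (fun α w hw => ?_) h
  rw [Submodule.mem_bot]
  exact (deltaX_polyOp c s α w ⟨hw.support, hw.letters, le_top⟩).2 (Or.inr hc)

lemma operators_le_additiveCochains {n : ℕ} (s : Finset (Fin d)) (M : ℕ∞) :
    operators s M n ≤ additiveCochains (Poly d) n := by
  intro ψ hψ
  refine operators_mapsTo LinearMap.id _ (fun α w hw => ?_) hψ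
  intro i f a b
  change polyOp α w _ = polyOp α w _ + polyOp α w _
  simp only [polyOp, monomialOp, prod_update_word, map_add]
  ring

/-- The homotopy on polynomials. -/
abbrev homotX (s : Finset (Fin d)) (n : ℕ) : Cochain (Poly d) (n + 1) →ₗ[ℂ] Cochain (Poly d) n :=
  homot (AlgHom.id ℂ (Poly d)) pd s n

lemma spread_cup {B : Type} [CommRing B] [Algebra ℂ B] {n m : ℕ} {S : Cochain B n →ₗ[ℂ] Cochain B m}
    (hS : ∀ (a : B) χ, S (a • χ) = a • S χ) (T : Module.End ℂ B) (χ : Cochain B n) :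
    spread S (cup T χ) = cup T (S χ) :=
  cochain_ext fun g => by rw [slice_spread, slice_cup, slice_cup, hS]

lemma precomp_cup {B : Type} [CommRing B] [Algebra ℂ B] {n : ℕ} (S T : Module.End ℂ B)
    (χ : Cochain B n) : precomp S (cup T χ) = cup (T * S) χ :=
  cochain_ext fun g => by rw [slice_precomp, slice_cup, slice_cup]; rfl

lemma wordDeriv_snoc (v : List (Fin d)) (c : Fin d) :
    wordDeriv pd v * pd c = wordDeriv (pd (d := d)) (v ++ [c]) := by
  refine LinearMap.ext fun p => ?_
  rw [wordDeriv_append, wordDeriv_cons, wordDeriv_nil]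
  rfl

lemma homotX_mem {n : ℕ} {s : Finset (Fin d)} {ψ : Cochain (Poly d) (n + 1)}
    (h : ψ ∈ operators s ⊤ (n + 1)) : homotX s n ψ ∈ operators s ⊤ n := by
  refine operators_mapsTo _ _ (fun α w hw => ?_) h
  clear h ψ
  induction n with
  | zero => exact zero_mem _
  | succ n ih =>
    have ht : Admissible s ⊤ α (Fin.tail w) := ⟨hw.support, fun i => hw.letters i.succ, le_top⟩
    rw [polyOp_cons, homotX, homot_succ, spread_cup (homot_smul _ _ _)]
    refine sub_mem (neg_mem (cup_mem_operators (hw.letters 0) le_top (ih _ ht))) (sum_mem fun c hc => ?_)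
    rw [precomp_cup, spread_cup (delta_smul _), wordDeriv_snoc]
    refine cup_mem_operators (fun b hb => ?_) le_top (deltaX_mem_top c (polyOp_mem ht))
    rcases List.mem_append.mp hb with hb | hb
    · exact hw.letters 0 b hb
    · rw [List.mem_singleton.mp hb]; exact hc

lemma eulerOp_sub_mem {n : ℕ} {s : Finset (Fin d)} {M : ℕ} {ψ : Cochain (Poly d) n}
    (h : ψ ∈ operators s (M + 1 : ℕ) n) :
    eulerOp (AlgHom.id ℂ (Poly d)) pd s ψ - ((M + 1 : ℕ) : ℂ) • ψ ∈ operators s M n := by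
  obtain ⟨Ψ, hΨ⟩ := mem_operators.mp h
  have hP : eulerPair s (ψ, Ψ) - ((M + 1 : ℕ) : ℂ) • (ψ, Ψ) ∈ pairs s M n := eulerPair_sub_mem hΨ
  exact mem_operators.mpr ⟨eulerOp (polyToSmooth d) smoothDeriv s Ψ - ((M + 1 : ℕ) : ℂ) • Ψ, hP⟩

/-! ### The class of a polydifferential operator -/

/-- The total antisymmetrization of the principal symbol. -/
def symbolClass : (n : ℕ) → Cochain (Poly d) n →ₗ[ℂ] PV (Poly d) d
  | 0 => (TensorProduct.mk ℂ (Poly d) (Ext d)).flip 1 ∘ₗ LinearMap.proj ![]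
  | n + 1 => ∑ c, wedge c ∘ₗ symbolClass n ∘ₗ deltaX c n

lemma symbolClass_zero (ψ : Cochain (Poly d) 0) : symbolClass 0 ψ = ψ ![] ⊗ₜ 1 := rfl

lemma symbolClass_succ (n : ℕ) (ψ : Cochain (Poly d) (n + 1)) :
    symbolClass (n + 1) ψ = ∑ c, wedge c (symbolClass n (deltaX c n ψ)) := by
  rw [symbolClass, LinearMap.sum_apply]; rfl

/-- As the operators δ_c anticommute, each of the n + 1 factors ∂_b contributes equally.
Consequently, if the class of ψ vanishes, so do the classes of all δ_b ψ; this is what the induction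
in the HKR theorem uses. -/
lemma contr_symbolClass (b : Fin d) (n : ℕ) (ψ : Cochain (Poly d) (n + 1)) :
    contr b (symbolClass (n + 1) ψ) = ((n : ℂ) + 1) • symbolClass n (deltaX b n ψ) := by
  induction n with
  | zero =>
    have h0 : ∀ χ : Cochain (Poly d) 0, contr b (symbolClass 0 χ) = 0 := by
      intro χ
      rw [symbolClass_zero, contr_tmul]
      simp
    rw [symbolClass_succ, map_sum]
    simp only [contr_wedge, h0, map_zero, sub_zero]
    rw [Finset.sum_ite_eq Finset.univ b]
    simp
  | succ n ih =>
    have h1 : ∀ c, contr b (wedge c (symbolClass (n + 1) (deltaX c (n + 1) ψ))) =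
        (if b = c then symbolClass (n + 1) (deltaX c (n + 1) ψ) else 0) +
          ((n : ℂ) + 1) • wedge c (symbolClass n (deltaX c n (deltaX b (n + 1) ψ))) := by
      intro c
      rw [contr_wedge, ih, deltaX, deltaX, delta_delta, map_neg, map_smul, map_neg]
      module
    rw [symbolClass_succ, map_sum, Finset.sum_congr rfl fun c _ => h1 c, Finset.sum_add_distrib,
      Finset.sum_ite_eq Finset.univ b, ← Finset.smul_sum, ← symbolClass_succ,
      if_pos (Finset.mem_univ b)]
    push_cast
    module

lemma symbolClass_dHoch (n : ℕ) (χ : Cochain (Poly d) n) : symbolClass (n + 1) (dHoch n χ) = 0 := by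
  induction n with
  | zero => rw [dHoch_zero, map_zero]
  | succ n ih =>
    rw [symbolClass_succ]
    refine Finset.sum_eq_zero fun c _ => ?_
    rw [deltaX, delta_dHoch, map_neg, ih, neg_zero, map_zero]

lemma symbolClass_mem {n : ℕ} {s : Finset (Fin d)} {ψ : Cochain (Poly d) n}
    (h : ψ ∈ operators s ⊤ n) : symbolClass n ψ ∈ polyvecs s n := by
  induction n with
  | zero =>
    refine operators_mapsTo _ _ (fun α w hw => ?_) h
    rw [symbolClass_zero]
    have := polyvec_mem (w := []) hw.support (by simp)
    rw [polyvec_nil] at this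
    simpa [monomialOp] using this
  | succ n ih =>
    rw [symbolClass_succ]
    refine sum_mem fun c _ => ?_
    by_cases hc : c ∈ s
    · exact wedge_mem hc (ih (deltaX_mem_top c h))
    · rw [deltaX_eq_zero_of_notMem hc h, map_zero, map_zero]
      exact zero_mem _

/-- Each of the n operators δ lowers the order by one, and δ kills operators of order zero. -/
lemma symbolClass_eq_zero {n M : ℕ} (hM : M < n) {s : Finset (Fin d)} {ψ : Cochain (Poly d) n}
    (h : ψ ∈ operators s M n) : symbolClass n ψ = 0 := by
  induction n generalizing M with
  | zero => omega
  | succ n ih =>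
    rw [symbolClass_succ]
    refine Finset.sum_eq_zero fun c _ => ?_
    cases M with
    | zero => rw [deltaX_eq_zero_of_order_zero c (by simpa using h), map_zero, map_zero]
    | succ M => rw [ih (by omega) (deltaX_mem c h), map_zero]

lemma deltaX_words_self (b : Fin d) (n : ℕ) (γ : PV (Poly d) d) :
    deltaX b n (words pd (n + 1) (n + 1) γ) = ((n : ℂ) + 1) • words pd n n (contr b γ) := by
  have hD : ∀ c : Fin d, (pd c (MvPolynomial.X b) - MvPolynomial.X b * pd c 1 : Poly d) =
      if b = c then 1 else 0 := by
    intro c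
    have := wordDeriv_pd_X b [c]
    rw [wordDeriv_cons, wordDeriv_cons, wordDeriv_nil, wordDeriv_nil] at this
    rw [this]
    simp [eq_comm]
  simp only [words_self, altWords_succ, preT_succ, map_sum]
  induction n generalizing γ with
  | zero =>
    simp only [deltaX, delta_cup_zero, hD, ite_smul, one_smul, zero_smul]
    rw [Finset.sum_ite_eq Finset.univ b]
    simp
  | succ n ih =>
    have h1 : ∀ c, deltaX b (n + 1) (cup (pd c) (altWords pd (n + 1) (n + 1) (contr c γ))) =
        (if b = c then altWords pd (n + 1) (n + 1) (contr c γ) else 0) +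
          ((n : ℂ) + 1) • cup (pd c) (altWords pd n n (contr c (contr b γ))) := by
      intro c
      rw [deltaX, delta_cup, hD, altWords_succ, preT_succ, map_sum, ih, contr_contr, map_neg, map_smul,
        map_neg]
      split_ifs <;> module
    rw [Finset.sum_congr rfl fun c _ => h1 c, Finset.sum_add_distrib,
      Finset.sum_ite_eq Finset.univ b, ← Finset.smul_sum, ← preT_succ, ← altWords_succ,
      if_pos (Finset.mem_univ b)]
    push_cast
    module

/-- One factor n! comes from the successive δ, and the other from Σ_c ∂_c ∧ ι_c, which multiplies by
the degree. -/
lemma symbolClass_words_self {n : ℕ} {s : Finset (Fin d)} {γ : PV (Poly d) d} (h : γ ∈ polyvecs s n) :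
    symbolClass n (words pd n n γ) = ((n.factorial : ℂ) ^ 2) • γ := by
  induction n generalizing γ with
  | zero =>
    have : (symbolClass 0 ∘ₗ words pd 0 0 - LinearMap.id : Module.End ℂ (PV (Poly d) d)) γ ∈ (⊥ : Submodule ℂ (PV (Poly d) d)) := by
      refine polyvecs_mapsTo _ _ (fun α w hα hw hℓ => ?_) h
      rw [List.eq_nil_of_length_eq_zero hℓ, LinearMap.sub_apply, LinearMap.comp_apply,
        symbolClass_zero, words_zero, unitFam_zero, polyvec_nil, augment_tmul]
      simp
    rw [Submodule.mem_bot, LinearMap.sub_apply, sub_eq_zero] at this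
    simpa using this
  | succ n ih =>
    rw [symbolClass_succ]
    have h1 : ∀ c, wedge c (symbolClass n (deltaX c n (words pd (n + 1) (n + 1) γ))) =
        (((n : ℂ) + 1) * (n.factorial : ℂ) ^ 2) • wedge c (contr c γ) := by
      intro c
      have hm : contr c γ ∈ polyvecs s (n + 1 - 1) := contr_mem c h
      rw [Nat.add_sub_cancel] at hm
      have e := ih hm
      rw [deltaX_words_self, map_smul, e, smul_smul, map_smul]
    rw [Finset.sum_congr rfl fun c _ => h1 c, ← Finset.smul_sum, sum_wedge_contr h, smul_smul]
    congr 1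
    rw [Nat.factorial_succ]
    push_cast
    ring

/-! ### Cocycles with vanishing class are coboundaries -/

/-- All n + 2 terms of the differential equal the product of all arguments, with alternating signs.
-/
lemma dHoch_const (a : Poly d) (n : ℕ) :
    dHoch n (fun f => a * ∏ i, f i) = if Even n then 0 else fun f : Fin (n + 1) → Poly d => a * ∏ i, f i := by
  have hc : ∀ n, (fun f : Fin (n + 1) → Poly d => a * ∏ i, f i) = cup 1 fun f => a * ∏ i, f i := by
    intro n
    funext f
    rw [cup_apply, Fin.prod_univ_succ, Module.End.one_apply]
    simp only [Fin.tail]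
    ring
  induction n with
  | zero => rw [dHoch_zero, if_pos Even.zero]
  | succ n ih =>
    rw [hc n, dHoch_cup_one, ih, ← hc n, hc (n + 1), hc n]
    simp only [Nat.even_add_one]
    by_cases h : Even n
    · simp [h]
    · simp [h]

lemma eq_dHoch_of_order_zero {n : ℕ} {s : Finset (Fin d)} {ψ : Cochain (Poly d) (n + 1)}
    (h : ψ ∈ operators s 0 (n + 1)) (hψ : dHoch (n + 1) ψ = 0) :
    ∃ χ ∈ operators s ⊤ n, ψ = dHoch n χ := by
  obtain ⟨Ψ, hΨ⟩ := mem_operators.mp h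
  obtain ⟨a, ha, he⟩ := exists_of_mem_pairs_zero hΨ
  have h1 : ψ = fun f => a * ∏ i, f i := by
    have e : ψ = (monomialPair a fun _ => []).1 := congrArg Prod.fst he
    rw [e]
    funext f
    simp [monomialPair, monomialOp]
  have h2 : (fun f => a * ∏ i, f i : Cochain (Poly d) n) ∈ operators s ⊤ n := by
    have e : (fun f => a * ∏ i, f i : Cochain (Poly d) n) = (monomialPair a fun _ : Fin n => []).1 := by
      funext f
      simp [monomialPair, monomialOp]
    rw [e]
    exact mem_operators.mpr ⟨_, ha ⊤⟩
  subst h1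
  rw [dHoch_const] at hψ
  by_cases hn : Even n
  · have h3 : ¬ Even (n + 1) := by simpa [Nat.even_add_one] using hn
    rw [if_neg h3] at hψ
    have := congrFun hψ 1
    refine ⟨0, zero_mem _, ?_⟩
    have h4 : a = 0 := by simpa using this
    subst h4
    rw [map_zero]
    funext f
    simp
  · exact ⟨_, h2, by rw [dHoch_const, if_neg hn]⟩

/-- For a cocycle ψ the homotopy formula says that the Euler operator applied to ψ is a coboundary
plus Σ_c ∂_c ∪ δ_c ψ. The δ_c ψ are cocycles with vanishing class and fewer arguments, hence
coboundaries, and so are their cup products with ∂_c. Thus Euler(ψ) is a coboundary; as it equals (M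
+ 1)ψ up to lower order, induction on the order finishes. -/
lemma eq_dHoch_of_symbolClass_eq_zero {n : ℕ} {s : Finset (Fin d)} {ψ : Cochain (Poly d) (n + 1)}
    (h : ψ ∈ operators s ⊤ (n + 1)) (hψ : dHoch (n + 1) ψ = 0) (hcl : symbolClass (n + 1) ψ = 0) :
    ∃ χ ∈ operators s ⊤ n, ψ = dHoch n χ := by
  have step : ∀ n, (∀ ψ ∈ operators s ⊤ (n + 1), dHoch (n + 1) ψ = 0 → symbolClass (n + 1) ψ = 0 →
      ∀ c, ∃ χ ∈ operators s ⊤ n, cup (pd c) (deltaX c n ψ) = dHoch n χ ∧ (c ∉ s → χ = 0)) →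
      ∀ ψ ∈ operators s ⊤ (n + 1), dHoch (n + 1) ψ = 0 → symbolClass (n + 1) ψ = 0 →
      ∃ χ ∈ operators s ⊤ n, ψ = dHoch n χ := by
    intro n hn ψ h hψ hcl
    obtain ⟨M, hM⟩ := exists_mem_operators h
    clear h
    induction M generalizing ψ with
    | zero => exact eq_dHoch_of_order_zero (by simpa using hM) hψ
    | succ M ih =>
      have h := operators_mono subset_rfl le_top hM
      choose χ hχ hχ' _ using hn ψ h hψ hcl
      have e := dHoch_homot (s := s) (isDiffRing_poly d) (operators_le_additiveCochains _ _ h)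
      rw [hψ, map_zero, add_zero] at e
      have e2 : eulerOp (AlgHom.id ℂ (Poly d)) pd s ψ =
          dHoch n (homotX s n ψ + ∑ c ∈ s, χ c) := by
        rw [map_add, map_sum, ← Finset.sum_congr rfl fun c _ => hχ' c, e]
        exact (sub_add_cancel _ _).symm
      have hmem : homotX s n ψ + ∑ c ∈ s, χ c ∈ operators s ⊤ n :=
        add_mem (homotX_mem h) (sum_mem fun c _ => hχ c)
      obtain ⟨χ', hχm, hχe⟩ := ih (eulerOp (AlgHom.id ℂ (Poly d)) pd s ψ - ((M + 1 : ℕ) : ℂ) • ψ)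
        (by rw [map_sub, map_smul, hψ, e2, dHoch_dHoch, smul_zero, sub_zero])
        (by rw [map_sub, map_smul, hcl, e2, symbolClass_dHoch, smul_zero, sub_zero])
        (eulerOp_sub_mem hM)
      -- The Euler operator applied to ψ is the coboundary of the bracket without χ', and its
      -- difference from (M + 1)ψ is the coboundary of χ'.
      refine ⟨((M + 1 : ℕ) : ℂ)⁻¹ • (homotX s n ψ + ∑ c ∈ s, χ c - χ'),
        Submodule.smul_mem _ _ (sub_mem hmem hχm), ?_⟩
      rw [map_smul, map_sub, ← e2, ← hχe, sub_sub_cancel, inv_smul_smul₀]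
      exact_mod_cast Nat.succ_ne_zero M
  have hclass : ∀ n (ψ : Cochain (Poly d) (n + 1)), symbolClass (n + 1) ψ = 0 → ∀ c,
      symbolClass n (deltaX c n ψ) = 0 := by
    intro n ψ hcl c
    have := contr_symbolClass c n ψ
    rw [hcl, map_zero, eq_comm, smul_eq_zero] at this
    exact this.resolve_left (by exact_mod_cast Nat.succ_ne_zero n)
  induction n with
  | zero =>
    -- With one argument, δ_c ψ is a constant cochain, so its vanishing class already says that it
    -- is zero.
    refine step 0 (fun ψ h hψ hcl c => ⟨0, zero_mem _, ?_, fun _ => rfl⟩) ψ h hψ hcl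
    have h1 := hclass 0 ψ hcl c
    rw [symbolClass_zero] at h1
    have h2 := congrArg augment h1
    rw [augment_tmul, map_one, one_smul, map_zero] at h2
    have h3 : deltaX c 0 ψ = 0 := funext fun f => by rw [Subsingleton.elim f ![]]; exact h2
    rw [h3, map_zero, map_zero]
  | succ n ih =>
    refine step (n + 1) (fun ψ h hψ hcl c => ?_) ψ h hψ hcl
    by_cases hc : c ∈ s
    · obtain ⟨χ, hχ, e⟩ := ih (deltaX_mem_top c h) (by
        have := delta_dHoch (MvPolynomial.X c) ψ
        rw [hψ, map_zero, eq_comm, neg_eq_zero] at this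
        exact this) (hclass _ ψ hcl c)
      have hm := cup_mem_operators (v := [c]) (N := ⊤) (by simpa using hc) le_top hχ
      have hw : wordDeriv pd [c] = pd (d := d) c := LinearMap.ext fun p => by
        rw [wordDeriv_cons, wordDeriv_nil]
      rw [hw] at hm
      refine ⟨-cup (pd c) χ, neg_mem hm, ?_, fun h => absurd hc h⟩
      rw [map_neg, dHoch_cup_derivation ((isDiffRing_poly d).leibniz c), neg_neg, e]
    · refine ⟨0, zero_mem _, ?_, fun _ => rfl⟩
      rw [deltaX_eq_zero_of_notMem hc h, map_zero, map_zero]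

/-- The Hochschild–Kostant–Rosenberg theorem. -/
theorem exists_eq_words_add_dHoch {n : ℕ} {s : Finset (Fin d)} {ψ : Cochain (Poly d) (n + 1)}
    (h : ψ ∈ operators s ⊤ (n + 1)) (hψ : dHoch (n + 1) ψ = 0) :
    ∃ γ ∈ polyvecs s (n + 1), ∃ χ ∈ operators s ⊤ n, ψ = words pd (n + 1) (n + 1) γ + dHoch n χ := by
  have hN : (((n + 1).factorial : ℂ) ^ 2) ≠ 0 :=
    pow_ne_zero _ (by exact_mod_cast Nat.factorial_ne_zero _)
  -- The factor normalizes `symbolClass_words_self`, so that ψ and the word of γ have the same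
  -- class.
  set γ := (((n + 1).factorial : ℂ) ^ 2)⁻¹ • symbolClass (n + 1) ψ with hγ
  have hγm : γ ∈ polyvecs s (n + 1) := Submodule.smul_mem _ _ (symbolClass_mem h)
  have hw : words pd (n + 1) (n + 1) γ ∈ operators s ⊤ (n + 1) := operators_mono subset_rfl le_top
    (mem_operators.mpr ⟨_, words_pair_mem (n + 1) (n + 1) (n + 1) (n + 1) (by omega) hγm⟩)
  obtain ⟨χ, hχ, e⟩ := eq_dHoch_of_symbolClass_eq_zero (sub_mem h hw)
    (by rw [map_sub, hψ, dHoch_words (isDiffRing_poly d), sub_zero])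
    (by rw [map_sub, symbolClass_words_self hγm, hγ, smul_inv_smul₀ hN, sub_self])
  exact ⟨γ, hγm, χ, hχ, by rw [← e]; abel⟩

/-! ### Consequences for functionals -/

lemma polyF_mem_top {s : Finset (Fin d)} {L n ℓ : ℕ} {γ : PV (Poly d) d} (hγ : γ ∈ polyvecs s ℓ) :
    polyF L n γ ∈ functionals s ⊤ n :=
  functionals_mono subset_rfl le_top (polyF_mem (M := 2 * L) (by omega) hγ)

lemma exists_eq_polyF_add_hochDiff {n : ℕ} {s : Finset (Fin d)} {F : Functional d (n + 1)}
    (h : F ∈ functionals s ⊤ (n + 1)) (hF : hochDiff F = 0) :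
    ∃ γ ∈ polyvecs s (n + 1), ∃ χ ∈ functionals s ⊤ n, F = polyF (n + 1) (n + 1) γ + hochDiff χ := by
  obtain ⟨ψ, hψ, hr⟩ := exists_represents_of_mem_functionals h
  have h0 : dHoch (n + 1) ψ = 0 := by
    have := hr.dHoch
    rw [hF] at this
    exact this.unique_operator Represents.zero
  obtain ⟨γ, hγ, χ, hχ, rfl⟩ := exists_eq_words_add_dHoch hψ h0
  obtain ⟨X, hX, hX'⟩ := exists_represents_of_mem_operators hχ
  exact ⟨γ, hγ, X, hX, hr.unique_functional ((represents_polyF hγ).add hX'.dHoch)⟩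

lemma exists_eq_polyF_zero {s : Finset (Fin d)} {F : Functional d 0}
    (h : F ∈ functionals s ⊤ 0) : ∃ γ ∈ polyvecs s 0, F = polyF 0 0 γ := by
  obtain ⟨ψ, hψ, hr⟩ := exists_represents_of_mem_functionals h
  refine ⟨symbolClass 0 ψ, symbolClass_mem hψ, hr.unique_functional ?_⟩
  have : ψ = words pd 0 0 (symbolClass 0 ψ) := by
    funext f
    rw [words_zero, unitFam_zero, symbolClass_zero, augment_tmul, map_one, one_smul,
      Subsingleton.elim f ![]]
  conv_lhs => rw [this]
  exact represents_polyF (symbolClass_mem hψ)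

/-- A cyclic combination that is a coboundary up to lower order has vanishing leading term. -/
lemma eq_zero_of_polyF_eq {n M : ℕ} {s : Finset (Fin d)} {γ : PV (Poly d) d} (hγ : γ ∈ polyvecs s n)
    {ψ : Cochain (Poly d) n} {G : Functional d n} (hM : M < n)
    (hG : G ∈ functionals s M n) (hψ : symbolClass n ψ = 0)
    (h : Represents ψ (polyF n n γ + G)) : γ = 0 := by
  have hN : ((n.factorial : ℂ) ^ 2) ≠ 0 :=
    pow_ne_zero _ (by exact_mod_cast Nat.factorial_ne_zero _)
  obtain ⟨φ, hφ, hr⟩ := exists_represents_of_mem_functionals hG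
  have h1 := h.unique_operator ((represents_polyF hγ).add hr)
  rw [h1, map_add, symbolClass_words_self hγ] at hψ
  rw [symbolClass_eq_zero hM hφ, add_zero, smul_eq_zero] at hψ
  exact hψ.resolve_left hN

end
end CyclicHKR

/-! ### Diagonalizable operators, the cyclic map on functionals, and its weights. -/

namespace CyclicHKR
noncomputable section
open scoped TensorProduct ContDiff

/-! ### Polynomials in diagonalizable operators -/

section Eigen

open Polynomial

variable {V : Type*} [AddCommGroup V] [Module ℂ V]

lemma aeval_of_eigenvector {T : Module.End ℂ V} {v : V} {μ : ℂ} (h : T v = μ • v) (q : ℂ[X]) :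
    aeval T q v = q.eval μ • v := by
  induction q using Polynomial.induction_on' with
  | add p q hp hq => rw [map_add, LinearMap.add_apply, hp, hq, eval_add, add_smul]
  | monomial k a =>
    rw [aeval_monomial, Module.algebraMap_end_eq_smul_id, eval_monomial]
    have : (T ^ k) v = μ ^ k • v := by
      induction k with
      | zero => simp
      | succ k ih => rw [pow_succ', Module.End.mul_apply, ih, map_smul, h, smul_smul, pow_succ]
    rw [Module.End.mul_apply, this, LinearMap.smul_apply, LinearMap.id_apply, smul_smul]

lemma aeval_mem {T : Module.End ℂ V} {N : Submodule ℂ V} (h : ∀ v ∈ N, T v ∈ N) (q : ℂ[X]) {v : V}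
    (hv : v ∈ N) : aeval T q v ∈ N := by
  induction q using Polynomial.induction_on' with
  | add p q hp hq => rw [map_add, LinearMap.add_apply]; exact add_mem hp hq
  | monomial k a =>
    rw [aeval_monomial, Module.algebraMap_end_eq_smul_id]
    refine Submodule.smul_mem _ _ ?_
    induction k with
    | zero => exact hv
    | succ k ih => rw [pow_succ', Module.End.mul_apply]; exact h _ ih

/-- The vectors `v` such that `v` has a component of eigenvalue `μ` for `T`, that is given by a
polynomial in `T`. -/
def decomposable (T : Module.End ℂ V) (μ : ℂ) : Submodule ℂ V where
  carrier := {v | ∃ q : ℂ[X], q.eval μ ≠ 0 ∧ T (aeval T q v) = μ • aeval T q v}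
  zero_mem' := ⟨1, by simp, by simp⟩
  add_mem' := by
    rintro v v' ⟨q, hq, h⟩ ⟨q', hq', h'⟩
    have hc : ∀ (p q : ℂ[X]) (v : V), aeval T (p * q) v = aeval T p (aeval T q v) := by
      intro p q v; rw [map_mul]; rfl
    have hT : ∀ (p : ℂ[X]) (v : V), T (aeval T p v) = aeval T p (T v) := by
      intro p v
      have h1 := hc X p v
      have h2 := hc p X v
      rw [mul_comm, h2, aeval_X] at h1
      exact h1.symm
    -- Polynomials in T commute, so the product of the two polynomials serves both vectors and is
    -- still nonzero at μ.
    refine ⟨q * q', by rw [eval_mul]; exact mul_ne_zero hq hq', ?_⟩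
    rw [map_add, map_add, smul_add]
    congr 1
    · rw [mul_comm q, hc, hT, h, map_smul]
    · rw [hc, hT, h', map_smul]
  smul_mem' := by
    rintro c v ⟨q, hq, h⟩
    refine ⟨q, hq, ?_⟩
    rw [map_smul, map_smul, h, smul_comm]

/-- If the eigenvalue is μ, the constant polynomial 1 works; otherwise X − ν kills v and does not
vanish at μ. -/
lemma mem_decomposable {T : Module.End ℂ V} {v : V} {ν : ℂ} (h : T v = ν • v) (μ : ℂ) :
    v ∈ decomposable T μ := by
  rcases eq_or_ne μ ν with rfl | hμ
  · exact ⟨1, by simp, by simp [h]⟩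
  · refine ⟨X - C ν, by simpa [sub_eq_zero] using hμ, ?_⟩
    have : aeval T (X - C ν) v = 0 := by
      rw [aeval_of_eigenvector h]; simp
    rw [this, map_zero, smul_zero]

/-- An eigenvector in the span of a set of eigenvectors is in the span of those with the same
eigenvalue. -/
lemma mem_span_eigenvectors {T : Module.End ℂ V} {S : Set V} (hS : ∀ v ∈ S, ∃ ν : ℂ, T v = ν • v)
    {v : V} (hv : v ∈ Submodule.span ℂ S) {μ : ℂ} (h : T v = μ • v) :
    v ∈ Submodule.span ℂ {v ∈ S | T v = μ • v} := by
  have key : ∃ y ∈ Submodule.span ℂ {v ∈ S | T v = μ • v}, ∃ q : ℂ[X], q.eval μ ≠ 0 ∧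
      aeval T q (v - y) = 0 := by
    clear h
    induction hv using Submodule.span_induction with
    | mem v hv =>
      obtain ⟨ν, hν⟩ := hS v hv
      rcases eq_or_ne μ ν with rfl | hμ
      · exact ⟨v, Submodule.subset_span ⟨hv, hν⟩, 1, by simp, by simp⟩
      · exact ⟨0, zero_mem _, X - C ν, by simpa [sub_eq_zero] using hμ, by
          rw [sub_zero, aeval_of_eigenvector hν]; simp⟩
    | zero => exact ⟨0, zero_mem _, 1, by simp, by simp⟩
    | add v v' _ _ h h' =>
      obtain ⟨y, hy, q, hq, e⟩ := h
      obtain ⟨y', hy', q', hq', e'⟩ := h'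
      refine ⟨y + y', add_mem hy hy', q * q', by rw [eval_mul]; exact mul_ne_zero hq hq', ?_⟩
      have e1 : aeval T (q * q') (v - y) = 0 := by
        rw [mul_comm, map_mul, Module.End.mul_apply, e, map_zero]
      have e2 : aeval T (q * q') (v' - y') = 0 := by
        rw [map_mul, Module.End.mul_apply, e', map_zero]
      rw [add_sub_add_comm, map_add, e1, e2, zero_add]
    | smul c v _ h =>
      obtain ⟨y, hy, q, hq, e⟩ := h
      exact ⟨c • y, Submodule.smul_mem _ c hy, q, hq, by rw [← smul_sub, map_smul, e, smul_zero]⟩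
  obtain ⟨y, hy, q, hq, e⟩ := key
  have hy' : T y = μ • y := by
    clear e
    induction hy using Submodule.span_induction with
    | mem v hv => exact hv.2
    | zero => simp
    | add v v' _ _ h h' => rw [map_add, h, h', smul_add]
    | smul c v _ h => rw [map_smul, h, smul_comm]
  rw [aeval_of_eigenvector (μ := μ) (by rw [map_sub, h, hy', smul_sub]), smul_eq_zero] at e
  rw [sub_eq_zero.mp (e.resolve_left hq)]
  exact hy

end Eigen

variable {d : ℕ}

/-! ### Polyvectors with powers of `u` -/

/-- The space `∑_k T_poly u^k` of elements of degree `n` in the variables in `s`; the value of a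
sequence at `k` is the coefficient of `u^k`. -/
def uPolyvecs (s : Finset (Fin d)) (n : ℕ) : Submodule ℂ (ℕ → PV (Poly d) d) where
  carrier := {x | ∀ k, (2 * k ≤ n → x k ∈ polyvecs s (n - 2 * k)) ∧ (n < 2 * k → x k = 0)}
  zero_mem' k := ⟨fun _ => zero_mem _, fun _ => rfl⟩
  add_mem' {x y} hx hy k := ⟨fun h => add_mem ((hx k).1 h) ((hy k).1 h), fun h => by
    rw [Pi.add_apply, (hx k).2 h, (hy k).2 h, add_zero]⟩
  smul_mem' c x hx k := ⟨fun h => Submodule.smul_mem _ c ((hx k).1 h), fun h => by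
    rw [Pi.smul_apply, (hx k).2 h, smul_zero]⟩

/-- The differential `u · div`. -/
def uDivg : Module.End ℂ (ℕ → PV (Poly d) d) where
  toFun x k := Nat.casesOn k 0 fun k => divg pd (x k)
  map_add' x y := by funext k; cases k <;> simp
  map_smul' c x := by funext k; cases k <;> simp

lemma uDivg_zero (x : ℕ → PV (Poly d) d) : uDivg x 0 = 0 := rfl

lemma uDivg_succ (x : ℕ → PV (Poly d) d) (k : ℕ) : uDivg x (k + 1) = divg pd (x k) := rfl

lemma uDivg_uDivg (x : ℕ → PV (Poly d) d) : uDivg (uDivg x) = 0 := by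
  funext k
  match k with
  | 0 => rfl
  | 1 => exact map_zero (divg pd)
  | k + 2 => exact divg_divg (isDiffRing_poly d) _

lemma uDivg_mem {s : Finset (Fin d)} {n : ℕ} {x : ℕ → PV (Poly d) d} (hx : x ∈ uPolyvecs s n) :
    uDivg x ∈ uPolyvecs s (n + 1) := by
  intro k
  cases k with
  | zero => exact ⟨fun _ => zero_mem _, fun h => by omega⟩
  | succ k =>
    rw [uDivg_succ]
    refine ⟨fun h => ?_, fun h => ?_⟩
    · have := divg_mem ((hx k).1 (by omega))
      rwa [show n - 2 * k - 1 = n + 1 - 2 * (k + 1) by omega] at this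
    · rcases Nat.lt_or_ge n (2 * k) with h1 | h1
      · rw [(hx k).2 h1, map_zero]
      · have := (hx k).1 h1
        rw [show n - 2 * k = 0 by omega] at this
        exact divg_eq_zero_of_degree_zero this

/-- The cyclic Hochschild–Kostant–Rosenberg map, with values in functionals. -/
def cyclicMap (n : ℕ) : (ℕ → PV (Poly d) d) →ₗ[ℂ] Functional d n :=
  ∑ k ∈ Finset.range (n + 1), ((k.factorial : ℂ) / (n.factorial * (n + 1))) •
    cycNorm ∘ₗ polyF (n - k) n ∘ₗ
      (LinearMap.proj k : (ℕ → PV (Poly d) d) →ₗ[ℂ] PV (Poly d) d)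

/-- The coefficient of u^k has degree n − 2k; with its k pairs the words have n − k symbols. The
weight joins k!/n! from φ̃ with the 1/(n + 1) of the cyclic average. -/
lemma cyclicMap_apply (n : ℕ) (x : ℕ → PV (Poly d) d) : cyclicMap n x =
    ∑ k ∈ Finset.range (n + 1), ((k.factorial : ℂ) / (n.factorial * (n + 1))) •
      cycNorm (polyF (n - k) n (x k)) := by
  rw [cyclicMap, LinearMap.sum_apply]; rfl

lemma cyc_cyclicMap (n : ℕ) (x : ℕ → PV (Poly d) d) : cyc (cyclicMap n x) = cyclicMap n x := by
  rw [cyclicMap_apply, map_sum]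
  exact Finset.sum_congr rfl fun k _ => by rw [map_smul, cyc_cycNorm]

/-- For L = n − k the factor in `hochDiff_cycNorm_polyF` is (k + 1)/(n + 2), precisely the ratio of
the weights of u^{k+1} in degree n + 1 and of u^k in degree n. -/
lemma hochDiff_cyclicMap (n : ℕ) (x : ℕ → PV (Poly d) d) :
    hochDiff (cyclicMap n x) = cyclicMap (n + 1) (uDivg x) := by
  rw [cyclicMap_apply, cyclicMap_apply, Finset.sum_range_succ' _ (n + 1), uDivg_zero]
  simp only [map_zero, smul_zero, add_zero, map_sum]
  refine Finset.sum_congr rfl fun k hk => ?_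
  rw [Finset.mem_range] at hk
  have h := hochDiff_cycNorm_polyF (n - k) n (x k)
  rw [Nat.cast_sub (by omega)] at h
  have h2 : ((n : ℂ) + 2) ≠ 0 := by exact_mod_cast Nat.succ_ne_zero (n + 1)
  have h1 : ((n : ℂ) + 1) ≠ 0 := by exact_mod_cast Nat.succ_ne_zero n
  have h0 : (n.factorial : ℂ) ≠ 0 := by exact_mod_cast Nat.factorial_ne_zero n
  rw [map_smul, uDivg_succ, show n + 1 - (k + 1) = n - k by omega]
  rw [← inv_smul_smul₀ h2 (hochDiff _), h, smul_smul, smul_smul, Nat.factorial_succ,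
    Nat.factorial_succ]
  congr 1
  have h3 : (n : ℂ) + 1 + 1 = n + 2 := by ring
  push_cast
  rw [h3]
  field_simp
  ring

/-- Functionals that are invariant under cyclic rotations. -/
def cyclicFunctionals (s : Finset (Fin d)) (n : ℕ) : Submodule ℂ (Functional d n) :=
  functionals s ⊤ n ⊓ LinearMap.ker (cyc - 1)

lemma mem_cyclicFunctionals {s : Finset (Fin d)} {n : ℕ} {F : Functional d n} :
    F ∈ cyclicFunctionals s n ↔ F ∈ functionals s ⊤ n ∧ cyc F = F := by
  rw [cyclicFunctionals, Submodule.mem_inf, LinearMap.mem_ker, LinearMap.sub_apply, sub_eq_zero]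
  rfl

lemma cyclicMap_mem {s : Finset (Fin d)} {n : ℕ} {x : ℕ → PV (Poly d) d} (hx : x ∈ uPolyvecs s n) :
    cyclicMap n x ∈ cyclicFunctionals s n := by
  refine mem_cyclicFunctionals.mpr ⟨?_, cyc_cyclicMap n x⟩
  rw [cyclicMap_apply]
  refine sum_mem fun k _ => Submodule.smul_mem _ _ (cycNorm_mem ?_)
  rcases Nat.lt_or_ge n (2 * k) with h | h
  · rw [(hx k).2 h, map_zero]; exact zero_mem _
  · exact polyF_mem_top ((hx k).1 h)

lemma hochDiff_mem_cyclicFunctionals {s : Finset (Fin d)} {n : ℕ} {F : Functional d n}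
    (h : F ∈ cyclicFunctionals s n) : hochDiff F ∈ cyclicFunctionals s (n + 1) := by
  rw [mem_cyclicFunctionals] at h ⊢
  exact ⟨hochDiff_mem h.1, cyc_hochDiff h.2⟩

lemma hochDiff_hochDiff {s : Finset (Fin d)} {n : ℕ} {F : Functional d n}
    (h : F ∈ functionals s ⊤ n) : hochDiff (hochDiff F) = 0 := by
  obtain ⟨ψ, _, hr⟩ := exists_represents_of_mem_functionals h
  have := hr.dHoch.dHoch
  rw [dHoch_dHoch] at this
  exact this.unique_functional Represents.zero

/-! ### Symmetries of the cyclic map -/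

lemma lieE_cyclicMap (c : Fin d) (n : ℕ) (x : ℕ → PV (Poly d) d) :
    lieE c (cyclicMap n x) = cyclicMap n fun k => eulerPV c (x k) := by
  rw [cyclicMap_apply, cyclicMap_apply, map_sum]
  exact Finset.sum_congr rfl fun k _ => by rw [map_smul, totalAction_cycNorm, lieE_polyF]

lemma lieD_cyclicMap (c : Fin d) (n : ℕ) (x : ℕ → PV (Poly d) d) :
    lieD c (cyclicMap n x) = -cyclicMap n fun k => onCoeff (pd c) (x k) := by
  rw [cyclicMap_apply, cyclicMap_apply, map_sum, ← Finset.sum_neg_distrib]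
  exact Finset.sum_congr rfl fun k _ => by
    rw [map_smul, totalAction_cycNorm, lieD_polyF, map_neg, smul_neg]

lemma divg_eulerPV (c : Fin d) (γ : PV (Poly d) d) :
    divg pd (eulerPV c γ) = eulerPV c (divg pd γ) := by
  rw [eulerPV_eq, eulerPV_eq, map_neg, map_add, divg_divg (isDiffRing_poly d),
    divg_divg (isDiffRing_poly d)]
  simp

lemma divg_onCoeff_pd (c : Fin d) (γ : PV (Poly d) d) :
    divg pd (onCoeff (pd c) γ) = onCoeff (pd c) (divg pd γ) := by
  rw [divg_apply, divg_apply, map_sum]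
  refine Finset.sum_congr rfl fun b _ => ?_
  rw [← onCoeff_contr, onCoeff_onCoeff, onCoeff_onCoeff]
  rw [show pd b ∘ₗ pd c = pd c ∘ₗ pd b from LinearMap.ext fun p => pderiv_comm b c p]

lemma uDivg_eulerPV (c : Fin d) (x : ℕ → PV (Poly d) d) :
    uDivg (fun k => eulerPV c (x k)) = fun k => eulerPV c (uDivg x k) := by
  funext k
  cases k with
  | zero => exact (map_zero (eulerPV c)).symm
  | succ k => exact divg_eulerPV c _

lemma uDivg_onCoeff_pd (c : Fin d) (x : ℕ → PV (Poly d) d) :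
    uDivg (fun k => onCoeff (pd c) (x k)) = fun k => onCoeff (pd c) (uDivg x k) := by
  funext k
  cases k with
  | zero => exact (map_zero (onCoeff (pd c))).symm
  | succ k => exact divg_onCoeff_pd c _

lemma eulerPV_mem {s : Finset (Fin d)} {ℓ : ℕ} (c : Fin d) {γ : PV (Poly d) d}
    (h : γ ∈ polyvecs s ℓ) : eulerPV c γ ∈ polyvecs s ℓ := by
  refine polyvecs_mapsTo _ _ (fun α w hα hw hℓ => ?_) h
  rw [eulerPV_polyvec, ← hℓ]
  exact Submodule.smul_mem _ _ (polyvec_mem hα hw)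

lemma uPolyvecs_map {s t : Finset (Fin d)} {n : ℕ} {T : Module.End ℂ (PV (Poly d) d)}
    (hT : ∀ ℓ γ, γ ∈ polyvecs s ℓ → T γ ∈ polyvecs t ℓ) {x : ℕ → PV (Poly d) d}
    (hx : x ∈ uPolyvecs s n) : (fun k => T (x k)) ∈ uPolyvecs t n := fun k =>
  ⟨fun h => hT _ _ ((hx k).1 h), fun h => by
    change T (x k) = 0
    rw [(hx k).2 h, map_zero]⟩

/-! ### Antiderivatives -/

lemma exists_onCoeff_pd_eq {s : Finset (Fin d)} {c : Fin d} (hc : c ∈ s) {ℓ : ℕ} {γ : PV (Poly d) d}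
    (h : γ ∈ polyvecs s ℓ) : ∃ γ' ∈ polyvecs s ℓ, onCoeff (pd c) γ' = γ := by
  refine polyvecs_mapsTo LinearMap.id ((polyvecs s ℓ).map (onCoeff (pd c))) (fun α w hα hw hℓ => ?_) h
  refine ⟨((α c : ℂ) + 1)⁻¹ • polyvec (α + Finsupp.single c 1) w,
    Submodule.smul_mem _ _ (hℓ ▸ polyvec_mem (support_add_single hc hα) hw), ?_⟩
  rw [map_smul, onCoeff_pd_polyvec, add_tsub_cancel_right, smul_smul]
  have h1 : ((α c : ℂ) + 1) ≠ 0 := by exact_mod_cast Nat.succ_ne_zero (α c)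
  simp [inv_mul_cancel₀ h1]

/-- Up to a nonzero factor, raising the exponent of x_c in the coefficient gives an antiderivative.
It need not be cyclic, but averaging it is harmless, since ∂_c commutes with rotations and the given
functional is cyclic. -/
lemma exists_lieD_eq {s : Finset (Fin d)} {c : Fin d} (hc : c ∈ s) {n : ℕ} {F : Functional d n}
    (h : F ∈ cyclicFunctionals s n) : ∃ G ∈ cyclicFunctionals s n, lieD c G = F := by
  rw [mem_cyclicFunctionals] at h
  have h1 : ((n : ℂ) + 1) ≠ 0 := by exact_mod_cast Nat.succ_ne_zero n
  obtain ⟨G, hG, rfl⟩ : F ∈ (functionals s ⊤ n).map (lieD c) := by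
    refine functionals_mapsTo LinearMap.id _ (fun α w hw => ?_) h.1
    have hm : Admissible s ⊤ (α + Finsupp.single c 1) w :=
      ⟨support_add_single hc hw.support, hw.letters, le_top⟩
    refine ⟨-((α c : ℂ) + 1)⁻¹ • wordFunctional (MvPolynomial.monomial (α + Finsupp.single c 1) 1) w,
      Submodule.smul_mem _ _ (wordFunctional_mem hm), ?_⟩
    rw [map_smul, lieD_wordFunctional_monomial, add_tsub_cancel_right, smul_smul]
    have h1 : ((α c : ℂ) + 1) ≠ 0 := by exact_mod_cast Nat.succ_ne_zero (α c)
    simp only [Finsupp.add_apply, Finsupp.single_eq_same, Nat.cast_add, Nat.cast_one, neg_mul_neg,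
      inv_mul_cancel₀ h1, one_smul, LinearMap.id_apply]
  refine ⟨((n : ℂ) + 1)⁻¹ • cycNorm G, mem_cyclicFunctionals.mpr
    ⟨Submodule.smul_mem _ _ (cycNorm_mem hG), by rw [map_smul, cyc_cycNorm]⟩, ?_⟩
  rw [map_smul, totalAction_cycNorm, cycNorm_of_cyclic h.2, inv_smul_smul₀ h1]

/-! ### Elements that do not involve a variable -/

lemma onCoeff_pd_eq_zero {s : Finset (Fin d)} {c : Fin d} (hc : c ∉ s) {ℓ : ℕ} {γ : PV (Poly d) d}
    (h : γ ∈ polyvecs s ℓ) : onCoeff (pd c) γ = 0 := by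
  rw [← Submodule.mem_bot ℂ]
  refine polyvecs_mapsTo _ _ (fun α w hα hw hℓ => ?_) h
  rw [onCoeff_pd_polyvec, Finsupp.notMem_support_iff.mp fun h => hc (hα h)]
  simp

lemma eulerPV_eq_neg {s : Finset (Fin d)} {c : Fin d} (hc : c ∉ s) {ℓ : ℕ} {γ : PV (Poly d) d}
    (h : γ ∈ polyvecs s ℓ) : eulerPV c γ = -γ := by
  rw [eulerPV_apply, contr_eq_zero hc h, ← onCoeff_onCoeff, onCoeff_pd_eq_zero hc h]
  simp

/-- Vanishing derivative means that only monomials with α_c = 0 occur. The weight, the number of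
factors ∂_c minus α_c minus 1, is then −1 only if ∂_c does not occur either. -/
lemma mem_polyvecs_erase {s : Finset (Fin d)} {c : Fin d} {ℓ : ℕ} {γ : PV (Poly d) d}
    (h : γ ∈ polyvecs s ℓ) (h0 : onCoeff (pd c) γ = 0) (h1 : eulerPV c γ = -γ) :
    γ ∈ polyvecs (s.erase c) ℓ := by
  have hxd : ∀ (α : Fin d →₀ ℕ) (w : List (Fin d)),
      (onCoeff (mulX c) ∘ₗ onCoeff (pd c)) (polyvec α w) = (α c : ℂ) • polyvec α w := by
    intro α w
    rw [LinearMap.comp_apply, onCoeff_pd_polyvec, map_smul, onCoeff_mulX_polyvec]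
    rcases Nat.eq_zero_or_pos (α c) with h | h
    · rw [h]; simp
    · rw [tsub_add_cancel_of_le (Finsupp.single_le_iff.mpr h)]
  have hxd0 : (onCoeff (mulX c) ∘ₗ onCoeff (pd c)) γ = (0 : ℂ) • γ := by
    rw [LinearMap.comp_apply, h0, map_zero, zero_smul]
  have h2 := mem_span_eigenvectors (T := onCoeff (mulX c) ∘ₗ onCoeff (pd c)) (by
    rintro _ ⟨α, w, -, -, -, rfl⟩
    exact ⟨_, hxd α w⟩) h hxd0
  have h3 := mem_span_eigenvectors (T := eulerPV c) (by
    rintro _ ⟨⟨α, w, -, -, -, rfl⟩, -⟩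
    exact ⟨_, eulerPV_polyvec c α w⟩) h2 (show eulerPV c γ = (-1 : ℂ) • γ by rw [h1, neg_one_smul])
  refine (Submodule.span_le.mpr ?_) h3
  rintro v ⟨⟨⟨α, w, hα, hw, rfl, rfl⟩, hv⟩, hv'⟩
  by_cases hz : polyvec α w = 0
  · rw [hz]; exact zero_mem _
  rw [hxd, ← sub_eq_zero, ← sub_smul, smul_eq_zero, or_iff_left hz, sub_zero] at hv
  rw [eulerPV_polyvec, hv, ← sub_eq_zero, ← sub_smul, smul_eq_zero, or_iff_left hz] at hv'
  have hcount : w.count c = 0 := by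
    have : (w.count c : ℂ) = 0 := by linear_combination hv'
    exact_mod_cast this
  have hαc : α c = 0 := by exact_mod_cast hv
  exact polyvec_mem (fun i hi => Finset.mem_erase.mpr ⟨fun h => by
      rw [h, Finsupp.mem_support_iff] at hi; exact hi hαc, hα hi⟩)
    (fun b hb => Finset.mem_erase.mpr ⟨fun h => List.count_eq_zero.mp hcount (h ▸ hb), hw b hb⟩)

lemma lieD_eq_zero {s : Finset (Fin d)} {c : Fin d} (hc : c ∉ s) {n : ℕ} {F : Functional d n}
    (h : F ∈ functionals s ⊤ n) : lieD c F = 0 := by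
  rw [← Submodule.mem_bot ℂ]
  refine functionals_mapsTo _ _ (fun α w hw => ?_) h
  rw [lieD_wordFunctional_monomial, Finsupp.notMem_support_iff.mp fun h => hc (hw.support h)]
  simp

lemma lieE_eq_neg {s : Finset (Fin d)} {c : Fin d} (hc : c ∉ s) {n : ℕ} {F : Functional d n}
    (h : F ∈ functionals s ⊤ n) : lieE c F = -F := by
  have : (lieE c + LinearMap.id : Module.End ℂ (Functional d n)) F ∈ (⊥ : Submodule ℂ (Functional d n)) := by
    refine functionals_mapsTo _ _ (fun α w hw => ?_) h
    have h1 : letterCount c w = 0 := Finset.sum_eq_zero fun i _ =>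
      List.count_eq_zero.mpr fun h => hc (hw.letters i c h)
    rw [LinearMap.add_apply, lieE_wordFunctional_monomial, h1,
      Finsupp.notMem_support_iff.mp fun h => hc (hw.support h)]
    simp
  rw [Submodule.mem_bot, LinearMap.add_apply] at this
  exact eq_neg_of_add_eq_zero_left this

/-- With no derivatives on the first argument, multiplying that argument by x_c multiplies the
coefficient without correction terms. So these generators are simultaneous eigenvectors of the
operators used in `mem_functionals_erase`. -/
lemma functionals_eq_span (s : Finset (Fin d)) (n : ℕ) : functionals s ⊤ n =
    Submodule.span ℂ {F | ∃ (α : Fin d →₀ ℕ) (w : Fin n → List (Fin d)), Admissible s ⊤ α w ∧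
      F = wordFunctional (MvPolynomial.monomial α 1) (Fin.cons [] w : Fin (n + 1) → List (Fin d))} := by
  apply le_antisymm
  · rw [functionals_eq_map]
    rintro _ ⟨P, hP, rfl⟩
    refine pairs_mapsTo (toFunctional ∘ₗ LinearMap.snd ℂ _ _) _ (fun α w hw => ?_) hP
    exact Submodule.subset_span ⟨α, w, hw, toFunctional_monomialOp _ _⟩
  · rw [Submodule.span_le]
    rintro _ ⟨α, w, hw, rfl⟩
    exact wordFunctional_mem ⟨hw.support, fun i => by
      refine Fin.cases ?_ (fun i => ?_) i
      · simp
      · simpa using hw.letters i, le_top⟩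

lemma mem_functionals_erase {s : Finset (Fin d)} {c : Fin d} {n : ℕ} {F : Functional d n}
    (h : F ∈ functionals s ⊤ n) (h0 : lieD c F = 0) (h1 : lieE c F = -F) :
    F ∈ functionals (s.erase c) ⊤ n := by
  have hxd : ∀ (α : Fin d →₀ ℕ) (w : Fin n → List (Fin d)),
      (plug (Test.X c) 0 ∘ₗ lieD c) (wordFunctional (MvPolynomial.monomial α 1)
        (Fin.cons [] w : Fin (n + 1) → List (Fin d))) =
      (-(α c : ℂ)) • wordFunctional (MvPolynomial.monomial α 1)
        (Fin.cons [] w : Fin (n + 1) → List (Fin d)) := by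
    intro α w
    rw [LinearMap.comp_apply, lieD_wordFunctional_monomial, map_smul]
    rcases Nat.eq_zero_or_pos (α c) with h | h
    · rw [h]; simp
    · rw [plug_X_wordFunctional, X_mul_monomial,
        tsub_add_cancel_of_le (Finsupp.single_le_iff.mpr h)]
      simp
  have hxd0 : (plug (Test.X c) 0 ∘ₗ lieD c) F = (0 : ℂ) • F := by
    rw [LinearMap.comp_apply, h0, map_zero, zero_smul]
  rw [functionals_eq_span] at h ⊢
  have h2 := mem_span_eigenvectors (T := plug (Test.X c) 0 ∘ₗ lieD c) (by
    rintro _ ⟨α, w, -, rfl⟩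
    exact ⟨_, hxd α w⟩) h hxd0
  have h3 := mem_span_eigenvectors (T := lieE c) (by
    rintro _ ⟨⟨α, w, -, rfl⟩, -⟩
    exact ⟨_, lieE_wordFunctional_monomial c α _⟩) h2
    (show lieE c F = (-1 : ℂ) • F by rw [h1, neg_one_smul])
  refine (Submodule.span_le.mpr ?_) h3
  rintro v ⟨⟨⟨α, w, hw, rfl⟩, hv⟩, hv'⟩
  by_cases hz : wordFunctional (MvPolynomial.monomial α 1)
      (Fin.cons [] w : Fin (n + 1) → List (Fin d)) = 0
  · rw [hz]; exact zero_mem _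
  rw [hxd, ← sub_eq_zero, ← sub_smul, smul_eq_zero, or_iff_left hz, sub_zero, neg_eq_zero] at hv
  rw [lieE_wordFunctional_monomial, hv, ← sub_eq_zero, ← sub_smul, smul_eq_zero, or_iff_left hz] at hv'
  have hcount : letterCount c (Fin.cons [] w : Fin (n + 1) → List (Fin d)) = 0 := by
    have : (letterCount c (Fin.cons [] w : Fin (n + 1) → List (Fin d)) : ℂ) = 0 := by
      linear_combination hv'
    exact_mod_cast this
  have hαc : α c = 0 := by exact_mod_cast hv
  rw [letterCount, Finset.sum_eq_zero_iff] at hcount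
  refine Submodule.subset_span ⟨α, w, ⟨fun i hi => Finset.mem_erase.mpr ⟨fun h => ?_,
    hw.support hi⟩, fun i b hb => Finset.mem_erase.mpr ⟨fun h => ?_, hw.letters i b hb⟩, le_top⟩, rfl⟩
  · rw [h, Finsupp.mem_support_iff] at hi
    exact hi hαc
  · have := hcount i.succ (Finset.mem_univ _)
    rw [Fin.cons_succ] at this
    exact List.count_eq_zero.mp this (h ▸ hb)

end
end CyclicHKR

/-! ### Acyclicity of the mapping cone by induction on the variables. -/

namespace CyclicHKR
noncomputable section
open scoped TensorProduct ContDiff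

variable {d n : ℕ}

/-! ### The mapping cone of the cyclic map -/

/-- The mapping cone of the cyclic map. -/
abbrev Cone (d n : ℕ) : Type := (ℕ → PV (Poly d) d) × Functional d n

/-- The Euler operator on the cone. -/
def coneE (c : Fin d) : Module.End ℂ (Cone d n) := ((eulerPV c).compLeft ℕ).prodMap (lieE c)

/-- The derivative of the coefficients on the cone. -/
def coneD (c : Fin d) : Module.End ℂ (Cone d n) := ((onCoeff (pd c)).compLeft ℕ).prodMap (-lieD c)

lemma coneE_apply (c : Fin d) (z : Cone d n) :
    coneE c z = (fun k => eulerPV c (z.1 k), lieE c z.2) := rfl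

lemma coneD_apply (c : Fin d) (z : Cone d n) :
    coneD c z = (fun k => onCoeff (pd c) (z.1 k), -lieD c z.2) := rfl

/-- The cochains of the cone in the variables in `s`. -/
def cone (s : Finset (Fin d)) (n : ℕ) : Submodule ℂ (Cone d n) :=
  (uPolyvecs s (n + 1)).prod (cyclicFunctionals s n)

/-- The cocycles of the cone. -/
def coneCocycles (s : Finset (Fin d)) (n : ℕ) : Submodule ℂ (Cone d n) :=
  cone s n ⊓ (LinearMap.ker (uDivg ∘ₗ LinearMap.fst ℂ _ _) ⊓
    LinearMap.ker (cyclicMap (n + 1) ∘ₗ LinearMap.fst ℂ _ _ - hochDiff ∘ₗ LinearMap.snd ℂ _ _))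

lemma mem_coneCocycles {s : Finset (Fin d)} {z : Cone d n} : z ∈ coneCocycles s n ↔
    z ∈ cone s n ∧ uDivg z.1 = 0 ∧ cyclicMap (n + 1) z.1 = hochDiff z.2 := by
  rw [coneCocycles, Submodule.mem_inf, Submodule.mem_inf, LinearMap.mem_ker, LinearMap.mem_ker,
    LinearMap.sub_apply, sub_eq_zero]
  rfl

/-- The coboundaries of cyclic functionals. -/
def cyclicCoboundaries (s : Finset (Fin d)) : (n : ℕ) → Submodule ℂ (Functional d n)
  | 0 => ⊥
  | n + 1 => (cyclicFunctionals s n).map hochDiff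

/-- The coboundaries of the cone. -/
def coneCoboundaries (s : Finset (Fin d)) (n : ℕ) : Submodule ℂ (Cone d n) where
  carrier := {z | ∃ y ∈ uPolyvecs s n, ∃ G ∈ cyclicCoboundaries s n,
    z = (uDivg y, cyclicMap n y + G)}
  zero_mem' := ⟨0, zero_mem _, 0, zero_mem _, Prod.ext (map_zero _).symm (by simp)⟩
  add_mem' := by
    rintro _ _ ⟨y, hy, G, hG, rfl⟩ ⟨y', hy', G', hG', rfl⟩
    refine ⟨y + y', add_mem hy hy', G + G', add_mem hG hG', ?_⟩
    rw [map_add, map_add, Prod.mk_add_mk]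
    congr 1
    abel
  smul_mem' := by
    rintro c _ ⟨y, hy, G, hG, rfl⟩
    refine ⟨c • y, Submodule.smul_mem _ c hy, c • G, Submodule.smul_mem _ c hG, ?_⟩
    rw [map_smul, map_smul, Prod.smul_mk, smul_add]

lemma coneE_mem_cone {s : Finset (Fin d)} {c : Fin d} (hc : c ∈ s) {z : Cone d n} (h : z ∈ cone s n) :
    coneE c z ∈ cone s n := by
  obtain ⟨h1, h2⟩ := h
  rw [SetLike.mem_coe, mem_cyclicFunctionals] at h2
  refine ⟨uPolyvecs_map (fun ℓ γ hγ => eulerPV_mem c hγ) h1, ?_⟩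
  rw [SetLike.mem_coe, mem_cyclicFunctionals, coneE_apply]
  exact ⟨lieE_mem hc h2.1, by rw [← totalAction_cyc, h2.2]⟩

lemma coneE_mem_coneCocycles {s : Finset (Fin d)} {c : Fin d} (hc : c ∈ s) {z : Cone d n}
    (h : z ∈ coneCocycles s n) : coneE c z ∈ coneCocycles s n := by
  rw [mem_coneCocycles] at h ⊢
  obtain ⟨h1, h2, h3⟩ := h
  refine ⟨coneE_mem_cone hc h1, ?_, ?_⟩
  · rw [coneE_apply, uDivg_eulerPV, h2]
    exact funext fun k => map_zero (eulerPV c)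
  · rw [coneE_apply, ← lieE_cyclicMap, h3, lieE,
      totalAction_hochDiff (Test.XD_mul c) (mem_cyclicFunctionals.mp h1.2).1]

lemma lieD_mem_cyclicCoboundaries {s : Finset (Fin d)} {c : Fin d} (hc : c ∈ s) {G : Functional d n}
    (h : G ∈ cyclicCoboundaries s n) : lieD c G ∈ cyclicCoboundaries s n := by
  cases n with
  | zero =>
    rw [(Submodule.mem_bot ℂ).mp h, map_zero]
    exact zero_mem _
  | succ n =>
    obtain ⟨F, hF, rfl⟩ := h
    have hF' := mem_cyclicFunctionals.mp hF
    rw [lieD, totalAction_hochDiff (Test.D_mul c) hF'.1]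
    exact ⟨_, mem_cyclicFunctionals.mpr ⟨lieD_mem hc hF'.1, by rw [← totalAction_cyc, hF'.2]⟩, rfl⟩

/-- The minus sign on the functional part of `coneD` is forced by `lieD_cyclicMap`; with it the
derivative commutes with the cyclic map. -/
lemma coneD_mem_coneCoboundaries {s : Finset (Fin d)} {c : Fin d} (hc : c ∈ s) {z : Cone d n}
    (h : z ∈ coneCoboundaries s n) : coneD c z ∈ coneCoboundaries s n := by
  obtain ⟨y, hy, G, hG, rfl⟩ := h
  refine ⟨fun k => onCoeff (pd c) (y k), uPolyvecs_map (fun ℓ γ hγ => onCoeff_pd_mem c hγ) hy,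
    -lieD c G, neg_mem (lieD_mem_cyclicCoboundaries hc hG), ?_⟩
  rw [coneD_apply, uDivg_onCoeff_pd, map_add, lieD_cyclicMap, neg_add, neg_neg]

/-! ### The Euler operator squared is null-homotopic on cocycles -/

/-- Rotating an alternating word changes it by a word of the divergence, which has one derivative
fewer or more lost; so the word is cyclic modulo lower order. -/
lemma cycNorm_polyF_self_sub_mem {s : Finset (Fin d)} {γ : PV (Poly d) d}
    (hγ : γ ∈ polyvecs s (n + 1)) : cycNorm (polyF (n + 1) (n + 1) γ) -
      (((n + 1 : ℕ) : ℂ) + 1) • polyF (n + 1) (n + 1) γ ∈ functionals s n (n + 1) := by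
  set F := polyF (n + 1) (n + 1) γ with hF
  have h1 : cyc F - F ∈ functionals s n (n + 1) := by
    rw [hF, polyF_apply, cyc_wordsF_self, add_sub_cancel_left, ← onCoeff_divg]
    exact intF_words_mem (by omega) (divg_mem hγ)
  have h2 : ∀ j, (cyc ^ j) F - F ∈ functionals s n (n + 1) := by
    intro j
    induction j with
    | zero => rw [pow_zero, Module.End.one_apply, sub_self]; exact zero_mem _
    | succ j ih =>
      have : (cyc ^ (j + 1)) F - F = (cyc ^ j) (cyc F - F) + ((cyc ^ j) F - F) := by
        rw [map_sub, pow_succ, Module.End.mul_apply]; abel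
      rw [this]
      exact add_mem (cyc_pow_mem h1 j) ih
  have h3 : cycNorm F - (((n + 1 : ℕ) : ℂ) + 1) • F =
      ∑ j ∈ Finset.range (n + 1 + 1), ((cyc ^ j) F - F) := by
    rw [cycNorm_apply, Finset.sum_sub_distrib, Finset.sum_const, Finset.card_range,
      ← Nat.cast_smul_eq_nsmul ℂ]
    push_cast
    rfl
  rw [h3]
  exact sum_mem fun j _ => h2 j

/-- The coefficient of u^0 is the only part of the cyclic map of full order n + 1. A coboundary has
vanishing class, and so do operators of order less than their number of arguments; hence this
coefficient vanishes. -/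
lemma cocycle_zero_eq_zero {s : Finset (Fin d)} {x : ℕ → PV (Poly d) d} {F : Functional d n}
    (hx : x ∈ uPolyvecs s (n + 1)) (hF : F ∈ functionals s ⊤ n)
    (h : cyclicMap (n + 1) x = hochDiff F) : x 0 = 0 := by
  obtain ⟨ψ, hψ, hr⟩ := exists_represents_of_mem_functionals hF
  have hx0 : x 0 ∈ polyvecs s (n + 1) := (hx 0).1 (by omega)
  have hN : ((n + 1).factorial : ℂ) ≠ 0 := by exact_mod_cast Nat.factorial_ne_zero _
  have hN1 : (((n + 1 : ℕ) : ℂ) + 1) ≠ 0 := by exact_mod_cast Nat.succ_ne_zero (n + 1)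
  -- On an alternating word N is multiplication by n + 2 modulo lower order, which leaves 1/(n + 1)!
  -- of the weight of x 0.
  set γ := ((n + 1).factorial : ℂ)⁻¹ • x 0 with hγ
  have hγm : γ ∈ polyvecs s (n + 1) := Submodule.smul_mem _ _ hx0
  have hG : hochDiff F - polyF (n + 1) (n + 1) γ ∈ functionals s n (n + 1) := by
    rw [← h, cyclicMap_apply, Finset.sum_range_succ', add_sub_assoc]
    refine add_mem (sum_mem fun k _ => Submodule.smul_mem _ _ (cycNorm_mem ?_)) ?_
    · rcases Nat.lt_or_ge (n + 1) (2 * (k + 1)) with h1 | h1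
      · rw [(hx (k + 1)).2 h1, map_zero]; exact zero_mem _
      · exact polyF_mem (by omega) ((hx (k + 1)).1 h1)
    · have := Submodule.smul_mem _ (((n + 1).factorial : ℂ) * (((n + 1 : ℕ) : ℂ) + 1))⁻¹
        (cycNorm_polyF_self_sub_mem hx0)
      convert this using 1
      rw [hγ, map_smul, smul_sub, smul_smul, Nat.factorial_zero, Nat.cast_one, one_div, Nat.sub_zero]
      congr 2
      field_simp
  have h1 := eq_zero_of_polyF_eq hγm (Nat.lt_succ_self n) hG (symbolClass_dHoch n ψ)
    (by rw [add_sub_cancel]; exact hr.dHoch)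
  rw [hγ, smul_eq_zero] at h1
  exact h1.resolve_left (inv_ne_zero hN)

/-- If the divergence vanishes, the alternating word is exactly cyclic, so N multiplies it by n + 1;
the factor n! undoes the rest of the weight. -/
lemma cyclicMap_single_zero {γ : PV (Poly d) d} (h : divg pd γ = 0) :
    cyclicMap n (Pi.single 0 ((n.factorial : ℂ) • γ)) = polyF n n γ := by
  have hN : (n.factorial : ℂ) ≠ 0 := by exact_mod_cast Nat.factorial_ne_zero _
  have hN1 : ((n : ℂ) + 1) ≠ 0 := by exact_mod_cast Nat.succ_ne_zero n
  have hcyc : cyc (polyF n n γ) = polyF n n γ := by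
    rw [polyF_apply, cyc_wordsF_self, ← onCoeff_divg, h]
    simp
  rw [cyclicMap_apply, Finset.sum_range_succ', Finset.sum_eq_zero, zero_add]
  · rw [Pi.single_eq_same, Nat.sub_zero, map_smul, map_smul, cycNorm_of_cyclic hcyc, smul_smul,
      smul_smul, Nat.factorial_zero, Nat.cast_one]
    rw [show (1 / (n.factorial * ((n : ℂ) + 1)) * n.factorial * (n + 1)) = 1 by field_simp, one_smul]
  · intro k _
    rw [Pi.single_eq_of_ne (Nat.succ_ne_zero k), map_zero, map_zero, smul_zero]

/-- The first application of E is homotopic, through the Cartan formula, to a pair with zero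
polyvector part and a cyclic b-closed functional. The second is evaluated on that functional by the
HKR theorem, and yields an alternating word of a divergence, which lies in the image of the cyclic
map, plus the coboundary of a cyclic functional. -/
lemma coneE_coneE_mem {s : Finset (Fin d)} {c : Fin d} (hc : c ∈ s) {z : Cone d n}
    (h : z ∈ coneCocycles s n) : coneE c (coneE c z) ∈ coneCoboundaries s n := by
  obtain ⟨x, F⟩ := z
  obtain ⟨⟨hx, hF⟩, hdx, hφ⟩ := mem_coneCocycles.mp h
  change x ∈ uPolyvecs s (n + 1) at hx
  change F ∈ cyclicFunctionals s n at hF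
  change uDivg x = 0 at hdx
  change cyclicMap (n + 1) x = hochDiff F at hφ
  obtain ⟨hFm, hFc⟩ := mem_cyclicFunctionals.mp hF
  have hx0 : x 0 = 0 := cocycle_zero_eq_zero hx hFm hφ
  -- The homotopy of `eulerPV_eq`, shifted by one power of u. The shift loses the coefficient of
  -- u^0, which is zero by `cocycle_zero_eq_zero`.
  set y : ℕ → PV (Poly d) d := fun k => -wedge c (onCoeff (mulX c) (x (k + 1))) with hy
  have hym : y ∈ uPolyvecs s n := by
    intro k
    refine ⟨fun hk => ?_, fun hk => ?_⟩
    · rw [hy]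
      refine neg_mem ?_
      rcases Nat.lt_or_ge (n + 1) (2 * (k + 1)) with h1 | h1
      · rw [(hx (k + 1)).2 h1, map_zero, map_zero]; exact zero_mem _
      · have := wedge_mem hc (onCoeff_mulX_mem hc ((hx (k + 1)).1 h1))
        rwa [show n + 1 - 2 * (k + 1) + 1 = n - 2 * k by omega] at this
    · change -wedge c (onCoeff (mulX c) (x (k + 1))) = 0
      rw [(hx (k + 1)).2 (by omega), map_zero, map_zero, neg_zero]
  have hdy : uDivg y = fun k => eulerPV c (x k) := by
    funext k
    cases k with
    | zero => rw [uDivg_zero, hx0, map_zero]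
    | succ k =>
      have h1 : divg pd (x (k + 1)) = 0 := congrFun hdx (k + 2)
      rw [uDivg_succ, eulerPV_eq, h1, hy]
      simp
  set F2 := lieE c F - cyclicMap n y with hF2
  have hEF : lieE c F ∈ cyclicFunctionals s n :=
    mem_cyclicFunctionals.mpr ⟨lieE_mem hc hFm, by rw [← totalAction_cyc, hFc]⟩
  have hF2m : F2 ∈ cyclicFunctionals s n := sub_mem hEF (cyclicMap_mem hym)
  obtain ⟨hF2f, hF2c⟩ := mem_cyclicFunctionals.mp hF2m
  have hbF2 : hochDiff F2 = 0 := by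
    rw [hF2, map_sub, hochDiff_cyclicMap, hdy, ← lieE_cyclicMap, hφ, lieE,
      totalAction_hochDiff (Test.XD_mul c) hFm, sub_self]
  have hEF2 : lieE c F2 = cycNorm (plug (Test.D c) 0 (plug (Test.X c) 0 F2)) := by
    rw [lieE, ← cycNorm_plug_of_cyclic _ hF2c]
    congr 1
    funext f
    simp [plug_apply]
  -- The HKR summands of F2 need not be cyclic. This does not matter: on the cyclic F2, E is already
  -- rewritten as N after x_c and ∂_c on the first argument, which makes sense for each summand.
  obtain ⟨γ, hγ, G, hG, hE⟩ : ∃ γ ∈ polyvecs s n, ∃ G ∈ cyclicCoboundaries s n,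
      lieE c F2 = -polyF n n (divg pd (wedge c (onCoeff (mulX c) γ))) + G := by
    cases n with
    | zero =>
      obtain ⟨γ, hγ, e⟩ := exists_eq_polyF_zero hF2f
      refine ⟨γ, hγ, 0, zero_mem _, ?_⟩
      rw [hEF2, e, plug_X_polyF, cycNorm_plug_polyF_self, add_zero]
    | succ n =>
      obtain ⟨γ, hγ, χ, hχ, e⟩ := exists_eq_polyF_add_hochDiff hF2f hbF2
      have hχX := plug_X_mem hc 0 hχ
      refine ⟨γ, hγ, hochDiff (cycNorm (plug (Test.D c) 0 (plug (Test.X c) 0 χ))),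
        ⟨_, mem_cyclicFunctionals.mpr ⟨cycNorm_mem (plug_D_mem hc 0 hχX), cyc_cycNorm _⟩, rfl⟩, ?_⟩
      rw [hEF2, e, map_add, plug_X_polyF, plug_X_hochDiff c
        (functionals_mono (Finset.subset_univ s) le_rfl hχ), map_add, map_add,
        cycNorm_plug_polyF_self, cycNorm_plug_hochDiff (Test.D_mul c)
          (functionals_le_firstAdditive _ _ hχX)]
  set η := -divg pd (wedge c (onCoeff (mulX c) γ)) with hη
  have hdη : divg pd η = 0 := by rw [hη, map_neg, divg_divg (isDiffRing_poly d), neg_zero]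
  have hηm : η ∈ polyvecs s n := by
    have := divg_mem (wedge_mem hc (onCoeff_mulX_mem hc hγ))
    rw [Nat.add_sub_cancel] at this
    exact neg_mem this
  -- The summand E y accounts for the first homotopy; n! η in power u^0 produces the alternating
  -- word of η, which is divergence-free.
  refine ⟨(fun k => eulerPV c (y k)) + Pi.single 0 ((n.factorial : ℂ) • η), add_mem
    (uPolyvecs_map (fun ℓ γ hγ => eulerPV_mem c hγ) hym) (fun k => ?_), G, hG, ?_⟩
  · cases k with
    | zero =>
      rw [Pi.single_eq_same]
      exact ⟨fun _ => Submodule.smul_mem _ _ hηm, fun h => by omega⟩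
    | succ k =>
      rw [Pi.single_eq_of_ne (Nat.succ_ne_zero k)]
      exact ⟨fun _ => zero_mem _, fun _ => rfl⟩
  · have e1 : uDivg (Pi.single 0 ((n.factorial : ℂ) • η)) = (0 : ℕ → PV (Poly d) d) := by
      funext k
      match k with
      | 0 => rfl
      | 1 => rw [uDivg_succ, Pi.single_eq_same, map_smul, hdη, smul_zero]; rfl
      | k + 2 => rw [uDivg_succ, Pi.single_eq_of_ne (Nat.succ_ne_zero k), map_zero]; rfl
    rw [map_add, map_add, e1, add_zero, cyclicMap_single_zero hdη, uDivg_eulerPV, hdy, coneE_apply,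
      coneE_apply, ← lieE_cyclicMap]
    refine Prod.ext rfl ?_
    change lieE c (lieE c F) = lieE c (cyclicMap n y) + polyF n n η + G
    rw [← map_neg] at hE
    rw [add_assoc, ← hE, ← map_add, hF2]
    congr 1
    abel

/-! ### Acyclicity of the cone -/

open Polynomial in
lemma mem_decomposable_coneE (c : Fin d) {s : Finset (Fin d)} {z : Cone d n} (h : z ∈ cone s n)
    (μ : ℂ) : z ∈ decomposable (coneE c) μ := by
  obtain ⟨x, F⟩ := z
  obtain ⟨hx, hF⟩ := h
  change x ∈ uPolyvecs s (n + 1) at hx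
  change F ∈ cyclicFunctionals s n at hF
  -- A finite decomposition by powers of u, so that each component is spanned by eigenvectors of E.
  have e : ((x, F) : Cone d n) = ∑ k ∈ Finset.range (n + 2), (Pi.single k (x k), 0) + (0, F) := by
    refine Prod.ext ?_ ?_
    · rw [Prod.fst_add, Prod.fst_sum, add_zero]
      funext k
      rw [Finset.sum_apply]
      by_cases hk : k < n + 2
      · rw [Finset.sum_eq_single k]
        · simp
        · intro b _ hb
          change (Pi.single b (x b) : ℕ → PV (Poly d) d) k = 0
          exact Pi.single_eq_of_ne hb.symm _
        · intro h0
          exact absurd (Finset.mem_range.mpr hk) h0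
      · rw [Finset.sum_eq_zero]
        · exact (hx k).2 (by omega)
        · intro b hb
          rw [Finset.mem_range] at hb
          change (Pi.single b (x b) : ℕ → PV (Poly d) d) k = 0
          exact Pi.single_eq_of_ne (show k ≠ b by omega) _
    · rw [Prod.snd_add, Prod.snd_sum]
      simp
  rw [e]
  refine add_mem (sum_mem fun k _ => ?_) ?_
  · rcases Nat.lt_or_ge (n + 1) (2 * k) with h1 | h1
    · rw [(hx k).2 h1, Pi.single_zero]
      exact zero_mem _
    · refine polyvecs_mapsTo (LinearMap.inl ℂ (ℕ → PV (Poly d) d) (Functional d n) ∘ₗ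
        LinearMap.single ℂ (fun _ : ℕ => PV (Poly d) d) k) _ (fun α w _ _ _ => ?_) ((hx k).1 h1)
      refine mem_decomposable (ν := (w.count c : ℂ) - α c - 1) ?_ μ
      refine Prod.ext ?_ (by simp [coneE])
      funext i
      change eulerPV c ((Pi.single k (polyvec α w) : ℕ → PV (Poly d) d) i) =
        ((w.count c : ℂ) - α c - 1) • (Pi.single k (polyvec α w) : ℕ → PV (Poly d) d) i
      rcases eq_or_ne i k with rfl | hi
      · rw [Pi.single_eq_same, eulerPV_polyvec]
      · rw [Pi.single_eq_of_ne hi, map_zero, smul_zero]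
  · refine functionals_mapsTo (LinearMap.inr ℂ (ℕ → PV (Poly d) d) (Functional d n)) _
      (fun α w _ => ?_) (mem_cyclicFunctionals.mp hF).1
    refine mem_decomposable (ν := (letterCount c w : ℂ) - α c - 1) ?_ μ
    refine Prod.ext ?_ (lieE_wordFunctional_monomial c α w)
    funext i
    change eulerPV c 0 = ((letterCount c w : ℂ) - α c - 1) • (0 : PV (Poly d) d)
    rw [map_zero, smul_zero]

/-- The derivative ∂_c lowers the exponent of x_c, which enters the weight negatively; so it raises
the weight by one. -/
lemma coneD_coneE {s : Finset (Fin d)} (c : Fin d) {z : Cone d n} (h : z ∈ cone s n) :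
    coneD c (coneE c z) = coneE c (coneD c z) - coneD c z := by
  obtain ⟨x, F⟩ := z
  obtain ⟨hx, hF⟩ := h
  change x ∈ uPolyvecs s (n + 1) at hx
  change F ∈ cyclicFunctionals s n at hF
  refine Prod.ext (funext fun k => ?_) ?_
  · change onCoeff (pd c) (eulerPV c (x k)) =
      eulerPV c (onCoeff (pd c) (x k)) - onCoeff (pd c) (x k)
    rcases Nat.lt_or_ge (n + 1) (2 * k) with h1 | h1
    · rw [(hx k).2 h1]
      simp only [map_zero, sub_zero]
    · rw [← sub_eq_zero, ← Submodule.mem_bot ℂ]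
      refine polyvecs_mapsTo (onCoeff (pd c) ∘ₗ eulerPV c - (eulerPV c ∘ₗ onCoeff (pd c) -
        onCoeff (pd c))) _ (fun α w _ _ _ => ?_) ((hx k).1 h1)
      rw [Submodule.mem_bot]
      simp only [LinearMap.sub_apply, LinearMap.comp_apply, eulerPV_polyvec, map_smul,
        onCoeff_pd_polyvec]
      rcases Nat.eq_zero_or_pos (α c) with h | h
      · rw [h]; simp
      · rw [Finsupp.tsub_apply, Finsupp.single_eq_same, Nat.cast_sub h]
        push_cast
        module
  · change -lieD c (lieE c F) = lieE c (-lieD c F) - -lieD c F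
    rw [← sub_eq_zero, ← Submodule.mem_bot ℂ]
    refine functionals_mapsTo (-(lieD c ∘ₗ lieE c) - (lieE c ∘ₗ (-lieD c) - -lieD c) :
      Module.End ℂ (Functional d n)) _ (fun α w _ => ?_) (mem_cyclicFunctionals.mp hF).1
    rw [Submodule.mem_bot]
    simp only [LinearMap.sub_apply, LinearMap.neg_apply, LinearMap.comp_apply, map_neg,
      lieE_wordFunctional_monomial, map_smul, lieD_wordFunctional_monomial]
    rcases Nat.eq_zero_or_pos (α c) with h | h
    · rw [h]; simp
    · rw [Finsupp.tsub_apply, Finsupp.single_eq_same, Nat.cast_sub h]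
      push_cast
      module

open Polynomial in
-- If ∂_c z has weight zero, only the weight −1 part of z matters for it. Polynomials in E therefore
-- act through their value at −1, and an antiderivative can be projected to weight −1.
lemma coneD_aeval {s : Finset (Fin d)} {c : Fin d} (hc : c ∈ s) {z : Cone d n} (h : z ∈ cone s n)
    (h0 : coneE c (coneD c z) = 0) (q : ℂ[X]) :
    coneD c (aeval (coneE c) q z) = q.eval (-1) • coneD c z := by
  induction q using Polynomial.induction_on' with
  | add p q hp hq => rw [map_add, LinearMap.add_apply, map_add, hp, hq, eval_add, add_smul]
  | monomial k a =>
    rw [aeval_monomial, Module.algebraMap_end_eq_smul_id, eval_monomial]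
    have : coneD c ((coneE c ^ k) z) = (-1 : ℂ) ^ k • coneD c z ∧ (coneE c ^ k) z ∈ cone s n := by
      induction k with
      | zero => exact ⟨by simp, h⟩
      | succ k ih =>
        rw [pow_succ', Module.End.mul_apply]
        refine ⟨?_, coneE_mem_cone hc ih.2⟩
        rw [coneD_coneE c ih.2, ih.1, map_smul, h0, smul_zero, zero_sub, pow_succ]
        module
    rw [Module.End.mul_apply, LinearMap.smul_apply, LinearMap.id_apply, map_smul, this.1, smul_smul]

open Polynomial in
/-- A cocycle of the cone is a coboundary up to a cocycle of weight zero. -/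
lemma exists_weight_zero {s : Finset (Fin d)} {c : Fin d} (hc : c ∈ s) {z : Cone d n}
    (h : z ∈ coneCocycles s n) :
    ∃ z' ∈ coneCocycles s n, coneE c z' = 0 ∧ z - z' ∈ coneCoboundaries s n := by
  have hZ : ∀ (q : ℂ[X]), ∀ v ∈ coneCocycles s n, aeval (coneE c) q v ∈ coneCocycles s n :=
    fun q v hv => aeval_mem (fun v hv => coneE_mem_coneCocycles hc hv) q hv
  have hc' : ∀ (p q : ℂ[X]) (v : Cone d n),
      aeval (coneE c) (p * q) v = aeval (coneE c) p (aeval (coneE c) q v) := by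
    intro p q v; rw [map_mul]; rfl
  obtain ⟨q, hq, e⟩ := mem_decomposable_coneE c (mem_coneCocycles.mp h).1 0
  rw [zero_smul] at e
  -- The polynomial q(E) sends z to weight zero; writing q = q(0) + X r shows that z differs from
  -- its projection by a multiple of E r(E) z.
  obtain ⟨r, hr⟩ : ∃ r, q = C (q.eval 0) + X * r := by
    obtain ⟨r, hr⟩ := X_dvd_iff.mpr (show (q - C (q.eval 0)).coeff 0 = 0 by
      rw [coeff_zero_eq_eval_zero]; simp)
    exact ⟨r, by rw [← hr]; ring⟩
  have hdec : ∀ v : Cone d n, aeval (coneE c) q v =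
      q.eval 0 • v + coneE c (aeval (coneE c) r v) := by
    intro v
    conv_lhs => rw [hr]
    rw [map_add, LinearMap.add_apply, hc', aeval_X, aeval_C, Module.algebraMap_end_apply]
  have hkill : ∀ p : ℂ[X], coneE c (aeval (coneE c) q (aeval (coneE c) p z)) = 0 := by
    intro p
    have h1 : coneE c (aeval (coneE c) q (aeval (coneE c) p z)) =
        aeval (coneE c) p (coneE c (aeval (coneE c) q z)) := by
      have := hc' (X * q) p z
      rw [mul_comm, hc', hc', hc', aeval_X] at this
      exact this.symm
    rw [h1, e, map_zero]
  refine ⟨(q.eval 0)⁻¹ • aeval (coneE c) q z, Submodule.smul_mem _ _ (hZ q z h), ?_, ?_⟩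
  · rw [map_smul, e, smul_zero]
  · set u := aeval (coneE c) r z with hu
    have hum : u ∈ coneCocycles s n := hZ r z h
    have h1 : z - (q.eval 0)⁻¹ • aeval (coneE c) q z = -(q.eval 0)⁻¹ • coneE c u := by
      rw [hdec z, smul_add, inv_smul_smul₀ hq, neg_smul]
      abel
    -- As E q(E) kills u as well, E u is a multiple of E² r(E) u, hence a coboundary.
    have h2 : coneE c u = -(q.eval 0)⁻¹ • coneE c (coneE c (aeval (coneE c) r u)) := by
      have h3 := hkill r
      rw [← hu, hdec u, map_add, map_smul] at h3
      rw [neg_smul, ← smul_neg, ← eq_neg_of_add_eq_zero_left h3, inv_smul_smul₀ hq]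
    rw [h1, h2]
    exact Submodule.smul_mem _ _ (Submodule.smul_mem _ _ (coneE_coneE_mem hc (hZ r u hum)))

open Polynomial in
-- An antiderivative is chosen in each component, then projected to weight −1 by a polynomial in E,
-- normalized by its value at −1.
lemma exists_coneD_eq {s : Finset (Fin d)} {c : Fin d} (hc : c ∈ s) {z : Cone d n} (h : z ∈ cone s n)
    (h0 : coneE c z = 0) : ∃ z' ∈ cone s n, coneD c z' = z ∧ coneE c z' = -z' := by
  obtain ⟨x, F⟩ := z
  obtain ⟨hx, hF⟩ := h
  change x ∈ uPolyvecs s (n + 1) at hx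
  change F ∈ cyclicFunctionals s n at hF
  have hex : ∀ k, ∃ γ, ((2 * k ≤ n + 1 → γ ∈ polyvecs s (n + 1 - 2 * k)) ∧
      (n + 1 < 2 * k → γ = 0)) ∧ onCoeff (pd c) γ = x k := by
    intro k
    rcases Nat.lt_or_ge (n + 1) (2 * k) with h1 | h1
    · exact ⟨0, ⟨fun h => absurd h (by omega), fun _ => rfl⟩, by rw [(hx k).2 h1, map_zero]⟩
    · obtain ⟨γ, hγ, e⟩ := exists_onCoeff_pd_eq hc ((hx k).1 h1)
      exact ⟨γ, ⟨fun _ => hγ, fun h => absurd h (by omega)⟩, e⟩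
  choose x' hx' ex' using hex
  obtain ⟨G, hG, eG⟩ := exists_lieD_eq hc (neg_mem hF)
  set w : Cone d n := (x', G) with hw
  have hwm : w ∈ cone s n := ⟨hx', hG⟩
  have hDw : coneD c w = (x, F) := by
    rw [coneD_apply, hw]
    exact Prod.ext (funext ex') (by change -lieD c G = F; rw [eG, neg_neg])
  obtain ⟨q, hq, e⟩ := mem_decomposable_coneE c hwm (-1)
  refine ⟨(q.eval (-1))⁻¹ • aeval (coneE c) q w,
    Submodule.smul_mem _ _ (aeval_mem (fun v hv => coneE_mem_cone hc hv) q hwm), ?_, ?_⟩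
  · rw [map_smul, coneD_aeval hc hwm (by rw [hDw, h0]), hDw, inv_smul_smul₀ hq]
  · rw [map_smul, e, neg_one_smul, smul_neg]

/-- The inductive step: reduce to weight zero, integrate along x_c, and correct the antiderivative
to a cocycle w by means of the smaller cone. Since Ew = −w, the cocycle w is E²w and thus a
coboundary; differentiating it along x_c gives back the original cocycle. -/
lemma coneCocycles_le_succ {s : Finset (Fin d)} {c : Fin d} (hc : c ∈ s)
    (ih : ∀ n, coneCocycles (s.erase c) n ≤ coneCoboundaries (s.erase c) n) (n : ℕ) :
    coneCocycles s n ≤ coneCoboundaries s n := by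
  have hce : c ∉ s.erase c := Finset.notMem_erase c s
  have hse : s.erase c ⊆ s := Finset.erase_subset c s
  intro z₀ hz₀
  obtain ⟨z, hz, hE, hsub⟩ := exists_weight_zero hc hz₀
  suffices hzB : z ∈ coneCoboundaries s n by
    have := add_mem hsub hzB
    rwa [sub_add_cancel] at this
  obtain ⟨hzc, hdz, hφz⟩ := mem_coneCocycles.mp hz
  obtain ⟨⟨x, F⟩, ⟨hx, hF⟩, hDz, hEz⟩ := exists_coneD_eq hc hzc hE
  change x ∈ uPolyvecs s (n + 1) at hx
  change F ∈ cyclicFunctionals s n at hF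
  have hFm := (mem_cyclicFunctionals.mp hF).1
  have hDx : (fun k => onCoeff (pd c) (x k)) = z.1 := congrArg Prod.fst hDz
  have hDF : lieD c F = -z.2 := by rw [← congrArg Prod.snd hDz]; exact (neg_neg _).symm
  have hEx : (fun k => eulerPV c (x k)) = -x := congrArg Prod.fst hEz
  have hEF : lieE c F = -F := congrArg Prod.snd hEz
  -- The cone differential of the antiderivative. Its ∂_c-derivative is the differential of z, which
  -- is zero, and its weight is −1; so it involves neither x_c nor ∂_c.
  set v : Cone d (n + 1) := (uDivg x, cyclicMap (n + 1) x - hochDiff F) with hv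
  have hvm : v ∈ coneCocycles (s.erase c) (n + 1) := by
    rw [mem_coneCocycles]
    refine ⟨⟨fun k => ?_, ?_⟩, uDivg_uDivg x, ?_⟩
    · have hd := uDivg_mem hx k
      refine ⟨fun hk => mem_polyvecs_erase (hd.1 hk) ?_ ?_, hd.2⟩
      · have := congrFun (uDivg_onCoeff_pd c x) k
        rw [hDx, hdz] at this
        exact this.symm
      · have := congrFun (uDivg_eulerPV c x) k
        rw [hEx, map_neg] at this
        exact this.symm
    · have hm := sub_mem (cyclicMap_mem hx) (hochDiff_mem_cyclicFunctionals hF)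
      rw [mem_cyclicFunctionals] at hm
      refine mem_cyclicFunctionals.mpr ⟨mem_functionals_erase hm.1 ?_ ?_, hm.2⟩
      · rw [map_sub, lieD_cyclicMap, hDx, lieD, totalAction_hochDiff (Test.D_mul c) hFm]
        change -_ - hochDiff (lieD c F) = 0
        rw [hDF, map_neg, hφz]
        abel
      · rw [map_sub, lieE_cyclicMap, hEx, lieE, totalAction_hochDiff (Test.XD_mul c) hFm]
        change _ - hochDiff (lieE c F) = -(cyclicMap (n + 1) x - hochDiff F)
        rw [hEF, map_neg, map_neg]
        abel
    · rw [hv, map_sub, hochDiff_hochDiff hFm, sub_zero, hochDiff_cyclicMap]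
  obtain ⟨y, hy, B, ⟨G, hG, rfl⟩, hvy⟩ := ih (n + 1) hvm
  have e1 : uDivg x = uDivg y := congrArg Prod.fst hvy
  have e2 : cyclicMap (n + 1) x - hochDiff F = cyclicMap (n + 1) y + hochDiff G :=
    congrArg Prod.snd hvy
  have hGm := (mem_cyclicFunctionals.mp hG).1
  have hdy : (fun k => onCoeff (pd c) (y k)) = 0 := funext fun k => by
    rcases Nat.lt_or_ge (n + 1) (2 * k) with h1 | h1
    · rw [(hy k).2 h1, map_zero]; rfl
    · exact onCoeff_pd_eq_zero hce ((hy k).1 h1)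
  have hEy : (fun k => eulerPV c (y k)) = -y := funext fun k => by
    rcases Nat.lt_or_ge (n + 1) (2 * k) with h1 | h1
    · rw [Pi.neg_apply, (hy k).2 h1, map_zero, neg_zero]
    · exact eulerPV_eq_neg hce ((hy k).1 h1)
  -- The correction (y, −G) lives in the variables without c, so it is killed by ∂_c and has weight
  -- −1; derivative and weight of the antiderivative are unchanged.
  set w : Cone d n := (x - y, F + G) with hw
  have hys : y ∈ uPolyvecs s (n + 1) := fun k =>
    ⟨fun h => polyvecs_mono hse _ ((hy k).1 h), (hy k).2⟩
  have hGs : G ∈ cyclicFunctionals s n := mem_cyclicFunctionals.mpr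
    ⟨functionals_mono hse le_rfl hGm, (mem_cyclicFunctionals.mp hG).2⟩
  have hwm : w ∈ coneCocycles s n := by
    rw [mem_coneCocycles]
    refine ⟨⟨sub_mem hx hys, add_mem hF hGs⟩, ?_, ?_⟩
    · change uDivg (x - y) = 0
      rw [map_sub, e1, sub_self]
    · change cyclicMap (n + 1) (x - y) = hochDiff (F + G)
      rw [map_sub, map_add, sub_eq_iff_eq_add.mp e2]
      abel
  have hEw : coneE c w = -w := by
    refine Prod.ext ?_ ?_
    · change (fun k => eulerPV c (x k - y k)) = -(x - y)
      simp only [map_sub]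
      change (fun k => eulerPV c (x k)) - (fun k => eulerPV c (y k)) = _
      rw [hEx, hEy]
      abel
    · change lieE c (F + G) = -(F + G)
      rw [map_add, hEF, lieE_eq_neg hce hGm, neg_add]
  have hDw : coneD c w = z := by
    refine Prod.ext ?_ ?_
    · change (fun k => onCoeff (pd c) (x k - y k)) = _
      simp only [map_sub]
      change (fun k => onCoeff (pd c) (x k)) - (fun k => onCoeff (pd c) (y k)) = _
      rw [hDx, hdy, sub_zero]
    · change -lieD c (F + G) = _
      rw [map_add, hDF, lieD_eq_zero hce hGm, add_zero, neg_neg]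
  -- E²w = w.
  have hwB := coneE_coneE_mem hc hwm
  rw [hEw, map_neg, hEw, neg_neg] at hwB
  rw [← hDw]
  exact coneD_mem_coneCoboundaries hc hwB

/-! ### The case without variables -/

lemma polyvecs_empty {ℓ : ℕ} (hℓ : ℓ ≠ 0) {γ : PV (Poly d) d} (h : γ ∈ polyvecs ∅ ℓ) : γ = 0 := by
  rw [← Submodule.mem_bot ℂ]
  refine polyvecs_mapsTo LinearMap.id _ (fun α w _ hw h => ?_) h
  cases w with
  | nil => exact absurd h.symm hℓ
  | cons b w => exact absurd (hw b (by simp)) (Finset.notMem_empty b)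

lemma augment_tmul_one {s : Finset (Fin d)} {γ : PV (Poly d) d} (h : γ ∈ polyvecs s 0) :
    augment γ ⊗ₜ 1 = γ := by
  have := symbolClass_words_self h
  rw [symbolClass_zero] at this
  simpa [words_zero, unitFam_zero] using this

lemma words_of_contr_eq_zero {γ : PV (Poly d) d} (h : ∀ c, contr c γ = 0) (k : ℕ) :
    words pd k (2 * k) γ = fun f => augment γ * ∏ i, f i := by
  induction k with
  | zero =>
    funext f
    rw [words_zero]
    change augment γ = _ * ∏ i : Fin 0, f i
    simp
  | succ k ih =>
    change words pd (k + 1) (2 * k + 2) γ = fun f : Fin (2 * k + 2) → Poly d => _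
    rw [words_succ, pre]
    change preT pd _ (2 * k + 2) γ + preI (preI _) (2 * k + 2) γ = _
    rw [preT_succ, preI_succ, preI_succ, ih]
    funext f
    simp only [h, map_zero, Finset.sum_const_zero, zero_add, cup_apply, Module.End.one_apply,
      Fin.tail]
    have e : ∏ i : Fin (2 * k + 2), f i = f 0 * (f (Fin.succ 0) * ∏ i : Fin (2 * k), f i.succ.succ) := by
      rw [Fin.prod_univ_succ, Fin.prod_univ_succ]
    change _ = augment γ * ∏ i : Fin (2 * k + 2), f i
    rw [e]
    ring

/-- Without variables a functional is a constant times the integral of the product of all arguments,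
which is symmetric; only the sign of the rotation remains. -/
lemma cyc_of_mem_empty {F : Functional d n} (h : F ∈ functionals ∅ ⊤ n) :
    cyc F = (-1 : ℂ) ^ n • F := by
  rw [← sub_eq_zero, ← Submodule.mem_bot ℂ]
  refine functionals_mapsTo (cyc - (-1 : ℂ) ^ n • 1 : Module.End ℂ (Functional d n)) _
    (fun α w hw => ?_) h
  have h0 : w = fun _ => [] := funext fun i =>
    List.eq_nil_iff_forall_not_mem.mpr fun c hc => absurd (hw.letters i c hc) (Finset.notMem_empty c)
  have h1 : (Fin.snoc (Fin.tail w) (w 0) : Fin (n + 1) → List (Fin d)) = w := by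
    subst h0
    funext i
    refine Fin.lastCases ?_ (fun i => ?_) i
    · simp
    · simp [Fin.tail]
  rw [Submodule.mem_bot, LinearMap.sub_apply, cyc_wordFunctional, h1]
  exact sub_self _

lemma cyclicMap_single {k : ℕ} {γ : PV (Poly d) d} (h : γ ∈ polyvecs ∅ 0) :
    cyclicMap (2 * k) (Pi.single k γ) =
      ((k.factorial : ℂ) / (2 * k).factorial) • polyF k (2 * k) γ := by
  have hc : cyc (polyF k (2 * k) γ) = polyF k (2 * k) γ := by
    rw [cyc_of_mem_empty (polyF_mem_top h)]
    simp
  have hN1 : (((2 * k : ℕ) : ℂ) + 1) ≠ 0 := by exact_mod_cast Nat.succ_ne_zero (2 * k)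
  rw [cyclicMap_apply, Finset.sum_eq_single k]
  · rw [Pi.single_eq_same, show 2 * k - k = k by omega, cycNorm_of_cyclic hc, smul_smul]
    congr 1
    field_simp
  · intro b _ hb
    rw [Pi.single_eq_of_ne hb, map_zero, map_zero, smul_zero]
  · intro h0
    exact absurd (Finset.mem_range.mpr (by omega)) h0

lemma eq_single_of_mem_empty {k : ℕ} {x : ℕ → PV (Poly d) d} (hx : x ∈ uPolyvecs ∅ (2 * k)) :
    x = Pi.single k (x k) := by
  funext i
  rcases eq_or_ne i k with rfl | hi
  · rw [Pi.single_eq_same]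
  · rw [Pi.single_eq_of_ne hi]
    rcases Nat.lt_or_ge (2 * k) (2 * i) with h | h
    · exact (hx i).2 h
    · exact polyvecs_empty (by omega) ((hx i).1 h)

/-- Both complexes are spanned by one element in each even degree, with zero differential, and the
cyclic map is multiplication by a nonzero scalar. For even n the functional is hit; for odd n the
functional is zero and injectivity kills the polyvector. -/
lemma coneCocycles_empty_le (n : ℕ) :
    coneCocycles (∅ : Finset (Fin d)) n ≤ coneCoboundaries ∅ n := by
  rintro ⟨x, F⟩ h
  obtain ⟨⟨hx, hF⟩, hdx, hφ⟩ := mem_coneCocycles.mp h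
  change x ∈ uPolyvecs ∅ (n + 1) at hx
  change F ∈ cyclicFunctionals ∅ n at hF
  change cyclicMap (n + 1) x = hochDiff F at hφ
  obtain ⟨hFm, hFc⟩ := mem_cyclicFunctionals.mp hF
  have hfac : ∀ m : ℕ, (m.factorial : ℂ) ≠ 0 := fun m => by exact_mod_cast Nat.factorial_ne_zero m
  have hcontr : ∀ γ : PV (Poly d) d, γ ∈ polyvecs ∅ 0 → ∀ c, contr c γ = 0 :=
    fun γ hγ c => contr_eq_zero_of_degree_zero c hγ
  rcases Nat.even_or_odd' n with ⟨k, rfl | rfl⟩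
  · have hx0 : x = 0 := funext fun i => by
      rcases Nat.lt_or_ge (2 * k + 1) (2 * i) with h | h
      · exact (hx i).2 h
      · exact polyvecs_empty (by omega) ((hx i).1 h)
    obtain ⟨ψ, hψ, hr⟩ := exists_represents_of_mem_functionals hFm
    have hψ0 : ψ ∈ Submodule.map (words pd k (2 * k)) (polyvecs (∅ : Finset (Fin d)) 0) := by
      refine operators_mapsTo LinearMap.id _ (fun α w hw => ?_) hψ
      have h0 : w = fun _ => [] := funext fun i => List.eq_nil_iff_forall_not_mem.mpr
        fun c hc => absurd (hw.letters i c hc) (Finset.notMem_empty c)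
      have hm := polyvec_mem (w := []) hw.support (by simp)
      refine ⟨polyvec α [], hm, ?_⟩
      rw [words_of_contr_eq_zero (hcontr _ hm), h0, polyvec_nil, augment_tmul]
      funext f
      simp [monomialOp]
    obtain ⟨γ, hγ, rfl⟩ := hψ0
    have hFγ : F = polyF k (2 * k) γ := hr.unique_functional (represents_polyF hγ)
    set y : ℕ → PV (Poly d) d := Pi.single k ((((2 * k).factorial : ℂ) / k.factorial) • γ) with hy
    have hγ' := Submodule.smul_mem _ (((2 * k).factorial : ℂ) / k.factorial) hγ
    refine ⟨y, fun i => ?_, 0, zero_mem _, ?_⟩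
    · rcases eq_or_ne i k with rfl | hi
      · rw [hy, Pi.single_eq_same, Nat.sub_self]
        exact ⟨fun _ => hγ', fun h => absurd h (lt_irrefl _)⟩
      · rw [hy, Pi.single_eq_of_ne hi]
        exact ⟨fun _ => zero_mem _, fun _ => rfl⟩
    · refine Prod.ext ?_ ?_
      · change x = uDivg y
        rw [hx0]
        funext i
        cases i with
        | zero => rfl
        | succ i =>
          rw [uDivg_succ, hy]
          rcases eq_or_ne i k with rfl | hi
          · rw [Pi.single_eq_same, divg_eq_zero_of_degree_zero hγ']; rfl
          · rw [Pi.single_eq_of_ne hi, map_zero]; rfl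
      · change F = cyclicMap (2 * k) y + 0
        rw [add_zero, hy, cyclicMap_single hγ', map_smul, smul_smul, hFγ]
        rw [show (k.factorial : ℂ) / (2 * k).factorial * ((2 * k).factorial / k.factorial) = 1 by
          field_simp [hfac], one_smul]
  · have hF0 : F = 0 := by
      rw [cyc_of_mem_empty hFm, Odd.neg_one_pow ⟨k, rfl⟩, neg_one_smul, neg_eq_iff_add_eq_zero,
        ← two_smul ℂ, smul_eq_zero] at hFc
      exact hFc.resolve_left two_ne_zero
    change x ∈ uPolyvecs ∅ (2 * (k + 1)) at hx
    have hxk : x (k + 1) ∈ polyvecs ∅ 0 := by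
      have := (hx (k + 1)).1 le_rfl
      rwa [Nat.sub_self] at this
    have hx1 := eq_single_of_mem_empty hx
    rw [hF0, map_zero] at hφ
    change cyclicMap (2 * (k + 1)) x = 0 at hφ
    rw [hx1, cyclicMap_single hxk, smul_eq_zero,
      or_iff_right (div_ne_zero (hfac _) (hfac _))] at hφ
    have h1 := (represents_polyF (L := k + 1) (n := 2 * (k + 1)) hxk)
    rw [hφ] at h1
    have h2 := h1.unique_operator Represents.zero
    rw [words_of_contr_eq_zero (hcontr _ hxk)] at h2
    have h3 : augment (x (k + 1)) = 0 := by simpa using congrFun h2 1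
    have h4 : x (k + 1) = 0 := by rw [← augment_tmul_one hxk, h3, TensorProduct.zero_tmul]
    rw [h4, Pi.single_zero] at hx1
    rw [hF0, hx1]
    exact zero_mem _

/-- The cone of the cyclic map is acyclic. -/
theorem coneCocycles_le_coneCoboundaries (s : Finset (Fin d)) (n : ℕ) :
    coneCocycles s n ≤ coneCoboundaries s n := by
  induction s using Finset.strongInduction generalizing n with
  | H s ih =>
    rcases s.eq_empty_or_nonempty with rfl | ⟨c, hc⟩
    · exact coneCocycles_empty_le n
    · exact coneCocycles_le_succ hc (ih _ (Finset.erase_ssubset hc)) n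

/-- The cyclic map is injective in degree zero. -/
lemma eq_zero_of_cyclicMap_zero {s : Finset (Fin d)} {x : ℕ → PV (Poly d) d}
    (hx : x ∈ uPolyvecs s 0) (h : cyclicMap 0 x = 0) : x = 0 := by
  have hx0 := (hx 0).1 le_rfl
  have h1 : x = Pi.single 0 (x 0) := by
    funext i
    cases i with
    | zero => rw [Pi.single_eq_same]
    | succ i => rw [Pi.single_eq_of_ne (Nat.succ_ne_zero i)]; exact (hx _).2 (by omega)
  have h2 := cyclicMap_single_zero (n := 0) (divg_eq_zero_of_degree_zero hx0)
  rw [Nat.factorial_zero, Nat.cast_one, one_smul, ← h1, h] at h2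
  have h3 := represents_polyF (L := 0) (n := 0) hx0
  rw [← h2] at h3
  have h4 := symbolClass_words_self hx0
  rw [h3.unique_operator Represents.zero, map_zero] at h4
  rw [h1, ← one_smul ℂ (x 0)]
  simp at h4
  rw [h4.symm]
  simp

end
end CyclicHKR

/-! ### Translation back to the given volume form, polyvector fields and cyclic cochains. -/

namespace CyclicHKR
noncomputable section
open scoped TensorProduct ContDiff

variable {d n : ℕ}

/-! ### Volume forms with constant density -/

/-- Units of a polynomial ring over a field are constants. So the divergence is the flat one, and
the pairing is a nonzero multiple of the standard integral. -/
lemma exists_vol_eq (vol : (Poly d)ˣ) : ∃ v : ℂ, v ≠ 0 ∧ vol.val = MvPolynomial.C v := by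
  obtain ⟨v, hv, h⟩ := MvPolynomial.isUnit_iff_eq_C_of_isReduced.mp vol.isUnit
  exact ⟨v, hv.ne_zero, h⟩

lemma divergence_eq (vol : (Poly d)ˣ) (ℓ : ℕ) : divergence vol ℓ = flatDiv d ℓ := by
  obtain ⟨v, -, hv⟩ := exists_vol_eq vol
  refine TensorProduct.ext' fun a g => ?_
  rw [divergence, LinearMap.comp_apply, LinearMap.comp_apply, LinearMap.rTensor_tmul,
    LinearMap.mulLeft_apply, flatDiv_tmul, flatDiv_tmul, map_sum]
  refine Finset.sum_congr rfl fun i _ => ?_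
  rw [LinearMap.rTensor_tmul, LinearMap.mulLeft_apply]
  have h : MvPolynomial.pderiv i (vol.val * a) = vol.val * MvPolynomial.pderiv i a := by
    rw [hv, MvPolynomial.pderiv_C_mul, MvPolynomial.C_mul']
  rw [h, Units.inv_mul_cancel_left]

lemma pairing_eq {vol : (Poly d)ˣ} {v : ℂ} (hv : vol.val = MvPolynomial.C v)
    (Ψ : Cochain (SmoothFun d) n) (f : Fin (n + 1) → Test d) :
    pairing vol Ψ (fun i => (f i.succ).1) (f 0).1 = v * toFunctional Ψ f := by
  change _ = v * integral d ((f 0).1 * Ψ fun i => (f i.succ).1)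
  rw [mul_comm (f 0).1, integral_eq (mul_mem_testAlg _ (f 0).2), pairing,
    ← MeasureTheory.integral_const_mul]
  congr 1
  funext x
  rw [hv, polyToSmooth_apply, MvPolynomial.eval_C, mul_comm v]
  rfl

/-- The defining relation of C is, after cancelling the constant density and using (−1)^n (−1)^n =
1, the statement that C is the signed rotation of functionals. -/
lemma isSmoothShift_iff (vol : (Poly d)ˣ) (Ψ Φ : Cochain (SmoothFun d) n) :
    IsSmoothShift vol Ψ Φ ↔ cyc (toFunctional Ψ) = toFunctional Φ := by
  obtain ⟨v, hv0, hv⟩ := exists_vol_eq vol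
  have key : ∀ f : Fin (n + 1) → Test d,
      pairing vol Ψ (Fin.init fun i => (f i).1) (f (Fin.last n)).1 =
          (-1) ^ n * pairing vol Φ (Fin.tail fun i => (f i).1) (f 0).1 ↔
        cyc (toFunctional Ψ) f = toFunctional Φ f := by
    intro f
    have h1 := pairing_eq hv Ψ (rotate f)
    have h2 := pairing_eq hv Φ f
    have h3 : ((-1 : ℂ) ^ n) * (-1) ^ n = 1 := by rw [← mul_pow]; simp
    change pairing vol Ψ (Fin.init fun i => (f i).1) (f (Fin.last n)).1 = _ at h1
    change pairing vol Φ (Fin.tail fun i => (f i).1) (f 0).1 = _ at h2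
    rw [h1, h2, cyc_apply]
    constructor
    · intro h
      have h4 : toFunctional Ψ (rotate f) = (-1) ^ n * toFunctional Φ f :=
        mul_left_cancel₀ hv0 (by rw [h]; ring)
      rw [h4, ← mul_assoc, h3, one_mul]
    · intro h
      rw [← h]
      linear_combination (-(v * toFunctional Ψ (rotate f))) * h3
  constructor
  · intro h
    funext f
    exact (key f).mp (h (fun i => (f i).1) fun i => (f i).2)
  · intro h f hf
    exact (key fun i => ⟨f i, hf i⟩).mpr (congrFun h _)

lemma Represents.mem_functionals_univ {ψ : Cochain (Poly d) n} {F : Functional d n}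
    (h : Represents ψ F) : F ∈ functionals Finset.univ ⊤ n := by
  obtain ⟨Ψ, hΨ, rfl⟩ := h
  rw [functionals_eq_map, ← polyDiffPair_eq]
  exact ⟨_, hΨ, rfl⟩

/-- Rotated functionals are again polydifferential, so an operator satisfying the defining relation
of C exists and the choice in `cyclicShift` does satisfy it; its functional is determined by the
uniqueness of the extension to smooth functions. -/
lemma Represents.cyclicShift (vol : (Poly d)ˣ) {ψ : Cochain (Poly d) n} {F : Functional d n}
    (h : Represents ψ F) : Represents (cyclicShift vol ψ) (cyc F) := by
  have hex : ∃ φ, IsCyclicShift vol ψ φ := by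
    obtain ⟨φ, -, Φ, hΦ, e⟩ := exists_represents_of_mem_functionals (cyc_mem h.mem_functionals_univ)
    obtain ⟨Ψ, hΨ, rfl⟩ := h
    exact ⟨φ, Ψ, Φ, hΨ, hΦ, (isSmoothShift_iff vol Ψ Φ).mpr e.symm⟩
  obtain ⟨Ψ, Φ, hΨ, hΦ, hs⟩ := Classical.epsilon_spec hex
  rw [h.unique_functional ⟨Ψ, hΨ, rfl⟩]
  exact ⟨Φ, hΦ, ((isSmoothShift_iff vol Ψ Φ).mp hs).symm⟩

lemma mem_cyclicCochains_iff {vol : (Poly d)ˣ} {ψ : Cochain (Poly d) n} :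
    ψ ∈ cyclicCochains vol n ↔ ∃ F ∈ cyclicFunctionals Finset.univ n, Represents ψ F := by
  rw [mem_cyclicCochains]
  constructor
  · rintro ⟨Ψ, hΨ, hs⟩
    have hr : Represents ψ (toFunctional Ψ) := ⟨Ψ, hΨ, rfl⟩
    exact ⟨_, mem_cyclicFunctionals.mpr ⟨hr.mem_functionals_univ, (isSmoothShift_iff _ _ _).mp hs⟩, hr⟩
  · rintro ⟨F, hF, Ψ, hΨ, rfl⟩
    exact ⟨Ψ, hΨ, (isSmoothShift_iff _ _ _).mpr (mem_cyclicFunctionals.mp hF).2⟩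

/-! ### Polyvector fields as elements of the exterior algebra -/

lemma toPV_injective (ℓ : ℕ) : Function.Injective (toPV (d := d) ℓ) :=
  Module.Flat.lTensor_preserves_injective_linearMap _ (Submodule.injective_subtype _)

lemma monomial_tmul_ιMulti_mem (α : Fin d →₀ ℕ) (ℓ : ℕ) (v : Fin ℓ → Fin d → ℂ) :
    MvPolynomial.monomial α (1 : ℂ) ⊗ₜ ExteriorAlgebra.ιMulti ℂ ℓ v ∈
      polyvecs (Finset.univ : Finset (Fin d)) ℓ := by
  induction ℓ with
  | zero =>
    rw [ExteriorAlgebra.ιMulti_zero_apply]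
    exact polyvec_mem (w := []) (Finset.subset_univ _) (by simp)
  | succ ℓ ih =>
    have hv : v 0 = ∑ c, v 0 c • (Pi.single c 1 : Fin d → ℂ) := by
      simpa using (Pi.basisFun ℂ (Fin d)).sum_repr (v 0) |>.symm
    rw [ExteriorAlgebra.ιMulti_succ_apply, hv, map_sum, Finset.sum_mul, TensorProduct.tmul_sum]
    refine sum_mem fun c _ => ?_
    rw [map_smul, smul_mul_assoc, TensorProduct.tmul_smul, ← wedge_tmul]
    exact Submodule.smul_mem _ _ (wedge_mem (Finset.mem_univ c) (ih _))

lemma toPV_mem (ℓ : ℕ) (γ : Polyvector d ℓ) : toPV ℓ γ ∈ polyvecs Finset.univ ℓ := by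
  induction γ using TensorProduct.induction_on with
  | zero => rw [map_zero]; exact zero_mem _
  | add x y hx hy => rw [map_add]; exact add_mem hx hy
  | tmul a g =>
    have hg : g ∈ Submodule.span ℂ (Set.range (exteriorPower.ιMulti ℂ ℓ (M := Fin d → ℂ))) := by
      rw [exteriorPower.ιMulti_span]; trivial
    induction hg using Submodule.span_induction with
    | mem g hg =>
      obtain ⟨v, rfl⟩ := hg
      rw [toPV, LinearMap.lTensor_tmul, Submodule.subtype_apply, exteriorPower.ιMulti_apply_coe]
      induction a using MvPolynomial.induction_on' with
      | monomial α c =>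
        have : MvPolynomial.monomial α c = c • MvPolynomial.monomial α (1 : ℂ) := by
          rw [MvPolynomial.smul_monomial, smul_eq_mul, mul_one]
        rw [this, ← TensorProduct.smul_tmul']
        exact Submodule.smul_mem _ _ (monomial_tmul_ιMulti_mem α ℓ v)
      | add a b ha hb => rw [TensorProduct.add_tmul]; exact add_mem ha hb
    | zero => rw [TensorProduct.tmul_zero, map_zero]; exact zero_mem _
    | add g h _ _ hg hh => rw [TensorProduct.tmul_add, map_add]; exact add_mem hg hh
    | smul c g _ hg => rw [TensorProduct.tmul_smul, map_smul]; exact Submodule.smul_mem _ _ hg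

lemma exists_toPV_eq {ℓ : ℕ} {γ : PV (Poly d) d} (h : γ ∈ polyvecs Finset.univ ℓ) :
    ∃ t : Polyvector d ℓ, toPV ℓ t = γ := by
  change γ ∈ LinearMap.range (toPV ℓ)
  refine polyvecs_mapsTo LinearMap.id _ (fun α w _ _ hw => ?_) h
  obtain ⟨g, hg, e⟩ : ∃ g ∈ ⋀[ℂ]^w.length (Fin d → ℂ),
      polyvec α w = MvPolynomial.monomial α 1 ⊗ₜ g := by
    clear * -
    induction w with
    | nil =>
      refine ⟨1, ?_, rfl⟩
      change 1 ∈ LinearMap.range (ExteriorAlgebra.ι ℂ : (Fin d → ℂ) →ₗ[ℂ] _) ^ 0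
      rw [pow_zero]
      exact Submodule.one_le.mp le_rfl
    | cons c w ih =>
      obtain ⟨g, hg, e⟩ := ih
      refine ⟨_, ?_, by rw [polyvec_cons, e, wedge_tmul]⟩
      change _ ∈ LinearMap.range (ExteriorAlgebra.ι ℂ : (Fin d → ℂ) →ₗ[ℂ] _) ^ (w.length + 1)
      rw [pow_succ']
      exact Submodule.mul_mem_mul (LinearMap.mem_range_self _ _) hg
  subst hw
  exact ⟨MvPolynomial.monomial α 1 ⊗ₜ ⟨g, hg⟩, e.symm⟩

lemma toPV_flatDiv (ℓ : ℕ) (γ : Polyvector d (ℓ + 1)) :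
    toPV ℓ (flatDiv d ℓ γ) = divg pd (toPV (ℓ + 1) γ) := by
  induction γ using TensorProduct.induction_on with
  | zero => simp only [map_zero]
  | add x y hx hy => simp only [map_add, hx, hy]
  | tmul a g =>
    rw [flatDiv_tmul, map_sum, divg_apply]
    refine Finset.sum_congr rfl fun i _ => ?_
    rw [toPV, LinearMap.lTensor_tmul, Submodule.subtype_apply, coe_contract]
    rfl

/-- The components of an element of `T_poly ⊗ ℂ[u]`, by powers of `u`. -/
def toSeq (n : ℕ) : PolyvectorU d n →ₗ[ℂ] ℕ → PV (Poly d) d :=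
  ∑ p : Bidegree n, LinearMap.single ℂ (fun _ : ℕ => PV (Poly d) d) p.1.2 ∘ₗ toPV p.1.1 ∘ₗ
    LinearMap.proj p

lemma Bidegree.ext_right {p q : Bidegree n} (h : p.1.2 = q.1.2) : p = q := by
  have hp := p.2
  have hq := q.2
  exact Subtype.ext (Prod.ext (by omega) h)

lemma toSeq_apply (x : PolyvectorU d n) (k : ℕ) :
    toSeq n x k = ∑ p : Bidegree n, (Pi.single p.1.2 (toPV p.1.1 (x p)) : ℕ → PV (Poly d) d) k := by
  rw [toSeq, LinearMap.sum_apply, Finset.sum_apply]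
  rfl

lemma toSeq_right (x : PolyvectorU d n) (p : Bidegree n) : toSeq n x p.1.2 = toPV p.1.1 (x p) := by
  rw [toSeq_apply, Finset.sum_eq_single p, Pi.single_eq_same]
  · intro q _ hq
    exact Pi.single_eq_of_ne (fun h => hq (Bidegree.ext_right h.symm)) _
  · intro h
    exact absurd (Finset.mem_univ p) h

lemma toSeq_of_lt (x : PolyvectorU d n) {k : ℕ} (h : n < 2 * k) : toSeq n x k = 0 := by
  rw [toSeq_apply, Finset.sum_eq_zero]
  intro p _
  have := p.2
  exact Pi.single_eq_of_ne (by omega) _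

lemma toSeq_mem (x : PolyvectorU d n) : toSeq n x ∈ uPolyvecs Finset.univ n := fun k =>
  ⟨fun h => by
    have := toSeq_right x ⟨(n - 2 * k, k), by dsimp only; omega⟩
    dsimp only at this
    rw [this]
    exact toPV_mem _ _, toSeq_of_lt x⟩

lemma toSeq_injective : Function.Injective (toSeq (d := d) n) := by
  intro x y h
  funext p
  apply toPV_injective
  rw [← toSeq_right, ← toSeq_right, h]

lemma exists_toSeq_eq {y : ℕ → PV (Poly d) d} (hy : y ∈ uPolyvecs Finset.univ n) :
    ∃ x : PolyvectorU d n, toSeq n x = y := by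
  have hex : ∀ p : Bidegree n, ∃ t : Polyvector d p.1.1, toPV p.1.1 t = y p.1.2 := by
    intro p
    have hp := p.2
    refine exists_toPV_eq ?_
    have := (hy p.1.2).1 (by omega)
    rwa [show n - 2 * p.1.2 = p.1.1 by omega] at this
  choose x hx using hex
  refine ⟨x, funext fun k => ?_⟩
  rcases Nat.lt_or_ge n (2 * k) with h | h
  · rw [toSeq_of_lt x h, (hy k).2 h]
  · exact (toSeq_right x ⟨(n - 2 * k, k), by dsimp only; omega⟩).trans (hx _)

lemma toSeq_dDiv (vol : (Poly d)ˣ) (x : PolyvectorU d n) :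
    toSeq (n + 1) (dDiv vol n x) = uDivg (toSeq n x) := by
  funext k
  cases k with
  | zero =>
    refine (toSeq_right (dDiv vol n x) ⟨(n + 1, 0), rfl⟩).trans ?_
    exact map_zero (toPV (n + 1))
  | succ k =>
    rw [uDivg_succ]
    rcases Nat.lt_or_ge (n + 1) (2 * (k + 1)) with h | h
    · rw [toSeq_of_lt _ h]
      rcases Nat.lt_or_ge n (2 * k) with h1 | h1
      · rw [toSeq_of_lt x h1, map_zero]
      · have := (toSeq_mem x k).1 h1
        rw [show n - 2 * k = 0 by omega] at this
        exact (divg_eq_zero_of_degree_zero this).symm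
    · obtain ⟨ℓ, hℓ⟩ : ∃ ℓ, ℓ + 2 * (k + 1) = n + 1 := ⟨n + 1 - 2 * (k + 1), by omega⟩
      refine (toSeq_right (dDiv vol n x) ⟨(ℓ, k + 1), hℓ⟩).trans ?_
      rw [toSeq_right x ⟨(ℓ + 1, k), by dsimp only; omega⟩, ← toPV_flatDiv, ← divergence_eq vol]
      rfl

/-! ### The map of complexes -/

lemma represents_phiTilde (x : PolyvectorU d n) : Represents (phiTilde n x)
    (∑ k ∈ Finset.range (n + 1), ((k.factorial : ℂ) / n.factorial) •
      polyF (n - k) n (toSeq n x k)) := by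
  have h : ∑ k ∈ Finset.range (n + 1), ((k.factorial : ℂ) / n.factorial) •
      polyF (n - k) n (toSeq n x k) = ∑ p : Bidegree n, ((p.1.2.factorial : ℂ) / n.factorial) •
        polyF (p.1.1 + p.1.2) n (toPV p.1.1 (x p)) := by
    symm
    -- The pairs (ℓ, k) with ℓ + 2k = n are indexed by k; for larger k the component of x is zero.
    refine Finset.sum_of_injOn (fun p => p.1.2) (fun p _ q _ h => Bidegree.ext_right h) ?_ ?_ ?_
    · intro p _
      have := p.2
      simp only [Finset.coe_range, Set.mem_Iio]
      omega
    · intro k hk hk'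
      rcases Nat.lt_or_ge n (2 * k) with h | h
      · rw [toSeq_of_lt x h, map_zero, smul_zero]
      · exact absurd ⟨⟨(n - 2 * k, k), by dsimp only; omega⟩, Finset.mem_coe.mpr (Finset.mem_univ _), rfl⟩ hk'
    · intro p _
      have := p.2
      rw [toSeq_right, show n - p.1.2 = p.1.1 + p.1.2 by omega]
  rw [h]
  refine Represents.sum _ fun p _ => Represents.smul _ ?_
  obtain ⟨⟨ℓ, k⟩, rfl⟩ := p
  dsimp only
  rw [sum_graphCochain]
  exact represents_polyF (toPV_mem _ _)

lemma represents_phiCycl (vol : (Poly d)ˣ) (x : PolyvectorU d n) :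
    Represents (phiCycl vol n x) (cyclicMap n (toSeq n x)) := by
  set F := ∑ k ∈ Finset.range (n + 1), ((k.factorial : ℂ) / n.factorial) •
      polyF (n - k) n (toSeq n x k) with hF
  have hit : ∀ j, Represents ((cyclicShift vol)^[j] (phiTilde n x)) ((cyc ^ j) F) := by
    intro j
    induction j with
    | zero => exact represents_phiTilde x
    | succ j ih =>
      rw [Function.iterate_succ_apply', pow_succ', Module.End.mul_apply]
      exact ih.cyclicShift vol
  have h : cyclicMap n (toSeq n x) = (1 / ((n : ℂ) + 1)) •
      ∑ j ∈ Finset.range (n + 1), (cyc ^ j) F := by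
    rw [← cycNorm_apply, hF, map_sum, Finset.smul_sum, cyclicMap_apply]
    refine Finset.sum_congr rfl fun k _ => ?_
    rw [map_smul, smul_smul]
    rw [div_mul_div_comm, one_mul, mul_comm ((n : ℂ) + 1)]
  rw [h]
  exact Represents.smul _ (Represents.sum _ fun j _ => hit j)

/-- The map `φ_HKR^cycl` in degree `n`. -/
def phiHom (vol : (Poly d)ˣ) (n : ℕ) : PolyvectorU d n →ₗ[ℂ] cyclicCochains vol n where
  toFun x := ⟨phiCycl vol n x, mem_cyclicCochains_iff.mpr
    ⟨_, cyclicMap_mem (toSeq_mem x), represents_phiCycl vol x⟩⟩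
  map_add' x y := Subtype.ext <| (represents_phiCycl vol (x + y)).unique_operator <| by
    rw [map_add, map_add]
    exact (represents_phiCycl vol x).add (represents_phiCycl vol y)
  map_smul' c x := Subtype.ext <| (represents_phiCycl vol (c • x)).unique_operator <| by
    rw [map_smul, map_smul]
    exact (represents_phiCycl vol x).smul c

lemma represents_phiHom (vol : (Poly d)ˣ) (x : PolyvectorU d n) :
    Represents (phiHom vol n x).1 (cyclicMap n (toSeq n x)) := represents_phiCycl vol x

lemma cyclicDiff_phiHom (vol : (Poly d)ˣ) (x : PolyvectorU d n) :
    cyclicDiff vol n (phiHom vol n x) = phiHom vol (n + 1) (dDiv vol n x) := by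
  refine Subtype.ext (Represents.unique_operator (represents_phiHom vol x).dHoch ?_)
  rw [hochDiff_cyclicMap, ← toSeq_dDiv vol]
  exact represents_phiHom vol _

/-- The cone starts with polyvectors of degree one and functionals of degree zero, so injectivity in
degree zero is a separate statement. -/
lemma eq_zero_of_phiHom_zero (vol : (Poly d)ˣ) {x : PolyvectorU d 0} (h : phiHom vol 0 x = 0) :
    x = 0 := by
  have h1 := represents_phiHom vol x
  rw [h] at h1
  refine toSeq_injective ?_
  rw [map_zero]
  exact eq_zero_of_cyclicMap_zero (toSeq_mem x) (h1.unique_functional Represents.zero)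

lemma toSeq_eq_zero_of_dDiv (vol : (Poly d)ˣ) {x : PolyvectorU d n} (h : dDiv vol n x = 0) :
    uDivg (toSeq n x) = 0 := by
  rw [← toSeq_dDiv vol, h, map_zero]

/-- Injectivity on cohomology: a closed x together with a primitive of its image is a cone cocycle,
and a cone primitive contains a primitive of x. -/
lemma exists_dDiv_eq (vol : (Poly d)ˣ) {x : PolyvectorU d (n + 1)} (hx : dDiv vol (n + 1) x = 0)
    {ψ : cyclicCochains vol n} (h : cyclicDiff vol n ψ = phiHom vol (n + 1) x) :
    ∃ y, dDiv vol n y = x := by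
  obtain ⟨F, hF, hr⟩ := mem_cyclicCochains_iff.mp ψ.2
  have h1 : Represents (cyclicDiff vol n ψ).1 (hochDiff F) := hr.dHoch
  rw [h] at h1
  have hc : ((toSeq (n + 1) x, F) : Cone d n) ∈ coneCocycles Finset.univ n :=
    mem_coneCocycles.mpr ⟨⟨toSeq_mem x, hF⟩, toSeq_eq_zero_of_dDiv vol hx,
      (represents_phiHom vol x).unique_functional h1⟩
  obtain ⟨y, hy, G, hG, e⟩ := coneCocycles_le_coneCoboundaries Finset.univ n hc
  obtain ⟨y, rfl⟩ := exists_toSeq_eq hy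
  refine ⟨y, toSeq_injective ?_⟩
  rw [toSeq_dDiv]
  exact (congrArg Prod.fst e).symm

/-- Surjectivity on cohomology: a cyclic cocycle F gives the cone cocycle (0, F), whose cone
primitive consists of a closed polyvector and a cyclic coboundary. Degree zero, where no nonzero
coboundary exists, is handled together with the others. -/
lemma exists_represents_of_cocycle (vol : (Poly d)ˣ) {ψ : cyclicCochains vol n}
    (h : cyclicDiff vol n ψ = 0) : ∃ x, dDiv vol n x = 0 ∧ ∃ G ∈ cyclicCoboundaries Finset.univ n,
      Represents (ψ.1 - (phiHom vol n x).1) G := by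
  obtain ⟨F, hF, hr⟩ := mem_cyclicCochains_iff.mp ψ.2
  have h1 : Represents (cyclicDiff vol n ψ).1 (hochDiff F) := hr.dHoch
  rw [h] at h1
  have hc : ((0, F) : Cone d n) ∈ coneCocycles Finset.univ n :=
    mem_coneCocycles.mpr ⟨⟨zero_mem _, hF⟩, map_zero _,
      (map_zero _).trans (Represents.zero.unique_functional h1)⟩
  obtain ⟨y, hy, G, hG, e⟩ := coneCocycles_le_coneCoboundaries Finset.univ n hc
  obtain ⟨x, rfl⟩ := exists_toSeq_eq hy
  refine ⟨x, toSeq_injective ?_, G, hG, ?_⟩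
  · rw [toSeq_dDiv, map_zero]
    exact (congrArg Prod.fst e).symm
  · have h2 : F - cyclicMap n (toSeq n x) = G := sub_eq_iff_eq_add'.mpr (congrArg Prod.snd e)
    rw [← h2]
    exact hr.sub (represents_phiHom vol x)

lemma exists_phiHom_eq_zero (vol : (Poly d)ˣ) {ψ : cyclicCochains vol 0}
    (h : cyclicDiff vol 0 ψ = 0) : ∃ x, dDiv vol 0 x = 0 ∧ ψ = phiHom vol 0 x := by
  obtain ⟨x, hx, G, hG, hr⟩ := exists_represents_of_cocycle vol h
  rw [(Submodule.mem_bot ℂ).mp hG] at hr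
  exact ⟨x, hx, Subtype.ext (sub_eq_zero.mp (hr.unique_operator Represents.zero))⟩

lemma exists_phiHom_add_cyclicDiff_eq (vol : (Poly d)ˣ) {ψ : cyclicCochains vol (n + 1)}
    (h : cyclicDiff vol (n + 1) ψ = 0) : ∃ x, dDiv vol (n + 1) x = 0 ∧
      ∃ φ, ψ = phiHom vol (n + 1) x + cyclicDiff vol n φ := by
  obtain ⟨x, hx, B, ⟨G, hG, rfl⟩, hr⟩ := exists_represents_of_cocycle vol h
  obtain ⟨φ, -, hφ⟩ := exists_represents_of_mem_functionals (mem_cyclicFunctionals.mp hG).1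
  refine ⟨x, hx, ⟨φ, mem_cyclicCochains_iff.mpr ⟨G, hG, hφ⟩⟩, Subtype.ext ?_⟩
  exact sub_eq_iff_eq_add'.mp (hr.unique_operator hφ.dHoch)

end
end CyclicHKR

/-! ### From statements about elements to a quasi-isomorphism of complexes. -/

namespace CyclicHKR
noncomputable section
open scoped TensorProduct ContDiff
open CategoryTheory

/-! ### Quasi-isomorphisms of complexes of vector spaces -/

lemma quasiIso_of_elements {S T : ShortComplex (ModuleCat.{0} ℂ)} (φ : S ⟶ T)
    (hinj : ∀ x : S.X₂, S.g.hom x = 0 → (∃ y, T.f.hom y = φ.τ₂.hom x) → ∃ z, S.f.hom z = x)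
    (hsurj : ∀ y : T.X₂, T.g.hom y = 0 →
      ∃ x, S.g.hom x = 0 ∧ ∃ z, y = φ.τ₂.hom x + T.f.hom z) : ShortComplex.QuasiIso φ := by
  -- Homology is taken in its explicit form, kernel modulo image, where maps can be evaluated on
  -- representatives.
  rw [ShortComplex.LeftHomologyMapData.quasiIso_iff
    (h₁ := S.moduleCatLeftHomologyData) (h₂ := T.moduleCatLeftHomologyData) default]
  set γ : ShortComplex.LeftHomologyMapData φ S.moduleCatLeftHomologyData
    T.moduleCatLeftHomologyData := default with hγ
  have hK : ∀ x : LinearMap.ker S.g.hom, (γ.φK.hom x : LinearMap.ker T.g.hom).1 = φ.τ₂.hom x.1 :=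
    fun x => LinearMap.congr_fun (congrArg ModuleCat.Hom.hom γ.commi) x
  have hH : ∀ x : LinearMap.ker S.g.hom, γ.φH.hom (Submodule.Quotient.mk x) =
      Submodule.Quotient.mk (γ.φK.hom x) :=
    fun x => LinearMap.congr_fun (congrArg ModuleCat.Hom.hom γ.commπ) x
  rw [ConcreteCategory.isIso_iff_bijective]
  constructor
  · refine (injective_iff_map_eq_zero γ.φH.hom).mpr fun a ha => ?_
    obtain ⟨x, rfl⟩ := Submodule.Quotient.mk_surjective _ a
    rw [hH] at ha
    obtain ⟨y, hy⟩ := (Submodule.Quotient.mk_eq_zero _).mp ha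
    obtain ⟨z, hz⟩ := hinj x.1 x.2 ⟨y, (congrArg Subtype.val hy).trans (hK x)⟩
    exact (Submodule.Quotient.mk_eq_zero _).mpr ⟨z, Subtype.ext hz⟩
  · intro b
    obtain ⟨y, rfl⟩ := Submodule.Quotient.mk_surjective _ b
    obtain ⟨x, hx, z, e⟩ := hsurj y.1 y.2
    refine ⟨Submodule.Quotient.mk ⟨x, hx⟩, (hH ⟨x, hx⟩).trans ?_⟩
    refine ((Submodule.Quotient.eq
      (LinearMap.range T.moduleCatToCycles)).mpr ⟨z, Subtype.ext ?_⟩).symm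
    have h1 := hK ⟨x, hx⟩
    change T.f.hom z = y.1 - (γ.φK.hom ⟨x, hx⟩ : LinearMap.ker T.g.hom).1
    rw [h1, e, add_sub_cancel_left]

variable {d : ℕ}

lemma polyvectorComplex_d (vol : (Poly d)ˣ) (n : ℕ) :
    (polyvectorComplex vol).d n (n + 1) = ModuleCat.ofHom (dDiv vol n) :=
  CochainComplex.of_d (fun n => ModuleCat.of ℂ (PolyvectorU d n))
    (fun n => ModuleCat.ofHom (dDiv vol n)) n

lemma cyclicComplex_d (vol : (Poly d)ˣ) (n : ℕ) :
    (cyclicComplex vol).d n (n + 1) = ModuleCat.ofHom (cyclicDiff vol n) :=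
  CochainComplex.of_d (fun n => ModuleCat.of ℂ (cyclicCochains vol n))
    (fun n => ModuleCat.ofHom (cyclicDiff vol n)) n

/-- The map of complexes `φ_HKR^cycl`. -/
def cyclicHKR (vol : (Poly d)ˣ) : polyvectorComplex vol ⟶ cyclicComplex vol :=
  CochainComplex.ofHom (fun n => ModuleCat.ofHom (phiHom vol n)) fun n => by
    rw [polyvectorComplex_d, cyclicComplex_d]
    exact ModuleCat.hom_ext (LinearMap.ext fun x => cyclicDiff_phiHom vol x)

lemma quasiIsoAt_cyclicHKR_zero (vol : (Poly d)ˣ) : QuasiIsoAt (cyclicHKR vol) 0 := by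
  -- In degree zero the predecessor of 0 is 0 itself, and the incoming differential `d 0 0` is zero
  -- by the shape of the complex.
  rw [quasiIsoAt_iff' _ 0 0 1 CochainComplex.prev_nat_zero (CochainComplex.next ℕ 0)]
  have h1 : (polyvectorComplex vol).d 0 0 = 0 := HomologicalComplex.shape _ _ _ (by simp)
  have h2 : (cyclicComplex vol).d 0 0 = 0 := HomologicalComplex.shape _ _ _ (by simp)
  apply quasiIso_of_elements
  · rintro x - ⟨y, hy⟩
    change ((cyclicComplex vol).d 0 0).hom y = phiHom vol 0 x at hy
    rw [h2] at hy
    exact ⟨0, (map_zero _).trans (eq_zero_of_phiHom_zero vol hy.symm).symm⟩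
  · intro y hy
    change ((cyclicComplex vol).d 0 1).hom y = 0 at hy
    rw [cyclicComplex_d vol 0] at hy
    obtain ⟨x, hx, e⟩ := exists_phiHom_eq_zero vol hy
    refine ⟨x, ?_, 0, e.trans ?_⟩
    · change ((polyvectorComplex vol).d 0 1).hom x = 0
      rw [polyvectorComplex_d vol 0]
      exact hx
    · rw [map_zero, add_zero]
      rfl

lemma quasiIsoAt_cyclicHKR_succ (vol : (Poly d)ˣ) (n : ℕ) :
    QuasiIsoAt (cyclicHKR vol) (n + 1) := by
  rw [quasiIsoAt_iff' _ n (n + 1) (n + 2) (CochainComplex.prev_nat_succ n)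
    (CochainComplex.next ℕ (n + 1))]
  apply quasiIso_of_elements
  · rintro x hx ⟨y, hy⟩
    change ((polyvectorComplex vol).d (n + 1) (n + 1 + 1)).hom x = 0 at hx
    change ((cyclicComplex vol).d n (n + 1)).hom y = phiHom vol (n + 1) x at hy
    rw [polyvectorComplex_d] at hx
    rw [cyclicComplex_d] at hy
    obtain ⟨z, hz⟩ := exists_dDiv_eq vol hx hy
    refine ⟨z, ?_⟩
    change ((polyvectorComplex vol).d n (n + 1)).hom z = x
    rw [polyvectorComplex_d]
    exact hz
  · intro y hy
    change ((cyclicComplex vol).d (n + 1) (n + 1 + 1)).hom y = 0 at hy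
    rw [cyclicComplex_d] at hy
    obtain ⟨x, hx, z, e⟩ := exists_phiHom_add_cyclicDiff_eq vol hy
    refine ⟨x, ?_, z, e.trans ?_⟩
    · change ((polyvectorComplex vol).d (n + 1) (n + 1 + 1)).hom x = 0
      rw [polyvectorComplex_d]
      exact hx
    · refine congrArg (fun φ : cyclicCochains vol (n + 1) => phiHom vol (n + 1) x + φ) ?_
      change _ = ((cyclicComplex vol).d n (n + 1)).hom z
      rw [cyclicComplex_d]
      rfl

end
end CyclicHKR

theorem theorem2p3 (d : ℕ) (vol : (CyclicHKR.Poly d)ˣ) :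
    ∃ Φ : CyclicHKR.polyvectorComplex vol ⟶ CyclicHKR.cyclicComplex vol,
      (∀ (n : ℕ) (x : CyclicHKR.PolyvectorU d n),
        ((Φ.f n).hom x : CyclicHKR.cyclicCochains vol n).val = CyclicHKR.phiCycl vol n x) ∧
      QuasiIso Φ := by
  refine ⟨CyclicHKR.cyclicHKR vol, fun n x => rfl, ⟨fun n => ?_⟩⟩
  cases n with
  | zero => exact CyclicHKR.quasiIsoAt_cyclicHKR_zero vol
  | succ n => exact CyclicHKR.quasiIsoAt_cyclicHKR_succ vol n
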